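/- **Notation.** Let $m\ge 0$ be real. For ${\bf y}=(y_j)_{j\ge1}\in\mathbb C^{\mathbb N}$ put $\|{\bf y}\|_{m,1}=\sum_{j\ge1}j^m|y_j|$, $\|{\bf y}\|_1=\|{\bf y}\|_{0,1}$, and let $\ell^1(m,\mathbb C)$ be the space of sequences with $\|{\bf y}\|_{m,1}<\infty$. Throughout, $|u|=1$ and $u=e^{it}$, $t\in\mathbb R$. **The main equation.** Let $F(x,y)=\sum_{n,k\ge 0}F_{n,k}x^ny^k$ have real coefficients $F_{n,k}\ge0$, with $F(0,y)\equiv0$ and $F(x,0)\not\equiv0$. Suppose that there are $x_0,y_0\ge 0$ and $\varepsilon>0$ such that the series converges for $|x|<x_0+\varepsilon$, $|y|<y_0+\varepsilon$, and $$y_0=F(x_0,y_0),\quad 1=F_y(x_0,y_0),\quad F_x(x_0,y_0)\ne0,\quad F_{yy}(x_0,y_0)\ne0 .$$ **The infinite system.** For $j\ge1$ let $$F_j(x,{\bf y},u)=\sum_{n,{\bf k}}F_{j;n,{\bf k}}(u)\,x^n y_1^{k_1}y_2^{k_2}\cdots$$ (sum over $n\ge 0$ and finitely supported ${\bf k}=(k_1,k_2,\ldots)$)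 satisfy $|F_{j;n,{\bf k}}(u)|\le F_{j;n,{\bf k}}(1)$ for $|u|=1$. Suppose that there are functions $\tilde F_j(x,y)$ with (partition property) $$F_j(x,{\bf y},1)=\tilde F_j(x,y_1+y_2+\cdots)\quad(|x|<x_0+\varepsilon,\ \|{\bf y}\|_1<y_0+\varepsilon),$$ $$\sum_{j\ge1}\tilde F_j(x,y)=F(x,y)\quad(|x|<x_0+\varepsilon,\ |y|<y_0+\varepsilon).$$ Let $D$ be the set of $(x,{\bf y})\in\mathbb C\times\ell^1(m,\mathbb C)$ with $|x|<x_0+\varepsilon$ and $\|{\bf y}\|_1<y_0+\varepsilon$. Suppose that for all $j\ge1$ and $(x,{\bf y})\in D$ the function $t\mapsto F_j(x,{\bf y},e^{it})$ is three times continuously differentiable, and that for $r\in\{0,1,2,3\}$ the series $$\sum_{j\ge1}j^m\frac{\partial^r}{\partial t^r}F_j(x,{\bf y},e^{it})$$ converges absolutely on $D\times\mathbb R$, the sum of the absolute values being locally bounded on $D\times\mathbb R$ (with respect to the norm of $\ell^1(m,\mathbb C)$ in ${\bf y}$). **The solution.** Let $y_j(x,u)$, $j\ge1$, $|u|=1$,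 be power series in $x$ with $y_j(x,u)=F_j(x,(y_i(x,u))_{i\ge1},u)$ for all $j$ and all $x$ in a neighbourhood of $0$ (which may depend on $u$), where for some $\rho=\rho(u)>0$ we have $\sum_{j,n}|[x^n]y_j(x,u)|\rho^n<y_0+\varepsilon$. Let $y(x,u)=\sum_{j\ge1}y_j(x,u)$. Suppose that $y(x,1)$ is aperiodic: there are no integers $d\ge2$ and $r$ such that $[x^n]y(x,1)=0$ for all $n\not\equiv r \pmod d$. **Theorem.** There are real constants $\mu$ and $\sigma^2\ge0$ such that the following holds. Let $X_n$ be a sequence of real random variables such that $$\mathbb E\left[u^{X_n}\right]=\frac{[x^n]\,y(x,u)}{[x^n]\,y(x,1)}\qquad(|u|=1)$$ for all $n$ with $[x^n]y(x,1)\ne0$ (where $u^{X_n}$ means $e^{itX_n}$, for all $t\in\mathbb R$). Then, as $n\to\infty$, $X_n$ has finite second moment for all sufficiently large $n$, $$\mathbb E[X_n]=\mu n+O(1),\qquad \mathbb V{\rm ar}[X_n]=\sigma^2n+O(1),$$ and if $\sigma^2>0$ then $$\frac{X_n-\mathbb E[X_n]}{\sqrt{\mathbb V{\rm ar}[X_n]}}\to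 N(0,1)\quad\text{in distribution}.$$ The same conclusions, with the same $\mu$ and $\sigma^2$, hold for random variables $\tilde X_n$ with $\mathbb E[u^{\tilde X_n}]=[x^n]\tilde y(x,u)/[x^n]\tilde y(x,1)$ (for all $n$ with $[x^n]\tilde y(x,1)\neq 0$), where $$\tilde y(x,u)=\exp\left(\int_0^x\frac{y(\xi,u)}{\xi}\,d\xi\right).$$ Moreover, $\mu>0$ if and only if $$\sum_{j\ge1}\operatorname{Im}\left(\frac{\partial}{\partial t}F_j\bigl(x_0,(\tilde F_i(x_0,y_0))_{i\ge1},e^{it}\bigr)\Big|_{t=0}\right)>0$$ (for $F_j$ differentiable in $u$ this sum is $\sum_j\partial F_j/\partial u$ at $u=1$). -/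

import Mathlib

open MeasureTheory ProbabilityTheory Filter Topology
open scoped ENNReal NNReal

namespace InfiniteSystem

noncomputable section

/-- The bivariate function `F(x, y) = ∑ c n k * x ^ n * y ^ k`, as a function on `ℂ × ℂ`. -/
def seriesValue (c : ℕ → ℕ → ℝ) (x y : ℂ) : ℂ :=
  ∑' p : ℕ × ℕ, (c p.1 p.2 : ℂ) * x ^ p.1 * y ^ p.2

/-- The weighted `ℓ¹` norm `‖y‖_{w,1} = ∑_{j ≥ 1} j ^ w * |y_j|`, with value `∞` when the series
diverges. The space `ℓ¹(w, ℂ)` consists of the sequences of finite norm, and `w = 0` gives the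
usual `ℓ¹` norm. -/
def wnorm (w : ℝ) (y : ℕ+ → ℂ) : ℝ≥0∞ :=
  ∑' j : ℕ+, ENNReal.ofReal (((j : ℕ) : ℝ) ^ w) * ‖y j‖ₑ

/-- The points `(x, y)` with `|x| < x₀ + ε`, `y ∈ ℓ¹(w, ℂ)` and `‖y‖₁ < y₀ + ε`. -/
def domain (w x₀ y₀ ε : ℝ) : Set (ℂ × (ℕ+ → ℂ)) :=
  {z | ‖z.1‖ < x₀ + ε ∧ wnorm w z.2 < ∞ ∧ wnorm 0 z.2 < ENNReal.ofReal (y₀ + ε)}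

/-- The single term `a_{j;n,k}(u) * x ^ n * ∏ y_i ^ {k_i}` of the power series `F_j`, for a
multi-index `k` with finitely many non-zero entries. -/
def systemTerm (a : ℕ+ → ℕ → (ℕ+ →₀ ℕ) → Circle → ℂ) (j : ℕ+) (x : ℂ) (y : ℕ+ → ℂ) (u : Circle)
    (p : ℕ × (ℕ+ →₀ ℕ)) : ℂ :=
  a j p.1 p.2 u * x ^ p.1 * p.2.prod fun i e => y i ^ e

/-- The function `F_j(x, y, u)`. -/
def systemValue (a : ℕ+ → ℕ → (ℕ+ →₀ ℕ) → Circle → ℂ) (j : ℕ+) (x : ℂ) (y : ℕ+ → ℂ)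
    (u : Circle) : ℂ :=
  ∑' p : ℕ × (ℕ+ →₀ ℕ), systemTerm a j x y u p

/-- The derivative `∂^r/∂t^r F_j(x, y, e^{it})`. -/
def tDeriv (a : ℕ+ → ℕ → (ℕ+ →₀ ℕ) → Circle → ℂ) (r : ℕ) (j : ℕ+) (x : ℂ) (y : ℕ+ → ℂ)
    (t : ℝ) : ℂ :=
  iteratedDeriv r (fun s : ℝ => systemValue a j x y (Circle.exp s)) t

/-- The assumptions on the single equation `y = F(x, y)`, with `F(x, y) = ∑ c n k * x ^ n * y ^ k`,
and on the point `(x₀, y₀)`. -/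
structure MainEquation (c : ℕ → ℕ → ℝ) (x₀ y₀ ε : ℝ) : Prop where
  coeff_nonneg : ∀ n k, 0 ≤ c n k
  zero_left : ∀ k, c 0 k = 0
  zero_right : ∃ n, c n 0 ≠ 0
  x₀_nonneg : 0 ≤ x₀
  y₀_nonneg : 0 ≤ y₀
  ε_pos : 0 < ε
  summable : ∀ x y : ℂ, ‖x‖ < x₀ + ε → ‖y‖ < y₀ + ε →
    Summable fun p : ℕ × ℕ => (c p.1 p.2 : ℂ) * x ^ p.1 * y ^ p.2
  eq_point : seriesValue c x₀ y₀ = y₀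
  deriv_y : deriv (fun y : ℂ => seriesValue c x₀ y) y₀ = 1
  deriv_x : deriv (fun x : ℂ => seriesValue c x y₀) x₀ ≠ 0
  deriv_yy : iteratedDeriv 2 (fun y : ℂ => seriesValue c x₀ y) y₀ ≠ 0

/-- The assumptions on the infinite system `y_j = F_j(x, y, u)`, `j ≥ 1`, `|u| = 1`. -/
structure PartitionSystem (w x₀ y₀ ε : ℝ) (c : ℕ → ℕ → ℝ) (Ft : ℕ+ → ℂ → ℂ → ℂ)
    (a : ℕ+ → ℕ → (ℕ+ →₀ ℕ) → Circle → ℂ) : Prop where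
  /-- `|a_{j;n,k}(u)| ≤ a_{j;n,k}(1)`; in particular `a_{j;n,k}(1)` is real and non-negative. -/
  coeff_bound : ∀ j n k u, (a j n k 1).im = 0 ∧ ‖a j n k u‖ ≤ (a j n k 1).re
  /-- `F_j(x, y, 1) = Ft_j(x, y_1 + y_2 + ⋯)`. -/
  partition : ∀ (j : ℕ+) (x : ℂ) (y : ℕ+ → ℂ), ‖x‖ < x₀ + ε →
    wnorm 0 y < ENNReal.ofReal (y₀ + ε) →
      HasSum (systemTerm a j x y 1) (Ft j x (∑' i, y i))
  /-- `∑_j Ft_j(x, y) = F(x, y)`. -/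
  sum_eq : ∀ x y : ℂ, ‖x‖ < x₀ + ε → ‖y‖ < y₀ + ε →
    HasSum (fun j => Ft j x y) (seriesValue c x y)
  contDiff : ∀ (j : ℕ+) (x : ℂ) (y : ℕ+ → ℂ), (x, y) ∈ domain w x₀ y₀ ε →
    ContDiff ℝ 3 fun t : ℝ => systemValue a j x y (Circle.exp t)
  /-- `∑_j j ^ w * ∂^r/∂t^r F_j(x, y, e^{it})` converges absolutely for `r = 0, 1, 2, 3`, with
  locally bounded sums of absolute values (for the norm of `ℓ¹(w, ℂ)` in the variable `y`). -/
  deriv_bounded : ∀ r ≤ 3, ∀ (x : ℂ) (y : ℕ+ → ℂ) (t : ℝ), (x, y) ∈ domain w x₀ y₀ ε →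
    ∃ δ > (0 : ℝ), ∃ B : ℝ≥0, ∀ (x' : ℂ) (y' : ℕ+ → ℂ) (t' : ℝ),
      (x', y') ∈ domain w x₀ y₀ ε → ‖x' - x‖ < δ → wnorm w (y' - y) < ENNReal.ofReal δ →
      |t' - t| < δ → wnorm w (fun j => tDeriv a r j x' y' t') ≤ B

/-- The power series `Y j u = y_j(x, u)` solve the system in a neighbourhood of `x = 0` (which may
depend on `u`), where `∑_j y_j(x, u)` converges absolutely in the domain of the `F_j`. -/
def IsSolution (y₀ ε : ℝ) (a : ℕ+ → ℕ → (ℕ+ →₀ ℕ) → Circle → ℂ)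
    (Y : ℕ+ → Circle → PowerSeries ℂ) : Prop :=
  ∀ u : Circle, ∃ ρ : ℝ≥0, 0 < ρ ∧
    (∑' j : ℕ+, ∑' n : ℕ, ‖(Y j u).coeff n‖ₑ * (ρ : ℝ≥0∞) ^ n) < ENNReal.ofReal (y₀ + ε) ∧
    ∀ x : ℂ, ‖x‖ < ρ → ∀ j : ℕ+,
      ∑' n : ℕ, (Y j u).coeff n * x ^ n =
        systemValue a j x (fun i => ∑' n : ℕ, (Y i u).coeff n * x ^ n) u

/-- The support of `g` lies in no residue class of a modulus `d ≥ 2`. -/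
def Aperiodic (g : PowerSeries ℂ) : Prop :=
  ∀ d r : ℕ, 1 ≤ d → (∀ n, g.coeff n ≠ 0 → n ≡ r [MOD d]) → d = 1

/-- The power series `exp (∫₀ˣ g(ξ) / ξ dξ)` for a power series `g` with `g(0) = 0`. -/
def expIntegral (g : PowerSeries ℂ) : PowerSeries ℂ :=
  (PowerSeries.exp ℂ).subst (PowerSeries.mk fun n => g.coeff n / (n : ℂ))

/-- `𝔼[u ^ X_n] = [xⁿ] g(x, u) / [xⁿ] g(x, 1)` for all `u = e^{it}` on the unit circle and for all
`n` for which the right hand side is defined. -/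
def HasGeneratingFunction {Ω : ℕ → Type*} [∀ n, MeasurableSpace (Ω n)] (P : ∀ n, Measure (Ω n))
    (X : ∀ n, Ω n → ℝ) (g : Circle → PowerSeries ℂ) : Prop :=
  ∀ n, (g 1).coeff n ≠ 0 → ∀ t : ℝ,
    ∫ ω, Complex.exp (Complex.I * t * X n ω) ∂(P n) =
      (g (Circle.exp t)).coeff n / (g 1).coeff n

/-- `X_n` has finite second moments for large `n`, `𝔼[X_n] = μ n + O(1)`,
`Var[X_n] = σ² n + O(1)`, and if `σ² > 0` then the standardized variables converge in distribution
to the standard normal law. -/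
def SatisfiesCLT {Ω : ℕ → Type*} [∀ n, MeasurableSpace (Ω n)] (P : ∀ n, Measure (Ω n))
    [∀ n, IsProbabilityMeasure (P n)] (X : ∀ n, Ω n → ℝ) (μ σsq : ℝ) : Prop :=
  (∀ᶠ n in atTop, MemLp (X n) 2 (P n)) ∧
  (fun n : ℕ => (∫ ω, X n ω ∂(P n)) - μ * n) =O[atTop] (fun _ => (1 : ℝ)) ∧
  (fun n : ℕ => variance (X n) (P n) - σsq * n) =O[atTop] (fun _ => (1 : ℝ)) ∧
  (0 < σsq →
    TendstoInDistribution
      (fun n ω => (X n ω - ∫ ω', X n ω' ∂(P n)) / Real.sqrt (variance (X n) (P n)))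
      atTop (id : ℝ → ℝ) P (gaussianReal 0 1))

end

end InfiniteSystem

/-! The infinite system is reduced to a single equation whose dependence on `u` is a small
perturbation in a Banach space of holomorphic functions. The coefficients of its solution are
quasi-powers that depend holomorphically on the perturbation.

Reduction. Let `s = ∑ y_j`. The partition property says `F(x, y, 1) = Ft(x, s)`. Writing `y = Ft(x,
s) + v` at `u = e^{it}`, the system becomes `v = F(x, Ft(x, s) + v, e^{it}) - F(x, Ft(x, s) + v,
1)`. The right hand side is `O(t)`, hence a contraction in `v` for small `t`, and its fixed point is
holomorphic in `(x, s)`. Summing the coordinates leaves `s = F(x, s) + E_t(x, s)` with `E_t = t E₁ +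
t² E₂ + O(t³)` uniformly on a polydisc (`PartitionSystem.exists_reduction`). Thus `u` only moves a
point along a curve in `HoloSpace`, and three derivatives in `t` suffice although nothing is
analytic in `u`.

The single equation. Consider `s = F(x, s) + h(x, s)` with `h` near `0` in `HoloSpace`. As `F_x` and
`F_yy` are positive at `(x₀, y₀)`, the implicit function theorem yields a critical point `(f h, g
h)` holomorphic in `h`, and a rescaling moves it back to `(x₀, y₀)`. The coefficients of the
solution are integrals over `|s| = y₀` of the coefficients in `x` of `-log (1 - E(x, s) / s)`
(`Admissible.solCoeff_eq_integral`). For fixed `s` the derivative of this logarithm in `x` has its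
poles at the zeros of `s - E(x, s)`. By aperiodicity `(x₀, y₀)` is the only solution with `|x| ≤
x₀`, `|s| = y₀`, so only `s` near `y₀` matters. There exactly one simple zero `X(s) ≈ x₀ - B / (2A)
(s - y₀)²` is relevant, and `n` times the coefficient is `X(s)⁻ⁿ` up to an exponentially small
error. Laplace's method on the circle shows that `n^{3/2} f(h)ⁿ c_n(h)` has a nonzero limit as `h →
0` and `n → ∞` jointly. The solution is never continued beyond its disc of convergence.

Limit law. The joint limit means `c_n(h) = c_n(0) exp (n b(h) + Λ_n(h))` with `b = -log (f / x₀)`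
and holomorphic `Λ_n`, bounded uniformly in `n` (`quasiPowers_of_tendsto`). Cauchy estimates and the
expansion of the curve give quadratic Taylor expansions with cubic errors for the logarithms of the
characteristic functions. Moments, variance and the Gaussian limit follow
(`satisfiesCLT_of_charFun`).

The exponential. The coefficients of `exp (∫ y / x)` satisfy a convolution recursion, from which
they are seen to have the order of `y_n / n`, with a nonzero factor. The function `b` is unchanged,
hence so are `μ` and `σ²`. Finally `μ` is the imaginary part of `E₁(x₀, y₀) / (x₀ A)`, and `E₁(x₀,
y₀)` is the sum of the `t`-derivatives of the `F_j`. -/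

namespace InfiniteSystem

noncomputable section

open Metric Set Asymptotics

/-! ### Bounded holomorphic maps between normed spaces -/

section Holomorphic

variable {E F : Type*} [NormedAddCommGroup E] [NormedSpace ℂ E]
  [NormedAddCommGroup F] [NormedSpace ℂ F]

/-- A bounded holomorphic map is Lipschitz at the centre of a ball. -/
theorem norm_sub_le_of_bounded {f : E → F} {w z : E} {r M : ℝ} (hr : 0 < r)
    (hf : DifferentiableOn ℂ f (ball w r)) (hM : ∀ p ∈ ball w r, ‖f p‖ ≤ M) (hz : ‖f z‖ ≤ M) :
    ‖f z - f w‖ ≤ 2 * M / r * ‖z - w‖ := by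
  have hw := hM w (mem_ball_self hr)
  have hM0 : 0 ≤ M := (norm_nonneg _).trans hw
  by_cases h : z ∈ ball w r
  · have := Complex.dist_le_div_mul_dist_of_mapsTo_ball (R₂ := 2 * M) hf (fun p hp => ?_) h
    · simpa [dist_eq_norm] using this
    · rw [mem_closedBall, dist_eq_norm]
      calc _ ≤ ‖f p‖ + ‖f w‖ := norm_sub_le _ _
        _ ≤ 2 * M := by linarith [hM p hp]
  -- Outside the ball the trivial bound `2 M` is enough, since `‖z - w‖ ≥ r`.
  · rw [mem_ball, dist_eq_norm, not_lt] at h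
    calc _ ≤ ‖f z‖ + ‖f w‖ := norm_sub_le _ _
      _ ≤ 2 * M / r * r := by rw [div_mul_cancel₀ _ hr.ne']; linarith
      _ ≤ _ := by gcongr

theorem norm_fderiv_le_of_bounded {f : E → F} {w : E} {r M : ℝ} (hr : 0 < r)
    (hf : DifferentiableOn ℂ f (ball w r)) (hM : ∀ p ∈ ball w r, ‖f p‖ ≤ M) :
    ‖fderiv ℂ f w‖ ≤ 2 * M / r := by
  refine Complex.norm_fderiv_le_div_of_mapsTo_ball hf (fun p hp => ?_) hr
  rw [mem_closedBall, dist_eq_norm]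
  calc _ ≤ ‖f p‖ + ‖f w‖ := norm_sub_le _ _
    _ ≤ 2 * M := by linarith [hM p hp, hM w (mem_ball_self hr)]

/-- The second order Taylor bound for a bounded holomorphic map. -/
theorem norm_sub_fderiv_le_of_bounded {f : E → F} {w z : E} {r M : ℝ} (hr : 0 < r)
    (hf : DifferentiableOn ℂ f (ball w r)) (hM : ∀ p ∈ ball w r, ‖f p‖ ≤ M) (hz : z ∈ ball w r) :
    ‖f z - f w - fderiv ℂ f w (z - w)‖ ≤ 4 * M * (‖z - w‖ / r) ^ 2 := by
  have hw := hM w (mem_ball_self hr)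
  have hd : DifferentiableAt ℂ f w := hf.differentiableAt (ball_mem_nhds _ hr)
  -- Without its linear part the map is constant to first order at `w`, so the higher order Schwarz
  -- lemma applies. The radius is `4 M = M + 2 M + M`: the value, the linear part, and the value at
  -- `w`.
  set g : E → F := fun p => f p - fderiv ℂ f w (p - w) with hg
  have hgd : DifferentiableOn ℂ g (ball w r) := by
    refine hf.sub (DifferentiableOn.comp (t := univ) (g := fderiv ℂ f w)
      (fderiv ℂ f w).differentiable.differentiableOn (by fun_prop) (fun _ _ => mem_univ _))
  have hgw : g w = f w := by simp [hg]
  have hmaps : MapsTo g (ball w r) (closedBall (g w) (4 * M)) := by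
    intro p hp
    rw [mem_closedBall, dist_eq_norm, hgw]
    have h1 : ‖fderiv ℂ f w (p - w)‖ ≤ 2 * M / r * r := by
      refine ((fderiv ℂ f w).le_opNorm _).trans ?_
      have := norm_fderiv_le_of_bounded hr hf hM
      have h2 : ‖p - w‖ ≤ r := by rw [← dist_eq_norm]; exact (mem_ball.1 hp).le
      have hM0 : 0 ≤ M := (norm_nonneg _).trans hw
      gcongr
    rw [div_mul_cancel₀ _ hr.ne'] at h1
    calc ‖f p - fderiv ℂ f w (p - w) - f w‖ ≤ ‖f p‖ + ‖fderiv ℂ f w (p - w)‖ + ‖f w‖ :=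
        (norm_sub_le _ _).trans (by gcongr; exact norm_sub_le _ _)
      _ ≤ 4 * M := by linarith [hM p hp]
  have hlit : (g · - g w) =o[𝓝 w] (fun p => ‖p - w‖ ^ 1) := by
    have := hd.hasFDerivAt.isLittleO
    simp only [pow_one]
    refine IsLittleO.congr' this.norm_right ?_ EventuallyEq.rfl
    exact Eventually.of_forall fun p => by simp [hg]; abel
  have := Complex.dist_le_mul_div_pow_of_mapsTo_ball_of_isLittleO hgd hmaps hlit hz
  rw [dist_eq_norm, dist_eq_norm, hgw] at this
  refine le_trans (le_of_eq ?_) this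
  congr 1
  simp only [hg]; abel

/-- A pointwise limit of uniformly bounded holomorphic maps is holomorphic. -/
theorem differentiableAt_of_tendsto [CompleteSpace F] {ι : Type*} {l : Filter ι} [NeBot l]
    {f : ι → E → F} {g : E → F} {c : E} {r M : ℝ} (hr : 0 < r)
    (hf : ∀ᶠ i in l, DifferentiableOn ℂ (f i) (ball c r) ∧ ∀ z ∈ ball c r, ‖f i z‖ ≤ M)
    (hlim : ∀ z ∈ ball c r, Tendsto (fun i => f i z) l (𝓝 (g z))) :
    DifferentiableAt ℂ g c := by
  have hM0 : 0 ≤ M := by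
    obtain ⟨i, hi⟩ := hf.exists
    exact (norm_nonneg _).trans (hi.2 c (mem_ball_self hr))
  -- The constant in this bound does not depend on `i`, so it survives in the limit.
  have key : ∀ᶠ i in l, ∀ z ∈ ball c r,
      ‖f i z - f i c - fderiv ℂ (f i) c (z - c)‖ ≤ 4 * M / r ^ 2 * ‖z - c‖ ^ 2 := by
    filter_upwards [hf] with i hi z hz
    refine (norm_sub_fderiv_le_of_bounded hr hi.1 hi.2 hz).trans_eq ?_
    rw [div_pow]; ring
  set K := 4 * M / r ^ 2
  have hK : 0 ≤ K := by positivity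
  -- Difference quotients with a fixed step `s` converge along `l`, and they differ from the
  -- derivatives by at most `K s ‖v‖²`, uniformly in `i`. Hence the directional derivatives form a
  -- Cauchy filter.
  have hcau : ∀ v : E, ∃ a, Tendsto (fun i => fderiv ℂ (f i) c v) l (𝓝 a) := by
    intro v
    refine cauchy_map_iff_exists_tendsto.1 (Metric.cauchy_iff.2 ⟨inferInstance, fun ε hε => ?_⟩)
    obtain ⟨s, hs0, hs1, hs2⟩ : ∃ s : ℝ, 0 < s ∧ s * ‖v‖ < r ∧ K * s * ‖v‖ ^ 2 < ε / 4 := by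
      have h1 : Tendsto (fun s : ℝ => s * ‖v‖) (𝓝[>] 0) (𝓝 0) := by
        refine (Continuous.tendsto' (by fun_prop) _ _ (by simp)).mono_left nhdsWithin_le_nhds
      have h2 : Tendsto (fun s : ℝ => K * s * ‖v‖ ^ 2) (𝓝[>] 0) (𝓝 0) := by
        refine (Continuous.tendsto' (by fun_prop) _ _ (by simp)).mono_left nhdsWithin_le_nhds
      obtain ⟨s, h⟩ := ((h1.eventually_lt_const hr).and
        ((h2.eventually_lt_const (by positivity : 0 < ε / 4)).and self_mem_nhdsWithin)).exists
      exact ⟨s, h.2.2, h.1, h.2.1⟩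
    have hmem : c + (s : ℂ) • v ∈ ball c r := by
      simpa [mem_ball, dist_eq_norm, norm_smul, abs_of_pos hs0] using hs1
    have hl2 := ((hlim _ hmem).sub (hlim c (mem_ball_self hr))).const_smul ((s : ℂ)⁻¹)
    set a := (s : ℂ)⁻¹ • (g (c + (s : ℂ) • v) - g c)
    have hs' : (s : ℂ) ≠ 0 := by exact_mod_cast hs0.ne'
    have hev : ∀ᶠ i in l, dist (fderiv ℂ (f i) c v) a < ε / 2 := by
      filter_upwards [key, (Metric.tendsto_nhds.1 hl2) (ε / 4) (by positivity)] with i hi1 hi2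
      have h3 := hi1 _ hmem
      rw [add_sub_cancel_left, map_smul] at h3
      have h4 : ‖(s : ℂ)⁻¹ • (f i (c + (s : ℂ) • v) - f i c) - fderiv ℂ (f i) c v‖
          ≤ K * s * ‖v‖ ^ 2 := by
        have : (s : ℂ)⁻¹ • (f i (c + (s : ℂ) • v) - f i c) - fderiv ℂ (f i) c v =
          (s : ℂ)⁻¹ • (f i (c + (s : ℂ) • v) - f i c - (s : ℂ) • fderiv ℂ (f i) c v) := by
          rw [smul_sub _ (f i _ - f i c), smul_smul, inv_mul_cancel₀ hs', one_smul]
        rw [this, norm_smul, norm_inv, Complex.norm_real, Real.norm_of_nonneg hs0.le,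
          inv_mul_le_iff₀ hs0]
        refine h3.trans_eq ?_
        rw [norm_smul, Complex.norm_real, Real.norm_of_nonneg hs0.le]; ring
      rw [← dist_eq_norm] at h4
      calc _ ≤ dist (fderiv ℂ (f i) c v) ((s : ℂ)⁻¹ • (f i (c + (s : ℂ) • v) - f i c)) + dist _ a :=
            dist_triangle _ _ _
        _ < ε / 2 := by rw [dist_comm]; linarith
    refine ⟨{x | dist x a < ε / 2}, hev, fun x hx y hy => ?_⟩
    have := dist_triangle_right x y a
    simp only [mem_ofPred_eq] at hx hy
    linarith
  choose T hT using hcau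
  have hT' : Tendsto (fun i v => (fderiv ℂ (f i) c : E →ₗ[ℂ] F) v) l (𝓝 T) :=
    tendsto_pi_nhds.2 hT
  let T1 : E →ₗ[ℂ] F := linearMapOfTendsto (f := T)
    (g := fun i => (fderiv ℂ (f i) c : E →ₗ[ℂ] F)) hT'
  let T2 : E →L[ℂ] F := T1.mkContinuous (2 * M / r) (fun v => by
    refine le_of_tendsto (hT v).norm ?_
    filter_upwards [hf] with i hi
    refine ((fderiv ℂ (f i) c).le_opNorm v).trans ?_
    gcongr
    exact norm_fderiv_le_of_bounded hr hi.1 hi.2)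
  have hfin : ∀ z ∈ ball c r, ‖g z - g c - T2 (z - c)‖ ≤ K * ‖z - c‖ ^ 2 := by
    intro z hz
    refine le_of_tendsto (((hlim z hz).sub (hlim c (mem_ball_self hr))).sub (hT (z - c))).norm ?_
    filter_upwards [key] with i hi using hi z hz
  have : HasFDerivAt g T2 c := by
    rw [hasFDerivAt_iff_isLittleO]
    have hO : (fun z => g z - g c - T2 (z - c)) =O[𝓝 c] fun z => ‖z - c‖ ^ 2 := by
      refine IsBigO.of_bound K ?_
      filter_upwards [ball_mem_nhds c hr] with z hz
      simpa using hfin z hz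
    refine hO.trans_isLittleO ?_
    have h1 : (fun z : E => ‖z - c‖) =o[𝓝 c] fun _ => (1 : ℝ) := by
      rw [isLittleO_one_iff]
      exact Continuous.tendsto' (by fun_prop) _ _ (by simp)
    have := (h1.mul_isBigO (isBigO_refl (fun z : E => ‖z - c‖) (𝓝 c)))
    simp only [one_mul, ← sq] at this
    exact this.of_norm_right
  exact this.differentiableAt

/-- A holomorphic map is bounded on a small ball around each point of its domain. -/
theorem exists_ball_bounded {f : E → F} {U : Set E} (hU : IsOpen U) (hf : DifferentiableOn ℂ f U)
    {c : E} (hc : c ∈ U) : ∃ r > 0, ∃ M, ball c r ⊆ U ∧ ∀ z ∈ ball c r, ‖f z‖ ≤ M := by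
  have hcont := (hf.continuousOn.continuousAt (hU.mem_nhds hc)).norm
  have h1 := hcont.eventually_lt_const (lt_add_one ‖f c‖)
  obtain ⟨r, hr, h⟩ := Metric.mem_nhds_iff.1 (inter_mem h1 (hU.mem_nhds hc))
  exact ⟨r, hr, _, fun z hz => (h hz).2, fun z hz => le_of_lt (h hz).1⟩

/-- Directional derivatives of a holomorphic map are holomorphic. -/
theorem differentiableOn_fderiv_apply [CompleteSpace F] {f : E → F} {U : Set E} (hU : IsOpen U)
    (hf : DifferentiableOn ℂ f U) (v : E) : DifferentiableOn ℂ (fun z => fderiv ℂ f z v) U := by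
  intro c hc
  refine DifferentiableAt.differentiableWithinAt ?_
  obtain ⟨r, hr, M, hrU, hM⟩ := exists_ball_bounded hU hf hc
  have hM0 : 0 ≤ M := (norm_nonneg _).trans (hM c (mem_ball_self hr))
  have hsub : ∀ᶠ s : ℂ in 𝓝[≠] 0, ‖s • v‖ < r / 2 := by
    have : Tendsto (fun s : ℂ => ‖s • v‖) (𝓝[≠] 0) (𝓝 0) :=
      (Continuous.tendsto' (by fun_prop) _ _ (by simp)).mono_left nhdsWithin_le_nhds
    exact this.eventually_lt_const (by positivity)
  -- The directional derivative is the pointwise limit of the difference quotients, which are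
  -- holomorphic and bounded uniformly in the step.
  refine differentiableAt_of_tendsto (l := 𝓝[≠] (0 : ℂ)) (r := r / 2) (M := 2 * M / (r / 2) * ‖v‖)
    (f := fun (s : ℂ) z => s⁻¹ • (f (z + s • v) - f z)) (by positivity) ?_ ?_
  · filter_upwards [hsub, self_mem_nhdsWithin] with s hs hs0
    have hb : ∀ z ∈ ball c (r / 2), ball z (r / 2) ⊆ ball c r := fun z hz =>
      ball_subset_ball' (by linarith [mem_ball.1 hz])
    have hz2 : ∀ z ∈ ball c (r / 2), z + s • v ∈ ball c r := fun z hz =>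
      hb z hz (by simpa [mem_ball, dist_eq_norm] using hs)
    constructor
    · intro z hz
      have h1 : DifferentiableAt ℂ f z :=
        hf.differentiableAt (hU.mem_nhds (hrU (ball_subset_ball (by linarith) hz)))
      have h2 : DifferentiableAt ℂ f (z + s • v) :=
        hf.differentiableAt (hU.mem_nhds (hrU (hz2 z hz)))
      have h3 : DifferentiableAt ℂ (fun z => f (z + s • v)) z :=
        DifferentiableAt.comp z h2 (by fun_prop)
      exact ((h3.sub h1).const_smul _).differentiableWithinAt
    · intro z hz
      have := norm_sub_le_of_bounded (z := z + s • v) (M := M) (by positivity : 0 < r / 2)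
        (hf.mono ((hb z hz).trans hrU)) (fun p hp => hM p (hb z hz hp)) (hM _ (hz2 z hz))
      rw [norm_smul, norm_inv, inv_mul_le_iff₀ (norm_pos_iff.2 hs0)]
      refine this.trans_eq ?_
      rw [add_sub_cancel_left, norm_smul]; ring
  · intro z hz
    have h1 : DifferentiableAt ℂ f z :=
      hf.differentiableAt (hU.mem_nhds (hrU (ball_subset_ball (by linarith) hz)))
    have h2 : HasDerivAt (fun s : ℂ => f (z + s • v)) (fderiv ℂ f z v) 0 := by
      have h3 : HasFDerivAt f (fderiv ℂ f z) (z + (0 : ℂ) • v) := by simpa using h1.hasFDerivAt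
      have h4 : HasDerivAt (fun s : ℂ => z + s • v) v 0 := by
        simpa using ((hasDerivAt_id (0 : ℂ)).smul_const v).const_add z
      exact h3.comp_hasDerivAt 0 h4
    have := h2.tendsto_slope_zero
    simpa using this

/-- The difference of the derivatives at `z` and `w` is the derivative at `w` of `p ↦ f (p + (z -
w)) - f p`. This map is `O(‖z - w‖)` on a ball, so the Cauchy estimate makes the derivative locally
Lipschitz. Strict differentiability and the implicit function theorem rely on this. -/
theorem contDiffAt_one_of_differentiableOn {f : E → F} {U : Set E} (hU : IsOpen U)
    (hf : DifferentiableOn ℂ f U) {c : E} (hc : c ∈ U) : ContDiffAt ℂ 1 f c := by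
  obtain ⟨r, hr, M, hrU, hM⟩ := exists_ball_bounded hU hf hc
  have hM0 : 0 ≤ M := (norm_nonneg _).trans (hM c (mem_ball_self hr))
  refine contDiffAt_one_iff.2 ⟨fderiv ℂ f, ball c (r / 2), ball_mem_nhds _ (by positivity), ?_,
    fun z hz => (hf.differentiableAt
      (hU.mem_nhds (hrU (ball_subset_ball (by linarith) hz)))).hasFDerivAt⟩
  have hlip : ∀ z ∈ ball c (r / 2), ∀ w ∈ ball c (r / 2), ‖z - w‖ < r / 4 →
      ‖fderiv ℂ f z - fderiv ℂ f w‖ ≤ 2 * (2 * M / (r / 4) * ‖z - w‖) / (r / 4) := by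
    intro z hz w hw hzw
    have hsub : ∀ p ∈ ball w (r / 4), ball p (r / 4) ⊆ ball c r := fun p hp =>
      ball_subset_ball' (by linarith [mem_ball.1 hw, mem_ball.1 hp, dist_triangle p w c])
    have hdz : DifferentiableAt ℂ f z :=
      hf.differentiableAt (hU.mem_nhds (hrU (ball_subset_ball (by linarith) hz)))
    have hdw : DifferentiableAt ℂ f w :=
      hf.differentiableAt (hU.mem_nhds (hrU (ball_subset_ball (by linarith) hw)))
    have hd : ∀ p ∈ ball w (r / 4), DifferentiableAt ℂ (fun p => f (p + (z - w)) - f p) p := by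
      intro p hp
      have h1 : p + (z - w) ∈ ball c r := hsub p hp (by simpa [mem_ball, dist_eq_norm] using hzw)
      have h2 : p ∈ ball c r := hsub p hp (mem_ball_self (by positivity))
      have h3 : DifferentiableAt ℂ f (p + (z - w)) := hf.differentiableAt (hU.mem_nhds (hrU h1))
      exact (DifferentiableAt.comp p h3 (by fun_prop)).sub
        (hf.differentiableAt (hU.mem_nhds (hrU h2)))
    have hb := norm_fderiv_le_of_bounded (w := w) (r := r / 4)
      (f := fun p => f (p + (z - w)) - f p) (M := 2 * M / (r / 4) * ‖z - w‖) (by positivity)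
      (fun p hp => (hd p hp).differentiableWithinAt) (fun p hp => by
        have h1 : p + (z - w) ∈ ball c r := hsub p hp (by simpa [mem_ball, dist_eq_norm] using hzw)
        have := norm_sub_le_of_bounded (z := p + (z - w)) (M := M) (by positivity : 0 < r / 4)
          (hf.mono ((hsub p hp).trans hrU)) (fun q hq => hM q (hsub p hp hq)) (hM _ h1)
        simpa using this)
    convert hb using 2
    have h3 : HasFDerivAt f (fderiv ℂ f z) (w + (z - w)) := by simpa using hdz.hasFDerivAt
    have h4 : HasFDerivAt (fun p => p + (z - w)) (ContinuousLinearMap.id ℂ E) w :=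
      (hasFDerivAt_id w).add_const _
    exact ((h3.comp w h4).sub hdw.hasFDerivAt).fderiv.symm
  intro w hw
  refine ContinuousAt.continuousWithinAt ?_
  rw [ContinuousAt, tendsto_iff_norm_sub_tendsto_zero]
  have hlim : Tendsto (fun z => 2 * (2 * M / (r / 4) * ‖z - w‖) / (r / 4)) (𝓝 w) (𝓝 0) :=
    Continuous.tendsto' (by fun_prop) _ _ (by simp)
  refine squeeze_zero' (Eventually.of_forall fun _ => norm_nonneg _) ?_ hlim
  filter_upwards [isOpen_ball.mem_nhds hw, ball_mem_nhds w (by positivity : 0 < r / 4)] with z hz hzw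
  exact hlip z hz w hw (by simpa [mem_ball, dist_eq_norm] using hzw)

end Holomorphic

/-! ### Moments and the Gaussian limit from characteristic functions -/

section CentralLimit

theorem eq_zero_of_isLittleO_sq {a b : ℂ}
    (h : (fun t : ℝ => a * t + b * (t : ℂ) ^ 2) =o[𝓝 0] fun t : ℝ => t ^ 2) : a = 0 ∧ b = 0 := by
  have irr : ∀ k : ℕ, ¬ (fun t : ℝ => (t : ℂ) ^ k) =o[𝓝 0] fun t : ℝ => t ^ k := by
    intro k hk
    refine isLittleO_irrefl (f'' := fun t : ℝ => t ^ k) (l := 𝓝[≠] 0) ?_ ?_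
    · refine Eventually.frequently ?_
      filter_upwards [self_mem_nhdsWithin] with t ht using pow_ne_zero _ ht
    · refine IsLittleO.mono (IsLittleO.of_norm_left ?_) nhdsWithin_le_nhds
      simpa using hk.norm_left
  have h1 : (fun t : ℝ => t ^ 2) =o[𝓝 0] fun t : ℝ => t ^ 1 :=
    isLittleO_pow_pow (by norm_num)
  have h1' : (fun t : ℝ => b * (t : ℂ) ^ 2) =o[𝓝 0] fun t : ℝ => t ^ 1 := by
    refine IsBigO.trans_isLittleO ?_ h1
    refine (IsBigO.of_bound 1 ?_).const_mul_left _
    exact Eventually.of_forall fun t => by simp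
  have ha : a = 0 := by
    by_contra ha
    refine irr 1 ?_
    have := (h.trans h1).sub h1'
    simp only [add_sub_cancel_right] at this
    simpa using (isLittleO_const_mul_left_iff ha).1 this
  refine ⟨ha, ?_⟩
  by_contra hb
  refine irr 2 ((isLittleO_const_mul_left_iff hb).1 ?_)
  simpa [ha] using h

/-- Fatou's lemma: `(1 - cos (s x)) / s²` is eventually at least a constant times `x²` as `s → 0`,
while its integral is `(1 - Re φ(s)) / s² ≤ K`. Finite second moments thus come from the
characteristic function alone. -/
theorem memLp_two_of_re_charFun {ν : Measure ℝ} [IsProbabilityMeasure ν] {K t₀ : ℝ} (ht₀ : 0 < t₀)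
    (h : ∀ t : ℝ, |t| < t₀ → 1 - (charFun ν t).re ≤ K * t ^ 2) : MemLp id 2 ν := by
  rw [memLp_two_iff_integrable_sq aestronglyMeasurable_id]
  refine ⟨by fun_prop, ?_⟩
  rw [hasFiniteIntegral_iff_ofReal (Eventually.of_forall fun x => by positivity)]
  -- The summand `2` keeps the first term strictly below `t₀` as well.
  set s : ℕ → ℝ := fun k => t₀ / (k + 2) with hs
  have hs0 : ∀ k, 0 < s k := fun k => by positivity
  have hst : ∀ k, |s k| < t₀ := fun k => by
    rw [abs_of_pos (hs0 k), hs]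
    exact div_lt_self ht₀ (by linarith [(Nat.cast_nonneg k : (0 : ℝ) ≤ k)])
  have hslim : Tendsto s atTop (𝓝 0) :=
    tendsto_const_nhds.div_atTop (tendsto_atTop_add_const_right _ _ tendsto_natCast_atTop_atTop)
  -- The factor inverts the constant in `1 - cos y ≥ (2 / π²) y²` for `|y| ≤ π`, so that `f k x ≥
  -- x²` once `|s k * x| ≤ π`.
  set f : ℕ → ℝ → ℝ := fun k x => Real.pi ^ 2 / 2 * (1 - Real.cos (s k * x)) / s k ^ 2
  have hf0 : ∀ k x, 0 ≤ f k x := fun k x => by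
    have := Real.cos_le_one (s k * x)
    have : 0 ≤ 1 - Real.cos (s k * x) := by linarith
    positivity
  have hint : ∀ k, Integrable (fun x => Real.cos (s k * x)) ν := fun k =>
    Integrable.of_bound (by fun_prop) 1 (Eventually.of_forall fun x => Real.abs_cos_le_one _)
  have hre : ∀ k, ∫ x, Real.cos (s k * x) ∂ν = (charFun ν (s k)).re := by
    intro k
    have hi : Integrable (fun x : ℝ => Complex.exp (s k * x * Complex.I)) ν := by
      refine Integrable.of_bound (by fun_prop) 1 (Eventually.of_forall fun x => ?_)
      rw [← Complex.ofReal_mul, Complex.norm_exp_ofReal_mul_I]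
    rw [charFun_apply_real, ← RCLike.re_eq_complex_re, ← integral_re hi]
    refine integral_congr_ae (Eventually.of_forall fun x => ?_)
    simp only [RCLike.re_eq_complex_re]
    rw [← Complex.ofReal_mul, Complex.exp_ofReal_mul_I_re]
  have hbound : ∀ k, ∫⁻ x, ENNReal.ofReal (f k x) ∂ν ≤ ENNReal.ofReal (Real.pi ^ 2 / 2 * K) := by
    intro k
    have hif : Integrable (f k) ν := (((integrable_const 1).sub (hint k)).const_mul _).div_const _
    rw [← ofReal_integral_eq_lintegral_ofReal hif (Eventually.of_forall (hf0 k))]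
    refine ENNReal.ofReal_le_ofReal ?_
    rw [integral_div, integral_const_mul, integral_sub (integrable_const 1) (hint k), hre]
    have := h (s k) (hst k)
    simp only [integral_const, probReal_univ, smul_eq_mul, mul_one]
    rw [div_le_iff₀ (pow_pos (hs0 k) 2), mul_assoc]
    gcongr
  calc ∫⁻ x, ENNReal.ofReal (id x ^ 2) ∂ν
      ≤ ∫⁻ x, liminf (fun k => ENNReal.ofReal (f k x)) atTop ∂ν := by
        refine lintegral_mono fun x => le_liminf_of_le (by isBoundedDefault) ?_
        have : Tendsto (fun k => |s k * x|) atTop (𝓝 0) := by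
          simpa using (hslim.mul_const x).abs
        filter_upwards [this.eventually_le_const Real.pi_pos] with k hk
        refine ENNReal.ofReal_le_ofReal ?_
        have h2 := Real.cos_le_one_sub_mul_cos_sq hk
        have hp := Real.pi_pos
        rw [le_div_iff₀ (pow_pos (hs0 k) 2)]
        have h3 : 2 / Real.pi ^ 2 * (s k * x) ^ 2 ≤ 1 - Real.cos (s k * x) := by linarith
        calc id x ^ 2 * s k ^ 2 = Real.pi ^ 2 / 2 * (2 / Real.pi ^ 2 * (s k * x) ^ 2) := by
              simp only [id]; field_simp
          _ ≤ _ := by gcongr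
    _ ≤ liminf (fun k => ∫⁻ x, ENNReal.ofReal (f k x) ∂ν) atTop :=
        lintegral_liminf_le fun k => by fun_prop
    _ ≤ ENNReal.ofReal (Real.pi ^ 2 / 2 * K) := by
        refine liminf_le_of_frequently_le' (Frequently.of_forall hbound)
    _ < ∞ := ENNReal.ofReal_lt_top

/-- The first two moments can be read off from the logarithm of the characteristic function. -/
theorem moments_of_charFun_eq_exp {ν : Measure ℝ} [IsProbabilityMeasure ν] {K t₀ : ℝ}
    (ht₀ : 0 < t₀) {A B : ℂ} {w : ℝ → ℂ}
    (hw : ∀ t : ℝ, |t| < t₀ → charFun ν t = Complex.exp (w t))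
    (hexp : ∀ t : ℝ, |t| < t₀ → ‖w t - (A * t + B * (t : ℂ) ^ 2)‖ ≤ K * |t| ^ 3) :
    MemLp id 2 ν ∧ A = (∫ x, x ∂ν : ℝ) * Complex.I ∧ B = -((variance id ν : ℝ) : ℂ) / 2 := by
  have hcube : (fun t : ℝ => w t - (A * t + B * (t : ℂ) ^ 2)) =O[𝓝 0] fun t : ℝ => t ^ 3 := by
    refine IsBigO.of_bound K ?_
    have : ∀ᶠ t : ℝ in 𝓝 0, |t| < t₀ :=
      (Continuous.tendsto' continuous_abs 0 0 abs_zero).eventually_lt_const ht₀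
    filter_upwards [this] with t ht
    simpa using hexp t ht
  have h32 : (fun t : ℝ => t ^ 3) =o[𝓝 0] fun t : ℝ => t ^ 2 := isLittleO_pow_pow (by norm_num)
  have h21 : (fun t : ℝ => t ^ 2) =o[𝓝 0] fun t : ℝ => t := by
    simpa using (isLittleO_pow_pow (𝕜 := ℝ) (show 1 < 2 by norm_num))
  have hO1 : (fun t : ℝ => A * (t : ℂ)) =O[𝓝 0] fun t : ℝ => t :=
    (IsBigO.of_bound 1 (Eventually.of_forall fun t => by simp)).const_mul_left _
  have hO2 : (fun t : ℝ => B * (t : ℂ) ^ 2) =O[𝓝 0] fun t : ℝ => t ^ 2 :=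
    (IsBigO.of_bound 1 (Eventually.of_forall fun t => by simp)).const_mul_left _
  have hw2 : (fun t : ℝ => w t - A * t) =O[𝓝 0] fun t : ℝ => t ^ 2 := by
    have := (hcube.trans_isLittleO h32).isBigO.add hO2
    refine this.congr_left fun t => by ring
  have hw1 : w =O[𝓝 0] fun t : ℝ => t := by
    have := (hw2.trans_isLittleO h21).isBigO.add hO1
    refine this.congr_left fun t => by ring
  have hw0 : Tendsto w (𝓝 0) (𝓝 0) := hw1.trans_tendsto tendsto_id
  have hev : ∀ᶠ t : ℝ in 𝓝 0, |t| < t₀ :=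
    (Continuous.tendsto' continuous_abs 0 0 abs_zero).eventually_lt_const ht₀
  have hexp2 : (fun t => Complex.exp (w t) - 1 - w t) =O[𝓝 0] fun t : ℝ => t ^ 2 := by
    refine IsBigO.trans (IsBigO.of_bound 1 ?_) (hw1.pow 2)
    filter_upwards [hw0.norm.eventually_le_const (by simp : ‖(0 : ℂ)‖ < 1)] with t ht
    simpa using Complex.norm_exp_sub_one_sub_id_le ht
  have hexp3 : (fun t => Complex.exp (w t) - 1 - w t - w t ^ 2 / 2) =O[𝓝 0] fun t : ℝ => t ^ 3 := by
    refine IsBigO.trans (IsBigO.of_bound (Real.exp 1) ?_) (hw1.pow 3)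
    filter_upwards [hw0.norm.eventually_le_const (by simp : ‖(0 : ℂ)‖ < 1)] with t ht
    have := Complex.norm_exp_sub_sum_le_norm_mul_exp (w t) 3
    simp only [Finset.sum_range_succ, Finset.range_zero, Finset.sum_empty, pow_zero,
      Nat.factorial_zero, Nat.cast_one, div_one, zero_add, pow_one, Nat.factorial_one,
      Nat.factorial_two, Nat.cast_ofNat] at this
    rw [norm_pow, mul_comm]
    calc _ = ‖Complex.exp (w t) - (1 + w t + w t ^ 2 / 2)‖ := by congr 1; ring
      _ ≤ _ := this
      _ ≤ _ := by gcongr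
  have hphi : (fun t : ℝ => charFun ν t - (1 + A * t + (B + A ^ 2 / 2) * (t : ℂ) ^ 2))
      =o[𝓝 0] fun t : ℝ => t ^ 2 := by
    -- This is `(w² - A² t²) / 2`, the error of replacing `w` by its linear part in the quadratic
    -- term of the exponential.
    have h1 : (fun t : ℝ => (w t - A * t) * (w t + A * t) / 2) =o[𝓝 0] fun t : ℝ => t ^ 2 := by
      have hT : Tendsto (fun t : ℝ => w t + A * t) (𝓝 0) (𝓝 0) := by
        have := hw0.add (hO1.trans_tendsto tendsto_id)
        simpa using this
      have := hw2.mul_isLittleO ((isLittleO_one_iff ℝ).2 hT)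
      have := this.const_mul_left (1 / 2)
      simp only [mul_one] at this
      refine this.congr_left fun t => by ring
    have h2 := ((hexp3.trans_isLittleO h32).add h1).add (hcube.trans_isLittleO h32)
    refine h2.congr' ?_ EventuallyEq.rfl
    filter_upwards [hev] with t ht
    rw [hw t ht]; ring
  have hmem : MemLp id 2 ν := by
    have hneg : Tendsto (fun t : ℝ => -t) (𝓝 0) (𝓝 0) := Continuous.tendsto' (by fun_prop) _ _ (by simp)
    have h1 : (fun t : ℝ => charFun ν t - 1 - A * t) =O[𝓝 0] fun t : ℝ => t ^ 2 := by
      refine (hexp2.add hw2).congr' ?_ EventuallyEq.rfl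
      filter_upwards [hev] with t ht
      rw [hw t ht]; ring
    have h2 := h1.comp_tendsto hneg
    -- Symmetrization removes the linear term without any moment assumption, and the left hand side
    -- is `-2 (1 - Re φ(t))`.
    have h3 : (fun t : ℝ => charFun ν t + charFun ν (-t) - 2) =O[𝓝 0] fun t : ℝ => t ^ 2 := by
      simp only [Function.comp_def, even_two, Even.neg_pow] at h2
      refine (h1.add h2).congr_left fun t => ?_
      push_cast; ring
    obtain ⟨K', hK'⟩ := h3.bound
    obtain ⟨t₁, ht₁, hb⟩ := Metric.eventually_nhds_iff.1 hK'
    refine memLp_two_of_re_charFun (K := K') ht₁ fun t ht => ?_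
    have h4 := hb (by simpa using ht : dist t 0 < t₁)
    rw [charFun_neg] at h4
    have h5 : charFun ν t + (starRingEnd ℂ) (charFun ν t) - 2
        = ((-(2 * (1 - (charFun ν t).re)) : ℝ) : ℂ) := by
      rw [Complex.add_conj]; push_cast; ring
    rw [h5, Complex.norm_real, norm_neg, Real.norm_eq_abs, Real.norm_eq_abs, abs_pow, sq_abs] at h4
    have h6 : (charFun ν t).re ≤ 1 := (Complex.re_le_norm _).trans (norm_charFun_le_one t)
    have := le_abs_self (2 * (1 - (charFun ν t).re))
    linarith
  have hmap : ν.map id = ν := Measure.map_id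
  have htay := taylor_isLittleO_univ (n := 2) (x₀ := 0) (contDiff_charFun (μ := ν) (n := 2) hmem)
  have htay2 := taylorWithinEval_charFun_two_zero (P := ν) (X := id) aemeasurable_id
    (by rwa [hmap])
  rw [hmap] at htay2
  set m : ℝ := ∫ x, id x ∂ν with hm
  set q : ℝ := ∫ x, (id ^ 2 : ℝ → ℝ) x ∂ν with hq
  have hdiff : (fun t : ℝ => (A - m * Complex.I) * t + (B + A ^ 2 / 2 + q / 2) * (t : ℂ) ^ 2)
      =o[𝓝 0] fun t : ℝ => t ^ 2 := by
    simp only [sub_zero] at htay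
    refine (htay.sub hphi).congr_left fun t => ?_
    rw [htay2 t]; ring
  obtain ⟨hA, hB⟩ := eq_zero_of_isLittleO_sq hdiff
  have hA' : A = m * Complex.I := sub_eq_zero.1 hA
  refine ⟨hmem, hA', ?_⟩
  rw [variance_eq_sub hmem]
  have : B = -(A ^ 2 / 2 + q / 2) := by linear_combination hB
  rw [this, hA', mul_pow, Complex.I_sq]
  push_cast
  ring

/-- A quasi-power form of the characteristic functions yields mean, variance and a Gaussian
limit law. -/
theorem satisfiesCLT_of_charFun {Ω : ℕ → Type*} [∀ n, MeasurableSpace (Ω n)]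
    (P : ∀ n, Measure (Ω n)) [∀ n, IsProbabilityMeasure (P n)] (X : ∀ n, Ω n → ℝ)
    (hX : ∀ n, AEMeasurable (X n) (P n)) {N : ℕ} {t₀ C : ℝ} (ht₀ : 0 < t₀) {β₁ β₂ : ℂ}
    {l₁ l₂ : ℕ → ℂ} {b : ℝ → ℂ} {L : ℕ → ℝ → ℂ}
    (hφ : ∀ n ≥ N, ∀ t : ℝ, |t| < t₀ →
      charFun ((P n).map (X n)) t = Complex.exp (n * b t + L n t))
    (hb : ∀ t : ℝ, |t| < t₀ → ‖b t - (β₁ * t + β₂ * (t : ℂ) ^ 2)‖ ≤ C * |t| ^ 3)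
    (hL : ∀ n ≥ N, ∀ t : ℝ, |t| < t₀ → ‖L n t - (l₁ n * t + l₂ n * (t : ℂ) ^ 2)‖ ≤ C * |t| ^ 3)
    (hl₁ : ∀ n ≥ N, ‖l₁ n‖ ≤ C) (hl₂ : ∀ n ≥ N, ‖l₂ n‖ ≤ C) :
    0 ≤ -2 * β₂.re ∧ SatisfiesCLT P X β₁.im (-2 * β₂.re) := by
  have hprob : ∀ n, IsProbabilityMeasure ((P n).map (X n)) := fun n =>
    Measure.isProbabilityMeasure_map (hX n)
  have hcomb : ∀ n ≥ N, ∀ t : ℝ, |t| < t₀ →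
      ‖n * b t + L n t - ((n * β₁ + l₁ n) * t + (n * β₂ + l₂ n) * (t : ℂ) ^ 2)‖
        ≤ (n * C + C) * |t| ^ 3 := by
    intro n hn t ht
    calc _ = ‖(n : ℂ) * (b t - (β₁ * t + β₂ * (t : ℂ) ^ 2))
          + (L n t - (l₁ n * t + l₂ n * (t : ℂ) ^ 2))‖ := by congr 1; ring
      _ ≤ n * (C * |t| ^ 3) + C * |t| ^ 3 := by
        refine (norm_add_le _ _).trans (add_le_add ?_ (hL n hn t ht))
        rw [norm_mul, Complex.norm_natCast]
        gcongr
        exact hb t ht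
      _ = _ := by ring
  have hmom := fun n (hn : n ≥ N) => moments_of_charFun_eq_exp ht₀ (hφ n hn) (hcomb n hn)
  have hmem : ∀ n ≥ N, MemLp (X n) 2 (P n) := fun n hn =>
    (memLp_map_measure_iff aestronglyMeasurable_id (hX n)).1 (hmom n hn).1
  have hmean : ∀ n ≥ N, (n : ℂ) * β₁ + l₁ n = ((∫ ω, X n ω ∂(P n) : ℝ) : ℂ) * Complex.I := by
    intro n hn
    have := (hmom n hn).2.1
    rwa [integral_map (hX n) (by fun_prop)] at this
  have hvar : ∀ n ≥ N, (n : ℂ) * β₂ + l₂ n = -((variance (X n) (P n) : ℝ) : ℂ) / 2 := by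
    intro n hn
    have := (hmom n hn).2.2
    rwa [variance_map aemeasurable_id (hX n)] at this
  have hmean' : ∀ n ≥ N, ∫ ω, X n ω ∂(P n) = n * β₁.im + (l₁ n).im := by
    intro n hn
    simpa using (congrArg Complex.im (hmean n hn)).symm
  have hvar' : ∀ n ≥ N, variance (X n) (P n) = n * (-2 * β₂.re) - 2 * (l₂ n).re := by
    intro n hn
    have h := congrArg Complex.re (hvar n hn)
    have h2 : (-((variance (X n) (P n) : ℝ) : ℂ) / 2).re = -variance (X n) (P n) / 2 := by
      rw [← Complex.ofReal_neg, ← Complex.ofReal_ofNat, ← Complex.ofReal_div, Complex.ofReal_re]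
    rw [h2] at h
    simp only [Complex.add_re, Complex.mul_re, Complex.natCast_re, Complex.natCast_im, zero_mul,
      sub_zero] at h
    linarith
  have hCn : ∀ᶠ n : ℕ in atTop, n ≥ N := eventually_ge_atTop N
  -- A negative value would make the variances negative for large `n`.
  have hσ : 0 ≤ -2 * β₂.re := by
    by_contra hneg
    push Not at hneg
    have hlim : Tendsto (fun n : ℕ => (n : ℝ) * (-2 * β₂.re) + 2 * C) atTop atBot :=
      tendsto_atBot_add_const_right _ _
        (tendsto_natCast_atTop_atTop.atTop_mul_const_of_neg hneg)
    obtain ⟨n, h1, h2⟩ := ((hlim.eventually_lt_atBot 0).and hCn).exists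
    have h3 := hvar' n h2
    have h4 := variance_nonneg (X n) (P n)
    have h5 := (Complex.abs_re_le_norm (l₂ n)).trans (hl₂ n h2)
    have := (abs_le.1 h5).1
    linarith
  refine ⟨hσ, ?_, ?_, ?_, fun hpos => ?_⟩
  · filter_upwards [hCn] with n hn using hmem n hn
  · refine IsBigO.of_bound C ?_
    filter_upwards [hCn] with n hn
    rw [hmean' n hn, show (n : ℝ) * β₁.im + (l₁ n).im - β₁.im * n = (l₁ n).im by ring]
    simpa using (Complex.abs_im_le_norm (l₁ n)).trans (hl₁ n hn)
  · refine IsBigO.of_bound (2 * C) ?_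
    filter_upwards [hCn] with n hn
    rw [hvar' n hn, show (n : ℝ) * (-2 * β₂.re) - 2 * (l₂ n).re - -2 * β₂.re * n
      = -2 * (l₂ n).re by ring]
    have := (Complex.abs_re_le_norm (l₂ n)).trans (hl₂ n hn)
    simp only [Real.norm_eq_abs, abs_mul, abs_neg, abs_two, norm_one, mul_one]
    linarith
  · have hmeas : ∀ n, AEMeasurable
        (fun ω => (X n ω - ∫ ω', X n ω' ∂(P n)) / Real.sqrt (variance (X n) (P n))) (P n) :=
      fun n => ((hX n).sub_const _).div_const _
    refine ⟨hmeas, aemeasurable_id, ?_⟩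
    refine ProbabilityMeasure.tendsto_iff_tendsto_charFun.2 fun t => ?_
    simp only [ProbabilityMeasure.coe_mk, Measure.map_id, charFun_gaussianReal]
    set v : ℕ → ℝ := fun n => variance (X n) (P n) with hv
    set m : ℕ → ℝ := fun n => ∫ ω', X n ω' ∂(P n) with hm
    have hchar : ∀ n, charFun ((P n).map
        (fun ω => (X n ω - m n) / Real.sqrt (v n))) t =
        Complex.exp (-(m n * (t / Real.sqrt (v n)) : ℝ) * Complex.I)
          * charFun ((P n).map (X n)) (t / Real.sqrt (v n)) := by
      intro n
      rw [charFun_apply_real, charFun_apply_real, integral_map (hmeas n) (by fun_prop),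
        integral_map (hX n) (by fun_prop), ← integral_const_mul]
      congr 1 with ω
      rw [← Complex.exp_add]
      congr 1
      push_cast
      ring
    set s : ℕ → ℝ := fun n => Real.sqrt (v n)
    have hvtop : Tendsto (fun n : ℕ => v n) atTop atTop := by
      have hlim : Tendsto (fun n : ℕ => (n : ℝ) * (-2 * β₂.re) - 2 * C) atTop atTop :=
        tendsto_atTop_add_const_right _ _ (tendsto_natCast_atTop_atTop.atTop_mul_const hpos)
      refine tendsto_atTop_mono' _ ?_ hlim
      filter_upwards [hCn] with n hn
      have h5 := (Complex.abs_re_le_norm (l₂ n)).trans (hl₂ n hn)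
      simp only [hv, hvar' n hn]
      linarith [(abs_le.1 h5).2]
    have hs_top : Tendsto s atTop atTop := Real.tendsto_sqrt_atTop.comp hvtop
    have hts : Tendsto (fun n => |t / s n|) atTop (𝓝 0) := by
      simpa using (tendsto_const_nhds.div_atTop hs_top).abs
    -- The cubic error at the rescaled argument: `s n ^ 2` is the variance, which is asymptotic to
    -- `σ² n`, so `n |t / s n|²` stays bounded while `|t / s n| → 0`.
    have hratio : Tendsto (fun n : ℕ => (n * C + C) * |t / s n| ^ 3) atTop (𝓝 0) := by
      have h1 : Tendsto (fun n : ℕ => (n : ℝ) / v n) atTop (𝓝 (-2 * β₂.re)⁻¹) := by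
        have h2 : Tendsto (fun n : ℕ => v n / n) atTop (𝓝 (-2 * β₂.re)) := by
          have h3 : Tendsto (fun n : ℕ => (-2 * β₂.re) - 2 * ((l₂ n).re / n)) atTop
              (𝓝 ((-2 * β₂.re) - 2 * 0)) := by
            refine tendsto_const_nhds.sub (Tendsto.const_mul _ ?_)
            have h4 : Tendsto (fun n : ℕ => C / (n : ℝ)) atTop (𝓝 0) :=
              tendsto_const_nhds.div_atTop tendsto_natCast_atTop_atTop
            refine squeeze_zero_norm' ?_ h4
            filter_upwards [hCn] with n hn
            rw [norm_div, Real.norm_natCast]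
            gcongr
            exact (Complex.abs_re_le_norm (l₂ n)).trans (hl₂ n hn)
          rw [mul_zero, sub_zero] at h3
          refine h3.congr' ?_
          filter_upwards [hCn, eventually_gt_atTop 0] with n hn hn0
          have : (n : ℝ) ≠ 0 := by positivity
          simp only [hv, hvar' n hn]
          field_simp
        refine (h2.inv₀ hpos.ne').congr fun n => by rw [inv_div]
      have h6 : Tendsto (fun n : ℕ => C / v n) atTop (𝓝 0) := tendsto_const_nhds.div_atTop hvtop
      have h7 := (((h1.mul_const C).add h6).mul (tendsto_const_nhds (x := t ^ 2))).mul hts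
      rw [mul_zero] at h7
      refine h7.congr' ?_
      filter_upwards [hvtop.eventually_gt_atTop 0] with n hn
      have h8 : |t / s n| ^ 2 = t ^ 2 / v n := by
        rw [sq_abs, div_pow, Real.sq_sqrt hn.le]
      rw [pow_succ |t / s n| 2, h8]
      field_simp
    -- Centring by the exact mean and scaling by the exact variance turn the linear and quadratic
    -- terms into exactly `-t² / 2`. Only the cubic remainder has to tend to zero.
    have hfin : Tendsto (fun n : ℕ => Complex.exp (-(t : ℂ) ^ 2 / 2 +
        (n * b (t / s n) + L n (t / s n) - ((n * β₁ + l₁ n) * (t / s n : ℝ)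
          + (n * β₂ + l₂ n) * ((t / s n : ℝ) : ℂ) ^ 2)))) atTop
        (𝓝 (Complex.exp (-(t : ℂ) ^ 2 / 2 + 0))) := by
      refine (Complex.continuous_exp.tendsto _).comp (tendsto_const_nhds.add ?_)
      refine squeeze_zero_norm' ?_ hratio
      filter_upwards [hCn, hts.eventually_lt_const ht₀] with n hn hn2
      exact hcomb n hn _ hn2
    have hgoal : Complex.exp (t * (0 : ℝ) * Complex.I - ((1 : ℝ≥0) : ℝ) * (t : ℂ) ^ 2 / 2)
        = Complex.exp (-(t : ℂ) ^ 2 / 2 + 0) := by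
      congr 1; push_cast; ring
    rw [hgoal]
    refine hfin.congr' ?_
    filter_upwards [hCn, hts.eventually_lt_const ht₀, hvtop.eventually_gt_atTop 0] with n hn hn2 hv0
    rw [hchar n, hφ n hn _ hn2, ← Complex.exp_add, hmean n hn, hvar n hn]
    congr 1
    have h8 : ((t / s n : ℝ) : ℂ) ^ 2 = (t : ℂ) ^ 2 / (v n : ℂ) := by
      rw [← Complex.ofReal_pow, div_pow, Real.sq_sqrt hv0.le]; push_cast; rfl
    have hv0' : (v n : ℂ) ≠ 0 := by exact_mod_cast hv0.ne'
    rw [h8]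
    push_cast
    field_simp
    ring

end CentralLimit

/-! ### The equation `s = E(x, s)` on a polydisc and its small solution -/

/-- The open polydisc `|x| < R`, `|s| < S`. -/
def polydisc (R S : ℝ) : Set (ℂ × ℂ) := ball 0 R ×ˢ ball 0 S

theorem mem_polydisc {R S : ℝ} {x s : ℂ} : (x, s) ∈ polydisc R S ↔ ‖x‖ < R ∧ ‖s‖ < S := by
  simp [polydisc]

theorem isOpen_polydisc (R S : ℝ) : IsOpen (polydisc R S) := isOpen_ball.prod isOpen_ball

/-- Bounded holomorphic functions on a polydisc that vanish for `x = 0`. -/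
structure Admissible (R S M : ℝ) (E : ℂ × ℂ → ℂ) : Prop where
  diff : DifferentiableOn ℂ E (polydisc R S)
  bound : ∀ p ∈ polydisc R S, ‖E p‖ ≤ M
  zero : ∀ s : ℂ, ‖s‖ < S → E (0, s) = 0

/-- On the disc `|x| < r` the equation `s = E(x, s)` is a contraction. -/
structure SmallRadius (R S M y₀ r : ℝ) : Prop where
  y₀_pos : 0 < y₀
  y₀_lt : y₀ < S
  r_pos : 0 < r
  r_lt : r < R
  small : M * r ≤ R * (y₀ / 8)

theorem exists_smallRadius {R S M y₀ : ℝ} (hR : 0 < R) (hy : 0 < y₀) (hS : y₀ < S) :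
    ∃ r, SmallRadius R S M y₀ r := by
  have h : Tendsto (fun r : ℝ => M * r) (𝓝[>] 0) (𝓝 0) :=
    (Continuous.tendsto' (by fun_prop) _ _ (by simp)).mono_left nhdsWithin_le_nhds
  have h2 : Tendsto (fun r : ℝ => r) (𝓝[>] 0) (𝓝 0) := nhdsWithin_le_nhds
  obtain ⟨r, h3, h4, h5⟩ := ((h.eventually_le_const (by positivity : 0 < R * (y₀ / 8))).and
    ((h2.eventually_lt_const hR).and self_mem_nhdsWithin)).exists
  exact ⟨r, hy, hS, h5, h4, h3⟩

namespace Admissible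

variable {R S M y₀ r : ℝ} {E : ℂ × ℂ → ℂ}

theorem differentiableAt_left (hE : Admissible R S M E) {x s : ℂ} (hx : ‖x‖ < R) (hs : ‖s‖ < S) :
    DifferentiableAt ℂ (fun x => E (x, s)) x := by
  have : DifferentiableAt ℂ E (x, s) :=
    hE.diff.differentiableAt ((isOpen_polydisc R S).mem_nhds (mem_polydisc.2 ⟨hx, hs⟩))
  exact DifferentiableAt.comp x this (by fun_prop)

theorem differentiableAt_right (hE : Admissible R S M E) {x s : ℂ} (hx : ‖x‖ < R) (hs : ‖s‖ < S) :
    DifferentiableAt ℂ (fun s => E (x, s)) s := by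
  have : DifferentiableAt ℂ E (x, s) :=
    hE.diff.differentiableAt ((isOpen_polydisc R S).mem_nhds (mem_polydisc.2 ⟨hx, hs⟩))
  exact DifferentiableAt.comp s this (by fun_prop)

/-- Schwarz's lemma in `x`, since `E` vanishes at `x = 0`. -/
theorem norm_le (hE : Admissible R S M E) {x s : ℂ} (hx : ‖x‖ < R) (hs : ‖s‖ < S) :
    ‖E (x, s)‖ ≤ M / R * ‖x‖ := by
  have := Complex.dist_le_div_mul_dist_of_mapsTo_ball (f := fun x => E (x, s)) (c := 0) (R₁ := R)
    (R₂ := M) (z := x) (fun p hp => (hE.differentiableAt_left (by simpa using hp)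
      hs).differentiableWithinAt) (fun p hp => ?_) (by simpa using hx)
  · simpa [hE.zero s hs] using this
  · simpa [hE.zero s hs] using hE.bound (p, s) (mem_polydisc.2 ⟨by simpa using hp, hs⟩)

theorem norm_le_of_small (hE : Admissible R S M E) (hr : SmallRadius R S M y₀ r) {x s : ℂ}
    (hx : ‖x‖ < r) (hs : ‖s‖ < S) : ‖E (x, s)‖ ≤ y₀ / 8 := by
  have hR : 0 < R := hr.r_pos.trans hr.r_lt
  refine (hE.norm_le (hx.trans hr.r_lt) hs).trans ?_
  have hM : 0 ≤ M := (norm_nonneg _).trans (hE.bound (0, s) (mem_polydisc.2 ⟨by simpa, hs⟩))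
  rw [div_mul_eq_mul_div, div_le_iff₀ hR]
  calc M * ‖x‖ ≤ M * r := by gcongr
    _ ≤ _ := hr.small.trans_eq (by ring)

/-- A function bounded by `y₀ / 8` on discs of radius `S / 2` has Lipschitz constant `2 (y₀ / 8) /
(S / 2) = y₀ / (2 S)`, which is below `1 / 2`. The `8` in `SmallRadius` leaves room for this. -/
theorem lipschitz (hE : Admissible R S M E) (hr : SmallRadius R S M y₀ r) {x s s' : ℂ}
    (hx : ‖x‖ < r) (hs : ‖s‖ ≤ S / 2) (hs' : ‖s'‖ ≤ S / 2) :
    ‖E (x, s) - E (x, s')‖ ≤ 1 / 2 * ‖s - s'‖ := by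
  have hS : 0 < S := hr.y₀_pos.trans hr.y₀_lt
  have hb : ∀ p ∈ ball s' (S / 2), ‖p‖ < S := fun p hp => by
    have := norm_sub_norm_le p s'
    rw [mem_ball, dist_eq_norm] at hp
    linarith
  refine (norm_sub_le_of_bounded (f := fun s => E (x, s)) (r := S / 2) (M := y₀ / 8)
    (by positivity) (fun p hp => (hE.differentiableAt_right (hx.trans hr.r_lt)
      (hb p hp)).differentiableWithinAt) (fun p hp => hE.norm_le_of_small hr hx (hb p hp))
    (hE.norm_le_of_small hr hx (by linarith))).trans ?_
  have := hr.y₀_lt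
  refine mul_le_mul_of_nonneg_right ?_ (norm_nonneg _)
  rw [div_le_iff₀ (by positivity)]
  linarith

end Admissible

/-- The solution `s` of the equation `s = E(x, s)`, as the limit of Picard iterates. -/
def solAt (E : ℂ × ℂ → ℂ) (x : ℂ) : ℂ := limUnder atTop fun k => (fun s => E (x, s))^[k] 0

/-- The coefficients of the solution of `s = E(x, s)`. -/
def solCoeff (E : ℂ × ℂ → ℂ) (n : ℕ) : ℂ := (n.factorial : ℂ)⁻¹ * iteratedDeriv n (solAt E) 0

namespace Admissible

variable {R S M y₀ r : ℝ} {E : ℂ × ℂ → ℂ}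

theorem norm_iterate_le (hE : Admissible R S M E) (hr : SmallRadius R S M y₀ r) {x : ℂ}
    (hx : ‖x‖ < r) (k : ℕ) : ‖(fun s => E (x, s))^[k] 0‖ ≤ y₀ / 8 := by
  have hy := hr.y₀_pos
  have hS := hr.y₀_lt
  induction k with
  | zero => simpa using by positivity
  | succ k ih =>
    rw [Function.iterate_succ_apply']
    exact hE.norm_le_of_small hr hx (by linarith)

theorem solAt_spec (hE : Admissible R S M E) (hr : SmallRadius R S M y₀ r) {x : ℂ}
    (hx : ‖x‖ < r) : ‖solAt E x‖ ≤ y₀ / 8 ∧ E (x, solAt E x) = solAt E x ∧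
      Tendsto (fun k => (fun s => E (x, s))^[k] 0) atTop (𝓝 (solAt E x)) := by
  have hy := hr.y₀_pos
  have hS := hr.y₀_lt
  have hmaps : MapsTo (fun s => E (x, s)) (closedBall 0 (y₀ / 8)) (closedBall 0 (y₀ / 8)) := by
    intro s hs
    rw [mem_closedBall_zero_iff] at hs ⊢
    exact hE.norm_le_of_small hr hx (by linarith)
  have hlip : ContractingWith (1 / 2 : ℝ≥0) (hmaps.restrict _ _ _) := by
    refine ⟨by rw [one_div]; exact inv_lt_one_of_one_lt₀ (by norm_num), ?_⟩
    refine LipschitzWith.of_dist_le_mul fun a b => ?_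
    have ha := a.2
    have hb := b.2
    rw [mem_closedBall_zero_iff] at ha hb
    have := hE.lipschitz hr hx (s := a) (s' := b) (by linarith) (by linarith)
    rw [Subtype.dist_eq, Subtype.dist_eq, dist_eq_norm, dist_eq_norm]
    simpa using this
  obtain ⟨y, hy1, hy2, hy3, -⟩ := hlip.exists_fixedPoint'
    (isClosed_closedBall.isComplete) hmaps (x := 0) (by simp; positivity) (edist_ne_top _ _)
  have : solAt E x = y := hy3.limUnder_eq
  rw [this]
  exact ⟨by simpa using hy1, hy2, hy3⟩

/-- A solution with `|s| < S` automatically satisfies `|s| ≤ y₀ / 8`, where the contraction estimate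
forces uniqueness. -/
theorem eq_solAt (hE : Admissible R S M E) (hr : SmallRadius R S M y₀ r) {x s : ℂ}
    (hx : ‖x‖ < r) (hs : ‖s‖ < S) (h : E (x, s) = s) : s = solAt E x := by
  have hy := hr.y₀_pos
  have hS := hr.y₀_lt
  obtain ⟨h1, h2, -⟩ := hE.solAt_spec hr hx
  have h3 := hE.norm_le_of_small hr hx hs
  rw [h] at h3
  have := hE.lipschitz hr hx (s := s) (s' := solAt E x) (by linarith) (by linarith)
  rw [h, h2] at this
  have h0 := norm_nonneg (s - solAt E x)
  exact sub_eq_zero.1 (norm_eq_zero.1 (by linarith))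

end Admissible

/-! ### Holomorphic dependence of the solution on a parameter -/

section Family

variable {W : Type*} [NormedAddCommGroup W] [NormedSpace ℂ W] {R S M y₀ r : ℝ}
  {B : Set W} {e : W → ℂ × ℂ → ℂ}

/-- The Picard iterates are jointly holomorphic and bounded by `y₀ / 8`, so their pointwise limit is
holomorphic. -/
theorem differentiableOn_solAt (hB : IsOpen B) (hr : SmallRadius R S M y₀ r)
    (he : DifferentiableOn ℂ (fun q : W × (ℂ × ℂ) => e q.1 q.2) (B ×ˢ polydisc R S))
    (hE : ∀ h ∈ B, Admissible R S M (e h)) :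
    DifferentiableOn ℂ (fun q : W × ℂ => solAt (e q.1) q.2) (B ×ˢ ball 0 r) := by
  have hy := hr.y₀_pos
  have hS := hr.y₀_lt
  have hopen : IsOpen (B ×ˢ ball (0 : ℂ) r) := hB.prod isOpen_ball
  have hit : ∀ k : ℕ, DifferentiableOn ℂ
      (fun q : W × ℂ => (fun s => e q.1 (q.2, s))^[k] 0) (B ×ˢ ball 0 r) := by
    intro k
    induction k with
    | zero => simp
    | succ k ih =>
      simp_rw [Function.iterate_succ_apply']
      refine he.comp (f := fun q : W × ℂ => (q.1, (q.2, (fun s => e q.1 (q.2, s))^[k] 0)))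
        (by fun_prop) ?_
      rintro ⟨h, x⟩ ⟨h1, h2⟩
      have hx : ‖x‖ < r := by simpa using h2
      have := (hE h h1).norm_iterate_le hr hx k
      exact ⟨h1, mem_polydisc.2 ⟨hx.trans hr.r_lt, by simp only; linarith⟩⟩
  rintro c hc
  refine DifferentiableAt.differentiableWithinAt ?_
  obtain ⟨ρ, hρ, hsub⟩ := Metric.isOpen_iff.1 hopen c hc
  refine differentiableAt_of_tendsto (l := atTop) (M := y₀ / 8) hρ
    (f := fun k (q : W × ℂ) => (fun s => e q.1 (q.2, s))^[k] 0)
    (Eventually.of_forall fun k => ⟨(hit k).mono hsub, ?_⟩) ?_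
  · rintro ⟨h, x⟩ hq
    obtain ⟨h1, h2⟩ := hsub hq
    exact (hE h h1).norm_iterate_le hr (by simpa using h2) k
  · rintro ⟨h, x⟩ hq
    obtain ⟨h1, h2⟩ := hsub hq
    exact ((hE h h1).solAt_spec hr (by simpa using h2)).2.2

theorem exists_differentiableOn_iteratedDeriv (hB : IsOpen B) {g : W × ℂ → ℂ} {ρ : ℝ}
    (n : ℕ) (hg : DifferentiableOn ℂ g (B ×ˢ ball 0 ρ)) :
    ∃ g' : W × ℂ → ℂ, DifferentiableOn ℂ g' (B ×ˢ ball 0 ρ) ∧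
      ∀ h ∈ B, ∀ x ∈ ball (0 : ℂ) ρ, iteratedDeriv n (fun x => g (h, x)) x = g' (h, x) := by
  have hopen : IsOpen (B ×ˢ ball (0 : ℂ) ρ) := hB.prod isOpen_ball
  induction n with
  | zero => exact ⟨g, hg, by simp⟩
  | succ n ih =>
    obtain ⟨g', hg', h'⟩ := ih
    refine ⟨_, differentiableOn_fderiv_apply hopen hg' (0, 1), fun h hh x hx => ?_⟩
    have h1 : iteratedDeriv n (fun x => g (h, x)) =ᶠ[𝓝 x] fun x => g' (h, x) := by
      filter_upwards [isOpen_ball.mem_nhds hx] with z hz using h' h hh z hz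
    rw [iteratedDeriv_succ, h1.deriv_eq]
    have h2 : HasFDerivAt g' (fderiv ℂ g' (h, x)) (h, x) :=
      (hg'.differentiableAt (hopen.mem_nhds ⟨hh, hx⟩)).hasFDerivAt
    have h3 : HasDerivAt (fun x : ℂ => (h, x)) ((0, 1) : W × ℂ) x :=
      (hasDerivAt_const x h).prodMk (hasDerivAt_id x)
    exact (h2.comp_hasDerivAt x h3).deriv

theorem differentiableOn_solCoeff (hB : IsOpen B) (hr : SmallRadius R S M y₀ r)
    (he : DifferentiableOn ℂ (fun q : W × (ℂ × ℂ) => e q.1 q.2) (B ×ˢ polydisc R S))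
    (hE : ∀ h ∈ B, Admissible R S M (e h)) (n : ℕ) :
    DifferentiableOn ℂ (fun h => solCoeff (e h) n) B := by
  obtain ⟨g', hg', h'⟩ := exists_differentiableOn_iteratedDeriv hB n
    (differentiableOn_solAt hB hr he hE)
  refine DifferentiableOn.const_mul ?_ _
  have h0 : (0 : ℂ) ∈ ball (0 : ℂ) r := mem_ball_self hr.r_pos
  have : DifferentiableOn ℂ (fun h => g' (h, 0)) B :=
    hg'.comp (f := fun h : W => (h, (0 : ℂ))) (by fun_prop) fun h hh => ⟨hh, h0⟩
  exact this.congr fun h hh => h' h hh 0 h0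

end Family

/-! ### Coefficients of the solution and a contour integral for the solution -/

namespace Admissible

variable {R S M y₀ r : ℝ} {E : ℂ × ℂ → ℂ}

theorem differentiableOn_solAt (hE : Admissible R S M E) (hr : SmallRadius R S M y₀ r) :
    DifferentiableOn ℂ (solAt E) (ball 0 r) := by
  -- The parametrized statement is applied to a constant family.
  have := InfiniteSystem.differentiableOn_solAt (W := ℂ) (B := univ) (e := fun _ => E) isOpen_univ
    hr (hE.diff.comp differentiableOn_snd fun q hq => hq.2) (fun _ _ => hE)
  exact this.comp (f := fun x : ℂ => ((0 : ℂ), x)) (by fun_prop) fun x hx => ⟨mem_univ _, hx⟩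

theorem hasSum_solCoeff (hE : Admissible R S M E) (hr : SmallRadius R S M y₀ r) {x : ℂ}
    (hx : ‖x‖ < r) : HasSum (fun n => solCoeff E n * x ^ n) (solAt E x) := by
  have := Complex.hasSum_taylorSeries_on_ball (hE.differentiableOn_solAt hr)
    (z := x) (by simpa using hx)
  refine this.congr_fun fun n => ?_
  simp only [sub_zero, smul_eq_mul, solCoeff]; ring

/-- A convergent power series solution of `s = E(x, s)` has the coefficients `solCoeff`. -/
theorem solCoeff_eq (hE : Admissible R S M E) (hr : SmallRadius R S M y₀ r) {f : ℂ → ℂ}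
    (hf : ∀ᶠ x in 𝓝 0, ‖f x‖ < S ∧ E (x, f x) = f x) (n : ℕ) :
    solCoeff E n = (n.factorial : ℂ)⁻¹ * iteratedDeriv n f 0 := by
  have : f =ᶠ[𝓝 0] solAt E := by
    filter_upwards [hf, ball_mem_nhds _ hr.r_pos] with x hx hx2
    exact hE.eq_solAt hr (by simpa using hx2) hx.1 hx.2
  rw [solCoeff, this.iteratedDeriv_eq]

theorem solCoeff_zero (hE : Admissible R S M E) (hr : SmallRadius R S M y₀ r) :
    solCoeff E 0 = 0 := by
  have h0 : ‖(0 : ℂ)‖ < r := by simpa using hr.r_pos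
  have hS := hr.y₀_pos.trans hr.y₀_lt
  have := hE.eq_solAt hr h0 (s := 0) (by simpa) (hE.zero 0 (by simpa))
  simp [solCoeff, ← this]

/-- On the circle `|s| = y₀` the quotient `E / s` has modulus at most `1 / 8`, so the principal
branch of the logarithm is harmless. -/
theorem one_sub_div_mem_slitPlane (hE : Admissible R S M E) (hr : SmallRadius R S M y₀ r)
    {x s : ℂ} (hx : ‖x‖ < r) (hs : ‖s‖ = y₀) : 1 - E (x, s) / s ∈ Complex.slitPlane := by
  rw [sub_eq_add_neg]
  refine Complex.mem_slitPlane_of_norm_lt_one ?_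
  have hy := hr.y₀_pos
  have := hE.norm_le_of_small hr hx (s := s) (by rw [hs]; exact hr.y₀_lt)
  rw [norm_neg, norm_div, hs, div_lt_one hy]
  linarith

/-- The integral formula for the solution of `s = E(x, s)`. -/
theorem circleIntegral_log_eq (hE : Admissible R S M E) (hr : SmallRadius R S M y₀ r) {x : ℂ}
    (hx : ‖x‖ < r) :
    (∮ s in C(0, y₀), -Complex.log (1 - E (x, s) / s)) = 2 * Real.pi * Complex.I * solAt E x := by
  have hy := hr.y₀_pos
  have hS := hr.y₀_lt
  set s₁ := solAt E x with hs₁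
  obtain ⟨h1, h2, -⟩ := hE.solAt_spec hr hx
  set e : ℂ → ℂ := fun s => E (x, s) with he
  have hed : ∀ s : ℂ, ‖s‖ < S → DifferentiableAt ℂ e s := fun s hs =>
    hE.differentiableAt_right (hx.trans hr.r_lt) hs
  have hon : DifferentiableOn ℂ (fun s => s - e s) (ball 0 S) := fun s hs =>
    (differentiableAt_id.sub (hed s (by simpa using hs))).differentiableWithinAt
  have hs₁S : s₁ ∈ ball (0 : ℂ) S := by
    rw [mem_ball_zero_iff]; linarith
  -- The quotient `(s - e s) / (s - s₁)` is zero-free: `s₁` is the only zero of `s - e s`, and it is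
  -- simple because `|e'(s₁)| ≤ 1 / 2`.
  set q : ℂ → ℂ := dslope (fun s => s - e s) s₁ with hq
  have hqd : DifferentiableOn ℂ q (ball 0 S) :=
    (Complex.differentiableOn_dslope (isOpen_ball.mem_nhds hs₁S)).2 hon
  have hqe : ∀ s, (s - s₁) * q s = s - e s := fun s => by
    have := sub_smul_dslope (fun s => s - e s) s₁ s
    simp only [smul_eq_mul] at this
    rw [hq, this]
    simp only [he]
    rw [h2]; ring
  have hd : deriv (fun s => s - e s) s₁ = 1 - deriv e s₁ :=
    ((hasDerivAt_id s₁).sub (hed _ (by simpa using hs₁S)).hasDerivAt).deriv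
  have hq0 : ∀ s, ‖s‖ < S → q s ≠ 0 := by
    intro s hs h0
    have h3 := hqe s
    rw [h0, mul_zero] at h3
    have h4 : s = s₁ := hE.eq_solAt hr hx hs (sub_eq_zero.1 h3.symm).symm
    rw [h4, hq, dslope_same] at h0
    rw [hd] at h0
    have h5 : ‖deriv e s₁‖ ≤ 1 / 2 := by
      refine norm_deriv_le_of_lip' (by norm_num) ?_
      filter_upwards [isOpen_ball.mem_nhds
        (show s₁ ∈ ball (0 : ℂ) (S / 2) by rw [mem_ball_zero_iff]; linarith)] with z hz
      rw [mem_ball_zero_iff] at hz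
      exact hE.lipschitz hr hx hz.le (by linarith)
    rw [← sub_eq_zero.1 h0] at h5
    norm_num at h5
  have hed' : DifferentiableOn ℂ (deriv e) (ball 0 S) :=
    (DifferentiableOn.deriv (fun s hs => (hed s (by simpa using hs)).differentiableWithinAt)
      isOpen_ball)
  have hsub : closedBall (0 : ℂ) y₀ ⊆ ball 0 S := closedBall_subset_ball hS
  set k : ℂ → ℂ := fun s => s * (1 - deriv e s) / q s with hk
  have hkd : DifferentiableOn ℂ k (ball 0 S) :=
    (differentiableOn_id.mul ((differentiableOn_const 1).sub hed')).div hqd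
      fun s hs => hq0 s (by simpa using hs)
  have hkc : DiffContOnCl ℂ k (ball 0 y₀) := by
    refine DifferentiableOn.diffContOnCl (hkd.mono ?_)
    rw [closure_ball _ hy.ne']; exact hsub
  have hcauchy := hkc.circleIntegral_sub_inv_smul (w := s₁) (by rw [mem_ball_zero_iff]; linarith)
  have hks₁ : k s₁ = s₁ := by
    have : q s₁ = 1 - deriv e s₁ := by
      rw [hq, dslope_same, hd]
    simp only [hk]
    rw [this, mul_div_assoc, div_self (by rw [← this]; exact hq0 _ (by simpa using hs₁S)), mul_one]
  rw [hks₁, smul_eq_mul] at hcauchy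
  have hpos : ∀ s ∈ sphere (0 : ℂ) y₀, ‖s‖ < S ∧ s ≠ 0 ∧ s - s₁ ≠ 0 ∧ s - e s ≠ 0 := by
    intro s hs
    rw [mem_sphere_zero_iff_norm] at hs
    have h0 : s - s₁ ≠ 0 := fun h => by
      have := sub_eq_zero.1 h
      rw [← hs₁, ← this] at h1
      linarith
    have hsS : ‖s‖ < S := by linarith
    exact ⟨hsS, norm_pos_iff.1 (by linarith), h0, by rw [← hqe]; exact mul_ne_zero h0 (hq0 s hsS)⟩
  -- Integration by parts: the integrand is the derivative of `s log (1 - e s / s)`, because `(s -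
  -- s₁)⁻¹ k(s) = s (1 - e') / (s - e)`. The integral of the logarithm is then minus that of `(s -
  -- s₁)⁻¹ k(s)`, which Cauchy's formula evaluates with `k s₁ = s₁`.
  have hzero : (∮ s in C(0, y₀),
      (Complex.log (1 - e s / s) + ((s - s₁)⁻¹ • k s - 1))) = 0 := by
    refine circleIntegral.integral_eq_zero_of_hasDerivWithinAt
      (f := fun s => s * Complex.log (1 - e s / s)) hy.le fun s hs => HasDerivAt.hasDerivWithinAt ?_
    obtain ⟨hsS, hs0, hs1, hs2⟩ := hpos s hs
    have hslit := hE.one_sub_div_mem_slitPlane hr hx (mem_sphere_zero_iff_norm.1 hs)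
    have hd1 := ((hed s hsS).hasDerivAt.div (hasDerivAt_id s) hs0).const_sub 1
    have hd2 := (hasDerivAt_id s).mul (hd1.clog hslit)
    refine hd2.congr_deriv ?_
    have h3 : 1 - e s / s = (s - e s) / s := by field_simp
    simp only [id, one_mul, smul_eq_mul, Pi.div_apply]
    rw [h3]
    congr 1
    simp only [hk]
    have hqs := hq0 s hsS
    have h4 : (s - s₁)⁻¹ * (s * (1 - deriv e s) / q s) = s * (1 - deriv e s) / (s - e s) := by
      rw [← hqe s]; field_simp
    rw [h4]
    field_simp
    ring
  have hci1 : CircleIntegrable (fun s => Complex.log (1 - e s / s)) 0 y₀ := by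
    refine ContinuousOn.circleIntegrable hy.le fun s hs => ContinuousAt.continuousWithinAt ?_
    obtain ⟨hsS, hs0, -, -⟩ := hpos s hs
    have hslit := hE.one_sub_div_mem_slitPlane hr hx (mem_sphere_zero_iff_norm.1 hs)
    exact (continuousAt_const.sub ((hed s hsS).continuousAt.div continuousAt_id hs0)).clog hslit
  have hci2 : CircleIntegrable (fun s => (s - s₁)⁻¹ • k s) 0 y₀ := by
    refine ContinuousOn.circleIntegrable hy.le fun s hs => ContinuousAt.continuousWithinAt ?_
    obtain ⟨hsS, hs0, hs1, -⟩ := hpos s hs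
    exact ((continuousAt_id.sub continuousAt_const).inv₀ hs1).smul
      (hkd.differentiableAt (isOpen_ball.mem_nhds (by simpa using hsS))).continuousAt
  have hone : (∮ _s in C(0, y₀), (1 : ℂ)) = 0 := by
    refine Complex.circleIntegral_eq_zero_of_differentiable_on_off_countable hy.le countable_empty
      continuousOn_const (fun _ _ => by fun_prop)
  have hci3 := circleIntegrable_const (1 : ℂ) 0 y₀
  have hadd := (circleIntegral.integral_add hci1 (hci2.sub hci3)).symm.trans hzero
  have hsub2 := circleIntegral.integral_sub hci2 hci3
  simp only [Pi.sub_def] at hadd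
  rw [hsub2, hcauchy, hone, sub_zero] at hadd
  have hneg : (∮ s in C(0, y₀), -Complex.log (1 - e s / s))
      = -∮ s in C(0, y₀), Complex.log (1 - e s / s) := by
    simp [circleIntegral, intervalIntegral.integral_neg]
  rw [hneg]
  linear_combination -hadd

end Admissible

/-! ### Laplace's method for integrals of large powers -/

section Laplace

/-- `(1 + z)ⁿ → exp w` if `n z → w`. -/
theorem tendsto_one_add_pow {α : Type*} {l : Filter α} {N : α → ℕ} {z : α → ℂ} {w : ℂ}
    (hN : Tendsto N l atTop) (h : Tendsto (fun p => (N p : ℂ) * z p) l (𝓝 w)) :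
    Tendsto (fun p => (1 + z p) ^ N p) l (𝓝 (Complex.exp w)) := by
  have hinv : Tendsto (fun p => ((N p : ℂ))⁻¹) l (𝓝 0) := by
    refine tendsto_zero_iff_norm_tendsto_zero.2 ?_
    simp only [norm_inv, Complex.norm_natCast]
    exact (tendsto_inv_atTop_zero.comp (tendsto_natCast_atTop_atTop (R := ℝ))).comp hN
  have hz : Tendsto z l (𝓝 0) := by
    have := hinv.mul h
    rw [zero_mul] at this
    refine this.congr' ?_
    filter_upwards [hN.eventually_gt_atTop 0] with p hp
    have : (N p : ℂ) ≠ 0 := by exact_mod_cast hp.ne'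
    field_simp
  have hlog : Tendsto (fun p => (N p : ℂ) * Complex.log (1 + z p)) l (𝓝 w) := by
    have h2 : Tendsto (fun p => (N p : ℂ) * (Complex.log (1 + z p) - z p)) l (𝓝 0) := by
      have h3 : Tendsto (fun p => ‖(N p : ℂ) * z p‖ * ‖z p‖) l (𝓝 0) := by
        simpa using h.norm.mul hz.norm
      refine squeeze_zero_norm' ?_ h3
      filter_upwards [hz.norm.eventually_lt_const (by simp : ‖(0 : ℂ)‖ < 1 / 2)] with p hp
      have h4 := Complex.norm_log_one_add_sub_self_le (z := z p) (by linarith)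
      have h5 : (1 - ‖z p‖)⁻¹ ≤ 2 := by
        rw [inv_le_comm₀ (by linarith) (by norm_num)]; linarith
      rw [norm_mul, norm_mul, mul_assoc]
      gcongr
      refine h4.trans ?_
      calc ‖z p‖ ^ 2 * (1 - ‖z p‖)⁻¹ / 2 ≤ ‖z p‖ ^ 2 * 2 / 2 := by gcongr
        _ = _ := by ring
    have := h.add h2
    rw [add_zero] at this
    refine this.congr fun p => by ring
  refine ((Complex.continuous_exp.tendsto _).comp hlog).congr' ?_
  filter_upwards [hz.norm.eventually_lt_const (by simp : ‖(0 : ℂ)‖ < 1)] with p hp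
  have : 1 + z p ≠ 0 := Complex.slitPlane_ne_zero (Complex.mem_slitPlane_of_norm_lt_one hp)
  simp only [Function.comp_apply]
  rw [Complex.exp_nat_mul, Complex.exp_log this]

/-- Laplace's method for integrals of powers, uniformly along a filter. -/
theorem tendsto_sqrt_mul_integral {ι : Type*} {l : Filter ι} [l.IsCountablyGenerated]
    {a : ι → ℕ → ℝ → ℂ} {Z : ι → ℝ → ℂ} {Q C ρ δ₀ : ℝ} (hQ : 0 < Q) (hδ₀ : 0 < δ₀) (hC : 0 ≤ C)
    (hρ : 0 ≤ ρ) (hρ1 : ρ < 1) (hcont : ∀ᶠ i in l, ∀ n, Continuous (a i n))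
    (hfar : ∀ᶠ i in l, ∀ n ≥ 1, ∀ θ : ℝ, |θ| ≤ Real.pi → δ₀ ≤ |θ| → ‖a i n θ‖ ≤ C * ρ ^ n)
    (hnear : ∀ᶠ i in l, ∀ n ≥ 1, ∀ θ : ℝ, |θ| < δ₀ → ‖a i n θ - (Z i θ)⁻¹ ^ n‖ ≤ C * ρ ^ n)
    (hZ : ∀ᶠ i in l, ∀ θ : ℝ, |θ| < δ₀ → ‖Z i θ - 1 - Q * (θ : ℂ) ^ 2‖ ≤ Q / 2 * θ ^ 2)
    (hZ' : ∀ κ > 0, ∃ δ > 0, ∀ᶠ i in l, ∀ θ : ℝ, |θ| < δ →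
      ‖Z i θ - 1 - Q * (θ : ℂ) ^ 2‖ ≤ κ * θ ^ 2) :
    Tendsto (fun p : ι × ℕ => (Real.sqrt p.2 : ℂ) *
      ∫ θ in (-Real.pi)..Real.pi, a p.1 p.2 θ * Complex.exp (θ * Complex.I)) (l ×ˢ atTop)
      (𝓝 (Real.sqrt (Real.pi / Q) : ℂ)) := by
  have hπ := Real.pi_pos
  -- The substitution `v = √n θ`, with the integrand extended by zero to the whole line, prepares
  -- dominated convergence against a multiple of `(1 + v²)⁻¹`.
  set F : ι × ℕ → ℝ → ℂ := fun p => (Ioc (-(Real.pi * Real.sqrt p.2)) (Real.pi * Real.sqrt p.2)).indicator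
    fun v => a p.1 p.2 (v / Real.sqrt p.2) * Complex.exp ((v / Real.sqrt p.2 : ℝ) * Complex.I) with hF
  have hFint : ∀ᶠ p : ι × ℕ in l ×ˢ atTop, ∫ v, F p v = (Real.sqrt p.2 : ℂ) *
      ∫ θ in (-Real.pi)..Real.pi, a p.1 p.2 θ * Complex.exp (θ * Complex.I) := by
    filter_upwards [tendsto_snd.eventually (eventually_gt_atTop 0)] with p hp
    have hs : 0 < Real.sqrt p.2 := Real.sqrt_pos.2 (by exact_mod_cast hp)
    rw [hF, integral_indicator measurableSet_Ioc, ← intervalIntegral.integral_of_le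
      (by linarith [mul_pos hπ hs])]
    have := intervalIntegral.integral_comp_div (a := -(Real.pi * Real.sqrt p.2))
      (b := Real.pi * Real.sqrt p.2)
      (fun θ : ℝ => a p.1 p.2 θ * Complex.exp (θ * Complex.I)) hs.ne'
    rw [this, neg_div, mul_div_cancel_right₀ _ hs.ne', Complex.real_smul]
  -- On the range of integration `v² ≤ π² n`, so this bound turns exponentially small errors into
  -- multiples of `(1 + v²)⁻¹`.
  obtain ⟨C', hC'⟩ : ∃ C', ∀ n : ℕ, C * (ρ ^ n * (1 + Real.pi ^ 2 * n)) ≤ C' := by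
    have h1 : Tendsto (fun n : ℕ => ρ ^ n) atTop (𝓝 0) := tendsto_pow_atTop_nhds_zero_of_lt_one hρ hρ1
    have h2 : Tendsto (fun n : ℕ => (n : ℝ) * ρ ^ n) atTop (𝓝 0) :=
      tendsto_self_mul_const_pow_of_lt_one hρ hρ1
    have h3 := ((h1.add (h2.const_mul (Real.pi ^ 2))).const_mul C)
    obtain ⟨C', hC'⟩ := h3.bddAbove_range
    refine ⟨C', fun n => ?_⟩
    refine le_trans (le_of_eq ?_) (hC' ⟨n, rfl⟩)
    ring
  set K := (min 1 (Q / 2))⁻¹ + C' with hK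
  have hmin : 0 < min 1 (Q / 2) := lt_min one_pos (by positivity)
  have hgauss : ∫ v : ℝ, Complex.exp (-(Q * v ^ 2 : ℝ)) = (Real.sqrt (Real.pi / Q) : ℂ) := by
    rw [← integral_gaussian, ← integral_complex_ofReal]
    refine integral_congr_ae (Eventually.of_forall fun v => ?_)
    simp only
    rw [Complex.ofReal_exp]; push_cast; ring_nf
  rw [← hgauss]
  have hnormexp : ∀ θ : ℝ, ‖Complex.exp (θ * Complex.I)‖ = 1 := Complex.norm_exp_ofReal_mul_I
  have hn1 : ∀ᶠ p : ι × ℕ in l ×ˢ atTop, 1 ≤ p.2 := tendsto_snd.eventually (eventually_ge_atTop 1)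
  refine Tendsto.congr' hFint (tendsto_integral_filter_of_dominated_convergence
    (fun v => K * (1 + v ^ 2)⁻¹) ?_ ?_ (integrable_inv_one_add_sq.const_mul K) ?_)
  · filter_upwards [tendsto_fst.eventually hcont] with p hp
    refine AEStronglyMeasurable.indicator (Continuous.aestronglyMeasurable ?_) measurableSet_Ioc
    exact ((hp p.2).comp (by fun_prop)).mul (by fun_prop)
  · filter_upwards [tendsto_fst.eventually hfar, tendsto_fst.eventually hnear,
      tendsto_fst.eventually hZ, hn1] with p h1 h2 h3 hp
    refine Eventually.of_forall fun v => ?_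
    have hp' : (1 : ℝ) ≤ p.2 := by exact_mod_cast hp
    have hs : 0 < Real.sqrt p.2 := Real.sqrt_pos.2 (by linarith)
    have hsq : Real.sqrt p.2 ^ 2 = p.2 := Real.sq_sqrt (by linarith)
    have hC'0 : 0 ≤ C' := le_trans (by positivity) (hC' 0)
    have hv1 : 0 < 1 + v ^ 2 := by positivity
    by_cases hv : v ∈ Ioc (-(Real.pi * Real.sqrt p.2)) (Real.pi * Real.sqrt p.2)
    swap
    · rw [hF]; simp only [indicator_of_notMem hv, norm_zero]; positivity
    rw [hF]; simp only [indicator_of_mem hv, norm_mul]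
    rw [hnormexp, mul_one]
    set θ := v / Real.sqrt p.2 with hθ
    have habs : |v| ≤ Real.pi * Real.sqrt p.2 := abs_le.2 ⟨hv.1.le, hv.2⟩
    have hθπ : |θ| ≤ Real.pi := by
      rw [hθ, abs_div, abs_of_pos hs, div_le_iff₀ hs]; exact habs
    have hθ2 : θ ^ 2 * p.2 = v ^ 2 := by rw [hθ, div_pow, hsq]; field_simp
    have hexpo : C * ρ ^ p.2 ≤ C' * (1 + v ^ 2)⁻¹ := by
      rw [← div_eq_mul_inv, le_div_iff₀ hv1]
      refine le_trans ?_ (hC' p.2)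
      rw [mul_assoc]
      have : v ^ 2 ≤ Real.pi ^ 2 * p.2 := by
        rw [← sq_abs, ← hsq, ← mul_pow]; gcongr
      gcongr
    rcases lt_or_ge |θ| δ₀ with hlt | hge
    · have hZn := h3 θ hlt
      have hre : 1 + Q / 2 * θ ^ 2 ≤ ‖Z p.1 θ‖ := by
        have h4 := Complex.re_le_norm (Z p.1 θ)
        have h5 := (Complex.abs_re_le_norm _).trans hZn
        have h6 : (Z p.1 θ - 1 - Q * (θ : ℂ) ^ 2).re = (Z p.1 θ).re - 1 - Q * θ ^ 2 := by
          rw [← Complex.ofReal_pow, ← Complex.ofReal_mul, Complex.sub_re, Complex.sub_re,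
            Complex.one_re, Complex.ofReal_re]
        rw [h6] at h5
        linarith [(abs_le.1 h5).1]
      -- Bernoulli's inequality: `(1 + Q θ² / 2)ⁿ ≥ 1 + n Q θ² / 2 = 1 + Q v² / 2`.
      have hpow : ‖(Z p.1 θ)⁻¹ ^ p.2‖ ≤ (min 1 (Q / 2))⁻¹ * (1 + v ^ 2)⁻¹ := by
        rw [norm_pow, norm_inv, inv_pow, ← mul_inv]
        gcongr
        calc min 1 (Q / 2) * (1 + v ^ 2) ≤ 1 + Q / 2 * v ^ 2 := by
              have h7 := min_le_left 1 (Q / 2)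
              have h8 := min_le_right 1 (Q / 2)
              nlinarith [sq_nonneg v]
          _ = 1 + p.2 * (Q / 2 * θ ^ 2) := by rw [← hθ2]; ring
          _ ≤ (1 + Q / 2 * θ ^ 2) ^ p.2 :=
              one_add_mul_le_pow (by nlinarith [sq_nonneg θ]) _
          _ ≤ _ := by gcongr
      calc ‖a p.1 p.2 θ‖ = ‖(Z p.1 θ)⁻¹ ^ p.2 + (a p.1 p.2 θ - (Z p.1 θ)⁻¹ ^ p.2)‖ := by
            congr 1; ring
        _ ≤ _ := (norm_add_le _ _).trans (add_le_add hpow ((h2 p.2 hp θ hlt).trans hexpo))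
        _ = _ := by rw [hK]; ring
    · refine (h1 p.2 hp θ hθπ hge).trans (hexpo.trans ?_)
      gcongr
      rw [hK]; linarith [inv_pos.2 hmin]
  · refine Eventually.of_forall fun v => ?_
    have hN : Tendsto (fun p : ι × ℕ => p.2) (l ×ˢ atTop) atTop := tendsto_snd
    have hsqrt : Tendsto (fun p : ι × ℕ => Real.sqrt p.2) (l ×ˢ atTop) atTop :=
      Real.tendsto_sqrt_atTop.comp (tendsto_natCast_atTop_atTop.comp hN)
    have hθ0 : Tendsto (fun p : ι × ℕ => v / Real.sqrt p.2) (l ×ˢ atTop) (𝓝 0) :=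
      tendsto_const_nhds.div_atTop hsqrt
    have hθabs : Tendsto (fun p : ι × ℕ => |v / Real.sqrt p.2|) (l ×ˢ atTop) (𝓝 0) := by
      simpa using hθ0.abs
    have hsq : ∀ p : ι × ℕ, 1 ≤ p.2 → (p.2 : ℝ) * (v / Real.sqrt p.2) ^ 2 = v ^ 2 := by
      intro p hp
      have hp' : (1 : ℝ) ≤ p.2 := by exact_mod_cast hp
      rw [div_pow, Real.sq_sqrt (by linarith)]; field_simp
    -- For fixed `v` the argument tends to `0`, so the quadratic approximation with arbitrarily
    -- small `κ` becomes available and `n (Z - 1) → Q v²`.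
    have hz : Tendsto (fun p : ι × ℕ => (p.2 : ℂ) * (Z p.1 (v / Real.sqrt p.2) - 1)) (l ×ˢ atTop)
        (𝓝 (Q * v ^ 2 : ℝ)) := by
      rw [Metric.tendsto_nhds]
      intro η hη
      obtain ⟨δ, hδ, hd⟩ := hZ' (η / (2 * (1 + v ^ 2))) (by positivity)
      filter_upwards [tendsto_fst.eventually hd, hn1, hθabs.eventually_lt_const hδ] with p h1 h2 h3
      have h4 := h1 _ h3
      rw [dist_eq_norm]
      have h5 : (p.2 : ℂ) * (Z p.1 (v / Real.sqrt p.2) - 1) - ((Q * v ^ 2 : ℝ) : ℂ)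
          = (p.2 : ℂ) * (Z p.1 (v / Real.sqrt p.2) - 1 - Q * ((v / Real.sqrt p.2 : ℝ) : ℂ) ^ 2) := by
        rw [← hsq p h2]; push_cast; ring
      rw [h5, norm_mul, Complex.norm_natCast]
      calc (p.2 : ℝ) * ‖_‖ ≤ p.2 * (η / (2 * (1 + v ^ 2)) * (v / Real.sqrt p.2) ^ 2) := by gcongr
        _ = η / (2 * (1 + v ^ 2)) * v ^ 2 := by rw [← hsq p h2]; ring
        _ < η := by
          rw [div_mul_eq_mul_div, div_lt_iff₀ (by positivity)]
          nlinarith [sq_nonneg v]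
    have hpow := (tendsto_one_add_pow hN hz).inv₀ (Complex.exp_ne_zero _)
    rw [← Complex.exp_neg] at hpow
    have herr : Tendsto (fun p : ι × ℕ => C * ρ ^ p.2) (l ×ˢ atTop) (𝓝 0) := by
      simpa using ((tendsto_pow_atTop_nhds_zero_of_lt_one hρ hρ1).comp hN).const_mul C
    have hdiff : Tendsto (fun p : ι × ℕ => a p.1 p.2 (v / Real.sqrt p.2)
        - (Z p.1 (v / Real.sqrt p.2))⁻¹ ^ p.2) (l ×ˢ atTop) (𝓝 0) := by
      refine squeeze_zero_norm' ?_ herr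
      filter_upwards [tendsto_fst.eventually hnear, hn1, hθabs.eventually_lt_const hδ₀] with p h1 h2 h3
      exact h1 _ h2 _ h3
    have hexp : Tendsto (fun p : ι × ℕ => Complex.exp ((v / Real.sqrt p.2 : ℝ) * Complex.I))
        (l ×ˢ atTop) (𝓝 1) := by
      have h1 : Continuous fun θ : ℝ => Complex.exp (θ * Complex.I) := by fun_prop
      have h2 := (h1.tendsto 0).comp hθ0
      simp only [Complex.ofReal_zero, zero_mul, Complex.exp_zero] at h2
      exact h2
    have hfin := (hdiff.add hpow).mul hexp
    rw [zero_add, mul_one] at hfin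
    refine hfin.congr' ?_
    have hlarge : ∀ᶠ p : ι × ℕ in l ×ˢ atTop, |v| < Real.pi * Real.sqrt p.2 :=
      (hsqrt.const_mul_atTop hπ).eventually_gt_atTop |v|
    filter_upwards [hlarge] with p hp
    rw [hF]
    have hmem : v ∈ Ioc (-(Real.pi * Real.sqrt p.2)) (Real.pi * Real.sqrt p.2) :=
      ⟨(abs_lt.1 hp).1, (abs_lt.1 hp).2.le⟩
    simp only [indicator_of_mem hmem]
    congr 1
    rw [inv_pow]
    ring

end Laplace

/-! ### Coefficients in `x` of the logarithm -/

/-- The coefficients of `-log (1 - E(x, s) / s)` as a power series in `x`. -/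
def logCoeff (E : ℂ × ℂ → ℂ) (s : ℂ) (n : ℕ) : ℂ :=
  (n.factorial : ℂ)⁻¹ * iteratedDeriv n (fun x => -Complex.log (1 - E (x, s) / s)) 0

theorem inv_factorial_mul_iteratedDeriv_eq {f : ℂ → ℂ} {r r₁ : ℝ} (h0 : 0 < r₁) (h1 : r₁ < r)
    (hf : DifferentiableOn ℂ f (ball 0 r)) (n : ℕ) :
    (n.factorial : ℂ)⁻¹ * iteratedDeriv n f 0
      = (2 * Real.pi * Complex.I)⁻¹ * ∮ z in C(0, r₁), (1 / z ^ (n + 1)) * f z := by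
  have hd : DiffContOnCl ℂ f (ball 0 r₁) := by
    refine DifferentiableOn.diffContOnCl (hf.mono ?_)
    rw [closure_ball _ h0.ne']; exact closedBall_subset_ball h1
  have := hd.circleIntegral_one_div_sub_center_pow_smul h0 n
  simp only [sub_zero, smul_eq_mul] at this
  rw [this]
  have h2 : (2 * Real.pi * Complex.I : ℂ) ≠ 0 := Complex.two_pi_I_ne_zero
  have h3 : (n.factorial : ℂ) ≠ 0 := by exact_mod_cast n.factorial_ne_zero
  field_simp

/-- Fubini's theorem in the form that exchanges the Cauchy integral for the coefficients in `x` with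
the integral over `|s| = y₀`. -/
theorem integral_kernel_swap {A B : ℝ → ℂ} {K : ℝ × ℝ → ℂ} (hA : Continuous A) (hB : Continuous B)
    (hK : Continuous K) {a b : ℝ} :
    ∫ φ in a..b, A φ * ∫ θ in a..b, B θ * K (θ, φ)
      = ∫ θ in a..b, B θ * ∫ φ in a..b, A φ * K (θ, φ) := by
  have hc : Continuous (Function.uncurry fun φ θ : ℝ => A φ * (B θ * K (θ, φ))) :=
    (hA.comp continuous_fst).mul ((hB.comp continuous_snd).mul (hK.comp continuous_swap))
  have h : (∫ φ in a..b, ∫ θ in a..b, A φ * (B θ * K (θ, φ)))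
      = ∫ θ in a..b, ∫ φ in a..b, A φ * (B θ * K (θ, φ)) :=
    intervalIntegral_intervalIntegral_swap
      ((hc.continuousOn.integrableOn_compact
        (isCompact_uIcc.prod isCompact_uIcc)).mono_set
          (prod_mono uIoc_subset_uIcc uIoc_subset_uIcc))
  simp only [← intervalIntegral.integral_const_mul]
  rw [h]
  simp only [mul_left_comm]

namespace Admissible

variable {R S M y₀ r : ℝ} {E : ℂ × ℂ → ℂ}

theorem differentiableOn_log (hE : Admissible R S M E) (hr : SmallRadius R S M y₀ r) {s : ℂ}
    (hs : ‖s‖ = y₀) : DifferentiableOn ℂ (fun x => -Complex.log (1 - E (x, s) / s)) (ball 0 r) := by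
  intro x hx
  rw [mem_ball_zero_iff] at hx
  have h1 := hE.differentiableAt_left (hx.trans hr.r_lt) (s := s) (by rw [hs]; exact hr.y₀_lt)
  exact (((h1.div_const s).const_sub 1).clog
    (hE.one_sub_div_mem_slitPlane hr hx hs)).neg.differentiableWithinAt

theorem continuous_kernel (hE : Admissible R S M E) (hr : SmallRadius R S M y₀ r) :
    Continuous fun q : ℝ × ℝ => -Complex.log (1 - E (circleMap 0 (r / 2) q.2, circleMap 0 y₀ q.1)
      / circleMap 0 y₀ q.1) := by
  have hr0 := hr.r_pos
  have hy := hr.y₀_pos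
  refine continuous_iff_continuousAt.2 fun q => ContinuousAt.neg (ContinuousAt.clog ?_ ?_)
  · refine continuousAt_const.sub (ContinuousAt.div ?_ (by fun_prop)
      (circleMap_ne_center hy.ne'))
    have h1 : (circleMap 0 (r / 2) q.2, circleMap 0 y₀ q.1) ∈ polydisc R S := by
      refine mem_polydisc.2 ⟨?_, ?_⟩
      · rw [norm_circleMap_zero, abs_of_pos (by positivity)]; linarith [hr.r_lt]
      · rw [norm_circleMap_zero, abs_of_pos hy]; exact hr.y₀_lt
    have h2 : ContinuousAt E (circleMap 0 (r / 2) q.2, circleMap 0 y₀ q.1) :=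
      hE.diff.continuousOn.continuousAt ((isOpen_polydisc R S).mem_nhds h1)
    exact ContinuousAt.comp (f := fun q : ℝ × ℝ =>
      ((circleMap 0 (r / 2) q.2, circleMap 0 y₀ q.1) : ℂ × ℂ)) h2 (by fun_prop)
  · refine hE.one_sub_div_mem_slitPlane hr ?_ ?_
    · rw [norm_circleMap_zero, abs_of_pos (by positivity)]; linarith
    · rw [norm_circleMap_zero, abs_of_pos hy]

theorem logCoeff_circleMap (hE : Admissible R S M E) (hr : SmallRadius R S M y₀ r) (θ : ℝ) (n : ℕ) :
    logCoeff E (circleMap 0 y₀ θ) n = (2 * Real.pi * Complex.I)⁻¹ * ∫ φ in (0 : ℝ)..2 * Real.pi,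
      circleMap 0 (r / 2) φ * Complex.I * (1 / circleMap 0 (r / 2) φ ^ (n + 1) *
      -Complex.log (1 - E (circleMap 0 (r / 2) φ, circleMap 0 y₀ θ) / circleMap 0 y₀ θ)) := by
  have hr0 := hr.r_pos
  rw [logCoeff, inv_factorial_mul_iteratedDeriv_eq (r₁ := r / 2) (by linarith) (by linarith)
    (hE.differentiableOn_log hr (by rw [norm_circleMap_zero, abs_of_pos hr.y₀_pos]))]
  simp [circleIntegral]

theorem continuous_logCoeff (hE : Admissible R S M E) (hr : SmallRadius R S M y₀ r) (n : ℕ) :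
    Continuous fun θ => logCoeff E (circleMap 0 y₀ θ) n := by
  have hr0 := hr.r_pos
  simp_rw [hE.logCoeff_circleMap hr _ n]
  refine continuous_const.mul
    (intervalIntegral.continuous_parametric_intervalIntegral_of_continuous' ?_ _ _)
  refine Continuous.mul (by fun_prop) (Continuous.mul ?_ (hE.continuous_kernel hr))
  exact continuous_const.div (by fun_prop)
    fun q => pow_ne_zero _ (circleMap_ne_center (by positivity))

/-- The coefficients of the solution as integrals over the circle `|s| = y₀`. -/
theorem solCoeff_eq_integral (hE : Admissible R S M E) (hr : SmallRadius R S M y₀ r) (n : ℕ) :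
    solCoeff E n = (2 * Real.pi : ℂ)⁻¹ * ∫ θ in (-Real.pi)..Real.pi,
      circleMap 0 y₀ θ * logCoeff E (circleMap 0 y₀ θ) n := by
  have hr0 := hr.r_pos
  have hper : Function.Periodic (fun θ => circleMap 0 y₀ θ * logCoeff E (circleMap 0 y₀ θ) n)
      (2 * Real.pi) := fun θ => by simp only [periodic_circleMap 0 y₀ θ]
  -- The interval is shifted so that the critical angle `θ = 0` is an interior point.
  have hshift := hper.intervalIntegral_add_eq (-Real.pi) 0
  rw [show -Real.pi + 2 * Real.pi = Real.pi by ring, zero_add] at hshift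
  rw [hshift, solCoeff, inv_factorial_mul_iteratedDeriv_eq (r₁ := r / 2) (by linarith) (by linarith)
    (hE.differentiableOn_solAt hr)]
  have hAc : Continuous fun φ : ℝ =>
      circleMap 0 (r / 2) φ * Complex.I * (1 / circleMap 0 (r / 2) φ ^ (n + 1)) :=
    Continuous.mul (by fun_prop) (continuous_const.div (by fun_prop)
      fun q => pow_ne_zero _ (circleMap_ne_center (by positivity)))
  have hBc : Continuous fun θ : ℝ => circleMap 0 y₀ θ * Complex.I := by fun_prop
  have hsw := integral_kernel_swap hAc hBc (hE.continuous_kernel hr) (a := 0) (b := 2 * Real.pi)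
  have h1 : (∮ z in C(0, r / 2), (1 / z ^ (n + 1)) * solAt E z) = (2 * Real.pi * Complex.I)⁻¹ *
      ∫ φ in (0 : ℝ)..2 * Real.pi,
        circleMap 0 (r / 2) φ * Complex.I * (1 / circleMap 0 (r / 2) φ ^ (n + 1)) *
        ∫ θ in (0 : ℝ)..2 * Real.pi, circleMap 0 y₀ θ * Complex.I *
          -Complex.log (1 - E (circleMap 0 (r / 2) φ, circleMap 0 y₀ θ) / circleMap 0 y₀ θ) := by
    rw [circleIntegral, ← intervalIntegral.integral_const_mul]
    refine intervalIntegral.integral_congr fun φ _ => ?_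
    have hx : ‖circleMap 0 (r / 2) φ‖ < r := by
      rw [norm_circleMap_zero, abs_of_pos (by positivity)]; linarith
    have h := hE.circleIntegral_log_eq hr hx
    simp only [circleIntegral, deriv_circleMap, smul_eq_mul] at h ⊢
    rw [h]
    have hπ : (2 * Real.pi * Complex.I : ℂ) ≠ 0 := Complex.two_pi_I_ne_zero
    generalize (2 * Real.pi * Complex.I : ℂ) = p at hπ
    field_simp
  rw [h1, hsw, ← mul_assoc, ← intervalIntegral.integral_const_mul,
    ← intervalIntegral.integral_const_mul]
  refine intervalIntegral.integral_congr fun θ _ => ?_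
  simp only
  rw [hE.logCoeff_circleMap hr θ n]
  have h3 : (∫ φ in (0 : ℝ)..2 * Real.pi,
      circleMap 0 (r / 2) φ * Complex.I * (1 / circleMap 0 (r / 2) φ ^ (n + 1) *
      -Complex.log (1 - E (circleMap 0 (r / 2) φ, circleMap 0 y₀ θ) / circleMap 0 y₀ θ))) =
      ∫ φ in (0 : ℝ)..2 * Real.pi,
      circleMap 0 (r / 2) φ * Complex.I * (1 / circleMap 0 (r / 2) φ ^ (n + 1)) *
      -Complex.log (1 - E (circleMap 0 (r / 2) φ, circleMap 0 y₀ θ) / circleMap 0 y₀ θ) := by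
    simp only [mul_assoc]
  rw [h3]
  have hπ0 : (Real.pi : ℂ) ≠ 0 := by exact_mod_cast Real.pi_ne_zero
  generalize (∫ φ in (0 : ℝ)..2 * Real.pi, _ : ℂ) = J
  field_simp

end Admissible

theorem iteratedDeriv_const_sub_inv (X : ℂ) (n : ℕ) :
    iteratedDeriv n (fun x : ℂ => (X - x)⁻¹) 0 = n.factorial * X⁻¹ ^ (n + 1) := by
  have h := congrFun (iter_deriv_inv_linear_sub (𝕜 := ℂ) n (-1) (-X)) 0
  rw [iteratedDeriv_eq_iterate]
  have h1 : (fun x : ℂ => (-1 * x - -X)⁻¹) = fun x => (X - x)⁻¹ := by ext x; congr 1; ring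
  rw [h1] at h
  rw [h]
  have h2 : (-1 * (0 : ℂ) - -X) ^ (-1 - n : ℤ) = X⁻¹ ^ (n + 1) := by
    rw [show (-1 * (0 : ℂ) - -X) = X by ring, show (-1 - n : ℤ) = -((n + 1 : ℕ) : ℤ) by push_cast; ring,
      zpow_neg, zpow_natCast, inv_pow]
  rw [h2]
  have h3 : (-1 : ℂ) ^ n * (-1) ^ n = 1 := by rw [← mul_pow]; simp
  linear_combination (n.factorial : ℂ) * X⁻¹ ^ (n + 1) * h3

/-- The derivative is meromorphic wherever `e` is holomorphic, with poles only at solutions of `e x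
= s`. Larger discs can therefore be used without continuing the logarithm. -/
theorem hasDerivAt_neg_log {e : ℂ → ℂ} {s x : ℂ} (hs : s ≠ 0) (he : DifferentiableAt ℂ e x)
    (hx : 1 - e x / s ∈ Complex.slitPlane) :
    HasDerivAt (fun x => -Complex.log (1 - e x / s)) (deriv e x / (s - e x)) x := by
  have h := (((he.hasDerivAt.div_const s).const_sub 1).clog hx).neg
  refine h.congr_deriv ?_
  have h1 : 1 - e x / s ≠ 0 := Complex.slitPlane_ne_zero hx
  have h2 : 1 - e x / s = (s - e x) / s := by field_simp
  rw [h2] at h1 ⊢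
  have h3 : s - e x ≠ 0 := fun h => h1 (by rw [h, zero_div])
  field_simp

/-- `n [xⁿ] g = [xⁿ⁻¹] g'`, and Cauchy's estimate on the circle of radius `R₁` controls the part `m`
of `g'`. The splitting `g' = k + m` is needed only near `0`, although `m` lives on the larger disc.
-/
theorem norm_mul_iteratedDeriv_le {g k m : ℂ → ℂ} {R₁ r C : ℝ} (hr : 0 < r) (hR₁ : 0 < R₁)
    (hg : ∀ x ∈ ball (0 : ℂ) r, HasDerivAt g (k x + m x) x) {n : ℕ} (hn : 1 ≤ n)
    (hk : ContDiffAt ℂ (n - 1 : ℕ) k 0)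
    (hm : DiffContOnCl ℂ m (ball 0 R₁)) (hC : ∀ x ∈ sphere (0 : ℂ) R₁, ‖m x‖ ≤ C) :
    ‖n * ((n.factorial : ℂ)⁻¹ * iteratedDeriv n g 0)
      - ((n - 1).factorial : ℂ)⁻¹ * iteratedDeriv (n - 1) k 0‖ ≤ C * R₁⁻¹ ^ (n - 1) := by
  obtain ⟨j, rfl⟩ : ∃ j, n = j + 1 := ⟨n - 1, by omega⟩
  simp only [Nat.add_sub_cancel] at hk ⊢
  have h1 : deriv g =ᶠ[𝓝 0] k + m := by
    filter_upwards [ball_mem_nhds (0 : ℂ) hr] with x hx using (hg x hx).deriv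
  have hma : ContDiffAt ℂ j m 0 :=
    (hm.differentiableOn.analyticAt (ball_mem_nhds 0 hR₁)).contDiffAt
  rw [iteratedDeriv_succ', h1.iteratedDeriv_eq, iteratedDeriv_add hk hma]
  have h2 := Complex.norm_iteratedDeriv_le_of_forall_mem_sphere_norm_le j hR₁ hm hC
  have h3 : (j.factorial : ℂ) ≠ 0 := by exact_mod_cast j.factorial_ne_zero
  have h4 : ((j : ℂ) + 1) ≠ 0 := by exact_mod_cast j.succ_ne_zero
  have h5 : ((j + 1 : ℕ) : ℂ) * (((j + 1).factorial : ℂ)⁻¹ * (iteratedDeriv j k 0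
      + iteratedDeriv j m 0)) - (j.factorial : ℂ)⁻¹ * iteratedDeriv j k 0
      = (j.factorial : ℂ)⁻¹ * iteratedDeriv j m 0 := by
    rw [Nat.factorial_succ]; push_cast; field_simp; ring
  rw [h5, norm_mul, norm_inv, Complex.norm_natCast]
  have h6 : (0 : ℝ) < j.factorial := by exact_mod_cast j.factorial_pos
  rw [inv_mul_le_iff₀ h6]
  refine h2.trans_eq ?_
  rw [inv_pow]; field_simp

/-- The coefficients of `-log (1 - e(x) / s)` if `e(x) = s` has no solution in the disc. -/
theorem norm_logCoeff_le {e : ℂ → ℂ} {s : ℂ} {R R₁ r C : ℝ} (hr : 0 < r) (hrR : r ≤ R)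
    (hR₁ : 0 < R₁) (hR : R₁ < R) (he : DifferentiableOn ℂ e (ball 0 R)) (hs : s ≠ 0)
    (hlog : ∀ x ∈ ball (0 : ℂ) r, 1 - e x / s ∈ Complex.slitPlane)
    (hne : ∀ x ∈ closedBall (0 : ℂ) R₁, e x ≠ s)
    (hC : ∀ x ∈ sphere (0 : ℂ) R₁, ‖deriv e x / (s - e x)‖ ≤ C) {n : ℕ} (hn : 1 ≤ n) :
    ‖n * ((n.factorial : ℂ)⁻¹ * iteratedDeriv n (fun x => -Complex.log (1 - e x / s)) 0)‖
      ≤ C * R₁⁻¹ ^ (n - 1) := by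
  have h := norm_mul_iteratedDeriv_le (k := fun _ => 0) (m := fun x => deriv e x / (s - e x))
    (g := fun x => -Complex.log (1 - e x / s)) hr hR₁ (fun x hx => by
      rw [zero_add]
      exact hasDerivAt_neg_log hs (he.differentiableAt
        (isOpen_ball.mem_nhds (ball_subset_ball hrR hx))) (hlog x hx)) hn contDiffAt_const ?_ hC
  · simpa [iteratedDeriv_const] using h
  · refine DifferentiableOn.diffContOnCl ?_
    rw [closure_ball _ hR₁.ne']
    intro x hx
    have hx' := closedBall_subset_ball hR hx
    refine DifferentiableAt.differentiableWithinAt (DifferentiableAt.div ?_ ?_ ?_)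
    · exact (he.deriv isOpen_ball).differentiableAt (isOpen_ball.mem_nhds hx')
    · exact (he.differentiableAt (isOpen_ball.mem_nhds hx')).const_sub s
    · exact sub_ne_zero.2 (hne x hx).symm

/-- The coefficients of `-log (1 - e(x) / s)` if `e(x) = s` has a single simple solution `X`. -/
theorem norm_logCoeff_sub_le {e : ℂ → ℂ} {s X : ℂ} {R R₁ r C : ℝ} (hr : 0 < r) (hrR : r ≤ R)
    (hR : R₁ < R) (he : DifferentiableOn ℂ e (ball 0 R)) (hs : s ≠ 0)
    (hlog : ∀ x ∈ ball (0 : ℂ) r, 1 - e x / s ∈ Complex.slitPlane)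
    (hX : ‖X‖ < R₁) (heX : e X = s) (hne : ∀ x ∈ closedBall (0 : ℂ) R₁, e x = s → x = X)
    (hdX : deriv e X ≠ 0)
    (hC : ∀ x ∈ sphere (0 : ℂ) R₁, ‖deriv e x / (s - e x) - (X - x)⁻¹‖ ≤ C) {n : ℕ} (hn : 1 ≤ n) :
    ‖n * ((n.factorial : ℂ)⁻¹ * iteratedDeriv n (fun x => -Complex.log (1 - e x / s)) 0)
      - X⁻¹ ^ n‖ ≤ C * R₁⁻¹ ^ (n - 1) := by
  have hR₁ : 0 < R₁ := (norm_nonneg _).trans_lt hX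
  have hXR : X ∈ ball (0 : ℂ) R := by rw [mem_ball_zero_iff]; exact hX.trans hR
  have hXr : X ∉ ball (0 : ℂ) r := fun h => by
    have := hlog X h
    rw [heX, div_self hs, sub_self] at this
    exact Complex.slitPlane_ne_zero this rfl
  have hX0 : X ≠ 0 := fun h => hXr (by rw [h]; exact mem_ball_self hr)
  set q : ℂ → ℂ := dslope e X with hq
  have hqd : DifferentiableOn ℂ q (ball 0 R) :=
    (Complex.differentiableOn_dslope (isOpen_ball.mem_nhds hXR)).2 he
  have hqe : ∀ x, (x - X) * q x = e x - s := fun x => by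
    have := sub_smul_dslope e X x
    rwa [smul_eq_mul, heX] at this
  have hq0 : ∀ x ∈ closedBall (0 : ℂ) R₁, q x ≠ 0 := by
    intro x hx h0
    have h1 := hqe x
    rw [h0, mul_zero] at h1
    have h2 := hne x hx (sub_eq_zero.1 h1.symm)
    rw [h2, hq, dslope_same] at h0
    exact hdX h0
  -- Since `s - e x = (X - x) q x`, the pole `(X - x)⁻¹` splits off. The remainder `-q' / q` is
  -- holomorphic on the closed disc, and the hypothesis on the circle bounds it there.
  have hder : ∀ x ∈ closedBall (0 : ℂ) R₁, x ≠ X →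
      deriv e x / (s - e x) = (X - x)⁻¹ + -(deriv q x / q x) := by
    intro x hx hxX
    have hxR := isOpen_ball.mem_nhds (closedBall_subset_ball hR hx)
    have h1 : HasDerivAt (fun x => (x - X) * q x + s) (1 * q x + (x - X) * deriv q x) x :=
      (((hasDerivAt_id x).sub_const X).mul (hqd.differentiableAt hxR).hasDerivAt).add_const s
    have h2 : (fun x => (x - X) * q x + s) = e := by ext z; rw [hqe]; ring
    rw [h2] at h1
    rw [h1.deriv, show s - e x = (X - x) * q x by linear_combination hqe x]
    have h3 := hq0 x hx
    have h4 : X - x ≠ 0 := sub_ne_zero.2 hxX.symm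
    field_simp
    ring
  have hrR₁ : ball (0 : ℂ) (min r R₁) ⊆ closedBall 0 R₁ :=
    (ball_subset_ball (min_le_right _ _)).trans ball_subset_closedBall
  have hmin : 0 < min r R₁ := lt_min hr hR₁
  have hk : ContDiffAt ℂ (n - 1 : ℕ) (fun x : ℂ => (X - x)⁻¹) 0 :=
    (contDiffAt_const.sub contDiffAt_id).inv (by simpa using hX0)
  have h := norm_mul_iteratedDeriv_le (k := fun x => (X - x)⁻¹) (m := fun x => -(deriv q x / q x))
    (g := fun x => -Complex.log (1 - e x / s)) hmin hR₁ (fun x hx => by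
      have hxr : x ∈ ball (0 : ℂ) r := ball_subset_ball (min_le_left _ _) hx
      rw [← hder x (hrR₁ hx) (fun h => hXr (h ▸ hxr))]
      exact hasDerivAt_neg_log hs (he.differentiableAt
        (isOpen_ball.mem_nhds (ball_subset_ball hrR hxr))) (hlog x hxr)) hn hk (C := C) ?_ ?_
  · rw [iteratedDeriv_const_sub_inv, Nat.sub_add_cancel hn] at h
    have h3 : ((n - 1).factorial : ℂ) ≠ 0 := by exact_mod_cast (n - 1).factorial_ne_zero
    rwa [← mul_assoc _ _ (X⁻¹ ^ n), inv_mul_cancel₀ h3, one_mul] at h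
  · refine DifferentiableOn.diffContOnCl ?_
    rw [closure_ball _ hR₁.ne']
    intro x hx
    have hx' := isOpen_ball.mem_nhds (closedBall_subset_ball hR hx)
    exact (((hqd.deriv isOpen_ball).differentiableAt hx').div (hqd.differentiableAt hx')
      (hq0 x hx)).neg.differentiableWithinAt
  · intro x hx
    have hxX : x ≠ X := fun h => by
      rw [mem_sphere_zero_iff_norm, h] at hx; linarith
    have := hder x (sphere_subset_closedBall hx) hxX
    have h4 : -(deriv q x / q x) = deriv e x / (s - e x) - (X - x)⁻¹ := by rw [this]; ring
    rw [h4]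
    exact hC x hx

/-! ### Families with a common critical point and the zeros of `s - E(x, s)` -/

theorem exists_closedBall_subset_of_isOpen {E : Type*} [NormedAddCommGroup E] [NormedSpace ℝ E]
    [ProperSpace E] {c : E} {a : ℝ} {U : Set E} (ha : 0 ≤ a) (hU : IsOpen U)
    (h : closedBall c a ⊆ U) : ∃ b > a, closedBall c b ⊆ U := by
  obtain ⟨δ, hδ, hδU⟩ := (isCompact_closedBall c a).exists_cthickening_subset_open hU h
  rw [cthickening_closedBall hδ.le ha] at hδU
  exact ⟨δ + a, by linarith, hδU⟩

theorem isLittleO_sub_taylor_two {f : ℂ → ℂ} {z : ℂ} (hf : AnalyticAt ℂ f z) :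
    (fun w => f w - (f z + deriv f z * (w - z) + iteratedDeriv 2 f z / 2 * (w - z) ^ 2))
      =o[𝓝 z] fun w => (w - z) ^ 2 := by
  have h := (hf.hasFPowerSeriesAt).isBigO_sub_partialSum_pow 3
  have h1 : Tendsto (fun w => w - z) (𝓝 z) (𝓝 0) :=
    Continuous.tendsto' (by fun_prop) _ _ (sub_self z)
  have h2 := h.comp_tendsto h1
  have h3 : (fun w : ℂ => ‖w - z‖ ^ 3) =o[𝓝 z] fun w => (w - z) ^ 2 := by
    refine isLittleO_iff.2 fun c hc => ?_
    filter_upwards [h1.norm.eventually_le_const (by simpa using hc)] with w hw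
    rw [norm_pow, norm_norm, norm_pow]
    calc ‖w - z‖ ^ 3 = ‖w - z‖ * ‖w - z‖ ^ 2 := by ring
      _ ≤ _ := by gcongr
  refine (h2.trans_isLittleO h3).congr_left fun w => ?_
  simp [FormalMultilinearSeries.partialSum, Finset.sum_range_succ, iteratedDeriv_one]
  ring

/-- The critical point `(x₀, y₀)` of `y = F(x, y)`, and the uniqueness of the solution of this
equation with `|x| ≤ x₀` and `|y| = y₀`. -/
structure CriticalPoint (R S x₀ y₀ A B : ℝ) (F : ℂ × ℂ → ℂ) : Prop where
  x₀_pos : 0 < x₀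
  x₀_lt : x₀ < R
  y₀_pos : 0 < y₀
  y₀_lt : y₀ < S
  A_pos : 0 < A
  B_pos : 0 < B
  diff : DifferentiableOn ℂ F (polydisc R S)
  eq : F (x₀, y₀) = y₀
  deriv_left : deriv (fun x : ℂ => F (x, y₀)) x₀ = A
  deriv_right : deriv (fun s : ℂ => F (x₀, s)) y₀ = 1
  deriv_two : iteratedDeriv 2 (fun s : ℂ => F (x₀, s)) y₀ = B
  unique : ∀ x s : ℂ, ‖x‖ ≤ x₀ → ‖s‖ = y₀ → F (x, s) = s → x = x₀ ∧ s = y₀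

/-- A family of functions with the critical point `(x₀, y₀)` that converges to `F`. -/
structure NormalizedFamily {ι : Type*} (l : Filter ι) (R S M x₀ y₀ : ℝ) (F : ℂ × ℂ → ℂ)
    (E : ι → ℂ × ℂ → ℂ) : Prop where
  adm : ∀ᶠ i in l, Admissible R S M (E i)
  unif : ∀ η > 0, ∀ᶠ i in l, ∀ p ∈ polydisc R S, ‖E i p - F p‖ ≤ η
  eq : ∀ᶠ i in l, E i (x₀, y₀) = y₀
  deriv_right : ∀ᶠ i in l, deriv (fun s : ℂ => E i (x₀, s)) y₀ = 1

section

variable {ι : Type*} {l : Filter ι} {R S M x₀ y₀ A B : ℝ} {F : ℂ × ℂ → ℂ} {E : ι → ℂ × ℂ → ℂ}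

theorem CriticalPoint.mem (hF : CriticalPoint R S x₀ y₀ A B F) :
    ((x₀ : ℂ), (y₀ : ℂ)) ∈ polydisc R S :=
  mem_polydisc.2 ⟨by simpa [abs_of_pos hF.x₀_pos] using hF.x₀_lt,
    by simpa [abs_of_pos hF.y₀_pos] using hF.y₀_lt⟩

theorem CriticalPoint.exists_ball (hF : CriticalPoint R S x₀ y₀ A B F) :
    ∃ r > 0, ball ((x₀ : ℂ), (y₀ : ℂ)) r ⊆ polydisc R S :=
  Metric.isOpen_iff.1 (isOpen_polydisc R S) _ hF.mem

theorem fderiv_prod_apply {f : ℂ × ℂ → ℂ} {x s : ℂ} (hf : DifferentiableAt ℂ f (x, s)) (v : ℂ × ℂ) :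
    fderiv ℂ f (x, s) v
      = deriv (fun x => f (x, s)) x * v.1 + deriv (fun s => f (x, s)) s * v.2 := by
  have h1 : HasDerivAt (fun x => f (x, s)) (fderiv ℂ f (x, s) (1, 0)) x :=
    HasFDerivAt.comp_hasDerivAt (f := fun x : ℂ => (x, s)) x hf.hasFDerivAt
      ((hasDerivAt_id x).prodMk (hasDerivAt_const x s))
  have h2 : HasDerivAt (fun s => f (x, s)) (fderiv ℂ f (x, s) (0, 1)) s :=
    HasFDerivAt.comp_hasDerivAt (f := fun s : ℂ => (x, s)) s hf.hasFDerivAt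
      ((hasDerivAt_const s x).prodMk (hasDerivAt_id s))
  rw [h1.deriv, h2.deriv]
  have h3 : v = v.1 • ((1, 0) : ℂ × ℂ) + v.2 • ((0, 1) : ℂ × ℂ) := by ext <;> simp
  conv_lhs => rw [h3, map_add, map_smul, map_smul]
  simp [mul_comm]

/-- Strict differentiability handles `F`, and Cauchy's estimate makes the Lipschitz constant of the
uniformly small difference `E i - F` small. -/
theorem NormalizedFamily.approx_linear (hE : NormalizedFamily l R S M x₀ y₀ F E)
    (hF : CriticalPoint R S x₀ y₀ A B F) {θ : ℝ} (hθ : 0 < θ) :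
    ∃ δ > 0, ball ((x₀ : ℂ), (y₀ : ℂ)) δ ⊆ polydisc R S ∧ ∀ᶠ i in l,
      ∀ p ∈ ball ((x₀ : ℂ), (y₀ : ℂ)) δ, ∀ q ∈ ball ((x₀ : ℂ), (y₀ : ℂ)) δ,
      ‖E i p - E i q - (A * (p.1 - q.1) + (p.2 - q.2))‖ ≤ θ * ‖p - q‖ := by
  obtain ⟨r, hr, hrU⟩ := hF.exists_ball
  have hs := (contDiffAt_one_of_differentiableOn (isOpen_polydisc R S) hF.diff
    hF.mem).hasStrictFDerivAt (by norm_num)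
  have h1 := (hasStrictFDerivAt_iff_isLittleO.1 hs).def (half_pos hθ)
  obtain ⟨δ, hδ, h2⟩ := Metric.eventually_nhds_iff_ball.1 h1
  have hdF := hF.diff.differentiableAt ((isOpen_polydisc R S).mem_nhds hF.mem)
  refine ⟨min δ (r / 2), by positivity, (ball_subset_ball
    ((min_le_right _ _).trans (by linarith))).trans hrU, ?_⟩
  -- A difference of size `θ r / 8` has Lipschitz constant `2 (θ r / 8) / (r / 2) = θ / 2` on balls
  -- of radius `r / 2`.
  filter_upwards [hE.adm, hE.unif (θ * r / 8) (by positivity)] with i hi hu p hp q hq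
  have hp1 := ball_subset_ball (min_le_left _ _) hp
  have hq1 := ball_subset_ball (min_le_left _ _) hq
  have hp2 := ball_subset_ball (min_le_right _ _) hp
  have hq2 := ball_subset_ball (min_le_right _ _) hq
  have h3 := h2 (p, q) (by
    rw [← ball_prod_same]; exact ⟨hp1, hq1⟩)
  rw [fderiv_prod_apply hdF, hF.deriv_left, hF.deriv_right, one_mul] at h3
  have hsub : ball q (r / 2) ⊆ polydisc R S := (ball_subset_ball' (by
    rw [mem_ball] at hq2; linarith)).trans hrU
  have h4 := norm_sub_le_of_bounded (f := fun p => E i p - F p) (w := q) (z := p) (r := r / 2)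
    (M := θ * r / 8) (by positivity) ((hi.diff.sub hF.diff).mono hsub)
    (fun z hz => hu z (hsub hz)) (hu p (hrU (ball_subset_ball (by linarith) hp2)))
  calc _ = ‖(F p - F q - (A * (p - q).1 + (p - q).2)) + ((E i p - F p) - (E i q - F q))‖ := by
        congr 1; simp only [Prod.fst_sub, Prod.snd_sub]; ring
    _ ≤ θ / 2 * ‖p - q‖ + 2 * (θ * r / 8) / (r / 2) * ‖p - q‖ := (norm_add_le _ _).trans
        (add_le_add h3 h4)
    _ = _ := by field_simp; ring

/-- All members share the value and the first `s`-derivative of `F` at `(x₀, y₀)`. Hence `E i - F`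
vanishes there to second order in `s`, and a uniformly small bound for it becomes a small multiple
of `|s - y₀|²`. This is what the normalization is for. -/
theorem NormalizedFamily.approx_quadratic (hE : NormalizedFamily l R S M x₀ y₀ F E)
    (hF : CriticalPoint R S x₀ y₀ A B F) {κ : ℝ} (hκ : 0 < κ) :
    ∃ δ > 0, ∀ᶠ i in l, ∀ s ∈ ball (y₀ : ℂ) δ,
      ‖E i (x₀, s) - s - B / 2 * (s - y₀) ^ 2‖ ≤ κ * ‖s - y₀‖ ^ 2 := by
  obtain ⟨r, hr, hrU⟩ := hF.exists_ball
  have hsub : ∀ s ∈ ball (y₀ : ℂ) r, ((x₀ : ℂ), s) ∈ polydisc R S := fun s hs => hrU (by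
    rw [← ball_prod_same]; exact ⟨mem_ball_self hr, hs⟩)
  have hdF : DifferentiableOn ℂ (fun s : ℂ => F (x₀, s)) (ball y₀ r) :=
    hF.diff.comp (by fun_prop) hsub
  have h1 := (isLittleO_sub_taylor_two (hdF.analyticAt (ball_mem_nhds _ hr))).def (half_pos hκ)
  obtain ⟨δ, hδ, h2⟩ := Metric.eventually_nhds_iff_ball.1 h1
  rw [hF.eq, hF.deriv_right, hF.deriv_two] at h2
  refine ⟨min δ r, by positivity, ?_⟩
  filter_upwards [hE.adm, hE.unif (κ * r ^ 2 / 8) (by positivity), hE.eq, hE.deriv_right]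
    with i hi hu he hd s hs
  have hdE : DifferentiableOn ℂ (fun s : ℂ => E i (x₀, s)) (ball y₀ r) :=
    hi.diff.comp (by fun_prop) hsub
  have h3 := norm_sub_fderiv_le_of_bounded (f := fun s => E i (x₀, s) - F (x₀, s)) (w := (y₀ : ℂ))
    (z := s) (M := κ * r ^ 2 / 8) hr (hdE.sub hdF) (fun z hz => hu _ (hsub z hz))
    (ball_subset_ball (min_le_right _ _) hs)
  have h4 : deriv (fun s : ℂ => E i (x₀, s) - F (x₀, s)) y₀ = 0 := by
    rw [deriv_fun_sub (hdE.differentiableAt (ball_mem_nhds _ hr))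
      (hdF.differentiableAt (ball_mem_nhds _ hr)), hd, hF.deriv_right, sub_self]
  rw [he, hF.eq, fderiv_eq_smul_deriv, h4] at h3
  have h5 := h2 s (ball_subset_ball (min_le_left _ _) hs)
  rw [norm_pow] at h5
  calc _ = ‖(F (x₀, s) - (y₀ + 1 * (s - y₀) + B / 2 * (s - y₀) ^ 2))
        + (E i (x₀, s) - F (x₀, s) - (y₀ - y₀) - (s - y₀) • 0)‖ := by
        congr 1; simp only [smul_zero]; ring
    _ ≤ κ / 2 * ‖s - y₀‖ ^ 2 + 4 * (κ * r ^ 2 / 8) * (‖s - y₀‖ / r) ^ 2 :=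
        (norm_add_le _ _).trans (add_le_add h5 h3)
    _ = _ := by field_simp; ring

/-- The bound for zeros of `E(x, s) - s` with `x` near `x₀`. -/
theorem NormalizedFamily.exists_injective (hE : NormalizedFamily l R S M x₀ y₀ F E)
    (hF : CriticalPoint R S x₀ y₀ A B F) :
    ∃ δ > 0, (∀ x ∈ ball (x₀ : ℂ) δ, ∀ s ∈ ball (y₀ : ℂ) δ, (x, s) ∈ polydisc R S) ∧
      ∀ᶠ i in l, ∀ s ∈ ball (y₀ : ℂ) δ, ∀ x ∈ ball (x₀ : ℂ) δ, ∀ x' ∈ ball (x₀ : ℂ) δ,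
        A / 2 * ‖x - x'‖ ≤ ‖E i (x, s) - E i (x', s)‖ := by
  obtain ⟨δ, hδ, hsub, h⟩ := hE.approx_linear hF (half_pos hF.A_pos)
  refine ⟨δ, hδ, fun x hx s hs => hsub (by rw [← ball_prod_same]; exact ⟨hx, hs⟩), ?_⟩
  filter_upwards [h] with i hi s hs x hx x' hx'
  have h1 := hi (x, s) (by rw [← ball_prod_same]; exact ⟨hx, hs⟩) (x', s)
    (by rw [← ball_prod_same]; exact ⟨hx', hs⟩)
  simp only [Prod.mk_sub_mk, sub_self, add_zero, Prod.norm_mk, norm_zero,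
    max_eq_left (norm_nonneg _)] at h1
  have h2 : ‖(A : ℂ) * (x - x')‖ = A * ‖x - x'‖ := by
    rw [norm_mul, Complex.norm_real, Real.norm_of_nonneg hF.A_pos.le]
  have h3 := norm_sub_norm_le ((A : ℂ) * (x - x')) (E i (x, s) - E i (x', s))
  have h4 := norm_sub_rev ((A : ℂ) * (x - x')) (E i (x, s) - E i (x', s))
  linarith

/-- The position of the zero of `E(x, s) - s` near `x₀`. -/
theorem NormalizedFamily.zero_asymptotics (hE : NormalizedFamily l R S M x₀ y₀ F E)
    (hF : CriticalPoint R S x₀ y₀ A B F) {δ₁ : ℝ} (hδ₁ : 0 < δ₁)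
    (hinj : ∀ᶠ i in l, ∀ s ∈ ball (y₀ : ℂ) δ₁, ∀ x ∈ ball (x₀ : ℂ) δ₁, ∀ x' ∈ ball (x₀ : ℂ) δ₁,
      A / 2 * ‖x - x'‖ ≤ ‖E i (x, s) - E i (x', s)‖) {κ : ℝ} (hκ : 0 < κ) :
    ∃ δ > 0, ∀ᶠ i in l, ∀ s ∈ ball (y₀ : ℂ) δ, ∀ x ∈ ball (x₀ : ℂ) δ₁,
      E i (x, s) = s → ‖x - x₀ + B / (2 * A) * (s - y₀) ^ 2‖ ≤ κ * ‖s - y₀‖ ^ 2 := by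
  have hA := hF.A_pos
  have hB := hF.B_pos
  -- Chosen so that the a priori bound `|x - x₀| ≤ (B + 2) / A * σ²` gives `θ |x - x₀| ≤ κ A σ² /
  -- 4`.
  set θ : ℝ := κ * A ^ 2 / (4 * (B + 2)) with hθ
  obtain ⟨δ₂, hδ₂, -, hlin⟩ := hE.approx_linear hF (θ := θ) (by positivity)
  obtain ⟨δ₃, hδ₃, hquad⟩ := hE.approx_quadratic hF (κ := min 1 (κ * A / 2)) (by positivity)
  refine ⟨min (min δ₁ δ₂) (min δ₃ (min 1 (δ₂ * A / (2 * (B + 2))))), by positivity, ?_⟩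
  filter_upwards [hinj, hlin, hquad] with i hi hl hq s hs x hx hxs
  rw [mem_ball, lt_min_iff, lt_min_iff, lt_min_iff, lt_min_iff] at hs
  obtain ⟨⟨hs1, hs2⟩, hs3, hs4, hs5⟩ := hs
  have h1 := hi s (mem_ball.2 hs1) x hx x₀ (mem_ball_self hδ₁)
  have h2 := hq s (mem_ball.2 hs3)
  rw [dist_eq_norm] at hs4 hs5
  set σ := ‖s - y₀‖ with hσ
  have hσ0 : 0 ≤ σ := norm_nonneg _
  have h3 : ‖E i (x₀, s) - s‖ ≤ (B / 2 + 1) * σ ^ 2 := by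
    calc _ = ‖(E i (x₀, s) - s - B / 2 * (s - y₀) ^ 2) + B / 2 * (s - y₀) ^ 2‖ := by ring_nf
      _ ≤ min 1 (κ * A / 2) * σ ^ 2 + B / 2 * σ ^ 2 := by
          refine (norm_add_le _ _).trans (add_le_add h2 (le_of_eq ?_))
          rw [norm_mul, norm_div, norm_pow]
          simp [abs_of_pos hB, hσ]
      _ ≤ 1 * σ ^ 2 + B / 2 * σ ^ 2 := by gcongr; exact min_le_left _ _
      _ = _ := by ring
  rw [hxs, norm_sub_rev s] at h1
  -- Injectivity in `x` first gives this crude bound. It brings `(x, s)` into the range of the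
  -- linear approximation, which then identifies the coefficient of `(s - y₀)²`.
  have h4 : ‖x - x₀‖ ≤ (B + 2) / A * σ ^ 2 := by
    rw [div_mul_eq_mul_div, le_div_iff₀ hA]
    nlinarith
  have h5 : ‖x - x₀‖ < δ₂ := by
    refine h4.trans_lt ?_
    calc (B + 2) / A * σ ^ 2 = (B + 2) / A * (σ * σ) := by ring
      _ ≤ (B + 2) / A * (δ₂ * A / (2 * (B + 2)) * 1) := by gcongr
      _ = δ₂ / 2 := by field_simp
      _ < _ := by linarith
  have h6 := hl (x, s) (by rw [← ball_prod_same]; exact ⟨by simpa [dist_eq_norm] using h5, mem_ball.2 hs2⟩)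
    (x₀, s) (by rw [← ball_prod_same]; exact ⟨mem_ball_self hδ₂, mem_ball.2 hs2⟩)
  simp only [Prod.mk_sub_mk, sub_self, add_zero, Prod.norm_mk, norm_zero,
    max_eq_left (norm_nonneg _)] at h6
  rw [hxs] at h6
  have hA' : (A : ℂ) ≠ 0 := by exact_mod_cast hA.ne'
  have h7 : (A : ℂ) * (x - x₀ + B / (2 * A) * (s - y₀) ^ 2)
      = -(s - E i (x₀, s) - A * (x - x₀)) - (E i (x₀, s) - s - B / 2 * (s - y₀) ^ 2) := by
    field_simp; ring
  have h8 : A * ‖x - x₀ + B / (2 * A) * (s - y₀) ^ 2‖ ≤ θ * ‖x - x₀‖ + κ * A / 2 * σ ^ 2 := by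
    have : A * ‖x - x₀ + B / (2 * A) * (s - y₀) ^ 2‖
        = ‖(A : ℂ) * (x - x₀ + B / (2 * A) * (s - y₀) ^ 2)‖ := by
      rw [norm_mul, Complex.norm_real, Real.norm_of_nonneg hA.le]
    rw [this, h7]
    refine (norm_sub_le _ _).trans (add_le_add (by rwa [norm_neg]) (h2.trans ?_))
    gcongr; exact min_le_right _ _
  have h9 : θ * ‖x - x₀‖ ≤ κ * A / 4 * σ ^ 2 := by
    calc θ * ‖x - x₀‖ ≤ θ * ((B + 2) / A * σ ^ 2) := by gcongr
      _ = _ := by rw [hθ]; field_simp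
  have h10 : 0 ≤ κ * A * σ ^ 2 := by positivity
  refine le_of_mul_le_mul_left (a := A) ?_ hA
  nlinarith

theorem NormalizedFamily.exists_lower_bound (hE : NormalizedFamily l R S M x₀ y₀ F E)
    (hF : CriticalPoint R S x₀ y₀ A B F) {K : Set (ℂ × ℂ)} (hK : IsCompact K)
    (hKU : K ⊆ polydisc R S) (hne : ∀ p ∈ K, F p ≠ p.2) :
    ∃ m > 0, ∀ᶠ i in l, ∀ p ∈ K, m ≤ ‖p.2 - E i p‖ := by
  obtain ⟨m, hm, h⟩ := hK.exists_forall_le' (f := fun p => ‖p.2 - F p‖) (a := 0)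
    ((continuous_snd.continuousOn.sub (hF.diff.continuousOn.mono hKU)).norm)
    (fun p hp => norm_pos_iff.2 (sub_ne_zero.2 (hne p hp).symm))
  refine ⟨m / 2, half_pos hm, ?_⟩
  filter_upwards [hE.unif (m / 2) (half_pos hm)] with i hi p hp
  have h1 := hi p (hKU hp)
  have h2 := h p hp
  have h3 : ‖p.2 - F p‖ ≤ ‖p.2 - E i p‖ + ‖E i p - F p‖ := by
    refine (norm_add_le _ _).trans_eq' ?_; congr 1; ring
  linarith

theorem Admissible.norm_deriv_le {G : ℂ × ℂ → ℂ} (hG : Admissible R S M G) {R₁ : ℝ} (hR₁ : R₁ < R)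
    {x s : ℂ} (hx : ‖x‖ ≤ R₁) (hs : ‖s‖ < S) :
    ‖deriv (fun x => G (x, s)) x‖ ≤ 2 * M / (R - R₁) := by
  have hb : ∀ z ∈ ball x (R - R₁), ‖z‖ < R := fun z hz => by
    have := norm_sub_norm_le z x
    rw [mem_ball, dist_eq_norm] at hz
    linarith
  rw [norm_deriv_eq_norm_fderiv]
  exact norm_fderiv_le_of_bounded (sub_pos.2 hR₁)
    (fun z hz => (hG.differentiableAt_left (hb z hz) hs).differentiableWithinAt)
    (fun z hz => hG.bound _ (mem_polydisc.2 ⟨hb z hz, hs⟩))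

theorem isOpen_ne_snd (hF : CriticalPoint R S x₀ y₀ A B F) :
    IsOpen {p : ℂ × ℂ | p ∈ polydisc R S ∧ F p ≠ p.2} := by
  have h := (hF.diff.continuousOn.sub continuous_snd.continuousOn).isOpen_inter_preimage
    (isOpen_polydisc R S) (isOpen_compl_singleton (x := (0 : ℂ)))
  convert h using 1
  ext p
  simp [sub_eq_zero]

/-- For `s` on the circle away from `y₀`, uniqueness of the critical solution excludes `F(x, s) = s`
on `|x| ≤ x₀`. Compactness extends this to a larger disc with a uniform lower bound for `|s - F|`,
which then passes to `E i`. -/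
theorem NormalizedFamily.exists_far (hE : NormalizedFamily l R S M x₀ y₀ F E)
    (hF : CriticalPoint R S x₀ y₀ A B F) {δ₀ : ℝ} (hδ₀ : 0 < δ₀) :
    ∃ R₂ > x₀, R₂ < R ∧ ∃ C ≥ 0, ∀ᶠ i in l, ∀ s : ℂ, ‖s‖ = y₀ → δ₀ ≤ ‖s - y₀‖ →
      ∀ x ∈ closedBall (0 : ℂ) R₂, E i (x, s) ≠ s ∧
        ‖deriv (fun x => E i (x, s)) x / (s - E i (x, s))‖ ≤ C := by
  set T : Set ℂ := {s | ‖s‖ = y₀ ∧ δ₀ ≤ ‖s - y₀‖} with hT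
  have hTc : IsCompact T := by
    refine (isCompact_sphere (0 : ℂ) y₀).of_isClosed_subset ?_ (fun s hs => by simpa using hs.1)
    exact (isClosed_eq (f := fun s : ℂ => ‖s‖) (by fun_prop) continuous_const).inter
      (isClosed_le (g := fun s : ℂ => ‖s - y₀‖) continuous_const (by fun_prop))
  have hsub : closedBall (0 : ℂ) x₀ ×ˢ T ⊆ {p : ℂ × ℂ | p ∈ polydisc R S ∧ F p ≠ p.2} := by
    rintro ⟨x, s⟩ ⟨hx, hs, hs'⟩
    simp only [mem_closedBall_zero_iff] at hx hs hs'
    refine ⟨mem_polydisc.2 ⟨hx.trans_lt hF.x₀_lt, hs.trans_lt hF.y₀_lt⟩, fun h => ?_⟩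
    rw [(hF.unique x s hx hs h).2, sub_self, norm_zero] at hs'
    linarith
  obtain ⟨u, v, hu, hv, hxu, hTv, huv⟩ := generalized_tube_lemma (isCompact_closedBall _ _) hTc
    (isOpen_ne_snd hF) hsub
  obtain ⟨R', hR', hR'u⟩ := exists_closedBall_subset_of_isOpen hF.x₀_pos.le hu hxu
  have hx₀R := hF.x₀_lt
  set R₂ := min R' ((x₀ + R) / 2) with hR₂
  have h1 : R₂ < R := (min_le_right _ _).trans_lt (by linarith)
  have h2 : x₀ < R₂ := lt_min hR' (by linarith)
  have h3 : closedBall (0 : ℂ) R₂ ×ˢ T ⊆ {p : ℂ × ℂ | p ∈ polydisc R S ∧ F p ≠ p.2} :=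
    (prod_mono ((closedBall_subset_closedBall (min_le_left _ _)).trans hR'u) hTv).trans huv
  obtain ⟨m, hm, hlow⟩ := hE.exists_lower_bound hF ((isCompact_closedBall (0 : ℂ) R₂).prod hTc)
    (fun p hp => (h3 hp).1) (fun p hp => (h3 hp).2)
  refine ⟨R₂, h2, h1, |2 * M / (R - R₂) / m|, abs_nonneg _, ?_⟩
  filter_upwards [hE.adm, hlow] with i hi hl s hs hs' x hx
  have h4 := hl (x, s) ⟨hx, hs, hs'⟩
  simp only at h4
  refine ⟨fun h => ?_, ?_⟩
  · rw [h, sub_self, norm_zero] at h4; linarith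
  · have h5 := hi.norm_deriv_le h1 (mem_closedBall_zero_iff.1 hx) (hs.trans_lt hF.y₀_lt)
    rw [norm_div]
    have h6 := (norm_nonneg _).trans h5
    exact (div_le_div₀ h6 h5 hm h4).trans (le_abs_self _)

/-- Near `x₀` a quantitative open mapping theorem gives existence of the zero, and injectivity gives
uniqueness and simplicity. On the rest of the larger disc, compactness excludes zeros for all `s`
near `y₀`. -/
theorem NormalizedFamily.exists_near (hE : NormalizedFamily l R S M x₀ y₀ F E)
    (hF : CriticalPoint R S x₀ y₀ A B F) {δ₁ : ℝ} (hδ₁ : 0 < δ₁)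
    (hsub : ∀ x ∈ ball (x₀ : ℂ) δ₁, ∀ s ∈ ball (y₀ : ℂ) δ₁, (x, s) ∈ polydisc R S)
    (hinj : ∀ᶠ i in l, ∀ s ∈ ball (y₀ : ℂ) δ₁, ∀ x ∈ ball (x₀ : ℂ) δ₁, ∀ x' ∈ ball (x₀ : ℂ) δ₁,
      A / 2 * ‖x - x'‖ ≤ ‖E i (x, s) - E i (x', s)‖) :
    ∃ R₁ > x₀, R₁ < R ∧ ∃ C ≥ 0, ∃ δ₀ > 0, ∀ᶠ i in l, ∀ s : ℂ, ‖s‖ = y₀ → ‖s - y₀‖ < δ₀ →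
      ∃ X ∈ ball (x₀ : ℂ) δ₁, ‖X‖ < R₁ ∧ E i (X, s) = s ∧
        (∀ x ∈ closedBall (0 : ℂ) R₁, E i (x, s) = s → x = X) ∧
        deriv (fun x => E i (x, s)) X ≠ 0 ∧
        ∀ x ∈ sphere (0 : ℂ) R₁,
          ‖deriv (fun x => E i (x, s)) x / (s - E i (x, s)) - (X - x)⁻¹‖ ≤ C := by
  have hA := hF.A_pos
  have hx₀ := hF.x₀_pos
  have hy₀S : ‖(y₀ : ℂ)‖ < S := by simpa [abs_of_pos hF.y₀_pos] using hF.y₀_lt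
  have hNo := isOpen_ne_snd hF
  have hUo : IsOpen (ball (x₀ : ℂ) δ₁ ∪ (fun x : ℂ => (x, (y₀ : ℂ))) ⁻¹'
      {p : ℂ × ℂ | p ∈ polydisc R S ∧ F p ≠ p.2}) := isOpen_ball.union (hNo.preimage (by fun_prop))
  have hU : closedBall (0 : ℂ) x₀ ⊆ ball (x₀ : ℂ) δ₁ ∪ (fun x : ℂ => (x, (y₀ : ℂ))) ⁻¹'
      {p : ℂ × ℂ | p ∈ polydisc R S ∧ F p ≠ p.2} := by
    intro x hx
    rw [mem_closedBall_zero_iff] at hx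
    by_cases h : F (x, y₀) = y₀
    · left
      rw [(hF.unique x y₀ hx (by simp [abs_of_pos hF.y₀_pos]) h).1]
      exact mem_ball_self hδ₁
    · exact Or.inr ⟨mem_polydisc.2 ⟨hx.trans_lt hF.x₀_lt, hy₀S⟩, h⟩
  obtain ⟨R', hR', hR'U⟩ := exists_closedBall_subset_of_isOpen hx₀.le hUo hU
  have hx₀R := hF.x₀_lt
  set R₁ := min R' ((x₀ + R) / 2) with hR₁
  have hR₁R : R₁ < R := (min_le_right _ _).trans_lt (by linarith)
  have hxR₁ : x₀ < R₁ := lt_min hR' (by linarith)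
  have hR₁U := (closedBall_subset_closedBall (x := (0 : ℂ)) (min_le_left R' ((x₀ + R) / 2))).trans hR'U
  set K' : Set ℂ := closedBall 0 R₁ \ ball (x₀ : ℂ) δ₁ with hK'
  have hK'c : IsCompact K' := (isCompact_closedBall _ _).diff isOpen_ball
  obtain ⟨u, v, hu, hv, hxu, hyv, huv⟩ := generalized_tube_lemma hK'c (isCompact_singleton (x := (y₀ : ℂ)))
    hNo (by
      rintro ⟨x, s⟩ ⟨hx, rfl⟩
      exact (hR₁U hx.1).resolve_left hx.2)
  obtain ⟨δ₂, hδ₂, hδ₂v⟩ := Metric.nhds_basis_closedBall.mem_iff.1 (hv.mem_nhds (hyv rfl))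
  have h3 : K' ×ˢ closedBall (y₀ : ℂ) δ₂ ⊆ {p : ℂ × ℂ | p ∈ polydisc R S ∧ F p ≠ p.2} :=
    (prod_mono hxu hδ₂v).trans huv
  obtain ⟨m, hm, hlow⟩ := hE.exists_lower_bound hF (hK'c.prod (isCompact_closedBall (y₀ : ℂ) δ₂))
    (fun p hp => (h3 hp).1) (fun p hp => (h3 hp).2)
  -- The first entry keeps the zero where `E i` is injective in `x`, the second keeps it at distance
  -- at least `(R₁ - x₀) / 2` from the circle `|x| = R₁`.
  set δ' : ℝ := min (δ₁ / 2) ((R₁ - x₀) / 2) with hδ'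
  have hδ'0 : 0 < δ' := lt_min (by linarith) (by linarith)
  obtain ⟨δ₃, hδ₃, hquad⟩ := hE.approx_quadratic hF (κ := 1) one_pos
  have hB := hF.B_pos
  set δ₀ : ℝ := min (min δ₁ δ₂) (min δ₃ (min 1 (A * δ' / (4 * (B + 2))))) with hδ₀
  set m' : ℝ := min m (A / 2 * ((R₁ - x₀) / 2)) with hm'
  have hm'0 : 0 < m' := lt_min hm (by have := sub_pos.2 hxR₁; positivity)
  refine ⟨R₁, hxR₁, hR₁R, |2 * M / (R - R₁) / m'| + 2 / (R₁ - x₀),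
    by have := sub_pos.2 hxR₁; positivity, δ₀, by positivity, ?_⟩
  filter_upwards [hE.adm, hlow, hinj, hquad] with i hi hl hin hq s hs hsδ
  rw [lt_min_iff, lt_min_iff, lt_min_iff, lt_min_iff] at hsδ
  obtain ⟨⟨hs1, hs2⟩, hs3, hs4, hs5⟩ := hsδ
  have hsb : s ∈ ball (y₀ : ℂ) δ₁ := by rwa [mem_ball, dist_eq_norm]
  have hsS : ‖s‖ < S := hs.trans_lt hF.y₀_lt
  have hdiff : ∀ x ∈ ball (x₀ : ℂ) δ₁, DifferentiableAt ℂ (fun x => E i (x, s)) x := fun x hx =>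
    hi.differentiableAt_left (mem_polydisc.1 (hsub x hx s hsb)).1 hsS
  have hcl : closedBall (x₀ : ℂ) δ' ⊆ ball (x₀ : ℂ) δ₁ :=
    closedBall_subset_ball ((min_le_left _ _).trans_lt (by linarith))
  have hsm : ‖E i (x₀, s) - s‖ < A / 2 * δ' / 2 := by
    have h1 := hq s (by rwa [mem_ball, dist_eq_norm])
    set σ := ‖s - y₀‖ with hσ
    calc ‖E i (x₀, s) - s‖ = ‖(E i (x₀, s) - s - B / 2 * (s - y₀) ^ 2) + B / 2 * (s - y₀) ^ 2‖ := by
          ring_nf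
      _ ≤ 1 * σ ^ 2 + B / 2 * σ ^ 2 := by
          refine (norm_add_le _ _).trans (add_le_add h1 (le_of_eq ?_))
          rw [norm_mul, norm_div, norm_pow]
          simp [abs_of_pos hB, hσ]
      _ = (B + 2) / 2 * (σ * σ) := by ring
      _ ≤ (B + 2) / 2 * (A * δ' / (4 * (B + 2)) * 1) := by
          have : 0 ≤ σ := norm_nonneg _
          gcongr
      _ = A * δ' / 8 := by field_simp; norm_num
      _ < _ := by nlinarith [mul_pos hA hδ'0]
  -- On `|x - x₀| = δ'` the values differ from `E i (x₀, s)` by at least `A δ' / 2`, so the image of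
  -- the disc covers the ball of half that radius around `E i (x₀, s)`. By `hsm` this ball contains
  -- `s`.
  obtain ⟨X, hX, hXs⟩ : s ∈ (fun x => E i (x, s)) '' closedBall (x₀ : ℂ) δ' := by
    refine DiffContOnCl.ball_subset_image_closedBall (ε := A / 2 * δ') ?_ hδ'0 (fun z hz => ?_) ?_ ?_
    · refine DifferentiableOn.diffContOnCl fun z hz => ?_
      rw [closure_ball _ hδ'0.ne'] at hz
      exact (hdiff z (hcl hz)).differentiableWithinAt
    · have := hin s hsb z (hcl (sphere_subset_closedBall hz)) x₀ (mem_ball_self hδ₁)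
      rwa [← dist_eq_norm z, mem_sphere.1 hz] at this
    · have h1 : ∀ᶠ z in 𝓝[≠] (x₀ : ℂ), E i (z, s) ≠ E i (x₀, s) := by
        filter_upwards [self_mem_nhdsWithin, mem_nhdsWithin_of_mem_nhds (ball_mem_nhds _ hδ₁)]
          with z hz hzb h
        have := hin s hsb z hzb x₀ (mem_ball_self hδ₁)
        rw [h, sub_self, norm_zero] at this
        have h2 : 0 < ‖z - x₀‖ := norm_pos_iff.2 (sub_ne_zero.2 hz)
        nlinarith
      exact h1.frequently.filter_mono nhdsWithin_le_nhds
    · rwa [mem_ball, dist_eq_norm, norm_sub_rev]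
  have hXb := hcl hX
  have hXn : ‖X‖ ≤ x₀ + (R₁ - x₀) / 2 := by
    rw [mem_closedBall, dist_eq_norm] at hX
    have h1 := norm_sub_norm_le X (x₀ : ℂ)
    rw [Complex.norm_real, Real.norm_of_nonneg hx₀.le] at h1
    have h2 := hX.trans (min_le_right (δ₁ / 2) ((R₁ - x₀) / 2))
    linarith
  simp only at hXs
  have hs2' : s ∈ closedBall (y₀ : ℂ) δ₂ := by rw [mem_closedBall, dist_eq_norm]; exact hs2.le
  refine ⟨X, hXb, by linarith, hXs, fun x hx hxs => ?_, ?_, fun x hx => ?_⟩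
  · have hxb : x ∈ ball (x₀ : ℂ) δ₁ := by
      by_contra hxb
      have := hl (x, s) ⟨⟨hx, hxb⟩, hs2'⟩
      simp only [hxs, sub_self, norm_zero] at this
      linarith
    have := hin s hsb x hxb X hXb
    rw [hxs, hXs, sub_self, norm_zero] at this
    have h2 : ‖x - X‖ ≤ 0 := by
      by_contra h; push Not at h; nlinarith
    exact sub_eq_zero.1 (norm_le_zero_iff.1 h2)
  · intro h0
    have h1 := (hasDerivAt_iff_tendsto_slope.1 (hdiff X hXb).hasDerivAt).norm
    have h2 : A / 2 ≤ ‖deriv (fun x => E i (x, s)) X‖ := by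
      refine ge_of_tendsto h1 ?_
      filter_upwards [self_mem_nhdsWithin, mem_nhdsWithin_of_mem_nhds (isOpen_ball.mem_nhds hXb)]
        with z hz hzb
      have h2 : 0 < ‖z - X‖ := norm_pos_iff.2 (sub_ne_zero.2 hz)
      rw [slope_def_field, norm_div, le_div_iff₀ h2]
      exact hin s hsb z hzb X hXb
    rw [h0, norm_zero] at h2
    linarith
  · have hxn : ‖x‖ = R₁ := by simpa using hx
    have hR₁x := sub_pos.2 hxR₁
    have hXx : (R₁ - x₀) / 2 ≤ ‖X - x‖ := by
      have := norm_sub_norm_le x X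
      rw [norm_sub_rev] at this
      linarith
    -- Near `x₀` the bound comes from injectivity and the distance to `X`, elsewhere from
    -- compactness.
    have hden : m' ≤ ‖s - E i (x, s)‖ := by
      by_cases hxb : x ∈ ball (x₀ : ℂ) δ₁
      · have := hin s hsb X hXb x hxb
        rw [hXs] at this
        refine (min_le_right _ _).trans (le_trans ?_ this)
        gcongr
      · exact (min_le_left _ _).trans
          (hl (x, s) ⟨⟨mem_closedBall_zero_iff.2 hxn.le, hxb⟩, hs2'⟩)
    refine (norm_sub_le _ _).trans (add_le_add ?_ ?_)
    · have h5 := hi.norm_deriv_le hR₁R hxn.le hsS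
      rw [norm_div]
      exact (div_le_div₀ ((norm_nonneg _).trans h5) h5 hm'0 hden).trans (le_abs_self _)
    · rw [norm_inv]
      calc ‖X - x‖⁻¹ ≤ ((R₁ - x₀) / 2)⁻¹ := by gcongr
        _ = _ := by field_simp

end

/-! ### Uniform asymptotics of the coefficients for a normalized family -/

section

theorem norm_exp_sub_one_sq_add_sq_le {θ : ℝ} (hθ : |θ| ≤ 1) :
    ‖(Complex.exp (θ * Complex.I) - 1) ^ 2 + (θ : ℂ) ^ 2‖ ≤ 3 * |θ| ^ 3 := by
  have h0 : ‖(θ : ℂ) * Complex.I‖ = |θ| := by simp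
  have h1 := Complex.norm_exp_sub_one_sub_id_le (x := θ * Complex.I) (by rwa [h0])
  rw [h0] at h1
  have h2 : (Complex.exp (θ * Complex.I) - 1) ^ 2 + (θ : ℂ) ^ 2
      = (Complex.exp (θ * Complex.I) - 1 - θ * Complex.I)
        * ((Complex.exp (θ * Complex.I) - 1 - θ * Complex.I) + 2 * (θ * Complex.I)) := by
    ring_nf; simp
  rw [h2, norm_mul]
  have h3 : ‖(Complex.exp (θ * Complex.I) - 1 - θ * Complex.I) + 2 * (θ * Complex.I)‖
      ≤ |θ| ^ 2 + 2 * |θ| := by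
    refine (norm_add_le _ _).trans (add_le_add h1 ?_)
    rw [norm_mul, h0]; simp
  have h4 : 0 ≤ |θ| := abs_nonneg θ
  calc _ ≤ |θ| ^ 2 * (|θ| ^ 2 + 2 * |θ|) := by gcongr
    _ ≤ |θ| ^ 2 * (1 * |θ| + 2 * |θ|) := by rw [sq]; gcongr
    _ = _ := by ring

theorem circleMap_sub_self {y₀ : ℝ} (θ : ℝ) :
    circleMap 0 y₀ θ - y₀ = y₀ * (Complex.exp (θ * Complex.I) - 1) := by
  simp [circleMap]; ring

theorem norm_circleMap_sub_self_le {y₀ : ℝ} (hy₀ : 0 < y₀) (θ : ℝ) :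
    ‖circleMap 0 y₀ θ - y₀‖ ≤ y₀ * |θ| := by
  rw [circleMap_sub_self, norm_mul, Complex.norm_real, Real.norm_of_nonneg hy₀.le, mul_comm (θ : ℂ)]
  exact mul_le_mul_of_nonneg_left (Real.norm_exp_I_mul_ofReal_sub_one_le) hy₀.le

/-- Points of the circle `|s| = y₀` away from the positive axis. -/
theorem exists_le_norm_circleMap_sub {y₀ δ : ℝ} (hy₀ : 0 < y₀) (hδ : 0 < δ) :
    ∃ η > 0, ∀ θ : ℝ, |θ| ≤ Real.pi → δ ≤ |θ| → η ≤ ‖circleMap 0 y₀ θ - y₀‖ := by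
  refine ⟨y₀ * (2 / Real.pi * δ), by positivity, fun θ h1 h2 => ?_⟩
  rw [circleMap_sub_self, norm_mul, Complex.norm_real, Real.norm_of_nonneg hy₀.le]
  refine mul_le_mul_of_nonneg_left ?_ hy₀.le
  rw [mul_comm (θ : ℂ), Complex.norm_exp_I_mul_ofReal_sub_one, Real.norm_eq_abs, abs_mul]
  have h3 := Real.mul_abs_le_abs_sin (x := θ / 2) (by
    rw [abs_div, abs_two]; linarith)
  rw [abs_div, abs_two] at h3
  rw [abs_two]
  calc 2 / Real.pi * δ ≤ 2 / Real.pi * |θ| := by gcongr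
    _ = 2 * (2 / Real.pi * (|θ| / 2)) := by ring
    _ ≤ _ := by gcongr

variable {ι : Type*} {l : Filter ι} {R S M x₀ y₀ A B : ℝ} {F : ℂ × ℂ → ℂ} {E : ι → ℂ × ℂ → ℂ}

/-- The asymptotic behaviour of the coefficients of the solutions of `s = E(x, s)` for a family of
functions with the same critical point. -/
theorem NormalizedFamily.tendsto_solCoeff [l.IsCountablyGenerated]
    (hE : NormalizedFamily l R S M x₀ y₀ F E) (hF : CriticalPoint R S x₀ y₀ A B F) :
    Tendsto (fun p : ι × ℕ => (Real.sqrt p.2 : ℂ) * (p.2 * (x₀ ^ p.2 * solCoeff (E p.1) p.2)))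
      (l ×ˢ atTop)
      (𝓝 ((2 * Real.pi : ℂ)⁻¹ * y₀ * Real.sqrt (Real.pi / (B * y₀ ^ 2 / (2 * A * x₀))))) := by
  classical
  have hA := hF.A_pos
  have hB := hF.B_pos
  have hx₀ := hF.x₀_pos
  have hy₀ := hF.y₀_pos
  obtain ⟨r, hr⟩ := exists_smallRadius (M := M) (hx₀.trans hF.x₀_lt) hy₀ hF.y₀_lt
  obtain ⟨δ₁, hδ₁, hsub, hinj⟩ := hE.exists_injective hF
  obtain ⟨R₁, hxR₁, hR₁R, C₁, hC₁, δn, hδn, hnear⟩ := hE.exists_near hF hδ₁ hsub hinj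
  set Q : ℝ := B * y₀ ^ 2 / (2 * A * x₀) with hQ
  have hQ0 : 0 < Q := by positivity
  set P : ι → ℝ → ℂ → Prop := fun i θ X => X ∈ ball (x₀ : ℂ) δ₁ ∧ ‖X‖ < R₁ ∧
    E i (X, circleMap 0 y₀ θ) = circleMap 0 y₀ θ ∧
    (∀ x ∈ closedBall (0 : ℂ) R₁, E i (x, circleMap 0 y₀ θ) = circleMap 0 y₀ θ → x = X) ∧
    deriv (fun x => E i (x, circleMap 0 y₀ θ)) X ≠ 0 ∧
    ∀ x ∈ sphere (0 : ℂ) R₁, ‖deriv (fun x => E i (x, circleMap 0 y₀ θ)) x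
      / (circleMap 0 y₀ θ - E i (x, circleMap 0 y₀ θ)) - (X - x)⁻¹‖ ≤ C₁ with hP
  -- The default value `x₀` plays no role: for `|θ| < δn / y₀` the zero exists eventually along `l`.
  set X : ι → ℝ → ℂ := fun i θ => if h : ∃ X, P i θ X then h.choose else x₀ with hX
  have hXP : ∀ i θ, (∃ X, P i θ X) → P i θ (X i θ) := fun i θ h => by
    simp only [hX, dif_pos h]; exact h.choose_spec
  have hsn : ∀ θ : ℝ, ‖circleMap 0 y₀ θ‖ = y₀ := fun θ => by
    rw [norm_circleMap_zero, abs_of_pos hy₀]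
  have hPex : ∀ᶠ i in l, ∀ θ : ℝ, |θ| < δn / y₀ → P i θ (X i θ) := by
    filter_upwards [hnear] with i hi θ hθ
    refine hXP i θ ?_
    obtain ⟨X, h1, h2⟩ := hi (circleMap 0 y₀ θ) (hsn θ)
      ((norm_circleMap_sub_self_le hy₀ θ).trans_lt (by rwa [lt_div_iff₀' hy₀] at hθ))
    exact ⟨X, h1, h2⟩
  have hZ' : ∀ κ > 0, ∃ δ > 0, ∀ᶠ i in l, ∀ θ : ℝ, |θ| < δ →
      ‖X i θ / x₀ - 1 - Q * (θ : ℂ) ^ 2‖ ≤ κ * θ ^ 2 := by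
    intro κ hκ
    obtain ⟨δ, hδ, h⟩ := hE.zero_asymptotics hF hδ₁ hinj (κ := κ * x₀ / (2 * y₀ ^ 2)) (by positivity)
    refine ⟨min (min (δn / y₀) (δ / y₀)) (min 1 (κ / (6 * Q))), by positivity, ?_⟩
    filter_upwards [h, hPex] with i hi hPi θ hθ
    rw [lt_min_iff, lt_min_iff, lt_min_iff] at hθ
    obtain ⟨⟨h1, h2⟩, h3, h4⟩ := hθ
    obtain ⟨hXb, -, hXe, -⟩ := hPi θ h1
    have hs := norm_circleMap_sub_self_le hy₀ θ
    have h5 := hi (circleMap 0 y₀ θ) (by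
      rw [mem_ball, dist_eq_norm]
      exact hs.trans_lt (by rwa [lt_div_iff₀' hy₀] at h2)) _ hXb hXe
    have h6 := norm_exp_sub_one_sq_add_sq_le h3.le
    have hx' : (x₀ : ℂ) ≠ 0 := by exact_mod_cast hx₀.ne'
    have hA' : (A : ℂ) ≠ 0 := by exact_mod_cast hA.ne'
    -- On the circle `(s - y₀)² = y₀² (e^{iθ} - 1)² ≈ -y₀² θ²`. With the position of the zero this
    -- gives `X / x₀ ≈ 1 + Q θ²` for `Q = B y₀² / (2 A x₀)`, so `|X|` is smallest at `θ = 0` to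
    -- leading order.
    have h7 : X i θ / x₀ - 1 - Q * (θ : ℂ) ^ 2
        = (X i θ - x₀ + B / (2 * A) * (circleMap 0 y₀ θ - y₀) ^ 2) / x₀
          - Q * ((Complex.exp (θ * Complex.I) - 1) ^ 2 + (θ : ℂ) ^ 2) := by
      rw [circleMap_sub_self, hQ]; push_cast; field_simp; ring
    rw [h7]
    refine (norm_sub_le _ _).trans ?_
    have h8 : ‖(X i θ - x₀ + B / (2 * A) * (circleMap 0 y₀ θ - y₀) ^ 2) / x₀‖ ≤ κ / 2 * θ ^ 2 := by
      rw [norm_div, Complex.norm_real, Real.norm_of_nonneg hx₀.le, div_le_iff₀ hx₀]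
      calc _ ≤ κ * x₀ / (2 * y₀ ^ 2) * (y₀ * |θ|) ^ 2 := h5.trans (by gcongr)
        _ = _ := by rw [mul_pow, sq_abs]; field_simp
    have h9 : ‖Q * ((Complex.exp (θ * Complex.I) - 1) ^ 2 + (θ : ℂ) ^ 2)‖ ≤ κ / 2 * θ ^ 2 := by
      rw [norm_mul, Complex.norm_real, Real.norm_of_nonneg hQ0.le]
      calc _ ≤ Q * (3 * |θ| ^ 3) := by gcongr
        _ = Q * 3 * |θ| * θ ^ 2 := by rw [← sq_abs θ]; ring
        _ ≤ Q * 3 * (κ / (6 * Q)) * θ ^ 2 := by gcongr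
        _ = _ := by field_simp; ring
    linarith
  obtain ⟨δq, hδq, hZq⟩ := hZ' (Q / 2) (half_pos hQ0)
  set δ₀ : ℝ := min δq (δn / y₀) with hδ₀
  have hδ₀0 : 0 < δ₀ := by positivity
  obtain ⟨η, hη, hηθ⟩ := exists_le_norm_circleMap_sub hy₀ hδ₀0
  obtain ⟨R₂, hxR₂, hR₂R, C₂, hC₂, hfar⟩ := hE.exists_far hF hη
  have hR₁0 := hx₀.trans hxR₁
  have hR₂0 := hx₀.trans hxR₂
  set R₀ : ℝ := min R₁ R₂ with hR₀
  have hR₀0 : 0 < R₀ := lt_min hR₁0 hR₂0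
  set C : ℝ := max (C₁ * R₁) (C₂ * R₂) with hC
  have hC0 : 0 ≤ C := le_max_of_le_left (by positivity)
  -- The extra factor `R'` accounts for the exponent `n - 1` in the Cauchy estimate, and `R₀ > x₀`
  -- makes the error exponentially small relative to `x₀⁻ⁿ`.
  have hbound : ∀ {c : ℂ} {n : ℕ} {C' R' : ℝ}, 1 ≤ n → 0 ≤ C' → R₀ ≤ R' → C' * R' ≤ C →
      ‖c‖ ≤ C' * R'⁻¹ ^ (n - 1) → ‖(x₀ : ℂ) ^ n * c‖ ≤ C * (x₀ / R₀) ^ n := by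
    intro c n C' R' hn hC' hR' hCR hc
    have hR'0 := hR₀0.trans_le hR'
    obtain ⟨k, rfl⟩ : ∃ k, n = k + 1 := ⟨n - 1, by omega⟩
    rw [Nat.add_sub_cancel] at hc
    rw [norm_mul, norm_pow, Complex.norm_real, Real.norm_of_nonneg hx₀.le]
    calc x₀ ^ (k + 1) * ‖c‖ ≤ x₀ ^ (k + 1) * (C' * R'⁻¹ ^ k) := by gcongr
      _ = (C' * R') * (x₀ / R') ^ (k + 1) := by rw [div_eq_mul_inv, mul_pow, pow_succ R'⁻¹]; field_simp
      _ ≤ C * (x₀ / R₀) ^ (k + 1) := by gcongr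
  have hmain := tendsto_sqrt_mul_integral (l := l)
    (a := fun i n θ => (x₀ : ℂ) ^ n * (n * logCoeff (E i) (circleMap 0 y₀ θ) n))
    (Z := fun i θ => X i θ / x₀) (C := C) (ρ := x₀ / R₀) hQ0 hδ₀0 hC0
    (by positivity) ((div_lt_one hR₀0).2 (lt_min hxR₁ hxR₂)) ?_ ?_ ?_ ?_ hZ'
  · refine (hmain.const_mul ((2 * Real.pi : ℂ)⁻¹ * y₀)).congr' ?_
    filter_upwards [tendsto_fst.eventually hE.adm] with p hp
    rw [hp.solCoeff_eq_integral hr]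
    have h1 : (∫ θ in (-Real.pi)..Real.pi, (x₀ : ℂ) ^ p.2 *
        (p.2 * logCoeff (E p.1) (circleMap 0 y₀ θ) p.2) * Complex.exp (θ * Complex.I)) * y₀
        = p.2 * x₀ ^ p.2 * ∫ θ in (-Real.pi)..Real.pi,
          circleMap 0 y₀ θ * logCoeff (E p.1) (circleMap 0 y₀ θ) p.2 := by
      rw [← intervalIntegral.integral_mul_const, ← intervalIntegral.integral_const_mul]
      refine intervalIntegral.integral_congr fun θ _ => ?_
      generalize logCoeff (E p.1) (circleMap 0 y₀ θ) p.2 = L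
      simp only [circleMap]
      ring
    generalize (∫ θ in (-Real.pi)..Real.pi, (x₀ : ℂ) ^ p.2 *
        (p.2 * logCoeff (E p.1) (circleMap 0 y₀ θ) p.2) * Complex.exp (θ * Complex.I)) = J₁ at h1 ⊢
    linear_combination (2 * Real.pi : ℂ)⁻¹ * Real.sqrt p.2 * h1
  · filter_upwards [hE.adm] with i hi n
    exact continuous_const.mul (continuous_const.mul (hi.continuous_logCoeff hr n))
  · filter_upwards [hE.adm, hfar] with i hi hf n hn θ hθ hθ'
    have h1 := hf (circleMap 0 y₀ θ) (hsn θ) (hηθ θ hθ hθ')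
    refine hbound hn hC₂ (min_le_right _ _) (le_max_right _ _) ?_
    exact norm_logCoeff_le hr.r_pos hr.r_lt.le hR₂0 hR₂R
      (fun x hx => (hi.differentiableAt_left (mem_ball_zero_iff.1 hx)
        ((hsn θ).trans_lt hF.y₀_lt)).differentiableWithinAt)
      (circleMap_ne_center hy₀.ne')
      (fun x hx => hi.one_sub_div_mem_slitPlane hr (mem_ball_zero_iff.1 hx) (hsn θ))
      (fun x hx => (h1 x hx).1) (fun x hx => (h1 x (sphere_subset_closedBall hx)).2) hn
  · filter_upwards [hE.adm, hPex] with i hi hPi n hn θ hθ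
    obtain ⟨h1, h2, h3, h4, h5, h6⟩ := hPi θ (hθ.trans_le (min_le_right _ _))
    have h7 : (X i θ / x₀)⁻¹ ^ n = (x₀ : ℂ) ^ n * (X i θ)⁻¹ ^ n := by
      rw [inv_div, div_eq_mul_inv, mul_pow]
    rw [h7, ← mul_sub]
    refine hbound hn hC₁ (min_le_left _ _) (le_max_left _ _) ?_
    exact norm_logCoeff_sub_le hr.r_pos hr.r_lt.le hR₁R
      (fun x hx => (hi.differentiableAt_left (mem_ball_zero_iff.1 hx)
        ((hsn θ).trans_lt hF.y₀_lt)).differentiableWithinAt)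
      (circleMap_ne_center hy₀.ne')
      (fun x hx => hi.one_sub_div_mem_slitPlane hr (mem_ball_zero_iff.1 hx) (hsn θ))
      h2 h3 h4 h5 h6 hn
  · filter_upwards [hZq] with i hi θ hθ
    exact hi θ (hθ.trans_le (min_le_left _ _))

end

/-! ### Holomorphic families and their moving critical points -/

section

variable {W : Type*} [NormedAddCommGroup W] [NormedSpace ℂ W]

/-- A holomorphic family of admissible functions around a function with a critical point. -/
structure HolomorphicFamily (r R S M x₀ y₀ A B : ℝ) (e : W → ℂ × ℂ → ℂ) : Prop where
  r_pos : 0 < r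
  diff : DifferentiableOn ℂ (fun q : W × (ℂ × ℂ) => e q.1 q.2) (ball 0 r ×ˢ polydisc R S)
  adm : ∀ h ∈ ball (0 : W) r, Admissible R S M (e h)
  crit : CriticalPoint R S x₀ y₀ A B (e 0)

theorem fderiv_inr_apply {G : Type*} [NormedAddCommGroup G] [NormedSpace ℂ G] {V : Type*}
    [NormedAddCommGroup V] [NormedSpace ℂ V] {g : W × V → G} {h : W} {p : V}
    (hg : DifferentiableAt ℂ g (h, p)) (v : V) :
    fderiv ℂ g (h, p) (0, v) = fderiv ℂ (fun p => g (h, p)) p v := by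
  have h1 : HasFDerivAt (fun p => g (h, p)) (fderiv ℂ g (h, p) ∘L .inr ℂ W V) p :=
    hg.hasFDerivAt.comp p (hasFDerivAt_prodMk_right h p)
  rw [h1.fderiv]; rfl

theorem fderiv_inl_apply {G : Type*} [NormedAddCommGroup G] [NormedSpace ℂ G] {V : Type*}
    [NormedAddCommGroup V] [NormedSpace ℂ V] {g : W × V → G} {h : W} {p : V}
    (hg : DifferentiableAt ℂ g (h, p)) (v : W) :
    fderiv ℂ g (h, p) (v, 0) = fderiv ℂ (fun h => g (h, p)) h v := by
  have h1 : HasFDerivAt (fun h => g (h, p)) (fderiv ℂ g (h, p) ∘L .inl ℂ W V) h :=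
    hg.hasFDerivAt.comp h (hasFDerivAt_prodMk_left h p)
  rw [h1.fderiv]; rfl

namespace HolomorphicFamily

variable {r R S M x₀ y₀ A B : ℝ} {e : W → ℂ × ℂ → ℂ}

theorem isOpen (_ : HolomorphicFamily r R S M x₀ y₀ A B e) :
    IsOpen (ball (0 : W) r ×ˢ polydisc R S) := isOpen_ball.prod (isOpen_polydisc R S)

theorem differentiableAt (he : HolomorphicFamily r R S M x₀ y₀ A B e) {h : W} {p : ℂ × ℂ}
    (hh : h ∈ ball (0 : W) r) (hp : p ∈ polydisc R S) :
    DifferentiableAt ℂ (fun q : W × (ℂ × ℂ) => e q.1 q.2) (h, p) :=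
  he.diff.differentiableAt (he.isOpen.mem_nhds ⟨hh, hp⟩)

theorem deriv_right_eq (he : HolomorphicFamily r R S M x₀ y₀ A B e) {h : W} {x s : ℂ}
    (hh : h ∈ ball (0 : W) r) (hp : (x, s) ∈ polydisc R S) :
    fderiv ℂ (fun q : W × (ℂ × ℂ) => e q.1 q.2) (h, (x, s)) (0, (0, 1))
      = deriv (fun s => e h (x, s)) s := by
  rw [fderiv_inr_apply (he.differentiableAt hh hp), fderiv_prod_apply
    ((he.adm h hh).diff.differentiableAt ((isOpen_polydisc R S).mem_nhds hp))]
  simp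

theorem norm_sub_le (he : HolomorphicFamily r R S M x₀ y₀ A B e) {h : W} {p : ℂ × ℂ}
    (hh : h ∈ ball (0 : W) r) (hp : p ∈ polydisc R S) : ‖e h p - e 0 p‖ ≤ 2 * M / r * ‖h‖ := by
  have := norm_sub_le_of_bounded (f := fun h => e h p) (w := 0) (z := h) (M := M) he.r_pos
    (he.diff.comp (f := fun h => (h, p)) (by fun_prop) fun h hh => ⟨hh, hp⟩)
    (fun h hh => (he.adm h hh).bound p hp) ((he.adm h hh).bound p hp)
  simpa using this

/-- The critical point of `s = e h (x, s)` depends holomorphically on `h`. -/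
theorem exists_criticalPoint [CompleteSpace W] (he : HolomorphicFamily r R S M x₀ y₀ A B e) :
    ∃ f g : W → ℂ, ∃ ρ > 0, ρ ≤ r ∧ DifferentiableOn ℂ f (ball 0 ρ) ∧
      DifferentiableOn ℂ g (ball 0 ρ) ∧ f 0 = x₀ ∧ g 0 = y₀ ∧
      (∀ h ∈ ball (0 : W) ρ, (f h, g h) ∈ polydisc R S ∧ e h (f h, g h) = g h ∧
        deriv (fun s => e h (f h, s)) (g h) = 1) ∧
      ∀ v, A * fderiv ℂ f 0 v = -fderiv ℂ (fun h => e h (x₀, y₀)) 0 v := by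
  have hF := he.crit
  have h0 : (0 : W) ∈ ball (0 : W) r := mem_ball_self he.r_pos
  set D : W × (ℂ × ℂ) → ℂ :=
    fun q => fderiv ℂ (fun q : W × (ℂ × ℂ) => e q.1 q.2) q (0, (0, 1)) with hD
  have hDd : DifferentiableOn ℂ D (ball 0 r ×ˢ polydisc R S) :=
    differentiableOn_fderiv_apply he.isOpen he.diff _
  -- The critical point is a zero of `(E - s, ∂E/∂s - 1)`. At the base point the Jacobian in `(x,
  -- s)` is triangular with diagonal `A, B`, because the `s`-derivative of `E - s` vanishes. Hence
  -- it is invertible.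
  set m : W × (ℂ × ℂ) → ℂ × ℂ := fun q => (e q.1 q.2 - q.2.2, D q - 1) with hm
  have hmd : DifferentiableOn ℂ m (ball 0 r ×ˢ polydisc R S) :=
    (he.diff.sub (by fun_prop)).prodMk (hDd.sub_const 1)
  set u : W × (ℂ × ℂ) := (0, ((x₀ : ℂ), (y₀ : ℂ))) with hu
  have huU : u ∈ ball (0 : W) r ×ˢ polydisc R S := ⟨h0, hF.mem⟩
  have hcd : ContDiffAt ℂ 1 m u := contDiffAt_one_of_differentiableOn he.isOpen hmd huU
  have hmu : m u = 0 := by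
    simp only [hm, hD, hu]
    rw [he.deriv_right_eq h0 hF.mem, hF.deriv_right, hF.eq, sub_self, sub_self]; rfl
  have hd1 : DifferentiableAt ℂ (fun q : W × (ℂ × ℂ) => e q.1 q.2 - q.2.2) u :=
    (he.differentiableAt h0 hF.mem).sub (by fun_prop)
  have hd2 : DifferentiableAt ℂ (fun q => D q - 1) u :=
    (hDd.differentiableAt (he.isOpen.mem_nhds huU)).sub_const 1
  have hFd : DifferentiableAt ℂ (e 0) (x₀, y₀) :=
    hF.diff.differentiableAt ((isOpen_polydisc R S).mem_nhds hF.mem)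
  have hDp : DifferentiableAt ℂ (fun p : ℂ × ℂ => D (0, p)) (x₀, y₀) :=
    DifferentiableAt.comp (g := D) (f := fun p : ℂ × ℂ => ((0 : W), p)) _
      (hDd.differentiableAt (he.isOpen.mem_nhds huU)) (by fun_prop)
  have hm1 : ∀ v : ℂ × ℂ, (fderiv ℂ m u ∘L .inr ℂ W (ℂ × ℂ)) v =
      (A * v.1, deriv (fun x : ℂ => D (0, (x, (y₀ : ℂ)))) x₀ * v.1 + B * v.2) := by
    intro v
    have h1 : (fderiv ℂ m u ∘L .inr ℂ W (ℂ × ℂ)) v = fderiv ℂ m u (0, v) := rfl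
    rw [h1, hm, hd1.fderiv_prodMk hd2]
    refine Prod.ext ?_ ?_
    · change fderiv ℂ (fun q : W × (ℂ × ℂ) => e q.1 q.2 - q.2.2) u (0, v) = _
      rw [fderiv_inr_apply hd1, fderiv_prod_apply (f := fun p : ℂ × ℂ => e 0 p - p.2)
        (hFd.sub (by fun_prop))]
      have h2 : deriv (fun s : ℂ => e 0 (x₀, s) - s) y₀ = 0 := by
        rw [deriv_fun_sub ((he.adm 0 h0).differentiableAt_right (mem_polydisc.1 hF.mem).1
          (mem_polydisc.1 hF.mem).2) (by fun_prop), hF.deriv_right]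
        simp
      have h3 : deriv (fun x : ℂ => e 0 (x, y₀) - y₀) x₀ = A := by
        rw [deriv_sub_const_fun, hF.deriv_left]
      simp only [h2, h3]; ring
    · change fderiv ℂ (fun q => D q - 1) u (0, v) = _
      rw [fderiv_inr_apply hd2, fderiv_prod_apply (f := fun p : ℂ × ℂ => D (0, p) - 1)
        (hDp.sub_const 1)]
      simp only [deriv_sub_const_fun]
      congr 2
      rw [← hF.deriv_two, iteratedDeriv_succ, iteratedDeriv_one]
      refine EventuallyEq.deriv_eq ?_
      have hc : Continuous fun s : ℂ => ((x₀ : ℂ), s) := by fun_prop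
      filter_upwards [hc.continuousAt.preimage_mem_nhds ((isOpen_polydisc R S).mem_nhds hF.mem)]
        with s hs
      exact he.deriv_right_eq h0 hs
  have hA : (A : ℂ) ≠ 0 := by exact_mod_cast hF.A_pos.ne'
  have hB : (B : ℂ) ≠ 0 := by exact_mod_cast hF.B_pos.ne'
  have hinv : (fderiv ℂ m u ∘L .inr ℂ W (ℂ × ℂ)).IsInvertible := by
    set L := fderiv ℂ m u ∘L .inr ℂ W (ℂ × ℂ) with hL
    set d := deriv (fun x : ℂ => D (0, (x, (y₀ : ℂ)))) x₀ with hd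
    have hinj : LinearMap.ker (L : ℂ × ℂ →ₗ[ℂ] ℂ × ℂ) = ⊥ := by
      refine LinearMap.ker_eq_bot'.2 fun v hv => ?_
      have h1 : L v = 0 := hv
      rw [hm1] at h1
      have h2 : v.1 = 0 := (mul_eq_zero.1 (congrArg Prod.fst h1)).resolve_left hA
      have h3 := congrArg Prod.snd h1
      simp only [h2, mul_zero, zero_add, Prod.snd_zero] at h3
      exact Prod.ext h2 ((mul_eq_zero.1 h3).resolve_left hB)
    have hsurj : LinearMap.range (L : ℂ × ℂ →ₗ[ℂ] ℂ × ℂ) = ⊤ :=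
      LinearMap.range_eq_top.2 (LinearMap.injective_iff_surjective.1 (LinearMap.ker_eq_bot.1 hinj))
    exact ⟨ContinuousLinearEquiv.ofBijective L hinj hsurj, ContinuousLinearEquiv.coe_ofBijective ..⟩
  set φ := hcd.implicitFunction one_ne_zero hinv with hφ
  have hφ0 : φ 0 = ((x₀ : ℂ), (y₀ : ℂ)) := hcd.implicitFunction_apply_self one_ne_zero hinv
  have hφe : ∀ᶠ h in 𝓝 (0 : W), m (h, φ h) = 0 := by
    have := hcd.eventually_apply_implicitFunction one_ne_zero hinv
    rwa [hmu] at this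
  have hφc : ContDiffAt ℂ 1 φ 0 := hcd.contDiffAt_implicitFunction one_ne_zero hinv
  have hφd : ∀ᶠ h in 𝓝 (0 : W), DifferentiableAt ℂ φ h :=
    (hφc.eventually (by simp)).mono fun h hh => hh.differentiableAt (by norm_num)
  have hφU : ∀ᶠ h in 𝓝 (0 : W), φ h ∈ polydisc R S := by
    refine hφc.continuousAt.preimage_mem_nhds ((isOpen_polydisc R S).mem_nhds ?_)
    rw [hφ0]; exact hF.mem
  obtain ⟨ρ, hρ, hall⟩ := Metric.eventually_nhds_iff_ball.1
    (hφe.and (hφd.and (hφU.and (ball_mem_nhds (0 : W) he.r_pos))))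
  have hkey : ∀ h ∈ ball (0 : W) (min ρ r), e h (φ h) = (φ h).2 ∧ D (h, φ h) = 1 := by
    intro h hh
    have h1 := (hall h (ball_subset_ball (min_le_left _ _) hh)).1
    exact ⟨sub_eq_zero.1 (congrArg Prod.fst h1), sub_eq_zero.1 (congrArg Prod.snd h1)⟩
  refine ⟨fun h => (φ h).1, fun h => (φ h).2, min ρ r, lt_min hρ he.r_pos, min_le_right _ _,
    ?_, ?_, by simp [hφ0], by simp [hφ0], ?_, ?_⟩
  · exact fun h hh => ((hall h (ball_subset_ball (min_le_left _ _) hh)).2.1.fst).differentiableWithinAt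
  · exact fun h hh => ((hall h (ball_subset_ball (min_le_left _ _) hh)).2.1.snd).differentiableWithinAt
  · intro h hh
    obtain ⟨-, h2, h3, h4⟩ := hall h (ball_subset_ball (min_le_left _ _) hh)
    refine ⟨h3, (hkey h hh).1, ?_⟩
    exact (he.deriv_right_eq h4 h3).symm.trans (hkey h hh).2
  · intro v
    have hφd0 : DifferentiableAt ℂ φ 0 := hφc.differentiableAt (by norm_num)
    have hfst : fderiv ℂ (fun h => (φ h).1) 0 v = (fderiv ℂ φ 0 v).1 := by
      rw [hφd0.hasFDerivAt.fst.fderiv]; rfl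
    have hsnd : fderiv ℂ (fun h => (φ h).2) 0 v = (fderiv ℂ φ 0 v).2 := by
      rw [hφd0.hasFDerivAt.snd.fderiv]; rfl
    -- In the derivative of this identity the contributions of the `s`-component cancel, as `∂E/∂s =
    -- 1` at the critical point. What remains determines the derivative of the `x`-component.
    have h1 : (fun h => e h (φ h)) =ᶠ[𝓝 0] fun h => (φ h).2 := by
      filter_upwards [ball_mem_nhds (0 : W) (lt_min hρ he.r_pos)] with h hh using (hkey h hh).1
    have hd : DifferentiableAt ℂ (fun q : W × (ℂ × ℂ) => e q.1 q.2) (0, φ 0) := by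
      rw [hφ0]; exact he.differentiableAt h0 hF.mem
    have h2 : HasFDerivAt (fun h => e h (φ h))
        (fderiv ℂ (fun q : W × (ℂ × ℂ) => e q.1 q.2) (0, φ 0) ∘L
          (ContinuousLinearMap.id ℂ W).prod (fderiv ℂ φ 0)) 0 :=
      hd.hasFDerivAt.comp (f := fun h => (h, φ h)) (0 : W)
        ((hasFDerivAt_id (0 : W)).prodMk hφd0.hasFDerivAt)
    have h3 := h1.fderiv_eq (𝕜 := ℂ)
    rw [h2.fderiv] at h3
    have h4 := DFunLike.congr_fun h3 v
    simp only [hsnd] at h4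
    have h5 : (fderiv ℂ (fun q : W × (ℂ × ℂ) => e q.1 q.2) (0, φ 0) ∘L
          (ContinuousLinearMap.id ℂ W).prod (fderiv ℂ φ 0)) v
        = fderiv ℂ (fun q : W × (ℂ × ℂ) => e q.1 q.2) (0, φ 0) (v, 0) +
          fderiv ℂ (fun q : W × (ℂ × ℂ) => e q.1 q.2) (0, φ 0) (0, fderiv ℂ φ 0 v) := by
      rw [← map_add]; simp
    rw [h5, fderiv_inl_apply hd, fderiv_inr_apply hd, hφ0, fderiv_prod_apply hFd, hF.deriv_left,
      hF.deriv_right] at h4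
    rw [hfst]
    linear_combination h4

end HolomorphicFamily

end

/-! ### Rescaling to a fixed critical point, and quasi-powers -/

section

theorem inv_factorial_mul_iteratedDeriv_of_hasSum {f : ℂ → ℂ} {a : ℕ → ℂ}
    (h : ∀ᶠ x in 𝓝 0, HasSum (fun n => a n * x ^ n) (f x)) (n : ℕ) :
    (n.factorial : ℂ)⁻¹ * iteratedDeriv n f 0 = a n := by
  have h1 : HasFPowerSeriesAt f (FormalMultilinearSeries.ofScalars ℂ a) 0 := by
    rw [hasFPowerSeriesAt_iff]
    filter_upwards [h] with x hx
    simpa [FormalMultilinearSeries.coeff_ofScalars, mul_comm] using hx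
  have h2 := h1.eq_formalMultilinearSeries h1.analyticAt.hasFPowerSeriesAt
  have h3 := congrArg (fun p => FormalMultilinearSeries.coeff p n) h2
  simp only [FormalMultilinearSeries.coeff_ofScalars] at h3
  rw [h3, div_eq_inv_mul]

/-- The function `E` in the variables `x / f` and `s / g`, where `f` and `g` are given in multiples
of `x₀` and `y₀`. -/
def rescale (f g : ℂ) (E : ℂ × ℂ → ℂ) : ℂ × ℂ → ℂ := fun p => g⁻¹ * E (f * p.1, g * p.2)

theorem Admissible.rescale {R S M R' S' : ℝ} {E : ℂ × ℂ → ℂ} (hE : Admissible R S M E) {f g : ℂ}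
    (hf : ‖f‖ * R' ≤ R) (hf0 : f ≠ 0) (hg : ‖g‖ * S' ≤ S) (hg0 : g ≠ 0) :
    Admissible R' S' (‖g⁻¹‖ * M) (rescale f g E) := by
  have hmem : ∀ p ∈ polydisc R' S', (f * p.1, g * p.2) ∈ polydisc R S := by
    rintro ⟨x, s⟩ hp
    rw [mem_polydisc] at hp ⊢
    simp only [norm_mul]
    exact ⟨(mul_lt_mul_of_pos_left hp.1 (norm_pos_iff.2 hf0)).trans_le hf,
      (mul_lt_mul_of_pos_left hp.2 (norm_pos_iff.2 hg0)).trans_le hg⟩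
  refine ⟨?_, fun p hp => ?_, fun s hs => ?_⟩
  · exact (hE.diff.comp (f := fun p : ℂ × ℂ => (f * p.1, g * p.2)) (by fun_prop) hmem).const_mul _
  · rw [InfiniteSystem.rescale, norm_mul]
    exact mul_le_mul_of_nonneg_left (hE.bound _ (hmem p hp)) (norm_nonneg _)
  · simp only [InfiniteSystem.rescale, mul_zero]
    rw [hE.zero, mul_zero]
    rw [norm_mul]
    exact (mul_lt_mul_of_pos_left hs (norm_pos_iff.2 hg0)).trans_le hg

/-- If `s(x)` solves the original equation, then `g⁻¹ s(f x)` solves the rescaled one, and small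
solutions are unique. -/
theorem solCoeff_rescale {R S M R' S' M' y₀ r r' : ℝ} {E : ℂ × ℂ → ℂ} (hE : Admissible R S M E)
    (hr : SmallRadius R S M y₀ r) {f g : ℂ} (hE' : Admissible R' S' M' (rescale f g E))
    (hr' : SmallRadius R' S' M' y₀ r') (hg0 : g ≠ 0) (n : ℕ) :
    solCoeff (rescale f g E) n = g⁻¹ * (f ^ n * solCoeff E n) := by
  have hS' := hr'.y₀_pos.trans hr'.y₀_lt
  have hc : ContinuousAt (solAt E) (f * 0) := by
    rw [mul_zero]
    exact ((hE.differentiableOn_solAt hr).continuousOn).continuousAt (ball_mem_nhds _ hr.r_pos)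
  have h0 : solAt E 0 = 0 := by
    have h0 : ‖(0 : ℂ)‖ < r := by simpa using hr.r_pos
    have hS := hr.y₀_pos.trans hr.y₀_lt
    exact (hE.eq_solAt hr h0 (s := 0) (by simpa) (hE.zero 0 (by simpa))).symm
  have h1 : ∀ᶠ x : ℂ in 𝓝 0, ‖f * x‖ < r := by
    have : Continuous fun x : ℂ => ‖f * x‖ := by fun_prop
    exact this.continuousAt.eventually_lt continuousAt_const (by simpa using hr.r_pos)
  have h2 : ∀ᶠ x : ℂ in 𝓝 0, ‖g⁻¹ * solAt E (f * x)‖ < S' := by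
    have : ContinuousAt (fun x : ℂ => ‖g⁻¹ * solAt E (f * x)‖) 0 :=
      (continuousAt_const.mul (ContinuousAt.comp (f := fun x : ℂ => f * x) hc (by fun_prop))).norm
    exact this.eventually_lt continuousAt_const (by simpa [h0] using hS')
  rw [hE'.solCoeff_eq hr' (f := fun x => g⁻¹ * solAt E (f * x)) ?_]
  · refine inv_factorial_mul_iteratedDeriv_of_hasSum
      (a := fun n => g⁻¹ * (f ^ n * solCoeff E n)) ?_ n
    filter_upwards [h1] with x hx
    refine ((hE.hasSum_solCoeff hr hx).mul_left g⁻¹).congr_fun fun n => ?_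
    rw [mul_pow]; ring
  · filter_upwards [h1, h2] with x hx1 hx2
    refine ⟨hx2, ?_⟩
    simp only [rescale]
    rw [← mul_assoc g, mul_inv_cancel₀ hg0, one_mul, (hE.solAt_spec hr hx1).2.1]

/-- The coefficients `c n h` are `c n 0 * exp (n * b h + O(1))` with a holomorphic error term. -/
def QuasiPowers {W : Type*} [NormedAddCommGroup W] [NormedSpace ℂ W] (b : W → ℂ)
    (c : ℕ → W → ℂ) : Prop :=
  ∃ r > 0, ∃ N : ℕ, ∃ C : ℝ, ∃ Λ : ℕ → W → ℂ, ∀ n ≥ N, c n 0 ≠ 0 ∧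
    DifferentiableOn ℂ (Λ n) (ball 0 r) ∧ Λ n 0 = 0 ∧
    ∀ h ∈ ball (0 : W) r, ‖Λ n h‖ ≤ C ∧ c n h = c n 0 * Complex.exp (n * b h + Λ n h)

variable {W : Type*} [NormedAddCommGroup W] [NormedSpace ℂ W]

/-- A joint limit in `(h, n)` confines the normalized coefficients to a small neighbourhood of `κ ≠
0`, for all `h` in one ball and all large `n`. Their quotient by the value at `h = 0` then has a
holomorphic logarithm, bounded independently of `n`. -/
theorem quasiPowers_of_tendsto {f : W → ℂ} {c : ℕ → W → ℂ} {ω : ℕ → ℂ} {κ : ℂ} {ρ : ℝ}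
    (hρ : 0 < ρ) (hf : DifferentiableOn ℂ f (ball 0 ρ)) (hf0 : f 0 ≠ 0)
    (hc : ∀ n, DifferentiableOn ℂ (c n) (ball 0 ρ)) (hκ : κ ≠ 0)
    (hlim : Tendsto (fun p : W × ℕ => ω p.2 * (f p.1 ^ p.2 * c p.2 p.1)) (𝓝 0 ×ˢ atTop) (𝓝 κ)) :
    QuasiPowers (fun h => -Complex.log (f h / f 0)) c := by
  -- With `1 / 8` the quotients `T n h / T n 0` differ from `1` by at most `(1/8 + 1/8) / (7/8) ≤
  -- 1/2`, which keeps them in the slit plane.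
  have h1 : ∀ᶠ z in 𝓝 κ, ‖z / κ - 1‖ < 1 / 8 ∧ z ≠ 0 := by
    refine (ContinuousAt.eventually_lt (f := fun z : ℂ => ‖z / κ - 1‖) (by fun_prop)
      continuousAt_const ?_).and (isOpen_ne.mem_nhds hκ)
    simp [div_self hκ]
  have h2 := hlim.eventually h1
  obtain ⟨P, hP, Q, hQ, hPQ⟩ := eventually_prod_iff.1 h2
  obtain ⟨N, hN⟩ := eventually_atTop.1 hQ
  have hfc : ContinuousAt f 0 := hf.continuousOn.continuousAt (ball_mem_nhds _ hρ)
  have h3 : ∀ᶠ h in 𝓝 (0 : W), f h ≠ 0 := hfc.eventually_ne hf0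
  obtain ⟨r, hr, hball⟩ := Metric.eventually_nhds_iff_ball.1
    (hP.and (h3.and (ball_mem_nhds (0 : W) hρ)))
  set T : ℕ → W → ℂ := fun n h => ω n * (f h ^ n * c n h) with hT
  have hTn : ∀ n ≥ N, ∀ h ∈ ball (0 : W) r, ‖T n h / κ - 1‖ < 1 / 8 ∧ T n h ≠ 0 :=
    fun n hn h hh => hPQ (hball h hh).1 (hN n hn)
  have hratio : ∀ n ≥ N, ∀ h ∈ ball (0 : W) r, ‖T n h / T n 0 - 1‖ ≤ 1 / 2 := by
    intro n hn h hh
    obtain ⟨h4, h5⟩ := hTn n hn h hh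
    obtain ⟨h6, h7⟩ := hTn n hn 0 (mem_ball_self hr)
    have h8 : T n h / T n 0 - 1 = ((T n h / κ - 1) - (T n 0 / κ - 1)) / (T n 0 / κ) := by
      field_simp; ring
    have h9 : 7 / 8 ≤ ‖T n 0 / κ‖ := by
      have := norm_sub_norm_le (1 : ℂ) (1 - T n 0 / κ)
      rw [norm_sub_rev 1, norm_one, sub_sub_cancel] at this
      linarith
    rw [h8, norm_div, div_le_iff₀ (by linarith)]
    refine (norm_sub_le _ _).trans ?_
    linarith
  refine ⟨r, hr, N, Real.log 2 + 1, fun n h => Complex.log (T n h / T n 0), fun n hn => ?_⟩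
  have hT0 := (hTn n hn 0 (mem_ball_self hr)).2
  have hslit : ∀ h ∈ ball (0 : W) r, T n h / T n 0 ∈ Complex.slitPlane := fun h hh => by
    have := Complex.mem_slitPlane_of_norm_lt_one ((hratio n hn h hh).trans_lt (by norm_num))
    rwa [add_sub_cancel] at this
  refine ⟨fun h0 => hT0 (by simp [hT, h0]), ?_, by simp [div_self hT0], fun h hh => ⟨?_, ?_⟩⟩
  · intro h hh
    have hhρ := isOpen_ball.mem_nhds (hball h hh).2.2
    have hd : DifferentiableAt ℂ (T n) h :=
      (((hf.differentiableAt hhρ).pow n).mul ((hc n).differentiableAt hhρ)).const_mul _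
    have hd' : DifferentiableAt ℂ (fun h => T n h / T n 0) h := by
      simp only [div_eq_mul_inv]; exact hd.mul_const _
    exact (hd'.clog (hslit h hh)).differentiableWithinAt
  · have h4 := Complex.norm_log_one_add_half_le_self (hratio n hn h hh)
    rw [add_sub_cancel] at h4
    have := Real.log_pos (one_lt_two)
    linarith [hratio n hn h hh]
  · have h5 : f h ≠ 0 := (hball h hh).2.1
    rw [Complex.exp_add, mul_neg, Complex.exp_neg, Complex.exp_nat_mul,
      Complex.exp_log (div_ne_zero h5 hf0),
      Complex.exp_log (div_ne_zero (hTn n hn h hh).2 hT0)]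
    have h6 : c n 0 ≠ 0 := fun h0 => hT0 (by simp [hT, h0])
    have h7 : ω n ≠ 0 := fun h0 => hT0 (by simp [hT, h0])
    simp only [hT]
    rw [div_pow]
    field_simp

theorem CriticalPoint.mono {R S x₀ y₀ A B R' S' : ℝ} {F : ℂ × ℂ → ℂ}
    (hF : CriticalPoint R S x₀ y₀ A B F) (hR : x₀ < R') (hR' : R' ≤ R) (hS : y₀ < S')
    (hS' : S' ≤ S) : CriticalPoint R' S' x₀ y₀ A B F :=
  { hF with
    x₀_lt := hR
    y₀_lt := hS
    diff := hF.diff.mono (prod_mono (ball_subset_ball hR') (ball_subset_ball hS')) }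

namespace HolomorphicFamily

variable {r R S M x₀ y₀ A B : ℝ} {e : W → ℂ × ℂ → ℂ}

theorem M_nonneg (he : HolomorphicFamily r R S M x₀ y₀ A B e) : 0 ≤ M :=
  (norm_nonneg _).trans ((he.adm 0 (mem_ball_self he.r_pos)).bound _ he.crit.mem)

/-- The rescaled functions form a family with a fixed critical point. -/
theorem normalizedFamily (he : HolomorphicFamily r R S M x₀ y₀ A B e) {f g : W → ℂ} {ρ R' S' : ℝ}
    (hρ : 0 < ρ) (hρr : ρ ≤ r) (hf : ContinuousAt f 0) (hg : ContinuousAt g 0) (hf0 : f 0 = x₀)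
    (hg0 : g 0 = y₀)
    (hcrit : ∀ h ∈ ball (0 : W) ρ, (f h, g h) ∈ polydisc R S ∧ e h (f h, g h) = g h ∧
        deriv (fun s => e h (f h, s)) (g h) = 1)
    (hR : x₀ < R') (hR' : R' < R) (hS : y₀ < S') (hS' : S' < S) :
    NormalizedFamily (𝓝 0) R' S' (2 * M) x₀ y₀ (e 0)
      (fun h => rescale (f h / x₀) (g h / y₀) (e h)) := by
  have hx₀ := he.crit.x₀_pos
  have hy₀ := he.crit.y₀_pos
  have hM := he.M_nonneg
  have hx₀' : (x₀ : ℂ) ≠ 0 := by exact_mod_cast hx₀.ne'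
  have hy₀' : (y₀ : ℂ) ≠ 0 := by exact_mod_cast hy₀.ne'
  have hR'0 : 0 < R' := hx₀.trans hR
  have hS'0 : 0 < S' := hy₀.trans hS
  have hfl : Tendsto (fun h => f h / x₀) (𝓝 0) (𝓝 1) := by
    have := hf.tendsto.div_const (x₀ : ℂ)
    rwa [hf0, div_self hx₀'] at this
  have hgl : Tendsto (fun h => g h / y₀) (𝓝 0) (𝓝 1) := by
    have := hg.tendsto.div_const (y₀ : ℂ)
    rwa [hg0, div_self hy₀'] at this
  have hgi : Tendsto (fun h => (g h / y₀)⁻¹) (𝓝 0) (𝓝 1) := by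
    have := hgl.inv₀ one_ne_zero
    rwa [inv_one] at this
  have hfR : ∀ᶠ h in 𝓝 0, ‖f h / x₀‖ * R' ≤ R := by
    have := hfl.norm.mul_const R'
    rw [norm_one, one_mul] at this
    exact this.eventually_le_const hR'
  have hgS : ∀ᶠ h in 𝓝 0, ‖g h / y₀‖ * S' ≤ S := by
    have := hgl.norm.mul_const S'
    rw [norm_one, one_mul] at this
    exact this.eventually_le_const hS'
  have hf1 : ∀ᶠ h in 𝓝 0, f h / x₀ ≠ 0 := hfl.eventually_ne one_ne_zero
  have hg1 : ∀ᶠ h in 𝓝 0, g h / y₀ ≠ 0 := hgl.eventually_ne one_ne_zero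
  have hg2 : ∀ᶠ h in 𝓝 0, ‖(g h / y₀)⁻¹‖ ≤ 2 := by
    have := hgi.norm
    rw [norm_one] at this
    exact this.eventually_le_const one_lt_two
  have hball := ball_mem_nhds (0 : W) he.r_pos
  have hballρ := ball_mem_nhds (0 : W) hρ
  have hmem : ∀ {f g : ℂ}, ‖f‖ * R' ≤ R → f ≠ 0 → ‖g‖ * S' ≤ S → g ≠ 0 →
      ∀ p ∈ polydisc R' S', (f * p.1, g * p.2) ∈ polydisc R S := by
    rintro f g h1 h2 h3 h4 ⟨x, s⟩ hp
    rw [mem_polydisc] at hp ⊢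
    simp only [norm_mul]
    exact ⟨(mul_lt_mul_of_pos_left hp.1 (norm_pos_iff.2 h2)).trans_le h1,
      (mul_lt_mul_of_pos_left hp.2 (norm_pos_iff.2 h4)).trans_le h3⟩
  refine ⟨?_, ?_, ?_, ?_⟩
  · filter_upwards [hfR, hgS, hf1, hg1, hg2, hball] with h h1 h2 h3 h4 h5 h6
    have h7 := (he.adm h h6).rescale h1 h3 h2 h4
    exact ⟨h7.diff, fun p hp => (h7.bound p hp).trans (by gcongr), h7.zero⟩
  · intro η hη
    set δ := min (R - R') (S - S') with hδ
    have hδ0 : 0 < δ := lt_min (sub_pos.2 hR') (sub_pos.2 hS')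
    have hlim : Tendsto (fun h : W => ‖(g h / y₀)⁻¹ - 1‖ * M + 2 * M / r * ‖h‖
        + 2 * M / δ * (‖f h / x₀ - 1‖ * R' + ‖g h / y₀ - 1‖ * S')) (𝓝 0) (𝓝 0) := by
      have h1 := (tendsto_sub_nhds_zero_iff.2 hgi).norm.mul_const M
      have h2 : Tendsto (fun h : W => 2 * M / r * ‖h‖) (𝓝 0) (𝓝 0) :=
        Continuous.tendsto' (by fun_prop) _ _ (by simp)
      have h3 := ((tendsto_sub_nhds_zero_iff.2 hfl).norm.mul_const R').add
        ((tendsto_sub_nhds_zero_iff.2 hgl).norm.mul_const S')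
      have h4 := (h1.add h2).add (h3.const_mul (2 * M / δ))
      simpa using h4
    filter_upwards [hfR, hgS, hf1, hg1, hball, hlim.eventually_le_const hη]
      with h h1 h2 h3 h4 h6 h7 p hp
    refine le_trans ?_ h7
    set q : ℂ × ℂ := (f h / x₀ * p.1, g h / y₀ * p.2) with hq
    have hqU : q ∈ polydisc R S := hmem h1 h3 h2 h4 p hp
    have hp' := mem_polydisc.1 (show (p.1, p.2) ∈ polydisc R' S' from hp)
    have hbp : ball p δ ⊆ polydisc R S := by
      rintro ⟨x, s⟩ hz
      rw [mem_ball, dist_eq_norm, Prod.norm_def, max_lt_iff] at hz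
      have h8 := norm_sub_norm_le x p.1
      have h9 := norm_sub_norm_le s p.2
      have h10 := hz.1.trans_le (min_le_left _ _)
      have h11 := hz.2.trans_le (min_le_right _ _)
      simp only [Prod.fst_sub, Prod.snd_sub] at h10 h11
      exact mem_polydisc.2 ⟨by linarith [hp'.1], by linarith [hp'.2]⟩
    have hE0 := he.adm 0 (mem_ball_self he.r_pos)
    have h8 := norm_sub_le_of_bounded (f := e 0) (w := p) (z := q) (M := M) hδ0
      (hE0.diff.mono hbp) (fun z hz => hE0.bound z (hbp hz)) (hE0.bound q hqU)
    have h9 : ‖q - p‖ ≤ ‖f h / x₀ - 1‖ * R' + ‖g h / y₀ - 1‖ * S' := by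
      rw [Prod.norm_def]
      have h10 : (q - p).1 = (f h / x₀ - 1) * p.1 := by simp [hq]; ring
      have h11 : (q - p).2 = (g h / y₀ - 1) * p.2 := by simp [hq]; ring
      rw [h10, h11, norm_mul, norm_mul]
      refine max_le ?_ ?_
      · calc _ ≤ ‖f h / x₀ - 1‖ * R' := by gcongr; exact hp'.1.le
          _ ≤ _ := le_add_of_nonneg_right (by positivity)
      · calc _ ≤ ‖g h / y₀ - 1‖ * S' := by gcongr; exact hp'.2.le
          _ ≤ _ := le_add_of_nonneg_left (by positivity)
    -- Three sources of error: the prefactor, the parameter `h`, and the displacement of the point.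
    have h10 : rescale (f h / x₀) (g h / y₀) (e h) p - e 0 p
        = ((g h / y₀)⁻¹ - 1) * e h q + (e h q - e 0 q) + (e 0 q - e 0 p) := by
      simp only [rescale, hq]; ring
    rw [h10]
    refine (norm_add₃_le).trans (add_le_add_three ?_ (he.norm_sub_le h6 hqU) ?_)
    · rw [norm_mul]
      exact mul_le_mul_of_nonneg_left ((he.adm h h6).bound q hqU) (norm_nonneg _)
    · exact h8.trans (mul_le_mul_of_nonneg_left h9 (by positivity))
  · filter_upwards [hg1, hballρ] with h h1 h2
    simp only [rescale]
    rw [div_mul_cancel₀ _ hx₀', div_mul_cancel₀ _ hy₀', (hcrit h h2).2.1]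
    have : g h ≠ 0 := fun h0 => h1 (by rw [h0, zero_div])
    field_simp
  · filter_upwards [hg1, hballρ] with h h1 h2
    obtain ⟨h3, h4, h5⟩ := hcrit h h2
    have h3' := mem_polydisc.1 h3
    simp only [rescale]
    rw [div_mul_cancel₀ _ hx₀']
    have h6 : HasDerivAt (fun s => e h (f h, s)) 1 (g h / y₀ * y₀) := by
      rw [div_mul_cancel₀ _ hy₀', ← h5]
      exact ((he.adm h (ball_subset_ball hρr h2)).differentiableAt_right h3'.1 h3'.2).hasDerivAt
    have h7 : HasDerivAt (fun s : ℂ => g h / y₀ * s) (g h / y₀ * 1) y₀ :=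
      (hasDerivAt_id _).const_mul _
    -- The inner and outer scaling factors cancel, so the `s`-derivative `1` is preserved.
    have h8 := (HasDerivAt.comp (h₂ := fun s => e h (f h, s)) (y₀ : ℂ) h6 h7).const_mul (g h / y₀)⁻¹
    refine (h8.congr_deriv ?_).deriv
    rw [one_mul, mul_one, inv_mul_cancel₀ h1]

/-- The singularity and the asymptotic behaviour of the coefficients of the solution of
`s = e h (x, s)`. -/
theorem exists_tendsto_solCoeff [CompleteSpace W] (he : HolomorphicFamily r R S M x₀ y₀ A B e) :
    ∃ f : W → ℂ, ∃ ρ > 0, ρ ≤ r ∧ DifferentiableOn ℂ f (ball 0 ρ) ∧ f 0 = x₀ ∧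
      (∀ v, A * fderiv ℂ f 0 v = -fderiv ℂ (fun h => e h (x₀, y₀)) 0 v) ∧
      ∃ κ : ℝ, 0 < κ ∧ Tendsto (fun p : W × ℕ => (Real.sqrt p.2 * p.2 : ℂ)
        * (f p.1 ^ p.2 * solCoeff (e p.1) p.2)) (𝓝 0 ×ˢ atTop) (𝓝 κ) := by
  obtain ⟨f, g, ρ, hρ, hρr, hf, hg, hf0, hg0, hcrit, hder⟩ := he.exists_criticalPoint
  refine ⟨f, ρ, hρ, hρr, hf, hf0, hder, ?_⟩
  have hx₀ := he.crit.x₀_pos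
  have hy₀ := he.crit.y₀_pos
  have hA := he.crit.A_pos
  have hB := he.crit.B_pos
  have hx₀' : (x₀ : ℂ) ≠ 0 := by exact_mod_cast hx₀.ne'
  have hy₀' : (y₀ : ℂ) ≠ 0 := by exact_mod_cast hy₀.ne'
  have hfc : ContinuousAt f 0 := hf.continuousOn.continuousAt (ball_mem_nhds _ hρ)
  have hgc : ContinuousAt g 0 := hg.continuousOn.continuousAt (ball_mem_nhds _ hρ)
  obtain ⟨R', hR, hR'⟩ := exists_between he.crit.x₀_lt
  obtain ⟨S', hS, hS'⟩ := exists_between he.crit.y₀_lt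
  have hN := he.normalizedFamily hρ hρr hfc hgc hf0 hg0 hcrit hR hR' hS hS'
  have hlim := hN.tendsto_solCoeff (he.crit.mono hR hR'.le hS hS'.le)
  obtain ⟨r₁, hr₁⟩ := exists_smallRadius (M := M) (hx₀.trans he.crit.x₀_lt) hy₀ he.crit.y₀_lt
  obtain ⟨r₂, hr₂⟩ := exists_smallRadius (M := 2 * M) (hx₀.trans hR) hy₀ hS
  have hgl : Tendsto (fun h => g h / y₀) (𝓝 0) (𝓝 1) := by
    have := hgc.tendsto.div_const (y₀ : ℂ)
    rwa [hg0, div_self hy₀'] at this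
  set κ : ℝ := (2 * Real.pi)⁻¹ * y₀ * Real.sqrt (Real.pi / (B * y₀ ^ 2 / (2 * A * x₀))) with hκ
  refine ⟨κ, by positivity, ?_⟩
  have hlim2 := (hgl.comp (tendsto_fst (f := 𝓝 (0 : W)) (g := (atTop : Filter ℕ)))).mul hlim
  have h1 : (1 : ℂ) * ((2 * Real.pi : ℂ)⁻¹ * y₀ *
      Real.sqrt (Real.pi / (B * y₀ ^ 2 / (2 * A * x₀)))) = κ := by
    rw [hκ, one_mul]; push_cast; ring
  rw [h1] at hlim2
  refine hlim2.congr' ?_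
  filter_upwards [tendsto_fst.eventually hN.adm, tendsto_fst.eventually
    (hgl.eventually_ne one_ne_zero), tendsto_fst.eventually (ball_mem_nhds (0 : W) he.r_pos)]
    with p h2 h3 h4
  simp only [Function.comp_apply]
  rw [solCoeff_rescale (he.adm p.1 h4) hr₁ h2 hr₂ h3, div_pow]
  have h5 : (x₀ : ℂ) ^ p.2 ≠ 0 := pow_ne_zero _ hx₀'
  generalize g p.1 / y₀ = z at h3
  field_simp

end HolomorphicFamily

end

/-! ### Coefficients of the exponential: convolution recursions -/

/-- The weight `n ^ (3 / 2)`. -/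
def sqrtWeight (n : ℕ) : ℝ := Real.sqrt n * n

theorem sqrtWeight_zero : sqrtWeight 0 = 0 := by simp [sqrtWeight]

theorem sqrtWeight_pos {n : ℕ} (hn : 1 ≤ n) : 0 < sqrtWeight n := by
  have : (0 : ℝ) < n := by exact_mod_cast hn
  exact mul_pos (Real.sqrt_pos.2 this) this

theorem sqrtWeight_nonneg (n : ℕ) : 0 ≤ sqrtWeight n := by unfold sqrtWeight; positivity

/-- The constant `3` bounds `2^{3/2}`. In a convolution one of the two indices is always at least `n
/ 2`, and this compares its weight with that of `n`. -/
theorem sqrtWeight_le {n k : ℕ} (h : n ≤ 2 * k) : sqrtWeight n ≤ 3 * sqrtWeight k := by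
  have h1 : (n : ℝ) ≤ 2 * k := by exact_mod_cast h
  have h2 : Real.sqrt n ≤ 3 / 2 * Real.sqrt k := by
    rw [Real.sqrt_le_left (by positivity), mul_pow, Real.sq_sqrt (by positivity)]
    have : (0 : ℝ) ≤ k := by positivity
    linarith
  calc Real.sqrt n * n ≤ (3 / 2 * Real.sqrt k) * (2 * k) := by gcongr
    _ = _ := by unfold sqrtWeight; ring

theorem summable_inv_sqrtWeight : Summable fun n => (sqrtWeight n)⁻¹ := by
  have h := (Real.summable_nat_rpow_inv (p := 3 / 2)).2 (by norm_num)
  refine h.congr fun n => ?_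
  rcases Nat.eq_zero_or_pos n with rfl | hn
  · simp [sqrtWeight]
  · have : (0 : ℝ) < n := by exact_mod_cast hn
    rw [sqrtWeight, Real.sqrt_eq_rpow]
    nth_rewrite 3 [← Real.rpow_one (n : ℝ)]
    rw [← Real.rpow_add this]; norm_num

theorem sqrtWeight_le_cube (n : ℕ) : n * sqrtWeight n ≤ (n : ℝ) ^ 3 := by
  rcases Nat.eq_zero_or_pos n with rfl | hn
  · simp [sqrtWeight]
  · have h1 : (1 : ℝ) ≤ n := by exact_mod_cast hn
    have h2 : Real.sqrt n ≤ n := by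
      rw [Real.sqrt_le_left (by positivity)]; nlinarith
    calc (n : ℝ) * (Real.sqrt n * n) ≤ n * (n * n) := by gcongr
      _ = _ := by ring

section Convolution

variable {u v : ℕ → ℝ} {K : ℝ}

theorem le_div_sqrtWeight (hu0 : u 0 = 0) (hK : ∀ n, 1 ≤ n → sqrtWeight n * u n ≤ K) (n : ℕ) :
    u n ≤ K * (sqrtWeight n)⁻¹ := by
  rcases Nat.eq_zero_or_pos n with rfl | hn
  · simp [hu0, sqrtWeight_zero]
  · rw [← div_eq_mul_inv, le_div_iff₀' (sqrtWeight_pos hn)]; exact hK n hn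

theorem sum_le_of_sqrtWeight (hu : ∀ n, 0 ≤ u n) (hu0 : u 0 = 0)
    (hK : ∀ n, 1 ≤ n → sqrtWeight n * u n ≤ K) (s : Finset ℕ) :
    ∑ n ∈ s, u n ≤ K * ∑' n, (sqrtWeight n)⁻¹ := by
  have hK0 : 0 ≤ K := (mul_nonneg (sqrtWeight_nonneg 1) (hu 1)).trans (hK 1 le_rfl)
  calc ∑ n ∈ s, u n ≤ ∑ n ∈ s, K * (sqrtWeight n)⁻¹ :=
        Finset.sum_le_sum fun n _ => le_div_sqrtWeight hu0 hK n
    _ = K * ∑ n ∈ s, (sqrtWeight n)⁻¹ := by rw [Finset.mul_sum]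
    _ ≤ _ := mul_le_mul_of_nonneg_left (summable_inv_sqrtWeight.sum_le_tsum _ fun n _ =>
        inv_nonneg.2 (sqrtWeight_nonneg n)) hK0

theorem le_pow_of_convolution {U : ℝ} (hU : 1 ≤ U) (hu : ∀ n, 0 ≤ u n) (hu0 : u 0 = 0)
    (hv0 : v 0 ≤ 1) (hUs : ∀ s : Finset ℕ, ∑ n ∈ s, u n ≤ U) (hv : ∀ n, 0 ≤ v n)
    (huv : ∀ n, n * v n ≤ ∑ k ∈ Finset.range (n + 1), u k * v (n - k)) (n : ℕ) : v n ≤ U ^ n := by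
  induction n using Nat.strong_induction_on with
  | _ n ih =>
    rcases Nat.eq_zero_or_pos n with rfl | hn
    · simpa using hv0
    · have h1 : (1 : ℝ) ≤ n := by exact_mod_cast hn
      calc v n ≤ n * v n := le_mul_of_one_le_left (hv n) h1
        _ ≤ _ := huv n
        _ ≤ ∑ k ∈ Finset.range (n + 1), u k * U ^ (n - 1) := by
            refine Finset.sum_le_sum fun k _ => ?_
            rcases Nat.eq_zero_or_pos k with rfl | hk
            · simp [hu0]
            · refine mul_le_mul_of_nonneg_left ((ih (n - k) (by omega)).trans ?_) (hu k)
              exact pow_le_pow_right₀ hU (by omega)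
        _ = (∑ k ∈ Finset.range (n + 1), u k) * U ^ (n - 1) := by rw [Finset.sum_mul]
        _ ≤ U * U ^ (n - 1) := by
            gcongr; exact hUs _
        _ = U ^ n := by rw [← pow_succ']; congr 1; omega

/-- Let `A` be a partial sum of `v`. Summing the recursion gives `∑ n v n ≤ U A`. Terms with `n ≥ 2
U` satisfy `v n ≤ n v n / (2 U)` and contribute at most `A / 2`, which is absorbed. The remaining
terms are bounded by `le_pow_of_convolution`. -/
theorem sum_le_of_convolution {U : ℝ} (hU : 1 ≤ U) (hu : ∀ n, 0 ≤ u n) (hu0 : u 0 = 0)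
    (hv0 : v 0 ≤ 1) (hUs : ∀ s : Finset ℕ, ∑ n ∈ s, u n ≤ U) (hv : ∀ n, 0 ≤ v n)
    (huv : ∀ n, n * v n ≤ ∑ k ∈ Finset.range (n + 1), u k * v (n - k)) (s : Finset ℕ) :
    ∑ n ∈ s, v n ≤ 2 * ((⌈2 * U⌉₊ + 1) * U ^ ⌈2 * U⌉₊) := by
  have hU0 : 0 < U := one_pos.trans_le hU
  set m := ⌈2 * U⌉₊ with hm
  obtain ⟨N, hN⟩ : ∃ N, s ⊆ Finset.range (N + 1) :=
    ⟨s.sup id, fun n hn => Finset.mem_range.2 (Nat.lt_succ_of_le (Finset.le_sup (f := id) hn))⟩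
  refine (Finset.sum_le_sum_of_subset_of_nonneg hN fun n _ _ => hv n).trans ?_
  set A := ∑ n ∈ Finset.range (N + 1), v n with hA
  have hA0 : 0 ≤ A := Finset.sum_nonneg fun n _ => hv n
  have h1 : ∑ n ∈ Finset.range (N + 1), n * v n ≤ U * A := by
    calc _ ≤ ∑ n ∈ Finset.range (N + 1), ∑ k ∈ Finset.range (n + 1), u k * v (n - k) :=
          Finset.sum_le_sum fun n _ => huv n
      _ = ∑ k ∈ Finset.range (N + 1), ∑ j ∈ Finset.range (N + 1 - k), u k * v j := by
          rw [Finset.sum_sigma', Finset.sum_sigma']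
          refine Finset.sum_bij' (fun p _ => ⟨p.2, p.1 - p.2⟩) (fun p _ => ⟨p.1 + p.2, p.1⟩)
            ?_ ?_ ?_ ?_ ?_
          · rintro ⟨n, k⟩ h; simp only [Finset.mem_sigma, Finset.mem_range] at h ⊢; omega
          · rintro ⟨n, k⟩ h; simp only [Finset.mem_sigma, Finset.mem_range] at h ⊢; omega
          · rintro ⟨n, k⟩ h
            simp only [Finset.mem_sigma, Finset.mem_range] at h
            simp only [Sigma.mk.injEq, heq_eq_eq, and_true]; omega
          · rintro ⟨n, k⟩ h
            simp only [Sigma.mk.injEq, heq_eq_eq, true_and]; omega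
          · rintro ⟨n, k⟩ h; rfl
      _ ≤ ∑ k ∈ Finset.range (N + 1), u k * A := by
          refine Finset.sum_le_sum fun k _ => ?_
          rw [← Finset.mul_sum]
          refine mul_le_mul_of_nonneg_left (Finset.sum_le_sum_of_subset_of_nonneg
            (Finset.range_subset_range.2 (by omega)) fun n _ _ => hv n) (hu k)
      _ ≤ U * A := by
          rw [← Finset.sum_mul]; exact mul_le_mul_of_nonneg_right (hUs _) hA0
  have h2 : ∀ n, v n ≤ (if n ≤ m then U ^ m else 0) + n * v n / (2 * U) := by
    intro n
    split_ifs with h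
    · have h3 := le_pow_of_convolution hU hu hu0 hv0 hUs hv huv n
      have h4 : U ^ n ≤ U ^ m := pow_le_pow_right₀ hU h
      have h5 : 0 ≤ n * v n / (2 * U) := by have := hv n; positivity
      linarith
    · push Not at h
      have h3 : 2 * U ≤ n := (Nat.le_ceil _).trans (by exact_mod_cast h.le)
      rw [zero_add, le_div_iff₀ (by positivity), mul_comm]
      exact mul_le_mul_of_nonneg_right h3 (hv n)
  have h3 : A ≤ (m + 1) * U ^ m + A / 2 := by
    calc A ≤ ∑ n ∈ Finset.range (N + 1), ((if n ≤ m then U ^ m else 0) + n * v n / (2 * U)) :=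
          Finset.sum_le_sum fun n _ => h2 n
      _ = (∑ n ∈ Finset.range (N + 1), if n ≤ m then U ^ m else 0)
          + (∑ n ∈ Finset.range (N + 1), n * v n) / (2 * U) := by
          rw [Finset.sum_add_distrib, Finset.sum_div]
      _ ≤ (m + 1) * U ^ m + (U * A) / (2 * U) := by
          gcongr
          rw [← Finset.sum_filter, Finset.sum_const, nsmul_eq_mul]
          have h4 : (Finset.filter (fun n => n ≤ m) (Finset.range (N + 1))).card ≤ m + 1 := by
            refine (Finset.card_le_card (t := Finset.range (m + 1)) fun n hn => ?_).trans_eq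
              (Finset.card_range _)
            exact Finset.mem_range.2 (Nat.lt_succ_of_le (Finset.mem_filter.1 hn).2)
          gcongr
          exact_mod_cast h4
      _ = _ := by field_simp
  linarith

/-- Induction with the convolution split at `n / 2`: for large `k` the decay of `u k` is used
together with the bound for `∑ v`, for small `k` the inductive decay of `v (n - k)` together with
the bound for `∑ u`. The factor `1 / n` left over in the second part closes the induction once `n >
12 U`. The constant depends only on `K`, as uniformity in the parameter requires. -/
theorem exists_bound_of_convolution (K : ℝ) (hK0 : 0 ≤ K) : ∃ L, 0 ≤ L ∧ ∀ u v : ℕ → ℝ,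
    (∀ n, 0 ≤ u n) → u 0 = 0 → v 0 ≤ 1 → (∀ n, 0 ≤ v n) →
    (∀ n, 1 ≤ n → sqrtWeight n * u n ≤ K) →
    (∀ n, n * v n ≤ ∑ k ∈ Finset.range (n + 1), u k * v (n - k)) →
    ∀ n, n * sqrtWeight n * v n ≤ L := by
  set U : ℝ := max 1 (K * ∑' n, (sqrtWeight n)⁻¹) with hU
  have hU1 : 1 ≤ U := le_max_left _ _
  set S : ℝ := 2 * ((⌈2 * U⌉₊ + 1) * U ^ ⌈2 * U⌉₊) with hS
  have hS0 : 0 ≤ S := by positivity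
  -- The first term absorbs `3 K S` up to `L / 2`, and the second covers the indices `n ≤ 12 U`.
  set L : ℝ := 6 * K * S + S * (12 * U) ^ 3 with hL
  have hL0 : 0 ≤ L := by positivity
  refine ⟨L, hL0, fun u v hu hu0 hv0 hv hK huv => ?_⟩
  have hUs : ∀ s : Finset ℕ, ∑ n ∈ s, u n ≤ U := fun s =>
    (sum_le_of_sqrtWeight hu hu0 hK s).trans (le_max_right _ _)
  have hVs := sum_le_of_convolution hU1 hu hu0 hv0 hUs hv huv
  intro n
  induction n using Nat.strong_induction_on with
  | _ n ih =>
    rcases Nat.eq_zero_or_pos n with rfl | hn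
    · simpa using hL0
    have hn0 : (0 : ℝ) < n := by exact_mod_cast hn
    have hw := sqrtWeight_pos hn
    by_cases hsmall : (n : ℝ) ≤ 12 * U
    · have h1 : v n ≤ S := by simpa using hVs {n}
      calc n * sqrtWeight n * v n ≤ (n : ℝ) ^ 3 * S :=
            mul_le_mul (sqrtWeight_le_cube n) h1 (hv n) (by positivity)
        _ ≤ (12 * U) ^ 3 * S := by gcongr
        _ ≤ L := by rw [hL]; nlinarith [mul_nonneg hK0 hS0]
    push Not at hsmall
    have hterm : ∀ k ∈ Finset.range (n + 1), u k * v (n - k)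
        ≤ 3 * K / sqrtWeight n * v (n - k) + u k * (6 * L / (n * sqrtWeight n)) := by
      intro k hk
      rw [Finset.mem_range] at hk
      rcases Nat.eq_zero_or_pos k with rfl | hk0
      · rw [hu0, zero_mul, zero_mul, add_zero]
        have := hv (n - 0); positivity
      by_cases h2 : n ≤ 2 * k
      · have h3 : u k ≤ 3 * K / sqrtWeight n := by
          rw [le_div_iff₀ hw]
          have := hK k hk0
          have h4 := mul_le_mul_of_nonneg_left (sqrtWeight_le h2) (hu k)
          linarith
        have h5 : 0 ≤ u k * (6 * L / (n * sqrtWeight n)) := by have := hu k; positivity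
        have h6 := mul_le_mul_of_nonneg_right h3 (hv (n - k))
        linarith
      · have h3 : v (n - k) ≤ 6 * L / (n * sqrtWeight n) := by
          have h4 := ih (n - k) (by omega)
          have h5 : sqrtWeight n ≤ 3 * sqrtWeight (n - k) := sqrtWeight_le (by omega)
          have h6 : (n : ℝ) ≤ 2 * (n - k : ℕ) := by exact_mod_cast (by omega : n ≤ 2 * (n - k))
          rw [le_div_iff₀ (by positivity), mul_comm]
          calc n * sqrtWeight n * v (n - k)
              ≤ (2 * (n - k : ℕ)) * (3 * sqrtWeight (n - k)) * v (n - k) := by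
                have := hv (n - k); have := sqrtWeight_nonneg (n - k); gcongr
            _ = 6 * ((n - k : ℕ) * sqrtWeight (n - k) * v (n - k)) := by ring
            _ ≤ 6 * L := by gcongr
        have h5 : 0 ≤ 3 * K / sqrtWeight n * v (n - k) := by have := hv (n - k); positivity
        have h6 := mul_le_mul_of_nonneg_left h3 (hu k)
        linarith
    have hsum : n * v n ≤ 3 * K / sqrtWeight n * S + U * (6 * L / (n * sqrtWeight n)) := by
      refine (huv n).trans ((Finset.sum_le_sum hterm).trans ?_)
      rw [Finset.sum_add_distrib, ← Finset.mul_sum, ← Finset.sum_mul]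
      refine add_le_add ?_ ?_
      · refine mul_le_mul_of_nonneg_left ?_ (by positivity)
        have h3 : ∑ k ∈ Finset.range (n + 1), v (n - k) = ∑ k ∈ Finset.range (n + 1), v k := by
          have := Finset.sum_range_reflect v (n + 1)
          rw [← this]; simp
        rw [h3]; exact hVs _
      · exact mul_le_mul_of_nonneg_right (hUs _) (by positivity)
    calc n * sqrtWeight n * v n = sqrtWeight n * (n * v n) := by ring
      _ ≤ sqrtWeight n * (3 * K / sqrtWeight n * S + U * (6 * L / (n * sqrtWeight n))) := by gcongr
      _ = 3 * K * S + 6 * L * U / n := by field_simp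
      _ ≤ 3 * K * S + L / 2 := by
          refine add_le_add_right ?_ _
          rw [div_le_iff₀ hn0]
          nlinarith
      _ ≤ L := by
          have : 0 ≤ S * (12 * U) ^ 3 := by positivity
          linarith

end Convolution

theorem coeff_zero_expIntegral (g : PowerSeries ℂ) : (expIntegral g).coeff 0 = 1 := by
  set h : PowerSeries ℂ := PowerSeries.mk fun n => g.coeff n / (n : ℂ) with hh
  have h0 : PowerSeries.constantCoeff h = 0 := by
    rw [← PowerSeries.coeff_zero_eq_constantCoeff_apply, hh, PowerSeries.coeff_mk]; simp
  have hs : PowerSeries.HasSubst h := PowerSeries.HasSubst.of_constantCoeff_zero' h0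
  have h1 : (PowerSeries.exp ℂ) = (PowerSeries.exp ℂ - 1) + 1 := by ring
  have h2 : PowerSeries.subst h (1 : PowerSeries ℂ) = 1 := by
    rw [← PowerSeries.coe_substAlgHom hs, map_one]
  have h3 : PowerSeries.constantCoeff (PowerSeries.subst h (PowerSeries.exp ℂ - 1)) = 0 :=
    PowerSeries.constantCoeff_subst_eq_zero h0 _ (by simp)
  rw [expIntegral, ← hh, h1, PowerSeries.subst_add hs, h2, map_add,
    PowerSeries.coeff_zero_eq_constantCoeff_apply, h3]
  simp

theorem derivative_expIntegral (g : PowerSeries ℂ) :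
    PowerSeries.derivative ℂ (expIntegral g)
      = expIntegral g * PowerSeries.mk fun n => g.coeff (n + 1) := by
  set h : PowerSeries ℂ := PowerSeries.mk fun n => g.coeff n / (n : ℂ) with hh
  have h0 : PowerSeries.constantCoeff h = 0 := by
    rw [← PowerSeries.coeff_zero_eq_constantCoeff_apply, hh, PowerSeries.coeff_mk]; simp
  have hs : PowerSeries.HasSubst h := PowerSeries.HasSubst.of_constantCoeff_zero' h0
  rw [expIntegral, ← hh, PowerSeries.derivative_subst hs, PowerSeries.derivative_exp]
  congr 1
  ext k
  rw [PowerSeries.coeff_derivative, hh, PowerSeries.coeff_mk, PowerSeries.coeff_mk]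
  have : ((k : ℂ) + 1) ≠ 0 := by exact_mod_cast k.succ_ne_zero
  push_cast
  field_simp

theorem expIntegral_mul_expIntegral_neg (g : PowerSeries ℂ) :
    expIntegral g * expIntegral (-g) = 1 := by
  refine PowerSeries.derivative.ext ?_ ?_
  · have h1 : (PowerSeries.mk fun n => (-g).coeff (n + 1))
        = -PowerSeries.mk fun n => g.coeff (n + 1) := by ext; simp
    rw [Derivation.leibniz, derivative_expIntegral, derivative_expIntegral, h1]
    simp only [smul_eq_mul, Derivation.map_one_eq_zero]
    ring
  · rw [map_mul, ← PowerSeries.coeff_zero_eq_constantCoeff_apply,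
      ← PowerSeries.coeff_zero_eq_constantCoeff_apply, coeff_zero_expIntegral,
      coeff_zero_expIntegral]
    simp

/-- The differential equation `x T' = g T`, coefficient by coefficient. -/
theorem natCast_mul_coeff_expIntegral {g : PowerSeries ℂ} (hg : g.coeff 0 = 0) (n : ℕ) :
    n * (expIntegral g).coeff n
      = ∑ k ∈ Finset.range (n + 1), g.coeff k * (expIntegral g).coeff (n - k) := by
  rcases n with _ | n
  · simp [hg]
  have h1 := congrArg (PowerSeries.coeff n) (derivative_expIntegral g)
  rw [PowerSeries.coeff_derivative, mul_comm (expIntegral g), PowerSeries.coeff_mul,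
    Finset.Nat.sum_antidiagonal_eq_sum_range_succ (fun i j => (PowerSeries.coeff i)
      (PowerSeries.mk fun n => g.coeff (n + 1)) * (expIntegral g).coeff j)] at h1
  rw [Finset.sum_range_succ', hg, zero_mul, add_zero]
  push_cast
  rw [mul_comm, h1]
  refine Finset.sum_congr rfl fun k hk => ?_
  rw [PowerSeries.coeff_mk]

theorem pow_mul_coeff_expIntegral {g : PowerSeries ℂ} (hg : g.coeff 0 = 0) (f : ℂ) (n : ℕ) :
    n * (f ^ n * (expIntegral g).coeff n) = ∑ k ∈ Finset.range (n + 1), (f ^ k * g.coeff k) *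
      (f ^ (n - k) * (expIntegral g).coeff (n - k)) := by
  rw [mul_left_comm, natCast_mul_coeff_expIntegral hg, Finset.mul_sum]
  refine Finset.sum_congr rfl fun k hk => ?_
  rw [Finset.mem_range] at hk
  have h2 : f ^ n = f ^ k * f ^ (n - k) := by rw [← pow_add]; congr 1; omega
  rw [h2]; ring

theorem summable_norm_coeff_expIntegral {g : PowerSeries ℂ} (hg : g.coeff 0 = 0) {f : ℂ} {K : ℝ}
    (hK : ∀ n, sqrtWeight n * ‖f ^ n * g.coeff n‖ ≤ K) :
    Summable fun n => ‖f ^ n * (expIntegral g).coeff n‖ := by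
  have hK0 : 0 ≤ K := (mul_nonneg (sqrtWeight_nonneg 0) (norm_nonneg _)).trans (hK 0)
  obtain ⟨L, hL0, hL⟩ := exists_bound_of_convolution K hK0
  have h := hL (fun n => ‖f ^ n * g.coeff n‖) (fun n => ‖f ^ n * (expIntegral g).coeff n‖)
    (fun n => norm_nonneg _) (by simp [hg]) (by simp [coeff_zero_expIntegral])
    (fun n => norm_nonneg _) (fun n _ => hK n) fun n => by
      have h4 : n * ‖f ^ n * (expIntegral g).coeff n‖
          = ‖n * (f ^ n * (expIntegral g).coeff n)‖ := by rw [norm_mul _ (_ * _), Complex.norm_natCast]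
      rw [h4, pow_mul_coeff_expIntegral hg]
      exact (norm_sum_le _ _).trans_eq (by simp only [norm_mul])
  refine Summable.of_norm_bounded_eventually_nat (summable_inv_sqrtWeight.mul_left L) ?_
  filter_upwards [eventually_ge_atTop 1] with n hn
  rw [norm_norm, ← div_eq_mul_inv, le_div_iff₀' (sqrtWeight_pos hn)]
  refine le_trans ?_ (h n)
  have h3 : (1 : ℝ) ≤ n := by exact_mod_cast hn
  have h4 := mul_nonneg (sqrtWeight_nonneg n) (norm_nonneg (f ^ n * (expIntegral g).coeff n))
  rw [mul_assoc]
  exact le_mul_of_one_le_left h4 h3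

/-- The series of `expIntegral g` and `expIntegral (-g)` both converge absolutely at `f`, and their
Cauchy product is `1`. No convergence beyond `|f|` is needed. -/
theorem tsum_coeff_expIntegral_ne_zero {g : PowerSeries ℂ} (hg : g.coeff 0 = 0) {f : ℂ} {K : ℝ}
    (hK : ∀ n, sqrtWeight n * ‖f ^ n * g.coeff n‖ ≤ K) :
    ∑' n, f ^ n * (expIntegral g).coeff n ≠ 0 := by
  intro h0
  have h1 := tsum_mul_tsum_eq_tsum_sum_antidiagonal_of_summable_norm
    (summable_norm_coeff_expIntegral hg hK)
    (summable_norm_coeff_expIntegral (g := -g) (f := f) (by rw [map_neg, hg, neg_zero]) (K := K) (by simpa using hK))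
  have h2 : ∀ n, ∑ kl ∈ Finset.HasAntidiagonal.antidiagonal n, (f ^ kl.1 * (expIntegral g).coeff kl.1) *
      (f ^ kl.2 * (expIntegral (-g)).coeff kl.2) = if n = 0 then 1 else 0 := by
    intro n
    have h3 := congrArg (PowerSeries.coeff n) (expIntegral_mul_expIntegral_neg g)
    rw [PowerSeries.coeff_mul, PowerSeries.coeff_one] at h3
    calc _ = f ^ n * ∑ p ∈ Finset.HasAntidiagonal.antidiagonal n,
          (expIntegral g).coeff p.1 * (expIntegral (-g)).coeff p.2 := by
          rw [Finset.mul_sum]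
          refine Finset.sum_congr rfl fun p hp => ?_
          rw [← Finset.HasAntidiagonal.mem_antidiagonal.1 hp, pow_add]; ring
      _ = _ := by rw [h3]; split_ifs with h <;> simp [h]
  rw [h0, zero_mul, tsum_congr h2, tsum_ite_eq] at h1
  exact zero_ne_one h1

section Tannery

variable {ι : Type*} {l : Filter ι} {Y T : ι → ℕ → ℂ} {Y₀ T₀ : ℕ → ℂ} {κ : ℂ}

theorem tendsto_of_convolution
    (hT : ∀ᶠ i in l, T i 0 = 1 ∧ ∀ n : ℕ, n * T i n = ∑ k ∈ Finset.range (n + 1), Y i k * T i (n - k))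
    (hY0 : ∀ᶠ i in l, Y i 0 = 0) (hY₀ : Y₀ 0 = 0)
    (hT₀ : T₀ 0 = 1 ∧ ∀ n : ℕ, n * T₀ n = ∑ k ∈ Finset.range (n + 1), Y₀ k * T₀ (n - k))
    (hY : ∀ k, Tendsto (fun i => Y i k) l (𝓝 (Y₀ k))) (n : ℕ) :
    Tendsto (fun i => T i n) l (𝓝 (T₀ n)) := by
  induction n using Nat.strong_induction_on with
  | _ n ih =>
    rcases Nat.eq_zero_or_pos n with rfl | hn
    · rw [hT₀.1]
      refine tendsto_const_nhds.congr' ?_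
      filter_upwards [hT] with i hi using hi.1.symm
    have hn0 : (n : ℂ) ≠ 0 := by exact_mod_cast hn.ne'
    have h1 : ∀ {y t : ℕ → ℂ}, y 0 = 0 →
        (n * t n = ∑ k ∈ Finset.range (n + 1), y k * t (n - k)) →
        t n = (n : ℂ)⁻¹ * ∑ k ∈ Finset.range n, y (k + 1) * t (n - (k + 1)) := by
      intro y t hy h
      rw [Finset.sum_range_succ', hy, zero_mul, add_zero] at h
      rw [← h, inv_mul_cancel_left₀ hn0]
    rw [h1 hY₀ (hT₀.2 n)]
    refine Tendsto.congr' (f₁ := fun i => (n : ℂ)⁻¹ *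
      ∑ k ∈ Finset.range n, Y i (k + 1) * T i (n - (k + 1))) ?_ ?_
    · filter_upwards [hT, hY0] with i hi h0 using (h1 h0 (hi.2 n)).symm
    · refine (tendsto_finsetSum _ fun k _ => (hY (k + 1)).mul (ih _ (by omega))).const_mul _

/-- The joint limit bounds all terms from some index on, and coefficientwise convergence bounds the
finitely many others. -/
theorem exists_norm_le_of_tendsto (hY : ∀ k, Tendsto (fun i => Y i k) l (𝓝 (Y₀ k)))
    (hlim : Tendsto (fun p : ι × ℕ => (sqrtWeight p.2 : ℂ) * Y p.1 p.2) (l ×ˢ atTop) (𝓝 κ)) :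
    ∃ K, 0 ≤ K ∧ ∀ᶠ i in l, ∀ n, sqrtWeight n * ‖Y i n‖ ≤ K := by
  have h1 := hlim.norm.eventually_le_const (lt_add_one ‖κ‖)
  obtain ⟨P, hP, Q, hQ, hPQ⟩ := eventually_prod_iff.1 h1
  obtain ⟨N, hN⟩ := eventually_atTop.1 hQ
  have h2 : ∀ k ∈ Finset.range N, ∀ᶠ i in l, ‖Y i k‖ ≤ ‖Y₀ k‖ + 1 := fun k _ =>
    (hY k).norm.eventually_le_const (lt_add_one _)
  have h3 := (Finset.eventually_all (Finset.range N)).2 h2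
  refine ⟨max (‖κ‖ + 1) (∑ k ∈ Finset.range N, sqrtWeight k * (‖Y₀ k‖ + 1)),
    le_max_of_le_left (by positivity), ?_⟩
  filter_upwards [hP, h3] with i h4 h5 n
  by_cases hn : n < N
  · refine le_max_of_le_right ?_
    have h6 := h5 n (Finset.mem_range.2 hn)
    refine (mul_le_mul_of_nonneg_left h6 (sqrtWeight_nonneg n)).trans ?_
    exact Finset.single_le_sum (f := fun k => sqrtWeight k * (‖Y₀ k‖ + 1))
      (fun k _ => mul_nonneg (sqrtWeight_nonneg k) (by positivity)) (Finset.mem_range.2 hn)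
  · refine le_max_of_le_left ?_
    have := hPQ h4 (hN n (by omega))
    simp only [norm_mul, Complex.norm_real, Real.norm_of_nonneg (sqrtWeight_nonneg n)] at this
    exact this

theorem tendsto_sqrtWeight_div (j : ℕ) :
    Tendsto (fun n => sqrtWeight n / sqrtWeight (n - j)) atTop (𝓝 1) := by
  have h1 : Tendsto (fun n : ℕ => (n : ℝ) / (n - j : ℕ)) atTop (𝓝 1) := by
    have h2 := tendsto_natCast_div_add_atTop (𝕜 := ℝ) (j : ℝ)
    have h3 := (h2.inv₀ one_ne_zero).comp (tendsto_sub_atTop_nat j)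
    rw [inv_one] at h3
    refine h3.congr' ?_
    filter_upwards [eventually_ge_atTop j] with n hn
    simp only [Function.comp_apply, inv_div]
    congr 1
    exact_mod_cast Nat.sub_add_cancel hn
  have h2 := (h1.sqrt).mul h1
  rw [Real.sqrt_one, one_mul] at h2
  refine h2.congr fun n => ?_
  rw [Real.sqrt_div (by positivity), sqrtWeight, sqrtWeight, mul_div_mul_comm]

/-- The coefficients of `exp (∑ y_n x ^ n / n)` have the order of `y_n / n`. -/
theorem tendsto_mul_of_convolution
    (hT : ∀ᶠ i in l, T i 0 = 1 ∧ ∀ n : ℕ, n * T i n = ∑ k ∈ Finset.range (n + 1), Y i k * T i (n - k))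
    (hY0 : ∀ᶠ i in l, Y i 0 = 0) (hY₀ : Y₀ 0 = 0)
    (hT₀ : T₀ 0 = 1 ∧ ∀ n : ℕ, n * T₀ n = ∑ k ∈ Finset.range (n + 1), Y₀ k * T₀ (n - k))
    (hY : ∀ k, Tendsto (fun i => Y i k) l (𝓝 (Y₀ k)))
    (hlim : Tendsto (fun p : ι × ℕ => (sqrtWeight p.2 : ℂ) * Y p.1 p.2) (l ×ˢ atTop) (𝓝 κ)) :
    Tendsto (fun p : ι × ℕ => (p.2 * sqrtWeight p.2 : ℂ) * T p.1 p.2) (l ×ˢ atTop)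
      (𝓝 (∑' j, κ * T₀ j)) := by
  obtain ⟨K, hK0, hK⟩ := exists_norm_le_of_tendsto hY hlim
  obtain ⟨L, hL0, hL⟩ := exists_bound_of_convolution K hK0
  have hTL : ∀ᶠ i in l, ∀ n : ℕ, n * sqrtWeight n * ‖T i n‖ ≤ L := by
    filter_upwards [hT, hY0, hK] with i h1 h2 h3
    refine hL (fun n => ‖Y i n‖) (fun n => ‖T i n‖) (fun n => norm_nonneg _) (by simp [h2])
      (by simp [h1.1]) (fun n => norm_nonneg _) (fun n _ => h3 n) fun n => ?_
    have h4 : n * ‖T i n‖ = ‖n * T i n‖ := by rw [norm_mul, Complex.norm_natCast]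
    rw [h4, h1.2 n]
    exact (norm_sum_le _ _).trans_eq (by simp only [norm_mul])
  set U : ℝ := K * ∑' n, (sqrtWeight n)⁻¹ with hU
  have hUs : ∀ᶠ i in l, ∀ s : Finset ℕ, ∑ k ∈ s, ‖Y i k‖ ≤ U := by
    filter_upwards [hY0, hK] with i h2 h3 s
    exact sum_le_of_sqrtWeight (fun n => norm_nonneg _) (by simp [h2]) (fun n _ => h3 n) s
  -- The main part keeps the terms `Y (n - j) * T j` with `j ≤ n / 2`. There the weight of `n` is
  -- comparable to that of `n - j`, so the terms are dominated by the summable bound for `T j`.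
  set φ : ι × ℕ → ℕ → ℂ := fun p j =>
    if 2 * j ≤ p.2 then sqrtWeight p.2 * Y p.1 (p.2 - j) * T p.1 j else 0 with hφ
  have hTj : ∀ᶠ i in l, ∀ j, ‖T i j‖ ≤ L * (sqrtWeight j)⁻¹ + if j = 0 then 1 else 0 := by
    filter_upwards [hT, hTL] with i h1 h2 j
    rcases Nat.eq_zero_or_pos j with rfl | hj
    · simp [h1.1, sqrtWeight_zero]
    · rw [if_neg hj.ne', add_zero, ← div_eq_mul_inv, le_div_iff₀' (sqrtWeight_pos hj)]
      have h3 : (1 : ℝ) ≤ j := by exact_mod_cast hj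
      have h4 := mul_nonneg (sqrtWeight_nonneg j) (norm_nonneg (T i j))
      refine le_trans ?_ (h2 j)
      rw [mul_assoc]
      exact le_mul_of_one_le_left h4 h3
  have hφlim : Tendsto (fun p => ∑' j, φ p j) (l ×ˢ atTop) (𝓝 (∑' j, κ * T₀ j)) := by
    refine tendsto_tsum_of_dominated_convergence
      (bound := fun j => 3 * K * (L * (sqrtWeight j)⁻¹ + if j = 0 then 1 else 0)) ?_ ?_ ?_
    · exact ((summable_inv_sqrtWeight.mul_left L).add (summable_of_ne_finset_zero (s := {0})
        (by intro j hj; simpa using hj))).mul_left _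
    · intro j
      have h1 : Tendsto (fun p : ι × ℕ => (p.1, p.2 - j)) (l ×ˢ atTop) (l ×ˢ atTop) :=
        tendsto_fst.prodMk ((tendsto_sub_atTop_nat j).comp tendsto_snd)
      have h2 : Tendsto (fun p : ι × ℕ => ((sqrtWeight p.2 / sqrtWeight (p.2 - j) : ℝ) : ℂ))
          (l ×ˢ atTop) (𝓝 ((1 : ℝ) : ℂ)) :=
        (Complex.continuous_ofReal.tendsto _).comp ((tendsto_sqrtWeight_div j).comp tendsto_snd)
      have h3 := (h2.mul (hlim.comp h1)).mul
        ((tendsto_of_convolution hT hY0 hY₀ hT₀ hY j).comp (tendsto_fst (g := (atTop : Filter ℕ))))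
      rw [Complex.ofReal_one, one_mul] at h3
      refine h3.congr' ?_
      -- The summand `1` ensures `n - j ≥ 1`, hence a nonzero weight, also for `j = 0`.
      filter_upwards [tendsto_snd.eventually (eventually_ge_atTop (2 * j + 1))] with p hp
      simp only [hφ, Function.comp_apply]
      rw [if_pos (by omega)]
      have : (sqrtWeight (p.2 - j) : ℂ) ≠ 0 := by
        exact_mod_cast (sqrtWeight_pos (by omega)).ne'
      push_cast
      field_simp
    · filter_upwards [tendsto_fst.eventually hK, tendsto_fst.eventually hTj] with p h1 h2 j
      simp only [hφ]
      by_cases h : 2 * j ≤ p.2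
      · rw [if_pos h, norm_mul, norm_mul, Complex.norm_real, Real.norm_of_nonneg (sqrtWeight_nonneg _)]
        have h3 : sqrtWeight p.2 * ‖Y p.1 (p.2 - j)‖ ≤ 3 * K := by
          have h4 := mul_le_mul_of_nonneg_right (sqrtWeight_le (k := p.2 - j) (n := p.2) (by omega))
            (norm_nonneg (Y p.1 (p.2 - j)))
          linarith [h1 (p.2 - j)]
        exact mul_le_mul h3 (h2 j) (norm_nonneg _) (by positivity)
      · rw [if_neg h, norm_zero]
        exact mul_nonneg (by positivity) ((norm_nonneg _).trans (h2 j))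
  -- For `j > n / 2` the bound on `j * sqrtWeight j * T j` yields a factor `1 / n`, and the sums of
  -- `|Y|` are bounded by `U`.
  have hrest : Tendsto (fun p : ι × ℕ => (p.2 * sqrtWeight p.2 : ℂ) * T p.1 p.2 - ∑' j, φ p j)
      (l ×ˢ atTop) (𝓝 0) := by
    have hz : Tendsto (fun p : ι × ℕ => 6 * L * U / (p.2 : ℝ)) (l ×ˢ atTop) (𝓝 0) :=
      (tendsto_const_div_atTop_nhds_zero_nat (6 * L * U)).comp tendsto_snd
    refine squeeze_zero_norm' ?_ hz
    filter_upwards [tendsto_fst.eventually hT, tendsto_fst.eventually hTL,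
      tendsto_fst.eventually hUs, tendsto_snd.eventually (eventually_ge_atTop 1)] with p h1 h2 h3 hn
    obtain ⟨i, n⟩ := p
    simp only at h1 h2 h3 hn ⊢
    have hn0 : (0 : ℝ) < n := by exact_mod_cast hn
    have h4 : ∑' j, φ (i, n) j = ∑ j ∈ Finset.range (n + 1), φ (i, n) j := by
      refine tsum_eq_sum fun j hj => ?_
      rw [Finset.mem_range] at hj
      simp only [hφ]
      rw [if_neg (by omega)]
    have h5 : (n * sqrtWeight n : ℂ) * T i n
        = ∑ j ∈ Finset.range (n + 1), sqrtWeight n * Y i (n - j) * T i j := by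
      rw [mul_comm (n : ℂ), mul_assoc, h1.2 n, Finset.mul_sum, ← Finset.sum_range_reflect]
      refine Finset.sum_congr rfl fun j hj => ?_
      rw [Finset.mem_range] at hj
      rw [show n + 1 - 1 - j = n - j by omega, show n - (n - j) = j by omega, mul_assoc]
    rw [h4, h5, ← Finset.sum_sub_distrib]
    have h6 : ∀ j ∈ Finset.range (n + 1), ‖sqrtWeight n * Y i (n - j) * T i j - φ (i, n) j‖
        ≤ 6 * L / n * ‖Y i (n - j)‖ := by
      intro j hj
      simp only [hφ]
      split_ifs with h
      · rw [sub_self, norm_zero]; positivity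
      · rw [sub_zero, norm_mul, norm_mul, Complex.norm_real,
          Real.norm_of_nonneg (sqrtWeight_nonneg _)]
        have h7 : sqrtWeight n * ‖T i j‖ ≤ 6 * L / n := by
          rw [le_div_iff₀ hn0]
          have h8 : sqrtWeight n ≤ 3 * sqrtWeight j := sqrtWeight_le (by omega)
          have h9 : (n : ℝ) ≤ 2 * j := by exact_mod_cast (by omega : n ≤ 2 * j)
          calc sqrtWeight n * ‖T i j‖ * n ≤ (3 * sqrtWeight j) * ‖T i j‖ * (2 * j) := by
                have := sqrtWeight_nonneg j; gcongr
            _ = 6 * (j * sqrtWeight j * ‖T i j‖) := by ring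
            _ ≤ 6 * L := by gcongr; exact h2 j
        calc _ = sqrtWeight n * ‖T i j‖ * ‖Y i (n - j)‖ := by ring
          _ ≤ _ := by gcongr
    refine (norm_sum_le _ _).trans ((Finset.sum_le_sum h6).trans ?_)
    rw [← Finset.mul_sum]
    have h7 : ∑ j ∈ Finset.range (n + 1), ‖Y i (n - j)‖ = ∑ j ∈ Finset.range (n + 1), ‖Y i j‖ := by
      have := Finset.sum_range_reflect (fun j => ‖Y i j‖) (n + 1)
      rw [← this]; simp
    rw [h7]
    calc _ ≤ 6 * L / n * U := by gcongr; exact h3 _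
      _ = _ := by ring
  have := hφlim.add hrest
  simpa using this

end Tannery

/-! ### Quasi-powers for the solution and for its exponential -/

section

variable {W : Type*} [NormedAddCommGroup W] [NormedSpace ℂ W]

theorem differentiableOn_coeff_expIntegral {g : W → PowerSeries ℂ} {U : Set W}
    (hg : ∀ n, DifferentiableOn ℂ (fun h => (g h).coeff n) U) (hg0 : ∀ h ∈ U, (g h).coeff 0 = 0)
    (n : ℕ) : DifferentiableOn ℂ (fun h => (expIntegral (g h)).coeff n) U := by
  induction n using Nat.strong_induction_on with
  | _ n ih =>
    rcases Nat.eq_zero_or_pos n with rfl | hn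
    · simp only [coeff_zero_expIntegral]; exact differentiableOn_const _
    have hn0 : (n : ℂ) ≠ 0 := by exact_mod_cast hn.ne'
    refine DifferentiableOn.congr (f := fun h => (n : ℂ)⁻¹ * ∑ k ∈ Finset.range n,
      (g h).coeff (k + 1) * (expIntegral (g h)).coeff (n - (k + 1))) ?_ fun h hh => ?_
    · exact (DifferentiableOn.fun_sum fun k _ => (hg (k + 1)).mul (ih _ (by omega))).const_mul _
    · have h1 := natCast_mul_coeff_expIntegral (hg0 h hh) n
      rw [Finset.sum_range_succ', hg0 h hh, zero_mul, add_zero] at h1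
      rw [← h1, inv_mul_cancel_left₀ hn0]

/-- The coefficients of `exp (∫ y(x) / x dx)` for the solution `y` of `s = E(x, s)`. -/
def expCoeff (E : ℂ × ℂ → ℂ) (n : ℕ) : ℂ := (expIntegral (PowerSeries.mk (solCoeff E))).coeff n

theorem expCoeff_zero (E : ℂ × ℂ → ℂ) : expCoeff E 0 = 1 := coeff_zero_expIntegral _

theorem pow_mul_expCoeff {E : ℂ × ℂ → ℂ} (hE : solCoeff E 0 = 0) (f : ℂ) (n : ℕ) :
    n * (f ^ n * expCoeff E n) = ∑ k ∈ Finset.range (n + 1), (f ^ k * solCoeff E k) *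
      (f ^ (n - k) * expCoeff E (n - k)) := by
  have h1 := pow_mul_coeff_expIntegral (g := PowerSeries.mk (solCoeff E)) (by simpa using hE) f n
  simp only [PowerSeries.coeff_mk] at h1
  exact h1

namespace HolomorphicFamily

variable {r R S M x₀ y₀ A B : ℝ} {e : W → ℂ × ℂ → ℂ}

theorem exists_smallRadius (he : HolomorphicFamily r R S M x₀ y₀ A B e) :
    ∃ r₁, SmallRadius R S M y₀ r₁ :=
  InfiniteSystem.exists_smallRadius (he.crit.x₀_pos.trans he.crit.x₀_lt) he.crit.y₀_pos
    he.crit.y₀_lt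

theorem solCoeff_zero (he : HolomorphicFamily r R S M x₀ y₀ A B e) {h : W}
    (hh : h ∈ ball (0 : W) r) : solCoeff (e h) 0 = 0 := by
  obtain ⟨r₁, hr₁⟩ := he.exists_smallRadius
  exact (he.adm h hh).solCoeff_zero hr₁

theorem differentiableOn_solCoeff (he : HolomorphicFamily r R S M x₀ y₀ A B e) (n : ℕ) :
    DifferentiableOn ℂ (fun h => solCoeff (e h) n) (ball 0 r) := by
  obtain ⟨r₁, hr₁⟩ := he.exists_smallRadius
  exact InfiniteSystem.differentiableOn_solCoeff isOpen_ball hr₁ he.diff he.adm n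

theorem differentiableOn_expCoeff (he : HolomorphicFamily r R S M x₀ y₀ A B e) (n : ℕ) :
    DifferentiableOn ℂ (fun h => expCoeff (e h) n) (ball 0 r) :=
  differentiableOn_coeff_expIntegral (g := fun h => PowerSeries.mk (solCoeff (e h)))
    (fun n => by simpa using he.differentiableOn_solCoeff n)
    (fun h hh => by simpa using he.solCoeff_zero hh) n

theorem tendsto_expCoeff (he : HolomorphicFamily r R S M x₀ y₀ A B e) {f : W → ℂ} {κ : ℂ}
    (hfc : ContinuousAt f 0)
    (hlim : Tendsto (fun p : W × ℕ => (Real.sqrt p.2 * p.2 : ℂ)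
        * (f p.1 ^ p.2 * solCoeff (e p.1) p.2)) (𝓝 0 ×ˢ atTop) (𝓝 κ)) :
    ∑' n, f 0 ^ n * expCoeff (e 0) n ≠ 0 ∧
    Tendsto (fun p : W × ℕ => (p.2 * sqrtWeight p.2 : ℂ) * (f p.1 ^ p.2 * expCoeff (e p.1) p.2))
      (𝓝 0 ×ˢ atTop) (𝓝 (∑' n, κ * (f 0 ^ n * expCoeff (e 0) n))) := by
  have h0 : (0 : W) ∈ ball (0 : W) r := mem_ball_self he.r_pos
  have hb := ball_mem_nhds (0 : W) he.r_pos
  have hY : ∀ k, Tendsto (fun h => f h ^ k * solCoeff (e h) k) (𝓝 0)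
      (𝓝 (f 0 ^ k * solCoeff (e 0) k)) := fun k =>
    ((hfc.pow k).mul ((he.differentiableOn_solCoeff k).continuousOn.continuousAt hb)).tendsto
  have hlim' : Tendsto (fun p : W × ℕ => (sqrtWeight p.2 : ℂ) * (f p.1 ^ p.2 * solCoeff (e p.1) p.2))
      (𝓝 0 ×ˢ atTop) (𝓝 κ) := by
    refine hlim.congr fun p => ?_
    simp [sqrtWeight]
  obtain ⟨K, -, hK⟩ := exists_norm_le_of_tendsto hY hlim'
  have h := tendsto_mul_of_convolution (l := 𝓝 (0 : W))
      (Y := fun h n => f h ^ n * solCoeff (e h) n)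
      (T := fun h n => f h ^ n * expCoeff (e h) n)
      (Y₀ := fun n => f 0 ^ n * solCoeff (e 0) n)
      (T₀ := fun n => f 0 ^ n * expCoeff (e 0) n)
      (κ := κ) ?_ ?_ ?_ ?_ ?_ ?_
  · exact ⟨tsum_coeff_expIntegral_ne_zero (g := PowerSeries.mk (solCoeff (e 0)))
      (by simpa using he.solCoeff_zero h0) (by simpa using hK.self_of_nhds), h⟩
  · filter_upwards [hb] with h hh
    exact ⟨by simp [expCoeff_zero], pow_mul_expCoeff (he.solCoeff_zero hh) (f h)⟩
  · filter_upwards [hb] with h hh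
    simp [he.solCoeff_zero hh]
  · simp [he.solCoeff_zero h0]
  · exact ⟨by simp [expCoeff_zero], pow_mul_expCoeff (he.solCoeff_zero h0) (f 0)⟩
  · exact hY
  · exact hlim'

end HolomorphicFamily

theorem exists_differentiableOn_neg_log {f : W → ℂ} {ρ : ℝ} (hρ : 0 < ρ)
    (hf : DifferentiableOn ℂ f (ball 0 ρ)) (hf0 : f 0 ≠ 0) :
    (∃ ρ' > 0, DifferentiableOn ℂ (fun h => -Complex.log (f h / f 0)) (ball 0 ρ')) ∧
      ∀ v, fderiv ℂ (fun h => -Complex.log (f h / f 0)) 0 v = -(fderiv ℂ f 0 v / f 0) := by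
  have hdd : ∀ h ∈ ball (0 : W) ρ, DifferentiableAt ℂ (fun h => f h / f 0) h := fun h hh => by
    simp only [div_eq_mul_inv]
    exact (hf.differentiableAt (isOpen_ball.mem_nhds hh)).mul_const _
  have h1 : (fun h => f h / f 0) 0 ∈ Complex.slitPlane := by
    simp only [div_self hf0]; exact Complex.one_mem_slitPlane
  have hslit : ∀ᶠ h in 𝓝 (0 : W), f h / f 0 ∈ Complex.slitPlane :=
    (hdd 0 (mem_ball_self hρ)).continuousAt.preimage_mem_nhds
      (Complex.isOpen_slitPlane.mem_nhds h1)
  obtain ⟨ρ', hρ', hball⟩ := Metric.eventually_nhds_iff_ball.1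
    (hslit.and (ball_mem_nhds (0 : W) hρ))
  refine ⟨⟨ρ', hρ', fun h hh => ?_⟩, fun v => ?_⟩
  · exact ((hdd h (hball h hh).2).clog (hball h hh).1).neg.differentiableWithinAt
  · have h2 : HasFDerivAt (fun h => f h / f 0) ((f 0)⁻¹ • fderiv ℂ f 0) 0 := by
      have := (hf.differentiableAt (ball_mem_nhds _ hρ)).hasFDerivAt.const_mul (f 0)⁻¹
      refine this.congr_of_eventuallyEq (Eventually.of_forall fun h => ?_)
      simp only [div_eq_inv_mul]
    have h3 := (h2.clog h1).neg
    have h4 := DFunLike.congr_fun h3.fderiv v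
    refine h4.trans ?_
    simp [div_self hf0]
    ring

/-- Passing to the exponential changes only the power of `n` and the limiting constant. Both
sequences therefore share `b = -log (f / x₀)`, which is why mean and variance constants agree. The
derivative of `b` comes from that of the critical point. -/
theorem HolomorphicFamily.exists_quasiPowers [CompleteSpace W] {r R S M x₀ y₀ A B : ℝ}
    {e : W → ℂ × ℂ → ℂ} (he : HolomorphicFamily r R S M x₀ y₀ A B e) :
    ∃ b : W → ℂ, ∃ ρ > 0, DifferentiableOn ℂ b (ball 0 ρ) ∧ b 0 = 0 ∧
      (∀ v, fderiv ℂ b 0 v = fderiv ℂ (fun h => e h (x₀, y₀)) 0 v / (x₀ * A)) ∧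
      QuasiPowers b (fun n h => solCoeff (e h) n) ∧
      QuasiPowers b (fun n h => expCoeff (e h) n) := by
  obtain ⟨f, ρ, hρ, hρr, hf, hf0, hder, κ, hκ, hlim⟩ := he.exists_tendsto_solCoeff
  have hx₀' : (x₀ : ℂ) ≠ 0 := by exact_mod_cast he.crit.x₀_pos.ne'
  have hA' : (A : ℂ) ≠ 0 := by exact_mod_cast he.crit.A_pos.ne'
  have hκ' : (κ : ℂ) ≠ 0 := by exact_mod_cast hκ.ne'
  have hf0' : f 0 ≠ 0 := by rw [hf0]; exact hx₀'
  have hfc : ContinuousAt f 0 := hf.continuousOn.continuousAt (ball_mem_nhds _ hρ)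
  obtain ⟨⟨ρ', hρ', hbd⟩, hbder⟩ := exists_differentiableOn_neg_log hρ hf hf0'
  obtain ⟨hs, hlimT⟩ := he.tendsto_expCoeff hfc hlim
  have hq₁ : QuasiPowers (fun h => -Complex.log (f h / f 0)) (fun n h => solCoeff (e h) n) :=
    quasiPowers_of_tendsto (ω := fun n => (Real.sqrt n * n : ℂ)) (c := fun n h => solCoeff (e h) n)
      hρ hf hf0' (fun n => (he.differentiableOn_solCoeff n).mono (ball_subset_ball hρr)) hκ' hlim
  have hne : ∑' n, (κ : ℂ) * (f 0 ^ n * expCoeff (e 0) n) ≠ 0 := by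
    rw [tsum_mul_left]
    exact mul_ne_zero hκ' hs
  have hq₂ : QuasiPowers (fun h => -Complex.log (f h / f 0)) (fun n h => expCoeff (e h) n) :=
    quasiPowers_of_tendsto (ω := fun n => (n * sqrtWeight n : ℂ))
      (c := fun n h => expCoeff (e h) n)
      hρ hf hf0' (fun n => (he.differentiableOn_expCoeff n).mono (ball_subset_ball hρr)) hne hlimT
  have hder' : ∀ v, fderiv ℂ (fun h => -Complex.log (f h / f 0)) 0 v
      = fderiv ℂ (fun h => e h (x₀, y₀)) 0 v / (x₀ * A) := fun v => by
    rw [hbder, hf0]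
    have h3 := hder v
    generalize fderiv ℂ f 0 v = p at h3 ⊢
    generalize fderiv ℂ (fun h => e h (x₀, y₀)) 0 v = q at h3 ⊢
    field_simp
    linear_combination -h3
  exact ⟨_, ρ', hρ', hbd, by simp [div_self hf0'], hder', hq₁, hq₂⟩

/-! ### Taylor expansion along a curve and the limit theorem for quasi-powers -/

/-- A third order Taylor bound for a bounded holomorphic function of one variable. -/
theorem norm_sub_taylor_two_le {φ : ℂ → ℂ} {ρ C : ℝ} (hρ : 0 < ρ)
    (hφ : DifferentiableOn ℂ φ (ball 0 ρ)) (hC : ∀ z ∈ ball (0 : ℂ) ρ, ‖φ z‖ ≤ C) (h0 : φ 0 = 0) :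
    ‖deriv φ 0‖ ≤ 2 * C / ρ ∧ ‖iteratedDeriv 2 φ 0 / 2‖ ≤ 4 * C / ρ ^ 2 ∧
      ∀ z ∈ ball (0 : ℂ) ρ, ‖φ z - (deriv φ 0 * z + iteratedDeriv 2 φ 0 / 2 * z ^ 2)‖
        ≤ 7 * C / ρ ^ 3 * ‖z‖ ^ 3 := by
  have hC0 : 0 ≤ C := (norm_nonneg _).trans (hC 0 (mem_ball_self hρ))
  have hd : DiffContOnCl ℂ φ (ball 0 (ρ / 2)) := by
    refine DifferentiableOn.diffContOnCl (hφ.mono ?_)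
    rw [closure_ball _ (half_pos hρ).ne']; exact closedBall_subset_ball (half_lt_self hρ)
  have hs : ∀ z ∈ sphere (0 : ℂ) (ρ / 2), ‖φ z‖ ≤ C := fun z hz =>
    hC z (closedBall_subset_ball (half_lt_self hρ) (sphere_subset_closedBall hz))
  have h1 := Complex.norm_iteratedDeriv_le_of_forall_mem_sphere_norm_le 1 (half_pos hρ) hd hs
  have h2 := Complex.norm_iteratedDeriv_le_of_forall_mem_sphere_norm_le 2 (half_pos hρ) hd hs
  rw [iteratedDeriv_one] at h1
  have h1' : ‖deriv φ 0‖ ≤ 2 * C / ρ := by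
    refine h1.trans_eq ?_; simp; field_simp
  have h2' : ‖iteratedDeriv 2 φ 0 / 2‖ ≤ 4 * C / ρ ^ 2 := by
    rw [norm_div, div_le_iff₀ (by simp)]
    refine h2.trans_eq ?_; simp; field_simp; ring
  refine ⟨h1', h2', fun z hz => ?_⟩
  set ψ : ℂ → ℂ := fun z => φ z - (deriv φ 0 * z + iteratedDeriv 2 φ 0 / 2 * z ^ 2) with hψ
  have hψ0 : ψ 0 = 0 := by simp [hψ, h0]
  have hψd : DifferentiableOn ℂ ψ (ball 0 ρ) := hφ.sub (by fun_prop)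
  have hψo : (ψ · - ψ 0) =o[𝓝 0] fun w : ℂ => ‖w - 0‖ ^ 2 := by
    have h3 := isLittleO_sub_taylor_two (hφ.analyticAt (ball_mem_nhds _ hρ))
    have h4 : (fun w : ℂ => ‖w - 0‖ ^ 2) = fun w => ‖(w - 0) ^ 2‖ := by ext w; rw [norm_pow]
    rw [h4, isLittleO_norm_right]
    refine h3.congr_left fun w => ?_
    simp [hψ, h0]
  -- The radius is `7 C = C + 2 C + 4 C`, from the function, its linear term and its quadratic term.
  have hmaps : MapsTo ψ (ball 0 ρ) (closedBall (ψ 0) (7 * C)) := by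
    intro w hw
    rw [hψ0, mem_closedBall_zero_iff]
    have hw' : ‖w‖ ≤ ρ := (mem_ball_zero_iff.1 hw).le
    calc ‖ψ w‖ ≤ ‖φ w‖ + (‖deriv φ 0‖ * ‖w‖ + ‖iteratedDeriv 2 φ 0 / 2‖ * ‖w‖ ^ 2) := by
          refine (norm_sub_le _ _).trans (add_le_add le_rfl ((norm_add_le _ _).trans_eq ?_))
          rw [norm_mul, norm_mul, norm_pow]
      _ ≤ C + (2 * C / ρ * ρ + 4 * C / ρ ^ 2 * ρ ^ 2) := by
          gcongr
          exact hC w hw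
      _ = 7 * C := by field_simp; ring
  have h5 := Complex.dist_le_mul_div_pow_of_mapsTo_ball_of_isLittleO hψd hmaps hψo hz
  rw [dist_eq_norm, dist_eq_norm, hψ0, sub_zero, sub_zero] at h5
  refine h5.trans_eq ?_
  rw [div_pow]; ring

/-- Taylor expansion of bounded holomorphic functions along a curve. -/
theorem exists_taylor_along {z₁ z₂ : W} {c : ℝ → W} {t₁ K r C : ℝ} (ht₁ : 0 < t₁) (hr : 0 < r)
    (hC : 0 ≤ C)
    (hc : ∀ t : ℝ, |t| < t₁ → ‖c t - ((t : ℂ) • z₁ + (t : ℂ) ^ 2 • z₂)‖ ≤ K * |t| ^ 3) :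
    ∃ t₀ > 0, t₀ ≤ t₁ ∧ ∃ C' : ℝ, 0 ≤ C' ∧ (∀ t : ℝ, |t| < t₀ → c t ∈ ball (0 : W) r) ∧
      ∀ g : W → ℂ, DifferentiableOn ℂ g (ball 0 r) → (∀ h ∈ ball (0 : W) r, ‖g h‖ ≤ C) → g 0 = 0 →
        ‖fderiv ℂ g 0 z₁‖ ≤ C' ∧ ‖iteratedDeriv 2 (fun z : ℂ => g (z • z₁ + z ^ 2 • z₂)) 0 / 2‖ ≤ C' ∧
        ∀ t : ℝ, |t| < t₀ → ‖g (c t) - (fderiv ℂ g 0 z₁ * t +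
          iteratedDeriv 2 (fun z : ℂ => g (z • z₁ + z ^ 2 • z₂)) 0 / 2 * (t : ℂ) ^ 2)‖
            ≤ C' * |t| ^ 3 := by
  have hK : ∀ t : ℝ, |t| < t₁ → ‖c t - ((t : ℂ) • z₁ + (t : ℂ) ^ 2 • z₂)‖ ≤ |K| * |t| ^ 3 :=
    fun t ht => (hc t ht).trans (by gcongr; exact le_abs_self K)
  have h1 : Tendsto (fun z : ℂ => ‖z • z₁ + z ^ 2 • z₂‖) (𝓝 0) (𝓝 0) :=
    Continuous.tendsto' (by fun_prop) _ _ (by simp)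
  obtain ⟨ρ, hρ, hball⟩ := Metric.eventually_nhds_iff_ball.1
    (h1.eventually_lt_const (by positivity : (0 : ℝ) < r / 2))
  have h2 : Tendsto (fun t : ℝ => |K| * |t| ^ 3) (𝓝 0) (𝓝 0) :=
    Continuous.tendsto' (by fun_prop) _ _ (by simp)
  obtain ⟨t₂, ht₂, hball2⟩ := Metric.eventually_nhds_iff_ball.1
    (h2.eventually_lt_const (by positivity : (0 : ℝ) < r / 2))
  have hmem : ∀ t : ℝ, |t| < ρ → (t : ℂ) ∈ ball (0 : ℂ) ρ := fun t ht => by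
    simpa [mem_ball_zero_iff] using ht
  -- The first three terms are the Taylor bounds on the model curve `t z₁ + t² z₂`, and the last
  -- accounts for the cubic deviation of `c` from it. The constant is fixed before `g`, so it serves
  -- all `Λ n` simultaneously.
  set C' : ℝ := 2 * C / ρ + 4 * C / ρ ^ 2 + 7 * C / ρ ^ 3 + 2 * C / (r / 2) * |K| with hC'
  have hC'0 : 0 ≤ C' := by positivity
  have hct : ∀ t : ℝ, |t| < min t₁ (min t₂ ρ) → c t ∈ ball (0 : W) r := by
    intro t ht
    rw [lt_min_iff, lt_min_iff] at ht
    have h3 := hK t ht.1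
    have h4 := hball2 t (by simpa [mem_ball_zero_iff] using ht.2.1)
    have h5 := hball t (hmem t ht.2.2)
    rw [mem_ball_zero_iff]
    have := norm_le_norm_sub_add (c t) ((t : ℂ) • z₁ + (t : ℂ) ^ 2 • z₂)
    linarith
  refine ⟨min t₁ (min t₂ ρ), by positivity, min_le_left _ _, C', hC'0, hct, fun g hg hgC hg0 => ?_⟩
  set φ : ℂ → ℂ := fun z => g (z • z₁ + z ^ 2 • z₂) with hφ
  have hin : ∀ z ∈ ball (0 : ℂ) ρ, z • z₁ + z ^ 2 • z₂ ∈ ball (0 : W) r := fun z hz => by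
    have := hball z hz
    rw [mem_ball_zero_iff]; linarith
  obtain ⟨h3, h4, h5⟩ := norm_sub_taylor_two_le (φ := φ) (C := C) hρ
    (hg.comp (by fun_prop) hin) (fun z hz => hgC _ (hin z hz)) (by simp [hφ, hg0])
  have h6 : deriv φ 0 = fderiv ℂ g 0 z₁ := by
    have h7 : HasDerivAt (fun z : ℂ => z • z₁ + z ^ 2 • z₂) z₁ 0 := by
      have := ((hasDerivAt_id (0 : ℂ)).smul_const z₁).add
        (((hasDerivAt_id (0 : ℂ)).pow 2).smul_const z₂)
      refine (this.congr_deriv ?_).congr_of_eventuallyEq (Eventually.of_forall fun z => ?_)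
      · simp
      · simp
    have h8 : HasFDerivAt g (fderiv ℂ g 0) ((0 : ℂ) • z₁ + (0 : ℂ) ^ 2 • z₂) := by
      simpa using (hg.differentiableAt (ball_mem_nhds _ hr)).hasFDerivAt
    exact (h8.comp_hasDerivAt 0 h7).deriv
  rw [h6] at h3 h5
  have hp1 : 0 ≤ 2 * C / ρ := by positivity
  have hp2 : 0 ≤ 4 * C / ρ ^ 2 := by positivity
  have hp3 : 0 ≤ 7 * C / ρ ^ 3 := by positivity
  have hp4 : 0 ≤ 2 * C / (r / 2) * |K| := by positivity
  refine ⟨h3.trans (by linarith), h4.trans (by linarith), fun t ht => ?_⟩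
  have hct' := hct t ht
  rw [lt_min_iff, lt_min_iff] at ht
  have h7 := h5 t (hmem t ht.2.2)
  rw [Complex.norm_real, Real.norm_eq_abs] at h7
  have h8 := hball t (hmem t ht.2.2)
  have h9 : ball ((t : ℂ) • z₁ + (t : ℂ) ^ 2 • z₂) (r / 2) ⊆ ball (0 : W) r :=
    ball_subset_ball' (by rw [dist_zero_right]; linarith)
  have h10 := norm_sub_le_of_bounded (half_pos hr) (hg.mono h9) (fun p hp => hgC p (h9 hp))
    (hgC _ hct')
  calc _ = ‖(g (c t) - g ((t : ℂ) • z₁ + (t : ℂ) ^ 2 • z₂)) + (φ t - (fderiv ℂ g 0 z₁ * t +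
          iteratedDeriv 2 φ 0 / 2 * (t : ℂ) ^ 2))‖ := by congr 1; simp only [hφ]; ring
    _ ≤ 2 * C / (r / 2) * (|K| * |t| ^ 3) + 7 * C / ρ ^ 3 * |t| ^ 3 :=
        (norm_add_le _ _).trans (add_le_add (h10.trans (by gcongr; exact hK t ht.1)) h7)
    _ = (2 * C / (r / 2) * |K| + 7 * C / ρ ^ 3) * |t| ^ 3 := by ring
    _ ≤ _ := by gcongr; linarith

/-- The central limit theorem for quasi-powers along a curve. -/
theorem QuasiPowers.satisfiesCLT {b : W → ℂ} {q : ℕ → W → ℂ} (hq : QuasiPowers b q) {ρ : ℝ}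
    (hρ : 0 < ρ) (hb : DifferentiableOn ℂ b (ball 0 ρ)) (hb0 : b 0 = 0)
    {z₁ z₂ : W} {c : ℝ → W} {t₁ K : ℝ} (ht₁ : 0 < t₁)
    (hc : ∀ t : ℝ, |t| < t₁ → ‖c t - ((t : ℂ) • z₁ + (t : ℂ) ^ 2 • z₂)‖ ≤ K * |t| ^ 3)
    {Ω : ℕ → Type*} [∀ n, MeasurableSpace (Ω n)] (P : ∀ n, Measure (Ω n))
    [∀ n, IsProbabilityMeasure (P n)] (X : ∀ n, Ω n → ℝ) (hX : ∀ n, AEMeasurable (X n) (P n))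
    (hXq : ∀ n, q n 0 ≠ 0 → ∀ t : ℝ, |t| < t₁ → charFun ((P n).map (X n)) t = q n (c t) / q n 0) :
    0 ≤ -2 * (iteratedDeriv 2 (fun z : ℂ => b (z • z₁ + z ^ 2 • z₂)) 0 / 2).re ∧
      SatisfiesCLT P X (fderiv ℂ b 0 z₁).im
        (-2 * (iteratedDeriv 2 (fun z : ℂ => b (z • z₁ + z ^ 2 • z₂)) 0 / 2).re) := by
  obtain ⟨r, hr, N, C, Λ, hΛ⟩ := hq
  have hC : 0 ≤ |C| := abs_nonneg C
  -- The exponent `b` is only known to be holomorphic; a smaller ball makes it bounded.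
  obtain ⟨rb, hrb, Mb, hsub, hMb⟩ := exists_ball_bounded isOpen_ball hb (mem_ball_self hρ)
  obtain ⟨t₂, ht₂, ht₂₁, C₂, hC₂, hc₂, hT₂⟩ := exists_taylor_along ht₁ hr hC hc
  obtain ⟨t₃, ht₃, ht₃₁, C₃, hC₃, hc₃, hT₃⟩ := exists_taylor_along ht₁ hrb
    ((norm_nonneg _).trans (hMb 0 (mem_ball_self hrb))) hc
  have hbT := hT₃ b (hb.mono hsub) hMb hb0
  have hΛT : ∀ n ≥ N, _ := fun n hn => hT₂ (Λ n) (hΛ n hn).2.1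
    (fun h hh => ((hΛ n hn).2.2.2 h hh).1.trans (le_abs_self C)) (hΛ n hn).2.2.1
  refine satisfiesCLT_of_charFun P X hX (N := N) (t₀ := min t₂ t₃) (C := max C₂ C₃)
    (b := fun t => b (c t)) (L := fun n t => Λ n (c t))
    (l₁ := fun n => fderiv ℂ (Λ n) 0 z₁)
    (l₂ := fun n => iteratedDeriv 2 (fun z : ℂ => Λ n (z • z₁ + z ^ 2 • z₂)) 0 / 2)
    (lt_min ht₂ ht₃) ?_ ?_ ?_ ?_ ?_
  · intro n hn t ht
    rw [lt_min_iff] at ht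
    obtain ⟨h1, -, -, h2⟩ := hΛ n hn
    rw [hXq n h1 t (ht.1.trans_le ht₂₁), (h2 _ (hc₂ t ht.1)).2, mul_div_cancel_left₀ _ h1]
  · intro t ht
    rw [lt_min_iff] at ht
    exact (hbT.2.2 t ht.2).trans (by gcongr; exact le_max_right _ _)
  · intro n hn t ht
    rw [lt_min_iff] at ht
    exact ((hΛT n hn).2.2 t ht.1).trans (by gcongr; exact le_max_left _ _)
  · exact fun n hn => (hΛT n hn).1.trans (le_max_left _ _)
  · exact fun n hn => (hΛT n hn).2.1.trans (le_max_left _ _)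

end

/-! ### The main equation: positivity and uniqueness of the critical point -/

/-- The value of `∑ c n k * x ^ n * y ^ k` for real `x` and `y`. -/
def realValue (c : ℕ → ℕ → ℝ) (x y : ℝ) : ℝ := ∑' p : ℕ × ℕ, c p.1 p.2 * x ^ p.1 * y ^ p.2

theorem seriesValue_ofReal (c : ℕ → ℕ → ℝ) (x y : ℝ) : seriesValue c x y = realValue c x y := by
  simp [seriesValue, realValue, Complex.ofReal_tsum]

/-- Used to turn the assumptions `F_x ≠ 0` and `F_yy ≠ 0` into positivity, through difference
quotients of a series with nonnegative coefficients. -/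
theorem exists_pos_eq_of_tendsto {ι : Type*} {l : Filter ι} [NeBot l] {u : ι → ℂ} {z : ℂ}
    (h : Tendsto u l (𝓝 z)) (hu : ∀ᶠ i in l, ∃ a : ℝ, 0 ≤ a ∧ u i = a) (hz : z ≠ 0) :
    ∃ a : ℝ, 0 < a ∧ z = a := by
  have hre : 0 ≤ z.re := ge_of_tendsto ((Complex.continuous_re.tendsto z).comp h) (by
    filter_upwards [hu] with i ⟨a, ha, hi⟩; simpa [hi] using ha)
  have him : z.im = 0 := tendsto_nhds_unique ((Complex.continuous_im.tendsto z).comp h) (by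
    refine tendsto_const_nhds.congr' ?_
    filter_upwards [hu] with i ⟨a, ha, hi⟩; simp [hi])
  have hz' : z = z.re := Complex.ext rfl (by simpa using him)
  refine ⟨z.re, hre.lt_of_ne fun h0 => hz ?_, hz'⟩
  rw [hz', ← h0]; simp

namespace MainEquation

variable {c : ℕ → ℕ → ℝ} {x₀ y₀ ε : ℝ}

theorem summable_real (hF : MainEquation c x₀ y₀ ε) {x y : ℝ} (hx0 : 0 ≤ x) (hx : x < x₀ + ε)
    (hy0 : 0 ≤ y) (hy : y < y₀ + ε) :
    Summable fun p : ℕ × ℕ => c p.1 p.2 * x ^ p.1 * y ^ p.2 := by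
  have := hF.summable x y (by simpa [abs_of_nonneg hx0]) (by simpa [abs_of_nonneg hy0])
  exact_mod_cast this

theorem norm_term_le (hF : MainEquation c x₀ y₀ ε) {x y : ℂ} {a b : ℝ} (hx : ‖x‖ ≤ a)
    (hy : ‖y‖ ≤ b) (p : ℕ × ℕ) :
    ‖(c p.1 p.2 : ℂ) * x ^ p.1 * y ^ p.2‖ ≤ c p.1 p.2 * a ^ p.1 * b ^ p.2 := by
  have hc := hF.coeff_nonneg p.1 p.2
  have ha : 0 ≤ a := (norm_nonneg x).trans hx
  rw [norm_mul, norm_mul, norm_pow, norm_pow, Complex.norm_real, Real.norm_of_nonneg hc]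
  gcongr

theorem norm_seriesValue_le (hF : MainEquation c x₀ y₀ ε) {x y : ℂ} {a b : ℝ} (hx : ‖x‖ ≤ a)
    (ha : a < x₀ + ε) (hy : ‖y‖ ≤ b) (hb : b < y₀ + ε) :
    ‖seriesValue c x y‖ ≤ realValue c a b :=
  tsum_of_norm_bounded (hF.summable_real ((norm_nonneg x).trans hx) ha
    ((norm_nonneg y).trans hy) hb).hasSum (hF.norm_term_le hx hy)

theorem admissible (hF : MainEquation c x₀ y₀ ε) {R S : ℝ} (hR0 : 0 ≤ R) (hR : R < x₀ + ε)
    (hS0 : 0 ≤ S) (hS : S < y₀ + ε) :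
    Admissible R S (realValue c R S) fun p => seriesValue c p.1 p.2 where
  diff := by
    intro p hp
    refine DifferentiableAt.differentiableWithinAt ?_
    obtain ⟨r, hr, hsub⟩ := Metric.isOpen_iff.1 (isOpen_polydisc R S) p hp
    refine differentiableAt_of_tendsto (l := atTop) (M := realValue c R S)
      (f := fun (s : Finset (ℕ × ℕ)) (p : ℂ × ℂ) =>
        ∑ q ∈ s, (c q.1 q.2 : ℂ) * p.1 ^ q.1 * p.2 ^ q.2) hr
      (Eventually.of_forall fun s => ⟨by fun_prop, fun q hq => ?_⟩) fun q hq => ?_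
    · have h := mem_polydisc.1 (hsub hq)
      refine (norm_sum_le _ _).trans ((Finset.sum_le_sum fun i _ =>
        hF.norm_term_le h.1.le h.2.le i).trans ?_)
      exact (hF.summable_real hR0 hR hS0 hS).sum_le_tsum s fun i _ => by
        have := hF.coeff_nonneg i.1 i.2
        positivity
    · have h := mem_polydisc.1 (hsub hq)
      exact (hF.summable q.1 q.2 (h.1.trans hR) (h.2.trans hS)).hasSum
  bound p hp := hF.norm_seriesValue_le (mem_polydisc.1 hp).1.le hR (mem_polydisc.1 hp).2.le hS
  zero s _ := by
    have : ∀ p : ℕ × ℕ, (c p.1 p.2 : ℂ) * 0 ^ p.1 * s ^ p.2 = 0 := by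
      rintro ⟨n, k⟩
      rcases n with _ | n
      · simp [hF.zero_left]
      · simp
    simp only [seriesValue, this, tsum_zero]

/-- For `x₀ = 0` the function `F(x₀, ·)` would vanish identically, contradicting `F_y = 1`. -/
theorem x₀_pos (hF : MainEquation c x₀ y₀ ε) : 0 < x₀ := by
  refine hF.x₀_nonneg.lt_of_ne fun h => ?_
  have h1 := hF.deriv_y
  have : (fun y : ℂ => seriesValue c x₀ y) = fun _ => 0 := by
    ext y
    have : ∀ p : ℕ × ℕ, (c p.1 p.2 : ℂ) * 0 ^ p.1 * y ^ p.2 = 0 := by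
      rintro ⟨n, k⟩
      rcases n with _ | n
      · simp [hF.zero_left]
      · simp
    simp only [← h, Complex.ofReal_zero, seriesValue, this, tsum_zero]
  simp [this] at h1

theorem realValue_eq (hF : MainEquation c x₀ y₀ ε) : realValue c x₀ y₀ = y₀ := by
  have := hF.eq_point
  rw [seriesValue_ofReal] at this
  exact_mod_cast this

theorem y₀_pos (hF : MainEquation c x₀ y₀ ε) : 0 < y₀ := by
  refine hF.y₀_nonneg.lt_of_ne fun h => ?_
  obtain ⟨n, hn⟩ := hF.zero_right
  have hx := hF.x₀_pos
  have hs := hF.summable_real hF.x₀_nonneg (by linarith [hF.ε_pos]) hF.y₀_nonneg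
    (by linarith [hF.ε_pos])
  have h1 := hs.le_tsum (n, 0) fun q _ => by
    have := hF.coeff_nonneg q.1 q.2
    have := hF.y₀_nonneg
    positivity
  have h2 := hF.realValue_eq
  rw [realValue] at h2
  rw [h2, ← h] at h1
  have h3 : 0 < c n 0 := (hF.coeff_nonneg n 0).lt_of_ne (Ne.symm hn)
  have h4 : 0 < c n 0 * x₀ ^ n := by positivity
  simp at h1
  linarith

theorem exists_deriv_left (hF : MainEquation c x₀ y₀ ε) :
    ∃ A : ℝ, 0 < A ∧ deriv (fun x : ℂ => seriesValue c x y₀) x₀ = A := by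
  have hε := hF.ε_pos
  have hd : DifferentiableAt ℂ (fun x : ℂ => seriesValue c x y₀) x₀ :=
    differentiableAt_of_deriv_ne_zero hF.deriv_x
  have h1 := hd.hasDerivAt.tendsto_slope_zero
  have h2 : Tendsto (fun h : ℝ => (h : ℂ)) (𝓝[>] 0) (𝓝[≠] 0) := by
    refine tendsto_nhdsWithin_iff.2 ⟨?_, ?_⟩
    · exact (Continuous.tendsto' (by fun_prop) _ _ (by simp)).mono_left nhdsWithin_le_nhds
    · filter_upwards [self_mem_nhdsWithin] with h hh
      simpa using (ne_of_gt hh)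
  refine exists_pos_eq_of_tendsto (h1.comp h2) ?_ hF.deriv_x
  filter_upwards [self_mem_nhdsWithin, nhdsWithin_le_nhds (Iio_mem_nhds hε)] with h hh hhε
  rw [mem_Ioi] at hh
  rw [mem_Iio] at hhε
  refine ⟨h⁻¹ * (realValue c (x₀ + h) y₀ - realValue c x₀ y₀), ?_, ?_⟩
  · refine mul_nonneg (by positivity) (sub_nonneg.2 ?_)
    have hx := hF.x₀_nonneg
    have hy := hF.y₀_nonneg
    refine Summable.tsum_le_tsum (fun p => ?_)
      (hF.summable_real hx (by linarith) hy (by linarith))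
      (hF.summable_real (by linarith) (by linarith) hy (by linarith))
    have := hF.coeff_nonneg p.1 p.2
    gcongr
    linarith
  · simp only [Function.comp_apply, smul_eq_mul, ← Complex.ofReal_add, seriesValue_ofReal]
    push_cast
    rfl

theorem two_mul_pow_le {a h : ℝ} (h0 : 0 ≤ h) (ha : h ≤ a) (k : ℕ) :
    2 * a ^ k ≤ (a + h) ^ k + (a - h) ^ k := by
  have h1 : a + h ∈ Ici (0 : ℝ) := by rw [mem_Ici]; linarith
  have h2 : a - h ∈ Ici (0 : ℝ) := by rw [mem_Ici]; linarith
  have : (1 / 2 * (a + h) + 1 / 2 * (a - h)) ^ k ≤ 1 / 2 * (a + h) ^ k + 1 / 2 * (a - h) ^ k := by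
    simpa only [smul_eq_mul] using And.right (convexOn_pow (𝕜 := ℝ) k) h1 h2
      (by norm_num : (0 : ℝ) ≤ 1 / 2) (by norm_num : (0 : ℝ) ≤ 1 / 2) (by norm_num)
  rw [show 1 / 2 * (a + h) + 1 / 2 * (a - h) = a by ring] at this
  linarith

/-- The second derivative is the limit of symmetric second differences, which are nonnegative by
convexity of the powers. -/
theorem exists_deriv_two (hF : MainEquation c x₀ y₀ ε) :
    ∃ B : ℝ, 0 < B ∧ iteratedDeriv 2 (fun y : ℂ => seriesValue c x₀ y) y₀ = B := by
  have hε := hF.ε_pos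
  have hx := hF.x₀_pos
  have hy := hF.y₀_pos
  have hadm := hF.admissible (R := x₀ + ε / 2) (S := y₀ + ε / 2) (by linarith) (by linarith)
    (by linarith) (by linarith)
  set f : ℂ → ℂ := fun y => seriesValue c x₀ y with hf
  have han : AnalyticAt ℂ f y₀ := by
    have hd : DifferentiableOn ℂ f (ball 0 (y₀ + ε / 2)) := fun s hs =>
      (hadm.differentiableAt_right (x := x₀) (s := s) (by simp [abs_of_pos hx]; linarith)
        (by simpa using hs)).differentiableWithinAt
    refine hd.analyticAt (isOpen_ball.mem_nhds ?_)
    simp [abs_of_pos hy]; linarith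
  have h1 := isLittleO_sub_taylor_two han
  have hp : Tendsto (fun h : ℝ => ((y₀ + h : ℝ) : ℂ)) (𝓝[>] 0) (𝓝 y₀) :=
    (Continuous.tendsto' (by fun_prop) _ _ (by simp)).mono_left nhdsWithin_le_nhds
  have hm : Tendsto (fun h : ℝ => ((y₀ - h : ℝ) : ℂ)) (𝓝[>] 0) (𝓝 y₀) :=
    (Continuous.tendsto' (by fun_prop) _ _ (by simp)).mono_left nhdsWithin_le_nhds
  have h2 := ((h1.comp_tendsto hp).tendsto_div_nhds_zero).add
    ((h1.comp_tendsto hm).tendsto_div_nhds_zero)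
  have h3 : Tendsto (fun h : ℝ => (f (y₀ + h : ℝ) + f (y₀ - h : ℝ) - 2 * f y₀) / (h : ℂ) ^ 2)
      (𝓝[>] 0) (𝓝 (iteratedDeriv 2 f y₀)) := by
    have := h2.add_const (iteratedDeriv 2 f y₀)
    rw [add_zero, zero_add] at this
    refine this.congr' ?_
    filter_upwards [self_mem_nhdsWithin] with h hh
    have hh' : (h : ℂ) ≠ 0 := by simpa using (ne_of_gt hh)
    simp only [Function.comp_apply, Complex.ofReal_add, Complex.ofReal_sub, add_sub_cancel_left,
      sub_sub_cancel_left, even_two.neg_pow]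
    field_simp
    ring
  refine exists_pos_eq_of_tendsto h3 ?_ hF.deriv_yy
  filter_upwards [self_mem_nhdsWithin, nhdsWithin_le_nhds (Iio_mem_nhds hε),
    nhdsWithin_le_nhds (Iio_mem_nhds hy)] with h hh hhε hhy
  rw [mem_Ioi] at hh
  rw [mem_Iio] at hhε hhy
  refine ⟨(realValue c x₀ (y₀ + h) + realValue c x₀ (y₀ - h) - 2 * realValue c x₀ y₀) / h ^ 2,
    div_nonneg (sub_nonneg.2 ?_) (by positivity), ?_⟩
  · have hs : ∀ y, 0 ≤ y → y < y₀ + ε → _ := fun y h0 h1 =>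
      hF.summable_real hx.le (by linarith) h0 h1
    rw [realValue, realValue, realValue, ← tsum_mul_left,
      ← (hs (y₀ + h) (by linarith) (by linarith)).tsum_add (hs (y₀ - h) (by linarith) (by linarith))]
    refine Summable.tsum_le_tsum (fun p => ?_) ((hs y₀ hy.le (by linarith)).mul_left 2)
      ((hs _ (by linarith) (by linarith)).add (hs _ (by linarith) (by linarith)))
    have h4 := mul_le_mul_of_nonneg_left (two_mul_pow_le hh.le hhy.le p.2)
      (mul_nonneg (hF.coeff_nonneg p.1 p.2) (pow_nonneg hx.le p.1))
    linarith
  · simp only [hf, seriesValue_ofReal]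
    push_cast
    rfl

/-- The equality case of the triangle inequality for `F`. -/
theorem pow_mul_pow_eq (hF : MainEquation c x₀ y₀ ε) {x s : ℂ} (hx : ‖x‖ ≤ x₀) (hs : ‖s‖ = y₀)
    (h : seriesValue c x s = s) {n k : ℕ} (hc : c n k ≠ 0) :
    (x / x₀) ^ n * (s / y₀) ^ k = s / y₀ := by
  have hε := hF.ε_pos
  have hx₀ := hF.x₀_pos
  have hy₀ := hF.y₀_pos
  have hx₀' : (x₀ : ℂ) ≠ 0 := by exact_mod_cast hx₀.ne'
  have hy₀' : (y₀ : ℂ) ≠ 0 := by exact_mod_cast hy₀.ne'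
  have hs0 : s ≠ 0 := by rw [← norm_pos_iff, hs]; exact hy₀
  set η := s / y₀ with hη
  have hη1 : ‖η‖ = 1 := by
    rw [hη, norm_div, hs, Complex.norm_real, Real.norm_of_nonneg hy₀.le, div_self hy₀.ne']
  have hη0 : η ≠ 0 := norm_ne_zero_iff.1 (by rw [hη1]; exact one_ne_zero)
  -- The rotation by `η⁻¹` makes the sum equal to `y₀`. The real parts are at most the terms `b p`,
  -- which have the same sum, so every term agrees with `b p`.
  set τ : ℕ × ℕ → ℂ := fun p => η⁻¹ * ((c p.1 p.2 : ℂ) * x ^ p.1 * s ^ p.2) with hτ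
  set b : ℕ × ℕ → ℝ := fun p => c p.1 p.2 * x₀ ^ p.1 * y₀ ^ p.2 with hb
  have h1 : HasSum τ y₀ := by
    have := (hF.summable x s (by linarith) (by linarith)).hasSum.mul_left η⁻¹
    rw [← seriesValue, h] at this
    have h3 : η⁻¹ * s = y₀ := by rw [hη]; field_simp
    rwa [h3] at this
  have h2 : HasSum b y₀ := by
    have := (hF.summable_real hx₀.le (by linarith) hy₀.le (by linarith)).hasSum
    rwa [← realValue, hF.realValue_eq] at this
  have hle : ∀ p, ‖τ p‖ ≤ b p := fun p => by
    rw [hτ, norm_mul, norm_inv, hη1, inv_one, one_mul]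
    exact hF.norm_term_le hx hs.le p
  have h3 : HasSum (fun p => b p - (τ p).re) 0 := by
    simpa using h2.sub (Complex.hasSum_re h1)
  have h4 := (hasSum_zero_iff_of_nonneg fun p => sub_nonneg.2
    ((Complex.re_le_norm _).trans (hle p))).1 h3
  have h5 : (τ (n, k)).re = b (n, k) := by
    have := congrFun h4 (n, k)
    simp only [Pi.zero_apply] at this
    linarith
  have h6 : τ (n, k) = b (n, k) := by
    have h7 : (τ (n, k)).im = 0 := by
      have h8 := hle (n, k)
      have h9 := Complex.sq_norm (τ (n, k))
      rw [Complex.normSq_apply, h5] at h9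
      have : ‖τ (n, k)‖ ^ 2 ≤ b (n, k) ^ 2 := by gcongr
      nlinarith [mul_self_nonneg (τ (n, k)).im]
    exact Complex.ext (by simpa using h5) (by simpa using h7)
  have hc' : (c n k : ℂ) ≠ 0 := by exact_mod_cast hc
  simp only [hτ, hb] at h6
  push_cast at h6
  have h7 : x ^ n * s ^ k = η * (x₀ ^ n * y₀ ^ k) := by
    have := congrArg (fun z => (c n k : ℂ)⁻¹ * (η * z)) h6
    simp only [mul_inv_cancel_left₀ hη0] at this
    calc _ = (c n k : ℂ)⁻¹ * ((c n k : ℂ) * x ^ n * s ^ k) := by field_simp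
      _ = _ := by rw [this]; field_simp
  rw [hη, div_pow, div_pow, div_mul_div_comm, h7]
  field_simp
  rw [hη]
  field_simp

/-- With `ξ = x / x₀` and `η = s / y₀`, the equality case gives the symmetry `F(ξ z, η w) = η F(z,
w)`. Uniqueness of the small solution then yields `ξⁿ = η` for every `n` in the support of its
series. The support thus lies in one residue class modulo the order of `ξ`, and aperiodicity forces
`ξ = 1`, hence `η = 1`. -/
theorem unique (hF : MainEquation c x₀ y₀ ε)
    (hper : Aperiodic (PowerSeries.mk (solCoeff fun p => seriesValue c p.1 p.2))) {x s : ℂ}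
    (hx : ‖x‖ ≤ x₀) (hs : ‖s‖ = y₀) (h : seriesValue c x s = s) : x = x₀ ∧ s = y₀ := by
  have hε := hF.ε_pos
  have hx₀ := hF.x₀_pos
  have hy₀ := hF.y₀_pos
  have hx₀' : (x₀ : ℂ) ≠ 0 := by exact_mod_cast hx₀.ne'
  have hy₀' : (y₀ : ℂ) ≠ 0 := by exact_mod_cast hy₀.ne'
  have hpow := fun n k => hF.pow_mul_pow_eq hx hs h (n := n) (k := k)
  set ξ := x / x₀ with hξ
  set η := s / y₀ with hη
  have hη1 : ‖η‖ = 1 := by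
    rw [hη, norm_div, hs, Complex.norm_real, Real.norm_of_nonneg hy₀.le, div_self hy₀.ne']
  have hξ1 : ‖ξ‖ = 1 := by
    obtain ⟨n, hn⟩ := hF.zero_right
    have hn0 : n ≠ 0 := by rintro rfl; exact hn (hF.zero_left 0)
    have h1 := congrArg norm (hpow n 0 hn)
    rw [pow_zero, mul_one, norm_pow, hη1] at h1
    exact (pow_eq_one_iff_of_nonneg (norm_nonneg _) hn0).1 h1
  have hadm := hF.admissible (R := x₀ + ε / 2) (S := y₀ + ε / 2) (by linarith) (by linarith)
    (by linarith) (by linarith)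
  set F : ℂ × ℂ → ℂ := fun p => seriesValue c p.1 p.2 with hFdef
  have hsymm : ∀ z w : ℂ, F (ξ * z, η * w) = η * F (z, w) := by
    intro z w
    simp only [hFdef, seriesValue]
    rw [← tsum_mul_left]
    refine tsum_congr fun p => ?_
    by_cases hc : c p.1 p.2 = 0
    · simp [hc]
    · rw [mul_pow, mul_pow]
      have := hpow p.1 p.2 hc
      calc _ = (ξ ^ p.1 * η ^ p.2) * ((c p.1 p.2 : ℂ) * z ^ p.1 * w ^ p.2) := by ring
        _ = _ := by rw [this]
  obtain ⟨r, hr⟩ := InfiniteSystem.exists_smallRadius (M := realValue c (x₀ + ε / 2) (y₀ + ε / 2))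
    (R := x₀ + ε / 2) (S := y₀ + ε / 2) (by linarith) hy₀ (by linarith)
  have hsol : ∀ z : ℂ, ‖z‖ < r → η * solAt F z = solAt F (ξ * z) := by
    intro z hz
    have h1 := hadm.solAt_spec hr hz
    refine hadm.eq_solAt hr (by rwa [norm_mul, hξ1, one_mul]) ?_ ?_
    · rw [norm_mul, hη1, one_mul]; linarith [h1.1]
    · rw [hsymm, h1.2.1]
  have hcoeff : ∀ n, solCoeff F n ≠ 0 → ξ ^ n = η := by
    intro n hn
    have h1 := inv_factorial_mul_iteratedDeriv_of_hasSum (a := fun n => η * solCoeff F n)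
      (f := fun z => η * solAt F z) (by
        filter_upwards [ball_mem_nhds (0 : ℂ) hr.r_pos] with z hz
        have := (hadm.hasSum_solCoeff hr (x := z) (by simpa using hz)).mul_left η
        simpa only [mul_assoc] using this) n
    have h2 := inv_factorial_mul_iteratedDeriv_of_hasSum (a := fun n => ξ ^ n * solCoeff F n)
      (f := fun z => η * solAt F z) (by
        filter_upwards [ball_mem_nhds (0 : ℂ) hr.r_pos] with z hz
        have hz' : ‖z‖ < r := by simpa using hz
        have := hadm.hasSum_solCoeff hr (x := ξ * z) (by rwa [norm_mul, hξ1, one_mul])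
        rw [← hsol z hz'] at this
        convert this using 2 with n
        rw [mul_pow]; ring) n
    exact mul_right_cancel₀ hn (h2.symm.trans h1)
  have hξ0 : ξ ≠ 0 := norm_ne_zero_iff.1 (by rw [hξ1]; exact one_ne_zero)
  obtain ⟨n₀, hn₀⟩ : ∃ n, solCoeff F n ≠ 0 := by
    by_contra! h0
    have := hper 2 0 (by norm_num) fun n hn => absurd (h0 n) (by simpa using hn)
    omega
  have hmod : ∀ n, solCoeff F n ≠ 0 → n ≡ n₀ [MOD orderOf (Units.mk0 ξ hξ0)] := fun n hn => by
    refine pow_eq_pow_iff_modEq.1 (Units.ext ?_)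
    push_cast
    rw [Units.val_mk0, hcoeff n hn, hcoeff n₀ hn₀]
  have hξ' : Units.mk0 ξ hξ0 = 1 := by
    rw [← orderOf_eq_one_iff]
    -- Order `0` means that `ξ` is not a root of unity. The support would then be the single index
    -- `n₀`, which contradicts aperiodicity with modulus `2`.
    rcases Nat.eq_zero_or_pos (orderOf (Units.mk0 ξ hξ0)) with hd | hd
    · have := hper 2 n₀ (by norm_num) fun n hn => by
        have h1 := hmod n (by simpa using hn)
        rw [hd] at h1
        have h2 : n = n₀ := by simpa [Nat.ModEq] using h1
        rw [h2]
      omega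
    · exact hper _ n₀ hd fun n hn => hmod n (by simpa using hn)
  have hξ'' : ξ = 1 := by simpa using congrArg Units.val hξ'
  have hη'' : η = 1 := by rw [← hcoeff n₀ hn₀, hξ'', one_pow]
  exact ⟨(div_eq_one_iff_eq hx₀').1 hξ'', (div_eq_one_iff_eq hy₀').1 hη''⟩

theorem exists_criticalPoint (hF : MainEquation c x₀ y₀ ε)
    (hper : Aperiodic (PowerSeries.mk (solCoeff fun p => seriesValue c p.1 p.2))) {R S : ℝ}
    (hR0 : x₀ < R) (hR : R < x₀ + ε) (hS0 : y₀ < S) (hS : S < y₀ + ε) :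
    ∃ A B : ℝ, CriticalPoint R S x₀ y₀ A B fun p => seriesValue c p.1 p.2 := by
  obtain ⟨A, hA, hA'⟩ := hF.exists_deriv_left
  obtain ⟨B, hB, hB'⟩ := hF.exists_deriv_two
  have hx := hF.x₀_pos
  have hy := hF.y₀_pos
  exact ⟨A, B, hx, hR0, hy, hS0, hA, hB, (hF.admissible (by linarith) hR (by linarith) hS).diff,
    hF.eq_point, hA', hF.deriv_y, hB', fun x s h1 h2 h3 => hF.unique hper h1 h2 h3⟩

end MainEquation

/-! ### Fixed points of a small family of holomorphic maps -/

section FixedPoint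

variable {V : Type*} [NormedAddCommGroup V] [NormedSpace ℂ V] {P : Type*} [NormedAddCommGroup P]
  [NormedSpace ℂ P]

/-- A family `N t` of holomorphic maps with the expansion `N t = t n₁ + t² n₂ + O(t³)`. -/
structure TaylorFamily (U : Set P) (δ t₁ B : ℝ) (N : ℝ → P × V → V) (n₁ n₂ : P × V → V) :
    Prop where
  isOpen : IsOpen U
  δ_pos : 0 < δ
  t₁_pos : 0 < t₁
  t₁_le : t₁ ≤ 1
  B_nonneg : 0 ≤ B
  diff : ∀ t : ℝ, |t| < t₁ → DifferentiableOn ℂ (N t) (U ×ˢ ball 0 δ)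
  norm_fst_le : ∀ q ∈ U ×ˢ ball 0 δ, ‖n₁ q‖ ≤ B
  norm_snd_le : ∀ q ∈ U ×ˢ ball 0 δ, ‖n₂ q‖ ≤ B
  norm_sub_le : ∀ t : ℝ, |t| < t₁ → ∀ q ∈ U ×ˢ ball 0 δ,
    ‖N t q - ((t : ℂ) • n₁ q + (t : ℂ) ^ 2 • n₂ q)‖ ≤ B * |t| ^ 3

theorem norm_le_of_taylor {z z₁ z₂ : V} {t B : ℝ} (hB : 0 ≤ B) (ht : |t| ≤ 1) (h₁ : ‖z₁‖ ≤ B)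
    (h₂ : ‖z₂‖ ≤ B) (h : ‖z - ((t : ℂ) • z₁ + (t : ℂ) ^ 2 • z₂)‖ ≤ B * |t| ^ 3) :
    ‖z‖ ≤ 3 * B * |t| ∧ ‖z - (t : ℂ) • z₁‖ ≤ 2 * B * |t| ^ 2 := by
  have ht0 := abs_nonneg t
  have ht2 : |t| ^ 2 ≤ |t| := by nlinarith
  have ht3 : |t| ^ 3 ≤ |t| ^ 2 := pow_le_pow_of_le_one ht0 ht (by norm_num)
  have e1 : ‖(t : ℂ) • z₁‖ ≤ |t| * B := by
    rw [norm_smul, Complex.norm_real, Real.norm_eq_abs]; gcongr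
  have e2 : ‖(t : ℂ) ^ 2 • z₂‖ ≤ |t| ^ 2 * B := by
    rw [norm_smul, norm_pow, Complex.norm_real, Real.norm_eq_abs]; gcongr
  have e3 : B * |t| ^ 3 ≤ B * |t| ^ 2 := by gcongr
  have e4 : B * |t| ^ 2 ≤ B * |t| := by gcongr
  have h5 : ‖z - (t : ℂ) • z₁‖ ≤ 2 * B * |t| ^ 2 := by
    have : z - (t : ℂ) • z₁ = z - ((t : ℂ) • z₁ + (t : ℂ) ^ 2 • z₂) + (t : ℂ) ^ 2 • z₂ := by abel
    rw [this]
    refine (norm_add_le _ _).trans ?_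
    linarith
  refine ⟨?_, h5⟩
  have : z = z - (t : ℂ) • z₁ + (t : ℂ) • z₁ := by abel
  rw [this]
  refine (norm_add_le _ _).trans ?_
  linarith

/-- The Taylor coefficients of a family of holomorphic maps are holomorphic. -/
theorem differentiableOn_of_taylor [CompleteSpace V] {U : Set P} (hU : IsOpen U) {t₁ B : ℝ}
    (ht₁ : 0 < t₁) (ht₁' : t₁ ≤ 1) (hB : 0 ≤ B) {f : ℝ → P → V} {f₁ f₂ : P → V}
    (hf : ∀ t : ℝ, |t| < t₁ → DifferentiableOn ℂ (f t) U) (h₁ : ∀ p ∈ U, ‖f₁ p‖ ≤ B)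
    (h₂ : ∀ p ∈ U, ‖f₂ p‖ ≤ B)
    (h : ∀ t : ℝ, |t| < t₁ → ∀ p ∈ U,
      ‖f t p - ((t : ℂ) • f₁ p + (t : ℂ) ^ 2 • f₂ p)‖ ≤ B * |t| ^ 3) :
    DifferentiableOn ℂ f₁ U ∧ DifferentiableOn ℂ f₂ U := by
  have hev : ∀ᶠ t : ℝ in 𝓝[>] 0, 0 < t ∧ |t| < t₁ := by
    filter_upwards [self_mem_nhdsWithin, nhdsWithin_le_nhds (Iio_mem_nhds ht₁)] with t h0 h1
    exact ⟨h0, by rw [abs_of_pos h0]; exact h1⟩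
  have hlim : ∀ k : ℕ, k ≠ 0 → ∀ C : ℝ, Tendsto (fun t : ℝ => C * t ^ k) (𝓝[>] 0) (𝓝 0) :=
    fun k hk C => (Continuous.tendsto' (by fun_prop) _ _ (by simp [hk])).mono_left
      nhdsWithin_le_nhds
  have hb : ∀ t : ℝ, |t| < t₁ → ∀ p ∈ U, _ := fun t ht p hp =>
    norm_le_of_taylor hB (ht.le.trans ht₁') (h₁ p hp) (h₂ p hp) (h t ht p hp)
  have hd₁ : DifferentiableOn ℂ f₁ U := by
    intro p hp
    obtain ⟨r, hr, hsub⟩ := Metric.isOpen_iff.1 hU p hp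
    refine (differentiableAt_of_tendsto (l := 𝓝[>] (0 : ℝ)) (M := 3 * B) hr
      (f := fun t p => (t : ℂ)⁻¹ • f t p) ?_ fun q hq => ?_).differentiableWithinAt
    · filter_upwards [hev] with t ht
      refine ⟨((hf t ht.2).mono hsub).const_smul _, fun q hq => ?_⟩
      rw [norm_smul, norm_inv, Complex.norm_real, Real.norm_eq_abs,
        inv_mul_le_iff₀ (abs_pos.2 ht.1.ne')]
      exact (hb t ht.2 q (hsub hq)).1.trans_eq (by ring)
    · refine tendsto_iff_norm_sub_tendsto_zero.2 (squeeze_zero' (Eventually.of_forall fun _ =>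
        norm_nonneg _) ?_ (hlim 1 one_ne_zero (2 * B)))
      filter_upwards [hev] with t ht
      have ht0 : (t : ℂ) ≠ 0 := by exact_mod_cast ht.1.ne'
      have e : (t : ℂ)⁻¹ • f t q - f₁ q = (t : ℂ)⁻¹ • (f t q - (t : ℂ) • f₁ q) := by
        rw [smul_sub, smul_smul, inv_mul_cancel₀ ht0, one_smul]
      rw [e, norm_smul, norm_inv, Complex.norm_real, Real.norm_eq_abs,
        inv_mul_le_iff₀ (abs_pos.2 ht.1.ne')]
      refine (hb t ht.2 q (hsub hq)).2.trans_eq ?_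
      rw [abs_of_pos ht.1]; ring
  refine ⟨hd₁, fun p hp => ?_⟩
  obtain ⟨r, hr, hsub⟩ := Metric.isOpen_iff.1 hU p hp
  refine (differentiableAt_of_tendsto (l := 𝓝[>] (0 : ℝ)) (M := 2 * B) hr
    (f := fun t p => ((t : ℂ) ^ 2)⁻¹ • (f t p - (t : ℂ) • f₁ p)) ?_
      fun q hq => ?_).differentiableWithinAt
  · filter_upwards [hev] with t ht
    refine ⟨(((hf t ht.2).sub (hd₁.const_smul _)).mono hsub).const_smul _, fun q hq => ?_⟩
    have ht2 : 0 < |t| ^ 2 := by have := abs_pos.2 ht.1.ne'; positivity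
    rw [norm_smul, norm_inv, norm_pow, Complex.norm_real, Real.norm_eq_abs, inv_mul_le_iff₀ ht2]
    exact (hb t ht.2 q (hsub hq)).2.trans_eq (by ring)
  · refine tendsto_iff_norm_sub_tendsto_zero.2 (squeeze_zero' (Eventually.of_forall fun _ =>
      norm_nonneg _) ?_ (hlim 1 one_ne_zero B))
    filter_upwards [hev] with t ht
    have ht0 : (t : ℂ) ^ 2 ≠ 0 := pow_ne_zero 2 (by exact_mod_cast ht.1.ne')
    have ht2 : 0 < |t| ^ 2 := by have := abs_pos.2 ht.1.ne'; positivity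
    have e : ((t : ℂ) ^ 2)⁻¹ • (f t q - (t : ℂ) • f₁ q) - f₂ q
        = ((t : ℂ) ^ 2)⁻¹ • (f t q - ((t : ℂ) • f₁ q + (t : ℂ) ^ 2 • f₂ q)) := by
      rw [← sub_sub, smul_sub _ (_ - _), smul_smul, inv_mul_cancel₀ ht0, one_smul]
    rw [e, norm_smul, norm_inv, norm_pow, Complex.norm_real, Real.norm_eq_abs,
      inv_mul_le_iff₀ ht2]
    refine (h t ht.2 q (hsub hq)).trans_eq ?_
    rw [abs_of_pos ht.1]; ring

namespace TaylorFamily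

variable {U : Set P} {δ t₁ B : ℝ} {N : ℝ → P × V → V} {n₁ n₂ : P × V → V}

theorem norm_le (hN : TaylorFamily U δ t₁ B N n₁ n₂) {t : ℝ} (ht : |t| < t₁) {q : P × V}
    (hq : q ∈ U ×ˢ ball 0 δ) : ‖N t q‖ ≤ 3 * B * |t| :=
  (norm_le_of_taylor hN.B_nonneg (ht.le.trans hN.t₁_le) (hN.norm_fst_le q hq)
    (hN.norm_snd_le q hq) (hN.norm_sub_le t ht q hq)).1

theorem differentiableOn_coeff [CompleteSpace V] (hN : TaylorFamily U δ t₁ B N n₁ n₂) :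
    DifferentiableOn ℂ n₁ (U ×ˢ ball 0 δ) ∧ DifferentiableOn ℂ n₂ (U ×ˢ ball 0 δ) :=
  differentiableOn_of_taylor (hN.isOpen.prod isOpen_ball) hN.t₁_pos hN.t₁_le hN.B_nonneg hN.diff
    hN.norm_fst_le hN.norm_snd_le hN.norm_sub_le

theorem lipschitz_of_bounded {f : P × V → V} {M : ℝ} (hδ : 0 < δ)
    (hf : DifferentiableOn ℂ f (U ×ˢ ball 0 δ)) (hM : ∀ q ∈ U ×ˢ ball (0 : V) δ, ‖f q‖ ≤ M) {p : P}
    (hp : p ∈ U) {v v' : V} (hv : ‖v‖ < δ / 2) (hv' : ‖v'‖ < δ / 2) :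
    ‖f (p, v) - f (p, v')‖ ≤ 4 * M / δ * ‖v - v'‖ := by
  have hb : ∀ z ∈ ball v' (δ / 2), (p, z) ∈ U ×ˢ ball (0 : V) δ := fun z hz => ⟨hp, by
    have := norm_le_norm_add_norm_sub' z v'
    rw [mem_ball, dist_eq_norm] at hz
    rw [mem_ball_zero_iff]; linarith⟩
  have := norm_sub_le_of_bounded (f := fun z => f (p, z)) (w := v') (z := v) (half_pos hδ)
    (M := M) (hf.comp (f := fun z => (p, z)) (by fun_prop) hb) (fun z hz => hM _ (hb z hz))
    (hM _ ⟨hp, by rw [mem_ball_zero_iff]; linarith⟩)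
  refine this.trans_eq ?_
  field_simp
  ring

theorem lipschitz (hN : TaylorFamily U δ t₁ B N n₁ n₂) {t : ℝ} (ht : |t| < t₁) {p : P}
    (hp : p ∈ U) {v v' : V} (hv : ‖v‖ < δ / 2) (hv' : ‖v'‖ < δ / 2) :
    ‖N t (p, v) - N t (p, v')‖ ≤ 12 * B / δ * |t| * ‖v - v'‖ := by
  refine (lipschitz_of_bounded hN.δ_pos (hN.diff t ht) (fun q hq => hN.norm_le ht hq) hp hv
    hv').trans_eq ?_
  ring

/-- The fixed point `v = N t (p, v)`, which is holomorphic in `p`. -/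
theorem exists_fixedPoint [CompleteSpace V] (hN : TaylorFamily U δ t₁ B N n₁ n₂) :
    ∃ t₂ > 0, t₂ ≤ t₁ ∧ ∃ v : ℝ → P → V, ∀ t : ℝ, |t| < t₂ → DifferentiableOn ℂ (v t) U ∧
      ∀ p ∈ U, ‖v t p‖ ≤ 3 * B * |t| ∧ ‖v t p‖ < δ / 2 ∧ N t (p, v t p) = v t p ∧
        ∀ z : V, ‖z‖ < δ / 2 → N t (p, z) = z → z = v t p := by
  have hδ := hN.δ_pos
  have hB := hN.B_nonneg
  -- The first inequality keeps the iterates in the ball of radius `δ / 2`, the second makes the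
  -- maps contractions with constant `1 / 2`.
  obtain ⟨t₂, ht₂, ht₂₁, hs1, hs2⟩ : ∃ t₂ > 0, t₂ ≤ t₁ ∧ 3 * B * t₂ < δ / 2 ∧
      12 * B / δ * t₂ ≤ 1 / 2 := by
    have h1 : Tendsto (fun t : ℝ => 3 * B * t) (𝓝[>] 0) (𝓝 0) :=
      (Continuous.tendsto' (by fun_prop) _ _ (by simp)).mono_left nhdsWithin_le_nhds
    have h2 : Tendsto (fun t : ℝ => 12 * B / δ * t) (𝓝[>] 0) (𝓝 0) :=
      (Continuous.tendsto' (by fun_prop) _ _ (by simp)).mono_left nhdsWithin_le_nhds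
    have h3 : Tendsto (fun t : ℝ => t) (𝓝[>] 0) (𝓝 0) := nhdsWithin_le_nhds
    obtain ⟨t₂, ha, hb, hc, hd⟩ := ((h1.eventually_lt_const (half_pos hδ)).and
      ((h2.eventually_le_const (by norm_num : (0 : ℝ) < 1 / 2)).and
        ((h3.eventually_le_const hN.t₁_pos).and self_mem_nhdsWithin))).exists
    exact ⟨t₂, hd, hc, ha, hb⟩
  set w : ℝ → P → ℕ → V := fun t p k => (fun v => N t (p, v))^[k] 0 with hw
  have hw_succ : ∀ t p k, w t p (k + 1) = N t (p, w t p k) := fun t p k =>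
    Function.iterate_succ_apply' _ _ _
  have hball : ∀ z : V, ‖z‖ < δ / 2 → z ∈ ball (0 : V) δ := fun z hz => by
    rw [mem_ball_zero_iff]; linarith
  have hsmall : ∀ t : ℝ, |t| < t₂ → 3 * B * |t| < δ / 2 := fun t ht =>
    lt_of_le_of_lt (by gcongr) hs1
  have hwle : ∀ t : ℝ, |t| < t₂ → ∀ p ∈ U, ∀ k, ‖w t p k‖ ≤ 3 * B * |t| := by
    intro t ht p hp k
    induction k with
    | zero => simp only [hw, Function.iterate_zero, id_eq, norm_zero]; positivity
    | succ k ih =>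
      rw [hw_succ]
      exact hN.norm_le (ht.trans_le ht₂₁) ⟨hp, hball _ (ih.trans_lt (hsmall t ht))⟩
  have hwlt : ∀ t : ℝ, |t| < t₂ → ∀ p ∈ U, ∀ k, ‖w t p k‖ < δ / 2 := fun t ht p hp k =>
    (hwle t ht p hp k).trans_lt (hsmall t ht)
  have hcontr : ∀ t : ℝ, |t| < t₂ → ∀ p ∈ U, ∀ z z' : V, ‖z‖ < δ / 2 → ‖z'‖ < δ / 2 →
      ‖N t (p, z) - N t (p, z')‖ ≤ 1 / 2 * ‖z - z'‖ := by
    intro t ht p hp z z' hz hz'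
    refine (hN.lipschitz (ht.trans_le ht₂₁) hp hz hz').trans ?_
    gcongr
    exact le_trans (by gcongr) hs2
  have hlim : ∀ t : ℝ, |t| < t₂ → ∀ p ∈ U, ∃ z, Tendsto (w t p) atTop (𝓝 z) := by
    intro t ht p hp
    refine cauchySeq_tendsto_of_complete (cauchySeq_of_le_geometric (1 / 2) ‖w t p 0 - w t p 1‖
      (by norm_num) fun k => ?_)
    rw [dist_eq_norm]
    induction k with
    | zero => simp
    | succ k ih =>
      rw [hw_succ t p k, hw_succ t p (k + 1)]
      refine (hcontr t ht p hp _ _ (hwlt t ht p hp k) (hwlt t ht p hp (k + 1))).trans ?_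
      rw [pow_succ]; linarith
  refine ⟨t₂, ht₂, ht₂₁, fun t p => limUnder atTop (w t p), fun t ht => ?_⟩
  have hv : ∀ p ∈ U, Tendsto (w t p) atTop (𝓝 (limUnder atTop (w t p))) := fun p hp =>
    tendsto_nhds_limUnder (hlim t ht p hp)
  have hdiff : ∀ k, DifferentiableOn ℂ (fun p => w t p k) U := by
    intro k
    induction k with
    | zero => simp only [hw, Function.iterate_zero, id_eq]; exact differentiableOn_const _
    | succ k ih =>
      simp only [hw_succ]
      exact (hN.diff t (ht.trans_le ht₂₁)).comp (f := fun p => (p, w t p k))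
        (differentiableOn_id.prodMk ih) fun p hp => ⟨hp, hball _ (hwlt t ht p hp k)⟩
  refine ⟨fun p hp => ?_, fun p hp => ?_⟩
  · obtain ⟨r, hr, hsub⟩ := Metric.isOpen_iff.1 hN.isOpen p hp
    exact (differentiableAt_of_tendsto (l := atTop) (f := fun k p => w t p k) (M := 3 * B * |t|) hr
      (Eventually.of_forall fun k => ⟨(hdiff k).mono hsub, fun q hq => hwle t ht q (hsub hq) k⟩)
      fun q hq => hv q (hsub hq)).differentiableWithinAt
  · have h1 := le_of_tendsto (hv p hp).norm (Eventually.of_forall (hwle t ht p hp))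
    have h2 := h1.trans_lt (hsmall t ht)
    have hfix : N t (p, limUnder atTop (w t p)) = limUnder atTop (w t p) := by
      have h3 : Tendsto (fun k => w t p (k + 1)) atTop
          (𝓝 (N t (p, limUnder atTop (w t p)))) := by
        simp only [hw_succ]
        refine tendsto_iff_norm_sub_tendsto_zero.2 (squeeze_zero (fun _ => norm_nonneg _)
          (fun k => hcontr t ht p hp _ _ (hwlt t ht p hp k) h2) ?_)
        have h4 := (tendsto_iff_norm_sub_tendsto_zero.1 (hv p hp)).const_mul (1 / 2)
        rwa [mul_zero] at h4
      exact tendsto_nhds_unique h3 ((tendsto_add_atTop_iff_nat 1).2 (hv p hp))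
    refine ⟨h1, h2, hfix, fun z hz hzN => ?_⟩
    have h4 := hcontr t ht p hp z _ hz h2
    rw [hzN, hfix] at h4
    exact sub_eq_zero.1 (norm_eq_zero.1 (by linarith [norm_nonneg (z - limUnder atTop (w t p))]))

/-- The expansion of the fixed point `v = N t (p, v)`. -/
theorem exists_taylor_fixedPoint [CompleteSpace V] (hN : TaylorFamily U δ t₁ B N n₁ n₂)
    {t₂ : ℝ} (ht₂₁ : t₂ ≤ t₁) {v : ℝ → P → V}
    (hv : ∀ t : ℝ, |t| < t₂ → ∀ p ∈ U, ‖v t p‖ ≤ 3 * B * |t| ∧ ‖v t p‖ < δ / 2 ∧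
      N t (p, v t p) = v t p) :
    ∃ C : ℝ, 0 ≤ C ∧ ∃ e₂ : P → V, ∀ p ∈ U, ‖n₁ (p, 0)‖ ≤ C ∧ ‖e₂ p‖ ≤ C ∧
      ∀ t : ℝ, |t| < t₂ →
        ‖v t p - ((t : ℂ) • n₁ (p, 0) + (t : ℂ) ^ 2 • e₂ p)‖ ≤ C * |t| ^ 3 := by
  have hδ := hN.δ_pos
  have hB := hN.B_nonneg
  obtain ⟨hd₁, hd₂⟩ := hN.differentiableOn_coeff
  set L := 4 * B / δ with hL
  have hL0 : 0 ≤ L := by positivity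
  have h0 : ∀ p ∈ U, ((p, 0) : P × V) ∈ U ×ˢ ball (0 : V) δ := fun p hp => ⟨hp, mem_ball_self hδ⟩
  have hg : ∀ p ∈ U, DifferentiableOn ℂ (fun z => n₁ (p, z)) (ball 0 δ) := fun p hp =>
    hd₁.comp (f := fun z => (p, z)) (by fun_prop) fun z hz => ⟨hp, hz⟩
  have hgB : ∀ p ∈ U, ∀ z ∈ ball (0 : V) δ, ‖n₁ (p, z)‖ ≤ B := fun p hp z hz =>
    hN.norm_fst_le _ ⟨hp, hz⟩
  -- Inserting `v = t n₁(p, 0) + O(t²)` into `t n₁(p, v) + t² n₂(p, v)` shows that the quadratic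
  -- coefficient of the fixed point is `n₂(p, 0) + D p`.
  set D : P → V := fun p => fderiv ℂ (fun z => n₁ (p, z)) 0 (n₁ (p, 0)) with hD
  have hDop : ∀ p ∈ U, ‖fderiv ℂ (fun z => n₁ (p, z)) 0‖ ≤ 2 * B / δ := fun p hp =>
    norm_fderiv_le_of_bounded hδ (hg p hp) (hgB p hp)
  set C := B + B + 2 * B / δ * B + (B + L * (3 * B) + 4 * B * (3 * B / δ) ^ 2
    + 2 * B / δ * (3 * B + L * (3 * B))) with hC
  refine ⟨C, by positivity, fun p => n₂ (p, 0) + D p, fun p hp => ⟨?_, ?_, fun t ht => ?_⟩⟩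
  · refine (hN.norm_fst_le _ (h0 p hp)).trans ?_
    rw [hC]
    have : 0 ≤ B + 2 * B / δ * B + (B + L * (3 * B) + 4 * B * (3 * B / δ) ^ 2
      + 2 * B / δ * (3 * B + L * (3 * B))) := by positivity
    linarith
  · refine (norm_add_le _ _).trans ?_
    have h1 := hN.norm_snd_le _ (h0 p hp)
    have h2 : ‖D p‖ ≤ 2 * B / δ * B := ((fderiv ℂ _ 0).le_opNorm _).trans
      (by gcongr; exacts [hDop p hp, hN.norm_fst_le _ (h0 p hp)])
    have : 0 ≤ B + (B + L * (3 * B) + 4 * B * (3 * B / δ) ^ 2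
      + 2 * B / δ * (3 * B + L * (3 * B))) := by positivity
    rw [hC]
    linarith
  · obtain ⟨h1, h2, h3⟩ := hv t ht p hp
    have ht1 := ht.trans_le ht₂₁
    have hta : |t| ≤ 1 := ht1.le.trans hN.t₁_le
    have ht0 := abs_nonneg t
    set z := v t p with hz
    have hzm : (p, z) ∈ U ×ˢ ball (0 : V) δ :=
      ⟨hp, by rw [mem_ball_zero_iff]; linarith⟩
    have a0 := hN.norm_sub_le t ht1 _ hzm
    rw [h3] at a0
    have hδ2 : ‖(0 : V)‖ < δ / 2 := by simpa using half_pos hδ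
    have a1 := lipschitz_of_bounded hδ hd₂ hN.norm_snd_le hp h2 hδ2
    have a2 := lipschitz_of_bounded hδ hd₁ hN.norm_fst_le hp h2 hδ2
    rw [sub_zero, ← hL] at a1 a2
    have a3 := norm_sub_fderiv_le_of_bounded hδ (hg p hp) (hgB p hp) hzm.2
    rw [sub_zero] at a3
    have a4 := (norm_le_of_taylor hB hta (hN.norm_fst_le _ hzm) (hN.norm_snd_le _ hzm) a0).2
    have hs : ‖(t : ℂ)‖ = |t| := by rw [Complex.norm_real, Real.norm_eq_abs]
    set T := fderiv ℂ (fun z => n₁ (p, z)) 0 with hT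
    -- Four errors of order `t³`: the expansion of `N t`, the variation of `n₂`, the second order
    -- remainder of `n₁`, and the replacement of `z` by `t n₁(p, 0)` in its linear part.
    have key : z - ((t : ℂ) • n₁ (p, 0) + (t : ℂ) ^ 2 • (n₂ (p, 0) + D p))
        = (z - ((t : ℂ) • n₁ (p, z) + (t : ℂ) ^ 2 • n₂ (p, z)))
          + (t : ℂ) ^ 2 • (n₂ (p, z) - n₂ (p, 0)) + (t : ℂ) • (n₁ (p, z) - n₁ (p, 0) - T z)
          + (t : ℂ) • T ((z - (t : ℂ) • n₁ (p, z)) + (t : ℂ) • (n₁ (p, z) - n₁ (p, 0))) := by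
      simp only [map_add, map_sub, map_smul, hD, ← hT, smul_add, smul_sub, sq, mul_smul]
      abel
    have b1 : ‖(t : ℂ) ^ 2 • (n₂ (p, z) - n₂ (p, 0))‖ ≤ L * (3 * B) * |t| ^ 3 := by
      rw [norm_smul, norm_pow, hs]
      calc _ ≤ |t| ^ 2 * (L * (3 * B * |t|)) := by gcongr; exact a1.trans (by gcongr)
        _ = _ := by ring
    have b2 : ‖(t : ℂ) • (n₁ (p, z) - n₁ (p, 0) - T z)‖ ≤ 4 * B * (3 * B / δ) ^ 2 * |t| ^ 3 := by
      rw [norm_smul, hs]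
      calc _ ≤ |t| * (4 * B * (3 * B * |t| / δ) ^ 2) := by gcongr; exact a3.trans (by gcongr)
        _ = _ := by ring
    have b3 : ‖(t : ℂ) • T ((z - (t : ℂ) • n₁ (p, z)) + (t : ℂ) • (n₁ (p, z) - n₁ (p, 0)))‖
        ≤ 2 * B / δ * (3 * B + L * (3 * B)) * |t| ^ 3 := by
      rw [norm_smul, hs]
      have c1 : ‖(z - (t : ℂ) • n₁ (p, z)) + (t : ℂ) • (n₁ (p, z) - n₁ (p, 0))‖
          ≤ 3 * B * |t| ^ 2 + |t| * (L * (3 * B * |t|)) := by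
        refine (norm_add_le _ _).trans (add_le_add (a4.trans (by gcongr; norm_num)) ?_)
        rw [norm_smul, hs]
        gcongr
        exact a2.trans (by gcongr)
      calc _ ≤ |t| * (2 * B / δ * (3 * B * |t| ^ 2 + |t| * (L * (3 * B * |t|)))) := by
            gcongr
            exact (T.le_opNorm _).trans (by gcongr; exact hDop p hp)
        _ = _ := by ring
    rw [key]
    refine (norm_add₄_le).trans ?_
    have c0 : 0 ≤ (B + 2 * B / δ * B) * |t| ^ 3 := by positivity
    calc _ ≤ B * |t| ^ 3 + L * (3 * B) * |t| ^ 3 + 4 * B * (3 * B / δ) ^ 2 * |t| ^ 3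
          + 2 * B / δ * (3 * B + L * (3 * B)) * |t| ^ 3 := by gcongr
      _ ≤ C * |t| ^ 3 := by
          rw [hC]
          have c1 : 0 ≤ B * |t| ^ 3 := by positivity
          nlinarith

end TaylorFamily

end FixedPoint

/-! ### The weighted sequence space as a copy of `ℓ¹` -/

section SequenceSpace

/-- The Banach space `ℓ¹`; the space `ℓ¹(w, ℂ)` is identified with it via `z_j = j ^ w * y_j`. -/
abbrev EllOne := lp (fun _ : ℕ+ => ℂ) 1

def weight (w : ℝ) (j : ℕ+) : ℝ := ((j : ℕ) : ℝ) ^ w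

/-- The sequence `z_j / j ^ w`. -/
def unweight (w : ℝ) (z : EllOne) (j : ℕ+) : ℂ := z j / weight w j

open Classical in
/-- The sequence `j ^ w * y_j` as an element of `ℓ¹`, if it is summable. -/
def ofSeq (w : ℝ) (y : ℕ+ → ℂ) : EllOne :=
  if h : Memℓp (fun j => (weight w j : ℂ) * y j) 1 then ⟨_, h⟩ else 0

variable {w : ℝ} {y y' : ℕ+ → ℂ}

theorem weight_pos (w : ℝ) (j : ℕ+) : 0 < weight w j :=
  Real.rpow_pos_of_pos (by exact_mod_cast j.pos) w

theorem weight_ne_zero (w : ℝ) (j : ℕ+) : (weight w j : ℂ) ≠ 0 := by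
  exact_mod_cast (weight_pos w j).ne'

theorem one_le_weight (hw : 0 ≤ w) (j : ℕ+) : 1 ≤ weight w j :=
  Real.one_le_rpow (by exact_mod_cast (one_le : 1 ≤ j)) hw

theorem wnorm_eq (w : ℝ) (y : ℕ+ → ℂ) :
    wnorm w y = ∑' j, ENNReal.ofReal (weight w j * ‖y j‖) := by
  refine tsum_congr fun j => ?_
  rw [ENNReal.ofReal_mul (weight_pos w j).le, ofReal_norm]
  rfl

theorem wnorm_zero_eq (y : ℕ+ → ℂ) : wnorm 0 y = ∑' j, ENNReal.ofReal ‖y j‖ := by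
  simp [wnorm_eq, weight]

theorem sum_le_of_wnorm_le {B : ℝ} (hB : 0 ≤ B) (h : wnorm w y ≤ ENNReal.ofReal B)
    (J : Finset ℕ+) : ∑ j ∈ J, weight w j * ‖y j‖ ≤ B := by
  have h0 : ∀ j ∈ J, 0 ≤ weight w j * ‖y j‖ := fun j _ =>
    mul_nonneg (weight_pos w j).le (norm_nonneg _)
  rw [← ENNReal.ofReal_le_ofReal_iff hB, ENNReal.ofReal_sum_of_nonneg h0]
  rw [wnorm_eq] at h
  exact (ENNReal.sum_le_tsum J).trans h

theorem summable_of_wnorm (h : wnorm w y < ∞) : Summable fun j => weight w j * ‖y j‖ := by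
  refine summable_of_sum_le (c := (wnorm w y).toReal)
    (fun j => mul_nonneg (weight_pos w j).le (norm_nonneg _)) fun J =>
    sum_le_of_wnorm_le ENNReal.toReal_nonneg ?_ J
  rw [ENNReal.ofReal_toReal h.ne]

theorem summable_norm_of_wnorm (h : wnorm 0 y < ∞) : Summable fun j => ‖y j‖ := by
  simpa [weight] using summable_of_wnorm h

theorem wnorm_eq_ofReal (h : wnorm w y < ∞) :
    wnorm w y = ENNReal.ofReal (∑' j, weight w j * ‖y j‖) := by
  rw [wnorm_eq, ENNReal.ofReal_tsum_of_nonneg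
    (fun j => mul_nonneg (weight_pos w j).le (norm_nonneg _)) (summable_of_wnorm h)]

theorem wnorm_lt_top_of_summable (h : Summable fun j => weight w j * ‖y j‖) :
    wnorm w y < ∞ := by
  rw [wnorm_eq, ← ENNReal.ofReal_tsum_of_nonneg
    (fun j => mul_nonneg (weight_pos w j).le (norm_nonneg _)) h]
  exact ENNReal.ofReal_lt_top

theorem wnorm_mono (h : ∀ j, ‖y j‖ ≤ ‖y' j‖) : wnorm w y ≤ wnorm w y' := by
  rw [wnorm_eq, wnorm_eq]
  refine ENNReal.tsum_le_tsum fun j => ENNReal.ofReal_le_ofReal ?_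
  exact mul_le_mul_of_nonneg_left (h j) (weight_pos w j).le

theorem wnorm_zero_le (hw : 0 ≤ w) (y : ℕ+ → ℂ) : wnorm 0 y ≤ wnorm w y := by
  rw [wnorm_zero_eq, wnorm_eq]
  refine ENNReal.tsum_le_tsum fun j => ENNReal.ofReal_le_ofReal ?_
  exact le_mul_of_one_le_left (norm_nonneg _) (one_le_weight hw j)

theorem wnorm_add_le (w : ℝ) (y y' : ℕ+ → ℂ) : wnorm w (y + y') ≤ wnorm w y + wnorm w y' := by
  rw [wnorm_eq, wnorm_eq, wnorm_eq, ← ENNReal.tsum_add]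
  refine ENNReal.tsum_le_tsum fun j => ?_
  have h := (weight_pos w j).le
  rw [← ENNReal.ofReal_add (mul_nonneg h (norm_nonneg _)) (mul_nonneg h (norm_nonneg _)),
    ← mul_add]
  exact ENNReal.ofReal_le_ofReal (mul_le_mul_of_nonneg_left (norm_add_le _ _) h)

theorem norm_weight_mul (w : ℝ) (j : ℕ+) (a : ℂ) : ‖(weight w j : ℂ) * a‖ = weight w j * ‖a‖ := by
  rw [norm_mul, Complex.norm_real, Real.norm_of_nonneg (weight_pos w j).le]

theorem ellOne_hasSum_norm (z : EllOne) : HasSum (fun j => ‖z j‖) ‖z‖ := by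
  simpa using lp.hasSum_norm (p := 1) (by norm_num) z

theorem ellOne_norm_le {z : EllOne} {C : ℝ} (hC : 0 ≤ C) (h : ∀ J : Finset ℕ+, ∑ j ∈ J, ‖z j‖ ≤ C) :
    ‖z‖ ≤ C :=
  lp.norm_le_of_forall_sum_le (by norm_num) hC fun J => by simpa using h J

theorem ofSeq_apply (h : wnorm w y < ∞) (j : ℕ+) : ofSeq w y j = weight w j * y j := by
  have hm : Memℓp (fun j => (weight w j : ℂ) * y j) 1 := by
    refine memℓp_gen ?_
    simpa only [ENNReal.toReal_one, Real.rpow_one, norm_weight_mul] using summable_of_wnorm h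
  rw [ofSeq, dif_pos hm]

theorem unweight_ofSeq (h : wnorm w y < ∞) : unweight w (ofSeq w y) = y := by
  ext j
  rw [unweight, ofSeq_apply h, mul_div_cancel_left₀ _ (weight_ne_zero w j)]

theorem weight_mul_norm_unweight (z : EllOne) (j : ℕ+) :
    weight w j * ‖unweight w z j‖ = ‖z j‖ := by
  rw [← norm_weight_mul, unweight, mul_div_cancel₀ _ (weight_ne_zero w j)]

theorem wnorm_unweight (w : ℝ) (z : EllOne) : wnorm w (unweight w z) = ENNReal.ofReal ‖z‖ := by
  have h := ellOne_hasSum_norm z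
  simp only [wnorm_eq, weight_mul_norm_unweight]
  rw [← ENNReal.ofReal_tsum_of_nonneg (fun _ => norm_nonneg _) h.summable, h.tsum_eq]

theorem wnorm_unweight_lt_top (w : ℝ) (z : EllOne) : wnorm w (unweight w z) < ∞ := by
  rw [wnorm_unweight]; exact ENNReal.ofReal_lt_top

theorem norm_ofSeq_le {B : ℝ} (hB : 0 ≤ B) (h : wnorm w y ≤ ENNReal.ofReal B) :
    ‖ofSeq w y‖ ≤ B := by
  have h1 : wnorm w y < ∞ := h.trans_lt ENNReal.ofReal_lt_top
  refine ellOne_norm_le hB fun J => ?_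
  simp only [ofSeq_apply h1, norm_weight_mul]
  exact sum_le_of_wnorm_le hB h J

theorem unweight_add (w : ℝ) (z z' : EllOne) :
    unweight w (z + z') = unweight w z + unweight w z' := by
  ext j; simp [unweight, add_div]

theorem unweight_sub (w : ℝ) (z z' : EllOne) :
    unweight w (z - z') = unweight w z - unweight w z' := by
  ext j; simp [unweight, sub_div]

theorem wnorm_zero_unweight_le (hw : 0 ≤ w) (z z' : EllOne) :
    wnorm 0 (unweight w z') ≤ wnorm 0 (unweight w z) + ENNReal.ofReal ‖z' - z‖ := by
  have : unweight w z' = unweight w z + unweight w (z' - z) := by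
    rw [← unweight_add, add_sub_cancel]
  rw [this, ← wnorm_unweight w]
  exact (wnorm_add_le _ _ _).trans (by gcongr; exact wnorm_zero_le hw _)

theorem summable_unweight (hw : 0 ≤ w) (z : EllOne) : Summable fun j => ‖unweight w z j‖ :=
  summable_norm_of_wnorm ((wnorm_zero_le hw _).trans_lt (wnorm_unweight_lt_top w z))

/-- The sum `∑ y_j` as a continuous linear functional on `ℓ¹(w, ℂ)`. -/
def total (w : ℝ) (hw : 0 ≤ w) : EllOne →L[ℂ] ℂ :=
  LinearMap.mkContinuous
    { toFun := fun z => ∑' j, unweight w z j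
      map_add' := fun z z' => by
        rw [unweight_add]
        exact (summable_unweight hw z).of_norm.tsum_add (summable_unweight hw z').of_norm
      map_smul' := fun a z => by
        rw [RingHom.id_apply, smul_eq_mul, ← tsum_mul_left]
        refine tsum_congr fun j => ?_
        simp [unweight, mul_div_assoc] } 1 fun z => by
    rw [one_mul]
    refine tsum_of_norm_bounded (ellOne_hasSum_norm z) fun j => ?_
    rw [← weight_mul_norm_unweight (w := w)]
    exact le_mul_of_one_le_left (norm_nonneg _) (one_le_weight hw j)

theorem total_apply (hw : 0 ≤ w) (z : EllOne) : total w hw z = ∑' j, unweight w z j := rfl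

theorem norm_total_le (hw : 0 ≤ w) (z : EllOne) : ‖total w hw z‖ ≤ ‖z‖ := by
  simpa using (total w hw).le_of_opNorm_le (LinearMap.mkContinuous_norm_le _ zero_le_one _) z

/-- A bounded map to `ℓ¹` with holomorphic coordinates is holomorphic. -/
theorem differentiableAt_ellOne {E : Type*} [NormedAddCommGroup E] [NormedSpace ℂ E]
    {g : E → EllOne} {c : E} {r M : ℝ} (hr : 0 < r)
    (hg : ∀ j, DifferentiableOn ℂ (fun z => g z j) (ball c r)) (hM : ∀ z ∈ ball c r, ‖g z‖ ≤ M) :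
    DifferentiableAt ℂ g c := by
  -- The truncations to finitely many coordinates are holomorphic, have norm at most that of `g z`,
  -- and converge to `g z`.
  refine differentiableAt_of_tendsto (l := atTop) (M := M)
    (f := fun (J : Finset ℕ+) z => ∑ j ∈ J, lp.single 1 j (g z j)) hr
    (Eventually.of_forall fun J => ⟨?_, fun z hz => ?_⟩) fun z hz =>
      lp.hasSum_single (by norm_num) (g z)
  · refine DifferentiableOn.fun_sum fun j _ => ?_
    exact (lp.singleContinuousLinearMap ℂ (fun _ : ℕ+ => ℂ) 1 j).differentiable.comp_differentiableOn
      (hg j)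
  · refine (le_trans ?_ (hM z hz))
    have h1 := lp.norm_sum_single (p := 1) (by norm_num) (fun j => g z j) J
    have h2 := lp.sum_rpow_le_norm_rpow (p := 1) (by norm_num) (g z) J
    simp only [ENNReal.toReal_one, Real.rpow_one] at h1 h2
    exact h1.trans_le h2

end SequenceSpace

/-! ### Taylor's formula with `ℓ¹` bounds -/

section Taylor

theorem norm_le_of_norm_deriv_le {E : Type*} [NormedAddCommGroup E] [NormedSpace ℝ E]
    {r r' : ℝ → E} {t₁ C : ℝ} {k : ℕ} (hC : 0 ≤ C) (h0 : r 0 = 0)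
    (hr : ∀ τ, HasDerivAt r (r' τ) τ) (hb : ∀ τ, |τ| < t₁ → ‖r' τ‖ ≤ C * |τ| ^ k) {t : ℝ}
    (ht : |t| < t₁) : ‖r t‖ ≤ C * |t| ^ (k + 1) := by
  have h := (convex_uIcc (0 : ℝ) t).norm_image_sub_le_of_norm_hasDerivWithin_le
    (f := r) (f' := r') (C := C * |t| ^ k) (fun τ _ => (hr τ).hasDerivWithinAt) (fun τ hτ => ?_)
    left_mem_uIcc right_mem_uIcc
  · rw [h0, sub_zero, sub_zero, Real.norm_eq_abs] at h
    exact h.trans_eq (by ring)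
  · have : |τ| ≤ |t| := by simpa using abs_sub_left_of_mem_uIcc hτ
    refine (hb τ (this.trans_lt ht)).trans ?_
    gcongr

/-- A bound for the sum of the norms of the derivatives is inherited by the functions. -/
theorem sum_norm_le_of_deriv {ι : Type*} (J : Finset ι) {r r' : ι → ℝ → ℂ} {t₁ C : ℝ} {k : ℕ}
    (hC : 0 ≤ C) (h0 : ∀ j, r j 0 = 0) (hr : ∀ j τ, HasDerivAt (r j) (r' j τ) τ)
    (hb : ∀ τ, |τ| < t₁ → ∑ j ∈ J, ‖r' j τ‖ ≤ C * |τ| ^ k) {t : ℝ} (ht : |t| < t₁) :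
    ∑ j ∈ J, ‖r j t‖ ≤ C * |t| ^ (k + 1) := by
  -- Multipliers aligned with the values at the fixed time `t` turn the sum of norms into the value
  -- of one function `∑ e_j r_j`, whose derivative is bounded by the sum of the norms of the `r'_j`.
  have hε : ∀ a : ℂ, ∃ e : ℂ, ‖e‖ ≤ 1 ∧ e * a = ‖a‖ := by
    intro a
    by_cases ha : a = 0
    · exact ⟨0, by simp, by simp [ha]⟩
    · have ha' : (‖a‖ : ℂ) ≠ 0 := by exact_mod_cast norm_ne_zero_iff.2 ha
      refine ⟨‖a‖ / a, ?_, div_mul_cancel₀ _ ha⟩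
      rw [norm_div, Complex.norm_real, norm_norm]
      exact div_self_le_one _
  choose e he1 he2 using hε
  have h := norm_le_of_norm_deriv_le (r := fun τ => ∑ j ∈ J, e (r j t) * r j τ)
    (r' := fun τ => ∑ j ∈ J, e (r j t) * r' j τ) (k := k) hC (by simp [h0])
    (fun τ => HasDerivAt.fun_sum fun j _ => (hr j τ).const_mul _) (fun τ hτ => ?_) ht
  · simp only [he2] at h
    rw [← Complex.ofReal_sum, Complex.norm_real] at h
    exact (le_abs_self _).trans h
  · refine (norm_sum_le _ _).trans ((Finset.sum_le_sum fun j _ => ?_).trans (hb τ hτ))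
    rw [norm_mul]
    exact mul_le_of_le_one_left (norm_nonneg _) (he1 _)

/-- The Taylor expansion of order two in `ℓ¹`. -/
theorem sum_norm_sub_taylor_le {ι : Type*} (J : Finset ι) {f : ι → ℝ → ℂ} {t₁ B : ℝ}
    (hB : 0 ≤ B) (hf : ∀ j, ContDiff ℝ 3 (f j))
    (hb : ∀ τ, |τ| < t₁ → ∑ j ∈ J, ‖iteratedDeriv 3 (f j) τ‖ ≤ B) {t : ℝ} (ht : |t| < t₁) :
    ∑ j ∈ J, ‖f j t - f j 0 - (t * iteratedDeriv 1 (f j) 0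
      + t ^ 2 * (iteratedDeriv 2 (f j) 0 / 2))‖ ≤ B * |t| ^ 3 := by
  have hd : ∀ j, ∀ m < 3, ∀ τ,
      HasDerivAt (iteratedDeriv m (f j)) (iteratedDeriv (m + 1) (f j) τ) τ := by
    intro j m hm τ
    rw [iteratedDeriv_succ]
    exact ((hf j).differentiable_iteratedDeriv m (by exact_mod_cast hm) τ).hasDerivAt
  have hid : ∀ τ : ℝ, HasDerivAt (fun τ : ℝ => (τ : ℂ)) 1 τ := fun τ =>
    (hasDerivAt_id (τ : ℂ)).comp_ofReal
  -- The bound for the third derivatives is integrated three times, each step gaining a factor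
  -- `|t|`.
  have h2 : ∀ t, |t| < t₁ → ∑ j ∈ J, ‖iteratedDeriv 2 (f j) t - iteratedDeriv 2 (f j) 0‖
      ≤ B * |t| ^ (0 + 1) := fun t ht => sum_norm_le_of_deriv J hB (fun j => sub_self _)
    (fun j τ => (hd j 2 (by norm_num) τ).sub_const _) (fun τ hτ => by simpa using hb τ hτ) ht
  have h1 : ∀ t, |t| < t₁ → ∑ j ∈ J, ‖iteratedDeriv 1 (f j) t - iteratedDeriv 1 (f j) 0
      - t * iteratedDeriv 2 (f j) 0‖ ≤ B * |t| ^ (0 + 1 + 1) := fun t ht =>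
    sum_norm_le_of_deriv (r := fun j t => iteratedDeriv 1 (f j) t - iteratedDeriv 1 (f j) 0
      - t * iteratedDeriv 2 (f j) 0) J hB (fun j => by simp)
      (fun j τ => (((hd j 1 (by norm_num) τ).sub_const (iteratedDeriv 1 (f j) 0)).sub
        ((hid τ).mul_const (iteratedDeriv 2 (f j) 0))).congr_deriv (by simp)) h2 ht
  refine sum_norm_le_of_deriv (r := fun j t => f j t - f j 0 - (t * iteratedDeriv 1 (f j) 0
    + t ^ 2 * (iteratedDeriv 2 (f j) 0 / 2))) (k := 2) J hB (fun j => by simp) (fun j τ => ?_) h1 ht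
  have e1 := (hd j 0 (by norm_num) τ).sub_const (f j 0)
  rw [iteratedDeriv_zero] at e1
  have e2 := ((hid τ).mul_const (iteratedDeriv 1 (f j) 0)).add
    (((hid τ).pow 2).mul_const (iteratedDeriv 2 (f j) 0 / 2))
  refine (e1.sub e2).congr_deriv ?_
  simp
  ring

end Taylor

/-! ### The infinite system as a holomorphic map on the sequence space -/

/-- The map `(x, y) ↦ (F_j(x, y, u))_j` on `ℂ × ℓ¹(w, ℂ)`. -/
def systemMap (w : ℝ) (a : ℕ+ → ℕ → (ℕ+ →₀ ℕ) → Circle → ℂ) (u : Circle) (p : ℂ × EllOne) :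
    EllOne :=
  ofSeq w fun j => systemValue a j p.1 (unweight w p.2) u

/-- The map `(x, s) ↦ (Ft_j(x, s))_j` with values in `ℓ¹(w, ℂ)`. -/
def baseMap (w : ℝ) (Ft : ℕ+ → ℂ → ℂ → ℂ) (p : ℂ × ℂ) : EllOne := ofSeq w fun j => Ft j p.1 p.2

/-- The set `domain` in the coordinates `z_j = j ^ w * y_j`, where finiteness of the weighted norm
is automatic. -/
def systemDomain (w x₀ y₀ ε : ℝ) : Set (ℂ × EllOne) :=
  {p | ‖p.1‖ < x₀ + ε ∧ wnorm 0 (unweight w p.2) < ENNReal.ofReal (y₀ + ε)}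

theorem isOpen_systemDomain {w : ℝ} (hw : 0 ≤ w) (x₀ y₀ ε : ℝ) :
    IsOpen (systemDomain w x₀ y₀ ε) := by
  have h0 : IsOpen {p : ℂ × EllOne | ‖p.1‖ < x₀ + ε} := isOpen_lt (by fun_prop) continuous_const
  refine h0.inter ?_
  refine isOpen_iff_mem_nhds.2 fun p hp => ?_
  have h : Tendsto (fun q : ℂ × EllOne => wnorm 0 (unweight w p.2) + ENNReal.ofReal ‖q.2 - p.2‖)
      (𝓝 p) (𝓝 (wnorm 0 (unweight w p.2))) := by
    have h1 : Tendsto (fun q : ℂ × EllOne => ‖q.2 - p.2‖) (𝓝 p) (𝓝 0) :=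
      Continuous.tendsto' (by fun_prop) _ _ (by simp)
    have h2 := (ENNReal.continuous_ofReal.tendsto 0).comp h1
    rw [ENNReal.ofReal_zero] at h2
    simpa using tendsto_const_nhds.add h2
  filter_upwards [h.eventually_lt_const hp] with q hq
  exact (wnorm_zero_unweight_le hw p.2 q.2).trans_lt hq

/-- The sequence `(s, 0, 0, …)` has total `s` and norm `|s|` for every weight. Evaluating the system
there at `u = 1` recovers `Ft_j(x, s)`, so properties of the system pass to `Ft`. -/
theorem wnorm_single (w : ℝ) (s : ℂ) :
    wnorm w (Pi.single (1 : ℕ+) s) = ENNReal.ofReal ‖s‖ := by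
  rw [wnorm_eq, tsum_eq_single (1 : ℕ+) fun j hj => by simp [Pi.single_eq_of_ne hj]]
  simp [weight]

theorem tsum_single_one (s : ℂ) : ∑' i, (Pi.single (1 : ℕ+) s : ℕ+ → ℂ) i = s := by
  rw [tsum_eq_single (1 : ℕ+) fun j hj => by simp [Pi.single_eq_of_ne hj]]
  simp

theorem mem_domain_single {w x₀ y₀ ε : ℝ} {x s : ℂ} (hx : ‖x‖ < x₀ + ε) (hs : ‖s‖ < y₀ + ε) :
    (x, Pi.single (1 : ℕ+) s) ∈ domain w x₀ y₀ ε := by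
  refine ⟨hx, ?_, ?_⟩
  · simp only [wnorm_single]; exact ENNReal.ofReal_lt_top
  · simp only [wnorm_single]
    exact (ENNReal.ofReal_lt_ofReal_iff ((norm_nonneg s).trans_lt hs)).2 hs

theorem tDeriv_zero (a : ℕ+ → ℕ → (ℕ+ →₀ ℕ) → Circle → ℂ) (j : ℕ+) (x : ℂ) (y : ℕ+ → ℂ) (t : ℝ) :
    tDeriv a 0 j x y t = systemValue a j x y (Circle.exp t) := by
  rw [tDeriv, iteratedDeriv_zero]

namespace PartitionSystem

variable {w x₀ y₀ ε : ℝ} {c : ℕ → ℕ → ℝ} {Ft : ℕ+ → ℂ → ℂ → ℂ}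
  {a : ℕ+ → ℕ → (ℕ+ →₀ ℕ) → Circle → ℂ} {x : ℂ} {y : ℕ+ → ℂ} {r q : ℝ}

/-- The coefficients at `u = 1` are nonnegative and dominate those at every `u`. Evaluated at a
sequence that dominates `|y|` and has total exactly `q`, they sum to `Ft_j(r, q)`, a bound that no
longer involves `y` or `u`. -/
theorem exists_majorant (hS : PartitionSystem w x₀ y₀ ε c Ft a) (j : ℕ+) (hx : ‖x‖ ≤ r)
    (hr : r < x₀ + ε) (hy : wnorm 0 y ≤ ENNReal.ofReal q) (hq0 : 0 ≤ q) (hq : q < y₀ + ε) :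
    ∃ b : ℕ × (ℕ+ →₀ ℕ) → ℝ, HasSum b (Ft j r q).re ∧
      ∀ u p, ‖systemTerm a j x y u p‖ ≤ b p := by
  have hr0 : 0 ≤ r := (norm_nonneg x).trans hx
  have hy1 : wnorm 0 y < ∞ := hy.trans_lt ENNReal.ofReal_lt_top
  have hsum := summable_norm_of_wnorm hy1
  set Q := ∑' i, ‖y i‖ with hQ
  have hQq : Q ≤ q := by
    rw [wnorm_eq_ofReal hy1] at hy
    have := (ENNReal.ofReal_le_ofReal_iff hq0).1 hy
    simpa [weight] using this
  -- The slack `q - ‖y‖₁` is added to the first coordinate so that the total is exactly `q`.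
  set b : ℕ+ → ℝ := fun i => ‖y i‖ + (Pi.single (1 : ℕ+) (q - Q) : ℕ+ → ℝ) i with hb
  have hyb : ∀ i, ‖y i‖ ≤ b i := fun i => by
    refine le_add_of_nonneg_right ?_
    by_cases hi : i = 1
    · subst hi; simpa using hQq
    · simp [Pi.single_eq_of_ne hi]
  have hb0 : ∀ i, 0 ≤ b i := fun i => (norm_nonneg _).trans (hyb i)
  have hbq : HasSum b q := by
    have := hsum.hasSum.add (hasSum_pi_single (1 : ℕ+) (q - Q))
    rw [← hQ, add_sub_cancel] at this
    exact this
  have h1 := hS.partition j r (fun i => (b i : ℂ)) (by simpa [abs_of_nonneg hr0] using hr) (by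
    have h2 : Summable fun i => weight 0 i * ‖(b i : ℂ)‖ := by
      simpa [weight, abs_of_nonneg (hb0 _)] using hbq.summable
    rw [wnorm_eq_ofReal (wnorm_lt_top_of_summable h2)]
    refine (ENNReal.ofReal_lt_ofReal_iff (hq0.trans_lt hq)).2 ?_
    have h3 : ∀ i, weight 0 i * ‖(b i : ℂ)‖ = b i := fun i => by
      simp [weight, abs_of_nonneg (hb0 _)]
    simp only [h3, hbq.tsum_eq]
    exact hq)
  rw [← Complex.ofReal_tsum, hbq.tsum_eq] at h1
  refine ⟨_, Complex.hasSum_re h1, fun u p => ?_⟩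
  have hc := hS.coeff_bound j p.1 p.2 u
  have ha : a j p.1 p.2 1 = ((a j p.1 p.2 1).re : ℂ) := Complex.ext rfl (by simpa using hc.1)
  have e : systemTerm a j r (fun i => (b i : ℂ)) 1 p
      = (((a j p.1 p.2 1).re * r ^ p.1 * p.2.prod fun i e => b i ^ e : ℝ) : ℂ) := by
    rw [systemTerm, ha]
    simp only [Complex.ofReal_mul, Complex.ofReal_pow, Finsupp.prod, Complex.ofReal_prod,
      Complex.ofReal_re]
  rw [e, Complex.ofReal_re, systemTerm, norm_mul, norm_mul, norm_pow, Finsupp.prod, Finsupp.prod,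
    norm_prod]
  have hre : 0 ≤ (a j p.1 p.2 1).re := (norm_nonneg _).trans hc.2
  gcongr with i hi
  · exact hc.2
  · rw [norm_pow]
    exact pow_le_pow_left₀ (norm_nonneg _) (hyb i) _

theorem norm_systemValue_le (hS : PartitionSystem w x₀ y₀ ε c Ft a) (j : ℕ+) (hx : ‖x‖ ≤ r)
    (hr : r < x₀ + ε) (hy : wnorm 0 y ≤ ENNReal.ofReal q) (hq0 : 0 ≤ q) (hq : q < y₀ + ε)
    (u : Circle) : ‖systemValue a j x y u‖ ≤ (Ft j r q).re := by
  obtain ⟨b, hb, hle⟩ := hS.exists_majorant j hx hr hy hq0 hq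
  exact tsum_of_norm_bounded hb (hle u)

theorem systemValue_one (hS : PartitionSystem w x₀ y₀ ε c Ft a) (j : ℕ+) (hx : ‖x‖ < x₀ + ε)
    (hy : wnorm 0 y < ENNReal.ofReal (y₀ + ε)) :
    systemValue a j x y 1 = Ft j x (∑' i, y i) :=
  (hS.partition j x y hx hy).tsum_eq

theorem systemValue_single (hS : PartitionSystem w x₀ y₀ ε c Ft a) (j : ℕ+) {s : ℂ}
    (hx : ‖x‖ < x₀ + ε) (hs : ‖s‖ < y₀ + ε) :
    systemValue a j x (Pi.single 1 s) 1 = Ft j x s := by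
  rw [hS.systemValue_one j hx (mem_domain_single (w := 0) hx hs).2.2, tsum_single_one]

theorem norm_le_re (hS : PartitionSystem w x₀ y₀ ε c Ft a) (j : ℕ+) {s : ℂ} (hx : ‖x‖ ≤ r)
    (hr : r < x₀ + ε) (hs : ‖s‖ ≤ q) (hq : q < y₀ + ε) : ‖Ft j x s‖ ≤ (Ft j r q).re := by
  have hq0 : 0 ≤ q := (norm_nonneg s).trans hs
  rw [← hS.systemValue_single j (hx.trans_lt hr) (hs.trans_lt hq)]
  refine hS.norm_systemValue_le j hx hr ?_ hq0 hq 1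
  rw [wnorm_single]
  exact ENNReal.ofReal_le_ofReal hs

/-- The case `r = 0` of the local bounds, at `t = 0` and the sequence `(s, 0, 0, …)`. -/
theorem wnorm_lt_top (hS : PartitionSystem w x₀ y₀ ε c Ft a) {s : ℂ} (hx : ‖x‖ < x₀ + ε)
    (hs : ‖s‖ < y₀ + ε) : wnorm w (fun j => Ft j x s) < ∞ := by
  obtain ⟨δ, hδ, B, hB⟩ := hS.deriv_bounded 0 (by norm_num) x (Pi.single 1 s) 0
    (mem_domain_single hx hs)
  have h := hB x (Pi.single 1 s) 0 (mem_domain_single hx hs) (by simpa) (by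
    rw [sub_self]
    have : wnorm w 0 = 0 := by simp [wnorm_eq]
    rw [this]
    exact ENNReal.ofReal_pos.2 hδ) (by simpa)
  have e : ∀ j, tDeriv a 0 j x (Pi.single 1 s) 0 = Ft j x s := fun j => by
    rw [tDeriv_zero, Circle.exp_zero, hS.systemValue_single j hx hs]
  simp only [e] at h
  exact h.trans_lt ENNReal.coe_lt_top

theorem wnorm_systemValue_le (hS : PartitionSystem w x₀ y₀ ε c Ft a) (hx : ‖x‖ ≤ r)
    (hr : r < x₀ + ε) (hy : wnorm 0 y ≤ ENNReal.ofReal q) (hq0 : 0 ≤ q) (hq : q < y₀ + ε)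
    (u : Circle) :
    wnorm w (fun j => systemValue a j x y u) ≤ ENNReal.ofReal ‖baseMap w Ft (r, q)‖ := by
  have hr0 : 0 ≤ r := (norm_nonneg x).trans hx
  have h := hS.wnorm_lt_top (x := r) (s := q) (by simpa [abs_of_nonneg hr0] using hr)
    (by simpa [abs_of_nonneg hq0] using hq)
  rw [← wnorm_unweight w, baseMap, unweight_ofSeq h]
  exact wnorm_mono fun j => (hS.norm_systemValue_le j hx hr hy hq0 hq u).trans
    (Complex.re_le_norm _)

/-- A radius below `y₀ + ε` that bounds `‖y‖₁`. -/
theorem exists_radius {b : ℝ} (h : wnorm 0 y < ENNReal.ofReal b) :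
    ∃ q, 0 ≤ q ∧ q < b ∧ wnorm 0 y < ENNReal.ofReal q := by
  obtain ⟨q, h1, h2⟩ := ENNReal.lt_iff_exists_nnreal_btwn.1 h
  refine ⟨q, q.2, ?_, by simpa using h1⟩
  rw [← ENNReal.ofReal_coe_nnreal] at h2
  exact (ENNReal.ofReal_lt_ofReal_iff_of_nonneg q.2).1 h2

theorem wnorm_systemValue_lt_top (hS : PartitionSystem w x₀ y₀ ε c Ft a) (hx : ‖x‖ < x₀ + ε)
    (hy : wnorm 0 y < ENNReal.ofReal (y₀ + ε)) (u : Circle) :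
    wnorm w (fun j => systemValue a j x y u) < ∞ := by
  obtain ⟨q, hq0, hq, hyq⟩ := exists_radius hy
  exact (hS.wnorm_systemValue_le le_rfl hx hyq.le hq0 hq u).trans_lt ENNReal.ofReal_lt_top

theorem norm_systemMap_le (hS : PartitionSystem w x₀ y₀ ε c Ft a) {z : EllOne} (hx : ‖x‖ ≤ r)
    (hr : r < x₀ + ε) (hy : wnorm 0 (unweight w z) ≤ ENNReal.ofReal q) (hq0 : 0 ≤ q)
    (hq : q < y₀ + ε) (u : Circle) : ‖systemMap w a u (x, z)‖ ≤ ‖baseMap w Ft (r, q)‖ :=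
  norm_ofSeq_le (norm_nonneg _) (hS.wnorm_systemValue_le hx hr hy hq0 hq u)

theorem systemMap_apply (hS : PartitionSystem w x₀ y₀ ε c Ft a) {p : ℂ × EllOne}
    (hp : p ∈ systemDomain w x₀ y₀ ε) (u : Circle) (j : ℕ+) :
    systemMap w a u p j = weight w j * systemValue a j p.1 (unweight w p.2) u :=
  ofSeq_apply (hS.wnorm_systemValue_lt_top hp.1 hp.2 u) j

theorem differentiable_unweight (w : ℝ) (j : ℕ+) :
    Differentiable ℂ fun z : EllOne => unweight w z j := by
  have h : (fun z : EllOne => unweight w z j)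
      = fun z => (weight w j : ℂ)⁻¹ * lp.evalCLM ℂ (fun _ : ℕ+ => ℂ) 1 j z := by
    ext z; rw [unweight, div_eq_inv_mul]; rfl
  rw [h]
  exact (ContinuousLinearMap.differentiable _).const_mul _

/-- Each coordinate is a limit of finite sums of monomials under the majorant, and the map is
locally bounded in `ℓ¹` by `‖baseMap w Ft (r, q)‖`. -/
theorem differentiableOn_systemMap (hw : 0 ≤ w) (hS : PartitionSystem w x₀ y₀ ε c Ft a)
    (u : Circle) : DifferentiableOn ℂ (systemMap w a u) (systemDomain w x₀ y₀ ε) := by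
  intro p hp
  refine DifferentiableAt.differentiableWithinAt ?_
  obtain ⟨q, hq0, hq, hyq⟩ := exists_radius hp.2
  obtain ⟨r, hr1, hr2⟩ := exists_between hp.1
  have hU : {p' : ℂ × EllOne | ‖p'.1‖ < r ∧ wnorm 0 (unweight w p'.2) < ENNReal.ofReal q} ∈ 𝓝 p := by
    have := (isOpen_systemDomain hw r q 0).mem_nhds (x := p) (by simpa [systemDomain] using ⟨hr1, hyq⟩)
    simpa [systemDomain] using this
  obtain ⟨ρ, hρ, hsub⟩ := Metric.mem_nhds_iff.1 hU
  have hdom : ∀ p' ∈ ball p ρ, p' ∈ systemDomain w x₀ y₀ ε := fun p' hp' =>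
    ⟨(hsub hp').1.trans hr2, (hsub hp').2.trans_le (ENNReal.ofReal_le_ofReal hq.le)⟩
  refine differentiableAt_ellOne hρ (M := ‖baseMap w Ft (r, q)‖) (fun j => ?_) fun p' hp' =>
    hS.norm_systemMap_le (hsub hp').1.le hr2 (hsub hp').2.le hq0 hq u
  suffices h : DifferentiableOn ℂ
      (fun p' : ℂ × EllOne => systemValue a j p'.1 (unweight w p'.2) u) (ball p ρ) from
    (h.const_mul (weight w j : ℂ)).congr fun p' hp' => hS.systemMap_apply (hdom p' hp') u j
  intro p' hp'
  refine DifferentiableAt.differentiableWithinAt ?_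
  obtain ⟨ρ', hρ', hsub'⟩ := Metric.isOpen_iff.1 isOpen_ball p' hp'
  have hmaj : ∀ p'' ∈ ball p' ρ', _ := fun p'' hp'' => hS.exists_majorant j
    (hsub (hsub' hp'')).1.le hr2 (hsub (hsub' hp'')).2.le hq0 hq
  refine differentiableAt_of_tendsto (l := atTop) (M := (Ft j r q).re)
    (f := fun (T : Finset (ℕ × (ℕ+ →₀ ℕ))) (p' : ℂ × EllOne) =>
      ∑ i ∈ T, systemTerm a j p'.1 (unweight w p'.2) u i) hρ'
    (Eventually.of_forall fun T => ⟨?_, fun p'' hp'' => ?_⟩) fun p'' hp'' => ?_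
  · refine DifferentiableOn.fun_sum fun i _ => Differentiable.differentiableOn ?_
    have h1 : Differentiable ℂ fun p : ℂ × EllOne => a j i.1 i.2 u * p.1 ^ i.1 := by fun_prop
    have h2 : Differentiable ℂ fun p : ℂ × EllOne =>
        ∏ k ∈ i.2.support, unweight w p.2 k ^ i.2 k := by
      induction i.2.support using Finset.cons_induction with
      | empty => simp only [Finset.prod_empty]; exact differentiable_const _
      | cons k T hk ih =>
        simp only [Finset.prod_cons]
        have h3 : Differentiable ℂ fun p : ℂ × EllOne => unweight w p.2 k :=
          (differentiable_unweight w k).comp differentiable_snd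
        exact (h3.pow _).mul ih
    exact h1.mul h2
  · obtain ⟨b, hb, hle⟩ := hmaj p'' hp''
    refine (norm_sum_le _ _).trans ((Finset.sum_le_sum fun i _ => hle u i).trans ?_)
    exact sum_le_hasSum T (fun i _ => (norm_nonneg _).trans (hle u i)) hb
  · obtain ⟨b, hb, hle⟩ := hmaj p'' hp''
    exact (Summable.of_norm_bounded hb.summable (hle u)).hasSum

theorem unweight_smul_single (w : ℝ) (s : ℂ) :
    unweight w (s • lp.single 1 (1 : ℕ+) (1 : ℂ)) = Pi.single 1 s := by
  ext j
  rw [unweight, lp.coeFn_smul, Pi.smul_apply, lp.single_apply]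
  by_cases hj : j = 1
  · subst hj; simp [weight]
  · rw [Pi.single_eq_of_ne hj, Pi.single_eq_of_ne hj, smul_zero, zero_div]

theorem differentiableOn_baseMap (hw : 0 ≤ w) (hS : PartitionSystem w x₀ y₀ ε c Ft a) :
    DifferentiableOn ℂ (baseMap w Ft) (polydisc (x₀ + ε) (y₀ + ε)) := by
  obtain ⟨e, he⟩ : ∃ e : EllOne, ∀ s : ℂ, unweight w (s • e) = Pi.single 1 s :=
    ⟨_, unweight_smul_single w⟩
  have hd : Differentiable ℂ fun p : ℂ × ℂ => (p.1, p.2 • e) := by fun_prop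
  have hm : ∀ p ∈ polydisc (x₀ + ε) (y₀ + ε), (p.1, p.2 • e) ∈ systemDomain w x₀ y₀ ε := by
    intro p hp
    have h := mem_polydisc.1 hp
    refine ⟨h.1, ?_⟩
    rw [he]
    exact (mem_domain_single (w := 0) h.1 h.2).2.2
  refine ((hS.differentiableOn_systemMap hw 1).comp hd.differentiableOn hm).congr fun p hp => ?_
  have h := mem_polydisc.1 hp
  simp only [systemMap, baseMap, Function.comp_apply, he]
  congr 1
  ext j
  exact (hS.systemValue_single j h.1 h.2).symm

theorem systemMap_one (hw : 0 ≤ w) (hS : PartitionSystem w x₀ y₀ ε c Ft a) {p : ℂ × EllOne}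
    (hp : p ∈ systemDomain w x₀ y₀ ε) :
    systemMap w a 1 p = baseMap w Ft (p.1, total w hw p.2) := by
  rw [systemMap, baseMap]
  congr 1
  ext j
  exact hS.systemValue_one j hp.1 hp.2

theorem total_baseMap (hw : 0 ≤ w) (hS : PartitionSystem w x₀ y₀ ε c Ft a) {s : ℂ}
    (hx : ‖x‖ < x₀ + ε) (hs : ‖s‖ < y₀ + ε) :
    total w hw (baseMap w Ft (x, s)) = seriesValue c x s := by
  rw [total_apply, baseMap, unweight_ofSeq (hS.wnorm_lt_top hx hs)]
  exact (hS.sum_eq x s hx hs).tsum_eq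

/-- The numbers `Ft_j(0, q)` have nonnegative real parts summing to `F(0, q) = 0`. These parts all
vanish, and they dominate `F_j(0, y, u)`. -/
theorem systemValue_zero (hF : MainEquation c x₀ y₀ ε) (hS : PartitionSystem w x₀ y₀ ε c Ft a)
    (hy : wnorm 0 y < ENNReal.ofReal (y₀ + ε)) (u : Circle) (j : ℕ+) :
    systemValue a j 0 y u = 0 := by
  have hx : (0 : ℝ) < x₀ + ε := by linarith [hF.x₀_pos, hF.ε_pos]
  obtain ⟨q, hq0, hq, hyq⟩ := exists_radius hy
  have h1 := Complex.hasSum_re (hS.sum_eq (0 : ℝ) q (by simpa) (by simpa [abs_of_nonneg hq0]))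
  have h2 : seriesValue c (0 : ℝ) q = 0 := by
    have h3 : ∀ p : ℕ × ℕ, (c p.1 p.2 : ℂ) * ((0 : ℝ) : ℂ) ^ p.1 * (q : ℂ) ^ p.2 = 0 := by
      rintro ⟨n, k⟩
      rcases n with _ | n
      · simp [hF.zero_left]
      · simp
    simp only [seriesValue, h3, tsum_zero]
  have h4 : ∀ i, ‖systemValue a i 0 y u‖ ≤ (Ft i (0 : ℝ) q).re := fun i =>
    hS.norm_systemValue_le i (by simp) hx hyq.le hq0 hq u
  rw [h2, Complex.zero_re] at h1
  have h5 := congrFun ((hasSum_zero_iff_of_nonneg fun i => (norm_nonneg _).trans (h4 i)).1 h1) j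
  have h6 := h4 j
  rw [h5] at h6
  exact norm_le_zero_iff.1 h6

theorem systemMap_zero (hF : MainEquation c x₀ y₀ ε) (hS : PartitionSystem w x₀ y₀ ε c Ft a)
    {z : EllOne} (hz : wnorm 0 (unweight w z) < ENNReal.ofReal (y₀ + ε)) (u : Circle) :
    systemMap w a u (0, z) = 0 := by
  refine lp.ext (funext fun j => ?_)
  have hx : ‖(0 : ℂ)‖ < x₀ + ε := by rw [norm_zero]; linarith [hF.x₀_pos, hF.ε_pos]
  rw [hS.systemMap_apply (p := (0, z)) ⟨hx, hz⟩, hS.systemValue_zero hF hz u j, mul_zero]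
  rfl

theorem wnorm_zero_le_realValue (hS : PartitionSystem w x₀ y₀ ε c Ft a) {s : ℂ} (hx : ‖x‖ ≤ r)
    (hr : r < x₀ + ε) (hs : ‖s‖ ≤ q) (hq : q < y₀ + ε) :
    wnorm 0 (fun j => Ft j x s) ≤ ENNReal.ofReal (realValue c r q) := by
  have hr0 : 0 ≤ r := (norm_nonneg x).trans hx
  have hq0 : 0 ≤ q := (norm_nonneg s).trans hs
  have h := Complex.hasSum_re (hS.sum_eq r q (by simpa [abs_of_nonneg hr0])
    (by simpa [abs_of_nonneg hq0]))
  rw [seriesValue_ofReal, Complex.ofReal_re] at h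
  have h0 : ∀ j, ‖Ft j x s‖ ≤ (Ft j r q).re := fun j => hS.norm_le_re j hx hr hs hq
  rw [wnorm_zero_eq, ← h.tsum_eq,
    ENNReal.ofReal_tsum_of_nonneg (fun j => (norm_nonneg _).trans (h0 j)) h.summable]
  exact ENNReal.tsum_le_tsum fun j => ENNReal.ofReal_le_ofReal (h0 j)

end PartitionSystem

/-! ### Reduction of the system to a single perturbed equation -/

namespace PartitionSystem

variable {w x₀ y₀ ε : ℝ} {c : ℕ → ℕ → ℝ} {Ft : ℕ+ → ℂ → ℂ → ℂ}
  {a : ℕ+ → ℕ → (ℕ+ →₀ ℕ) → Circle → ℂ} {R S : ℝ}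

theorem unweight_mem_domain {p : ℂ × EllOne}
    (hp : p ∈ systemDomain w x₀ y₀ ε) : (p.1, unweight w p.2) ∈ domain w x₀ y₀ ε :=
  ⟨hp.1, wnorm_unweight_lt_top w p.2, hp.2⟩

/-- The derivatives up to the third order are bounded near `t = 0`, locally in `(x, y)`. -/
theorem eventually_wnorm_tDeriv_le (hw : 0 ≤ w) (hS : PartitionSystem w x₀ y₀ ε c Ft a)
    {p : ℂ × EllOne} (hp : p ∈ systemDomain w x₀ y₀ ε) :
    ∃ B : ℝ, 0 ≤ B ∧ ∀ᶠ q : (ℂ × EllOne) × ℝ in 𝓝 (p, 0), q.1 ∈ systemDomain w x₀ y₀ ε ∧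
      ∀ m ≤ 3, wnorm w (fun j => tDeriv a m j q.1.1 (unweight w q.1.2) q.2)
        ≤ ENNReal.ofReal B := by
  have key : ∀ m : ℕ, ∃ B : ℝ, 0 ≤ B ∧ ∀ᶠ q : (ℂ × EllOne) × ℝ in 𝓝 (p, 0),
      m ≤ 3 → wnorm w (fun j => tDeriv a m j q.1.1 (unweight w q.1.2) q.2)
        ≤ ENNReal.ofReal B := by
    intro m
    by_cases hm : m ≤ 3
    swap
    · exact ⟨0, le_rfl, Eventually.of_forall fun q h => absurd h hm⟩
    obtain ⟨δ, hδ, B, hB⟩ := hS.deriv_bounded m hm p.1 (unweight w p.2) 0 (unweight_mem_domain hp)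
    refine ⟨B, B.2, ?_⟩
    have h1 : ∀ᶠ q : (ℂ × EllOne) × ℝ in 𝓝 (p, 0), q.1 ∈ systemDomain w x₀ y₀ ε :=
      continuousAt_fst.eventually ((isOpen_systemDomain hw x₀ y₀ ε).mem_nhds hp)
    filter_upwards [h1, ball_mem_nhds _ hδ] with q hq hqδ _
    rw [mem_ball, Prod.dist_eq, Prod.dist_eq, max_lt_iff, max_lt_iff, dist_eq_norm, dist_eq_norm,
      dist_eq_norm] at hqδ
    rw [ENNReal.ofReal_coe_nnreal]
    refine hB _ _ _ (unweight_mem_domain hq) hqδ.1.1 ?_ (by simpa using hqδ.2)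
    rw [← unweight_sub, wnorm_unweight]
    exact (ENNReal.ofReal_lt_ofReal_iff hδ).2 hqδ.1.2
  choose B hB0 hB using key
  refine ⟨∑ m ∈ Finset.range 4, B m, Finset.sum_nonneg fun m _ => hB0 m, ?_⟩
  have h1 : ∀ᶠ q : (ℂ × EllOne) × ℝ in 𝓝 (p, 0), q.1 ∈ systemDomain w x₀ y₀ ε :=
    continuousAt_fst.eventually ((isOpen_systemDomain hw x₀ y₀ ε).mem_nhds hp)
  filter_upwards [h1, (eventually_all_finset (Finset.range 4)).2 fun m _ => hB m] with q hq hqB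
  refine ⟨hq, fun m hm => ?_⟩
  have hm' : m ∈ Finset.range 4 := Finset.mem_range.2 (by omega)
  exact (hqB m hm' hm).trans (ENNReal.ofReal_le_ofReal
    (Finset.single_le_sum (fun m _ => hB0 m) hm'))

/-- The `ℓ¹` norm of `Ft(x, s)` is at most `F(R, S)`. The radii are taken close enough to `(x₀, y₀)`
for this to stay below `y₀ + ε`. -/
theorem baseMap_mem_systemDomain (hS : PartitionSystem w x₀ y₀ ε c Ft a) (hR : R < x₀ + ε)
    (hSε : S < y₀ + ε) (hRS : realValue c R S < y₀ + ε) {p : ℂ × ℂ} (h1 : ‖p.1‖ ≤ R)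
    (h2 : ‖p.2‖ ≤ S) (hy : 0 < y₀ + ε) : (p.1, baseMap w Ft p) ∈ systemDomain w x₀ y₀ ε := by
  refine ⟨h1.trans_lt hR, ?_⟩
  simp only [baseMap]
  rw [unweight_ofSeq (hS.wnorm_lt_top (h1.trans_lt hR) (h2.trans_lt hSε))]
  exact (hS.wnorm_zero_le_realValue h1 hR h2 hSε).trans_lt
    ((ENNReal.ofReal_lt_ofReal_iff hy).2 hRS)

/-- The bounds for the derivatives hold uniformly near the compact set of all
`(x, Ft(x, s))` with `|x| ≤ R` and `|s| ≤ S`. -/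
theorem exists_uniform_bound (hw : 0 ≤ w) (hS : PartitionSystem w x₀ y₀ ε c Ft a)
    (hR : R < x₀ + ε) (hSε : S < y₀ + ε) (hRS : realValue c R S < y₀ + ε) (hy : 0 < y₀ + ε) :
    ∃ B : ℝ, 0 ≤ B ∧ ∃ δ > 0, ∀ p : ℂ × ℂ, ‖p.1‖ ≤ R → ‖p.2‖ ≤ S → ∀ v : EllOne, ‖v‖ < δ →
      (p.1, baseMap w Ft p + v) ∈ systemDomain w x₀ y₀ ε ∧ ∀ t : ℝ, |t| < δ → ∀ m ≤ 3,
        wnorm w (fun j => tDeriv a m j p.1 (unweight w (baseMap w Ft p + v)) t)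
          ≤ ENNReal.ofReal B := by
  set K : Set (ℂ × ℂ) := closedBall 0 R ×ˢ closedBall 0 S with hK
  have hKc : IsCompact K := (isCompact_closedBall _ _).prod (isCompact_closedBall _ _)
  have hKm : ∀ p : ℂ × ℂ, p ∈ K ↔ ‖p.1‖ ≤ R ∧ ‖p.2‖ ≤ S := fun p => by simp [hK]
  have hcont : ∀ p ∈ K, ContinuousAt (baseMap w Ft) p := fun p hp =>
    (hS.differentiableOn_baseMap hw).continuousOn.continuousAt
      ((isOpen_polydisc _ _).mem_nhds (mem_polydisc.2
        ⟨((hKm p).1 hp).1.trans_lt hR, ((hKm p).1 hp).2.trans_lt hSε⟩))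
  have key : ∃ B : ℝ, 0 ≤ B ∧ ∃ δ > 0, ∀ p ∈ K, ∀ v : EllOne, ‖v‖ < δ →
      (p.1, baseMap w Ft p + v) ∈ systemDomain w x₀ y₀ ε ∧ ∀ t : ℝ, |t| < δ → ∀ m ≤ 3,
        wnorm w (fun j => tDeriv a m j p.1 (unweight w (baseMap w Ft p + v)) t)
          ≤ ENNReal.ofReal B := by
    -- The hypotheses only give local bounds on an infinite-dimensional domain. They become uniform
    -- because `(x, s)` ranges over a compact set and `baseMap` is continuous.
    refine hKc.induction_on (p := fun s => ∃ B : ℝ, 0 ≤ B ∧ ∃ δ > 0, ∀ p ∈ s, ∀ v : EllOne,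
      ‖v‖ < δ → (p.1, baseMap w Ft p + v) ∈ systemDomain w x₀ y₀ ε ∧ ∀ t : ℝ, |t| < δ → ∀ m ≤ 3,
        wnorm w (fun j => tDeriv a m j p.1 (unweight w (baseMap w Ft p + v)) t)
          ≤ ENNReal.ofReal B) ?_ ?_ ?_ ?_
    · exact ⟨0, le_rfl, 1, one_pos, fun p hp => absurd hp (notMem_empty p)⟩
    · rintro s s' hss ⟨B, hB, δ, hδ, h⟩
      exact ⟨B, hB, δ, hδ, fun p hp => h p (hss hp)⟩
    · rintro s s' ⟨B, hB, δ, hδ, h⟩ ⟨B', hB', δ', hδ', h'⟩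
      refine ⟨max B B', le_max_of_le_left hB, min δ δ', lt_min hδ hδ', ?_⟩
      rintro p (hp | hp) v hv
      · obtain ⟨h1, h2⟩ := h p hp v (hv.trans_le (min_le_left _ _))
        exact ⟨h1, fun t ht m hm => (h2 t (ht.trans_le (min_le_left _ _)) m hm).trans
          (ENNReal.ofReal_le_ofReal (le_max_left _ _))⟩
      · obtain ⟨h1, h2⟩ := h' p hp v (hv.trans_le (min_le_right _ _))
        exact ⟨h1, fun t ht m hm => (h2 t (ht.trans_le (min_le_right _ _)) m hm).trans
          (ENNReal.ofReal_le_ofReal (le_max_right _ _))⟩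
    · intro p hp
      have hpd := hS.baseMap_mem_systemDomain hR hSε hRS ((hKm p).1 hp).1 ((hKm p).1 hp).2 hy
      obtain ⟨B, hB, hev⟩ := hS.eventually_wnorm_tDeriv_le hw hpd
      have hc : ContinuousAt (fun q : (ℂ × ℂ) × (EllOne × ℝ) =>
          (((q.1.1, baseMap w Ft q.1 + q.2.1), q.2.2) : (ℂ × EllOne) × ℝ)) (p, (0, 0)) := by
        have h1 : ContinuousAt (fun q : (ℂ × ℂ) × (EllOne × ℝ) => baseMap w Ft q.1) (p, (0, 0)) :=
          ContinuousAt.comp (g := baseMap w Ft) (f := Prod.fst) (hcont p hp) continuousAt_fst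
        have h2 : ContinuousAt (fun q : (ℂ × ℂ) × (EllOne × ℝ) => q.2.1) (p, (0, 0)) := by fun_prop
        have h3 : ContinuousAt (fun q : (ℂ × ℂ) × (EllOne × ℝ) => q.1.1) (p, (0, 0)) := by fun_prop
        have h4 : ContinuousAt (fun q : (ℂ × ℂ) × (EllOne × ℝ) => q.2.2) (p, (0, 0)) := by fun_prop
        exact (h3.prodMk (h1.add h2)).prodMk h4
      rw [ContinuousAt, add_zero] at hc
      have hev' := hc.eventually hev
      obtain ⟨δ, hδ, hball⟩ := Metric.eventually_nhds_iff_ball.1 hev'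
      refine ⟨ball p δ, mem_nhdsWithin_of_mem_nhds (ball_mem_nhds p hδ), B, hB, δ, hδ,
        fun p' hp' v hv => ?_⟩
      have hmem : ∀ t : ℝ, |t| < δ → (p', (v, t)) ∈ ball (p, ((0 : EllOne), (0 : ℝ))) δ := by
        intro t ht
        rw [mem_ball, Prod.dist_eq, max_lt_iff]
        refine ⟨hp', ?_⟩
        rw [Prod.dist_eq, max_lt_iff]
        exact ⟨by simpa using hv, by simpa using ht⟩
      exact ⟨(hball _ (hmem 0 (by simpa))).1, fun t ht m hm => (hball _ (hmem t ht)).2 m hm⟩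
  obtain ⟨B, hB, δ, hδ, h⟩ := key
  exact ⟨B, hB, δ, hδ, fun p h1 h2 => h p ((hKm p).2 ⟨h1, h2⟩)⟩

/-- The perturbation `F(x, Ft(x, s) + v, e^{it}) - F(x, Ft(x, s) + v, 1)` of the system. -/
def perturbation (w : ℝ) (Ft : ℕ+ → ℂ → ℂ → ℂ) (a : ℕ+ → ℕ → (ℕ+ →₀ ℕ) → Circle → ℂ) (t : ℝ)
    (q : (ℂ × ℂ) × EllOne) : EllOne :=
  systemMap w a (Circle.exp t) (q.1.1, baseMap w Ft q.1 + q.2)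
    - systemMap w a 1 (q.1.1, baseMap w Ft q.1 + q.2)

/-- The derivative of order `m` of `F(x, Ft(x, s) + v, e^{it})` at `t = 0`. -/
def derivMap (w : ℝ) (Ft : ℕ+ → ℂ → ℂ → ℂ) (a : ℕ+ → ℕ → (ℕ+ →₀ ℕ) → Circle → ℂ) (m : ℕ)
    (q : (ℂ × ℂ) × EllOne) : EllOne :=
  ofSeq w fun j => tDeriv a m j q.1.1 (unweight w (baseMap w Ft q.1 + q.2)) 0

/-- The uniform bound on third `t`-derivatives gives the cubic remainder in `ℓ¹`, by way of finite
partial sums. The constant term drops out because the value at `u = 1` is subtracted. -/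
theorem exists_taylorFamily (hw : 0 ≤ w) (hS : PartitionSystem w x₀ y₀ ε c Ft a)
    (hR : R < x₀ + ε) (hSε : S < y₀ + ε) (hRS : realValue c R S < y₀ + ε) (hy : 0 < y₀ + ε) :
    ∃ δ t₁ B : ℝ, TaylorFamily (polydisc R S) δ t₁ B (perturbation w Ft a) (derivMap w Ft a 1)
        (fun q => (2 : ℂ)⁻¹ • derivMap w Ft a 2 q) ∧
      ∀ q ∈ polydisc R S ×ˢ ball (0 : EllOne) δ,
        (q.1.1, baseMap w Ft q.1 + q.2) ∈ systemDomain w x₀ y₀ ε ∧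
        wnorm w (fun j => tDeriv a 1 j q.1.1 (unweight w (baseMap w Ft q.1 + q.2)) 0) < ∞ := by
  obtain ⟨B, hB, δ, hδ, h⟩ := hS.exists_uniform_bound hw hR hSε hRS hy
  have h' : ∀ q ∈ polydisc R S ×ˢ ball (0 : EllOne) δ, _ := fun q hq =>
    h q.1 (mem_polydisc.1 hq.1).1.le (mem_polydisc.1 hq.1).2.le q.2 (by simpa using hq.2)
  have hnorm : ∀ m ≤ 3, ∀ q ∈ polydisc R S ×ˢ ball (0 : EllOne) δ, ‖derivMap w Ft a m q‖ ≤ B :=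
    fun m hm q hq => norm_ofSeq_le hB ((h' q hq).2 0 (by simpa) m hm)
  refine ⟨δ, min δ 1, B, ⟨isOpen_polydisc R S, hδ, lt_min hδ one_pos, min_le_right _ _, hB,
    fun t ht => ?_, hnorm 1 (by norm_num), fun q hq => ?_, fun t ht q hq => ?_⟩, fun q hq =>
    ⟨(h' q hq).1, ((h' q hq).2 0 (by simpa) 1 (by norm_num)).trans_lt ENNReal.ofReal_lt_top⟩⟩
  · have hb : DifferentiableOn ℂ (fun q : (ℂ × ℂ) × EllOne => (q.1.1, baseMap w Ft q.1 + q.2))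
        (polydisc R S ×ˢ ball 0 δ) := by
      have h1 : DifferentiableOn ℂ (fun q : (ℂ × ℂ) × EllOne => baseMap w Ft q.1)
          (polydisc R S ×ˢ ball 0 δ) :=
        (hS.differentiableOn_baseMap hw).comp differentiableOn_fst fun q hq =>
          mem_polydisc.2 ⟨(mem_polydisc.1 hq.1).1.trans hR, (mem_polydisc.1 hq.1).2.trans hSε⟩
      have h2 : DifferentiableOn ℂ (fun q : (ℂ × ℂ) × EllOne => q.1.1)
          (polydisc R S ×ˢ ball 0 δ) := by fun_prop
      exact h2.prodMk (h1.add differentiableOn_snd)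
    exact ((hS.differentiableOn_systemMap hw _).comp hb fun q hq => (h' q hq).1).sub
      ((hS.differentiableOn_systemMap hw _).comp hb fun q hq => (h' q hq).1)
  · rw [norm_smul, norm_inv, Complex.norm_ofNat]
    have := hnorm 2 (by norm_num) q hq
    have := norm_nonneg (derivMap w Ft a 2 q)
    linarith
  · obtain ⟨hq1, hq2⟩ := h' q hq
    set x := q.1.1 with hx
    set y := unweight w (baseMap w Ft q.1 + q.2) with hyd
    have ht' : |t| < δ := ht.trans_le (min_le_left _ _)
    set f : ℕ+ → ℝ → ℂ := fun j s => systemValue a j x y (Circle.exp s) with hf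
    have hfc : ∀ j, ContDiff ℝ 3 (f j) := fun j => hS.contDiff j x y (unweight_mem_domain hq1)
    have hlt : ∀ m ≤ 3, wnorm w (fun j => tDeriv a m j x y 0) < ∞ := fun m hm =>
      (hq2 0 (by simpa) m hm).trans_lt ENNReal.ofReal_lt_top
    refine ellOne_norm_le (by positivity) fun J => ?_
    have hT := sum_norm_sub_taylor_le J (f := fun j s => (weight w j : ℂ) * f j s) hB
      (fun j => contDiff_const.mul (hfc j)) (t₁ := δ) (fun τ hτ => ?_) ht'
    · refine le_trans (le_of_eq (Finset.sum_congr rfl fun j _ => ?_)) hT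
      congr 1
      have e : ∀ m ≤ 3, iteratedDeriv m (fun s => (weight w j : ℂ) * f j s) 0
          = derivMap w Ft a m q j := fun m hm => by
        rw [derivMap, ofSeq_apply (hlt m hm), iteratedDeriv_const_mul_field]
        rfl
      rw [e 1 (by norm_num), e 2 (by norm_num), lp.coeFn_sub, Pi.sub_apply, lp.coeFn_add,
        Pi.add_apply, lp.coeFn_smul, lp.coeFn_smul, lp.coeFn_smul, Pi.smul_apply, Pi.smul_apply,
        Pi.smul_apply, perturbation, lp.coeFn_sub, Pi.sub_apply, hS.systemMap_apply hq1,
        hS.systemMap_apply hq1]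
      simp only [hf, Circle.exp_zero, smul_eq_mul]
      ring
    · simp only [iteratedDeriv_const_mul_field, norm_weight_mul]
      exact sum_le_of_wnorm_le hB (hq2 τ hτ 3 le_rfl) J

theorem perturbation_zero (hF : MainEquation c x₀ y₀ ε) (hS : PartitionSystem w x₀ y₀ ε c Ft a)
    {s : ℂ} {v : EllOne} {t : ℝ}
    (h : ((0 : ℂ), baseMap w Ft (0, s) + v) ∈ systemDomain w x₀ y₀ ε) :
    perturbation w Ft a t ((0, s), v) = 0 := by
  rw [perturbation, hS.systemMap_zero hF h.2, hS.systemMap_zero hF h.2, sub_zero]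

/-- The reduction of the system to the single equation `s = F(x, s) + E t (x, s)`. -/
theorem exists_reduction (hw : 0 ≤ w) (hF : MainEquation c x₀ y₀ ε)
    (hS : PartitionSystem w x₀ y₀ ε c Ft a) (hRx : x₀ < R) (hR : R < x₀ + ε) (hSy : y₀ < S)
    (hSε : S < y₀ + ε) (hRS : realValue c R S < y₀ + ε) :
    ∃ t₂ > 0, ∃ C : ℝ, 0 ≤ C ∧ ∃ E : ℝ → ℂ × ℂ → ℂ, ∃ E₁ E₂ : ℂ × ℂ → ℂ,
      (∀ t : ℝ, |t| < t₂ → Admissible R S C (E t)) ∧ Admissible R S C E₁ ∧ Admissible R S C E₂ ∧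
      (∀ t : ℝ, |t| < t₂ → ∀ p ∈ polydisc R S,
        ‖E t p - (t * E₁ p + t ^ 2 * E₂ p)‖ ≤ C * |t| ^ 3) ∧
      HasSum (fun j => tDeriv a 1 j x₀ (fun i => Ft i x₀ y₀) 0) (E₁ (x₀, y₀)) ∧
      ∀ t : ℝ, |t| < t₂ → ∀ q : ℝ, 0 ≤ q → q < y₀ + ε → ∀ᶠ x : ℂ in 𝓝 0, ∀ y : ℕ+ → ℂ,
        wnorm 0 y ≤ ENNReal.ofReal q → (∀ j, y j = systemValue a j x y (Circle.exp t)) →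
          ‖∑' i, y i‖ < S ∧ seriesValue c x (∑' i, y i) + E t (x, ∑' i, y i) = ∑' i, y i := by
  have hε := hF.ε_pos
  have hx₀ := hF.x₀_pos
  have hy₀ := hF.y₀_pos
  obtain ⟨δ, t₁, B, hN, hdom⟩ := hS.exists_taylorFamily hw hR hSε hRS (by linarith)
  have hδ := hN.δ_pos
  have hB := hN.B_nonneg
  obtain ⟨t₂, ht₂, ht₂₁, v, hv⟩ := hN.exists_fixedPoint
  obtain ⟨C, hC, e₂, he⟩ := hN.exists_taylor_fixedPoint ht₂₁ fun t ht p hp =>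
    ⟨((hv t ht).2 p hp).1, ((hv t ht).2 p hp).2.1, ((hv t ht).2 p hp).2.2.1⟩
  obtain ⟨hd₁, hd₂⟩ := differentiableOn_of_taylor (isOpen_polydisc R S) (f₂ := e₂) ht₂
    (ht₂₁.trans hN.t₁_le) hC (fun t ht => (hv t ht).1) (fun p hp => (he p hp).1)
    (fun p hp => (he p hp).2.1) fun t ht p hp => (he p hp).2.2 t ht
  set σ := total w hw with hσ
  have hlin : ∀ z : EllOne, ‖σ z‖ ≤ ‖z‖ := norm_total_le hw
  have hv0 : ∀ t : ℝ, |t| < t₂ → ∀ s : ℂ, ‖s‖ < S → v t (0, s) = 0 := by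
    intro t ht s hs
    have hp : ((0 : ℂ), s) ∈ polydisc R S := mem_polydisc.2 ⟨by simp; linarith, hs⟩
    obtain ⟨-, h2, h3, -⟩ := (hv t ht).2 _ hp
    rw [← h3]
    exact hS.perturbation_zero hF
      (hdom ((0, s), v t (0, s)) ⟨hp, by rw [mem_ball_zero_iff]; linarith⟩).1
  -- Since `v t` vanishes at `x = 0` for all small `t`, so do its Taylor coefficients, as dividing
  -- the expansion by `t` and then by `t²` shows.
  have he0 : ∀ s : ℂ, ‖s‖ < S → derivMap w Ft a 1 ((0, s), 0) = 0 ∧ e₂ (0, s) = 0 := by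
    intro s hs
    have hp : ((0 : ℂ), s) ∈ polydisc R S := mem_polydisc.2 ⟨by simp; linarith, hs⟩
    have hev : ∀ᶠ t : ℝ in 𝓝[>] 0, 0 < t ∧ |t| < t₂ := by
      filter_upwards [self_mem_nhdsWithin, nhdsWithin_le_nhds (Iio_mem_nhds ht₂)] with t h0 h1
      exact ⟨h0, by rw [abs_of_pos h0]; exact h1⟩
    have hb : ∀ t : ℝ, |t| < t₂ → ‖(t : ℂ) • derivMap w Ft a 1 ((0, s), 0)
        + (t : ℂ) ^ 2 • e₂ (0, s)‖ ≤ C * |t| ^ 3 := fun t ht => by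
      have := (he _ hp).2.2 t ht
      rwa [hv0 t ht s hs, zero_sub, norm_neg] at this
    have h1 : derivMap w Ft a 1 ((0, s), 0) = 0 := by
      have hl : Tendsto (fun t : ℝ => C * t ^ 2 + t * C) (𝓝[>] 0) (𝓝 0) :=
        (Continuous.tendsto' (by fun_prop) _ _ (by simp)).mono_left nhdsWithin_le_nhds
      refine norm_le_zero_iff.1 (ge_of_tendsto hl ?_)
      filter_upwards [hev] with t ht
      have h2 := norm_sub_le ((t : ℂ) • derivMap w Ft a 1 ((0, s), 0) + (t : ℂ) ^ 2 • e₂ (0, s))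
        ((t : ℂ) ^ 2 • e₂ (0, s))
      rw [add_sub_cancel_right, norm_smul, norm_smul, norm_pow, Complex.norm_real,
        Real.norm_of_nonneg ht.1.le] at h2
      have h3 := hb t ht.2
      rw [abs_of_pos ht.1] at h3
      have h4 : t ^ 2 * ‖e₂ (0, s)‖ ≤ t ^ 2 * C := by gcongr; exact (he _ hp).2.1
      have h5 : t * ‖derivMap w Ft a 1 ((0, s), 0)‖ ≤ t * (C * t ^ 2 + t * C) := by nlinarith
      exact le_of_mul_le_mul_left h5 ht.1
    refine ⟨h1, ?_⟩
    have hl : Tendsto (fun t : ℝ => C * t) (𝓝[>] 0) (𝓝 0) :=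
      (Continuous.tendsto' (by fun_prop) _ _ (by simp)).mono_left nhdsWithin_le_nhds
    refine norm_le_zero_iff.1 (ge_of_tendsto hl ?_)
    filter_upwards [hev] with t ht
    have h3 := hb t ht.2
    rw [h1, smul_zero, zero_add, norm_smul, norm_pow, Complex.norm_real,
      Real.norm_of_nonneg ht.1.le, abs_of_pos ht.1] at h3
    exact le_of_mul_le_mul_left (h3.trans_eq (by ring) : t ^ 2 * _ ≤ t ^ 2 * (C * t))
      (by have := ht.1; positivity)
  have hcomp : ∀ {g : ℂ × ℂ → EllOne}, DifferentiableOn ℂ g (polydisc R S) →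
      DifferentiableOn ℂ (fun p => σ (g p)) (polydisc R S) := fun hg =>
    σ.differentiable.comp_differentiableOn hg
  -- `C` bounds the Taylor coefficients and the remainder, while `δ` bounds the fixed point itself.
  have hC' : C ≤ max C δ := le_max_left _ _
  refine ⟨t₂, ht₂, max C δ, hC.trans hC', fun t p => σ (v t p), fun p => σ (derivMap w Ft a 1 (p, 0)),
    fun p => σ (e₂ p), fun t ht => ⟨hcomp (hv t ht).1, fun p hp => ?_, fun s hs => ?_⟩,
    ⟨hcomp hd₁, fun p hp => ((hlin _).trans (he p hp).1).trans hC', fun s hs => ?_⟩,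
    ⟨hcomp hd₂, fun p hp => ((hlin _).trans (he p hp).2.1).trans hC', fun s hs => ?_⟩,
    fun t ht p hp => ?_, ?_, ?_⟩
  · refine (hlin _).trans (le_trans ?_ (le_max_right C δ))
    linarith [((hv t ht).2 p hp).2.1]
  · simp only [hv0 t ht s hs, map_zero]
  · simp only [(he0 s hs).1, map_zero]
  · simp only [(he0 s hs).2, map_zero]
  · have h1 := (hlin _).trans ((he p hp).2.2 t ht)
    rw [map_sub, map_add, map_smul, map_smul, smul_eq_mul, smul_eq_mul] at h1
    exact h1.trans (by gcongr)
  · have hp : ((x₀ : ℂ), (y₀ : ℂ)) ∈ polydisc R S := mem_polydisc.2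
      ⟨by simpa [abs_of_pos hx₀], by simpa [abs_of_pos hy₀]⟩
    have h1 := (hdom (((x₀ : ℂ), (y₀ : ℂ)), 0) ⟨hp, mem_ball_self hδ⟩).2
    have h2 := wnorm_zero_le hw _ |>.trans_lt h1
    have h3 : unweight w (baseMap w Ft ((x₀ : ℂ), (y₀ : ℂ)) + 0) = fun i => Ft i x₀ y₀ := by
      rw [add_zero, baseMap, unweight_ofSeq (hS.wnorm_lt_top
        ((mem_polydisc.1 hp).1.trans hR) ((mem_polydisc.1 hp).2.trans hSε))]
    change HasSum _ (∑' j, unweight w (derivMap w Ft a 1 (((x₀ : ℂ), (y₀ : ℂ)), 0)) j)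
    rw [derivMap, unweight_ofSeq h1]
    simp only [h3] at h2 ⊢
    exact (summable_norm_of_wnorm h2).of_norm.hasSum
  · intro t ht q hq0 hq
    have hx0 : ((0 : ℂ), (q : ℂ)) ∈ polydisc (x₀ + ε) (y₀ + ε) := mem_polydisc.2
      ⟨by simp; linarith, by simpa [abs_of_nonneg hq0]⟩
    -- A solution `y` of the system with `‖y‖₁ ≤ q` is bounded by this quantity. For small `x` every
    -- such solution is therefore small enough to be captured by the local fixed point.
    have hlim : Tendsto (fun x : ℂ => ‖baseMap w Ft ((‖x‖ : ℝ), q)‖) (𝓝 0) (𝓝 0) := by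
      have h1 := ((hS.differentiableOn_baseMap hw).continuousOn.continuousAt
        ((isOpen_polydisc _ _).mem_nhds hx0))
      have h2 : baseMap w Ft (0, (q : ℂ)) = 0 := by
        have h3 : ∀ z, z = wnorm 0 (Pi.single (1 : ℕ+) (q : ℂ)) → z < ENNReal.ofReal (y₀ + ε) :=
          fun z hz => hz ▸ (mem_domain_single (w := 0) (x₀ := x₀) (ε := ε) (mem_polydisc.1 hx0).1
            (mem_polydisc.1 hx0).2).2.2
        refine lp.ext (funext fun j => ?_)
        rw [baseMap, ofSeq_apply (hS.wnorm_lt_top (mem_polydisc.1 hx0).1 (mem_polydisc.1 hx0).2)]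
        change (weight w j : ℂ) * Ft j 0 q = 0
        rw [← hS.systemValue_single j (mem_polydisc.1 hx0).1 (mem_polydisc.1 hx0).2,
          hS.systemValue_zero hF (h3 _ rfl), mul_zero]
      have h3 : Tendsto (fun x : ℂ => (((‖x‖ : ℝ) : ℂ), (q : ℂ))) (𝓝 0) (𝓝 (0, (q : ℂ))) :=
        Continuous.tendsto' (by fun_prop) _ _ (by simp)
      have h4 := (h1.tendsto.comp h3).norm
      rwa [h2, norm_zero] at h4
    filter_upwards [hlim.eventually_lt_const (by positivity : 0 < δ / 4),
      hlim.eventually_lt_const (hy₀.trans hSy),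
      ball_mem_nhds (0 : ℂ) (by linarith : 0 < R)] with x hx1 hx2 hxR y hy hsol
    have hxR' : ‖x‖ < R := by simpa using hxR
    have hxε := hxR'.trans hR
    have hyε : wnorm 0 y < ENNReal.ofReal (y₀ + ε) :=
      hy.trans_lt ((ENNReal.ofReal_lt_ofReal_iff (by linarith)).2 hq)
    -- Only `‖y‖₁` is controlled at first; the equation itself puts `y` into the weighted space.
    have hyw : wnorm w y < ∞ := by
      rw [show y = fun j => systemValue a j x y (Circle.exp t) from funext hsol]
      exact hS.wnorm_systemValue_lt_top hxε hyε _
    set z := ofSeq w y with hz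
    have hzy : unweight w z = y := unweight_ofSeq hyw
    set s := ∑' i, y i with hs
    have hσz : σ z = s := by rw [hσ, total_apply, hzy]
    have hzd : (x, z) ∈ systemDomain w x₀ y₀ ε := ⟨hxε, by simpa only [hzy] using hyε⟩
    have hsys : systemMap w a (Circle.exp t) (x, z) = z := by
      refine lp.ext (funext fun j => ?_)
      rw [hS.systemMap_apply hzd, hz, ofSeq_apply hyw]
      change (weight w j : ℂ) * systemValue a j x (unweight w z) (Circle.exp t) = weight w j * y j
      rw [hzy, ← hsol j]
    have hbd : ∀ u, ‖systemMap w a u (x, z)‖ ≤ ‖baseMap w Ft ((‖x‖ : ℝ), q)‖ := fun u =>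
      hS.norm_systemMap_le le_rfl hxε (by rw [hzy]; exact hy) hq0 hq u
    have hone : systemMap w a 1 (x, z) = baseMap w Ft (x, s) := by
      rw [hS.systemMap_one hw hzd, ← hσ, hσz]
    have hzb := hbd (Circle.exp t)
    rw [hsys] at hzb
    have hsS : ‖s‖ < S := by
      rw [← hσz]; exact ((hlin z).trans hzb).trans_lt hx2
    refine ⟨hsS, ?_⟩
    have hp : (x, s) ∈ polydisc R S := mem_polydisc.2 ⟨hxR', hsS⟩
    -- The difference is a small fixed point of the perturbation, hence equal to `v t (x, s)` by
    -- uniqueness. Taking totals yields the scalar equation.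
    have hfix : z - baseMap w Ft (x, s) = v t (x, s) := by
      refine ((hv t ht).2 _ hp).2.2.2 _ ?_ ?_
      · refine (norm_sub_le _ _).trans_lt ?_
        have := hbd 1
        rw [hone] at this
        linarith
      · rw [perturbation, add_sub_cancel, hsys, hone]
    rw [← hfix, map_sub, hσz, hσ, hS.total_baseMap hw hxε (hsS.trans hSε)]
    ring

end PartitionSystem

/-! ### The Banach space of perturbations -/

section HoloSpace

/-- The bounded functions on `ℂ × ℂ` that are holomorphic on the polydisc and vanish there
for `x = 0`. -/
def holoSubmodule (R S : ℝ) : Submodule ℂ (lp (fun _ : ℂ × ℂ => ℂ) ∞) where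
  carrier := {f | DifferentiableOn ℂ (f : ℂ × ℂ → ℂ) (polydisc R S) ∧ ∀ s, ‖s‖ < S → f (0, s) = 0}
  add_mem' := fun {f g} hf hg => ⟨by rw [lp.coeFn_add]; exact hf.1.add hg.1, fun s hs => by
    rw [lp.coeFn_add, Pi.add_apply, hf.2 s hs, hg.2 s hs, add_zero]⟩
  zero_mem' := ⟨by rw [lp.coeFn_zero]; exact differentiableOn_const 0, fun s hs => rfl⟩
  smul_mem' := fun a f hf => ⟨by rw [lp.coeFn_smul]; exact hf.1.const_smul a, fun s hs => by
    rw [lp.coeFn_smul, Pi.smul_apply, hf.2 s hs, smul_zero]⟩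

abbrev HoloSpace (R S : ℝ) := holoSubmodule R S

variable {R S M : ℝ}

/-- The evaluation at a point. -/
def evalAt (R S : ℝ) (p : ℂ × ℂ) : HoloSpace R S →L[ℂ] ℂ :=
  (lp.evalCLM ℂ (fun _ : ℂ × ℂ => ℂ) ∞ p).comp (holoSubmodule R S).subtypeL

theorem norm_evalAt_le (p : ℂ × ℂ) (h : HoloSpace R S) : ‖evalAt R S p h‖ ≤ ‖h‖ :=
  lp.norm_apply_le_norm (by simp) h.1 p

theorem differentiableOn_evalAt (h : HoloSpace R S) :
    DifferentiableOn ℂ (fun p => evalAt R S p h) (polydisc R S) := h.2.1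

/-- Norm limits are pointwise limits of uniformly bounded holomorphic functions, so the subspace is
closed. The implicit function theorem in this space needs completeness. -/
instance : CompleteSpace (HoloSpace R S) := by
  refine IsClosed.completeSpace_coe (hs := IsSeqClosed.isClosed fun f g hf hfg => ?_)
  have hpt : ∀ p, Tendsto (fun n => f n p) atTop (𝓝 (g p)) := fun p =>
    ((lp.evalCLM ℂ (fun _ : ℂ × ℂ => ℂ) ∞ p).continuous.tendsto g).comp hfg
  refine ⟨fun p hp => ?_, fun s hs => ?_⟩
  · obtain ⟨r, hr, hsub⟩ := Metric.isOpen_iff.1 (isOpen_polydisc R S) p hp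
    refine (differentiableAt_of_tendsto (l := atTop) (M := ‖g‖ + 1) hr
      (f := fun n p => f n p) ?_ fun q _ => hpt q).differentiableWithinAt
    filter_upwards [hfg.norm.eventually_lt_const (lt_add_one ‖g‖)] with n hn
    exact ⟨(hf n).1.mono hsub, fun q _ => (lp.norm_apply_le_norm (by simp) (f n) q).trans hn.le⟩
  · refine tendsto_nhds_unique (hpt (0, s)) (tendsto_const_nhds.congr fun n => ?_)
    exact ((hf n).2 s hs).symm

/-- The element of the space of holomorphic functions given by the restriction of `E` to the
polydisc. -/
theorem Admissible.exists_holoSpace {E : ℂ × ℂ → ℂ} (hE : Admissible R S M E) :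
    ∃ h : HoloSpace R S, ∀ p, evalAt R S p h = (polydisc R S).indicator E p := by
  classical
  have hm : Memℓp ((polydisc R S).indicator E) ∞ := memℓp_infty ⟨max M 0, by
    rintro _ ⟨p, rfl⟩
    by_cases hp : p ∈ polydisc R S
    · simp only [indicator_of_mem hp]; exact (hE.bound p hp).trans (le_max_left _ _)
    · simp only [indicator_of_notMem hp, norm_zero]; exact le_max_right _ _⟩
  refine ⟨⟨⟨_, hm⟩, ?_, fun s hs => ?_⟩, fun p => rfl⟩
  · exact hE.diff.congr fun p hp => indicator_of_mem hp E
  · change (polydisc R S).indicator E (0, s) = 0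
    by_cases hp : ((0 : ℂ), s) ∈ polydisc R S
    · rw [indicator_of_mem hp, hE.zero s hs]
    · rw [indicator_of_notMem hp]

theorem norm_holoSpace_le {h : HoloSpace R S} {C : ℝ} (hC : 0 ≤ C)
    (hb : ∀ p, ‖evalAt R S p h‖ ≤ C) : ‖h‖ ≤ C :=
  lp.norm_le_of_forall_le hC hb

/-- Write `h(p) = h₀(p) + (h - h₀)(p₀) + ((h - h₀)(p) - (h - h₀)(p₀))`. The first two terms are
holomorphic in one variable each, and the third is quadratically small by the Cauchy estimate. -/
theorem differentiableAt_evalAt {h₀ : HoloSpace R S} {p₀ : ℂ × ℂ} (hp₀ : p₀ ∈ polydisc R S) :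
    DifferentiableAt ℂ (fun q : HoloSpace R S × (ℂ × ℂ) => evalAt R S q.2 q.1) (h₀, p₀) := by
  obtain ⟨r, hr, hsub⟩ := Metric.isOpen_iff.1 (isOpen_polydisc R S) p₀ hp₀
  have h1 : DifferentiableAt ℂ (fun q : HoloSpace R S × (ℂ × ℂ) => evalAt R S q.2 h₀) (h₀, p₀) :=
    DifferentiableAt.comp (g := fun p => evalAt R S p h₀) (f := Prod.snd) (h₀, p₀)
      ((differentiableOn_evalAt h₀).differentiableAt ((isOpen_polydisc R S).mem_nhds hp₀))
      differentiableAt_snd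
  have h2 : DifferentiableAt ℂ (fun q : HoloSpace R S × (ℂ × ℂ) => evalAt R S p₀ (q.1 - h₀))
      (h₀, p₀) := (evalAt R S p₀).differentiableAt.comp (f := fun q : HoloSpace R S × (ℂ × ℂ) =>
        q.1 - h₀) (h₀, p₀) (by fun_prop)
  have h3 : HasFDerivAt (𝕜 := ℂ) (fun q : HoloSpace R S × (ℂ × ℂ) =>
      evalAt R S q.2 (q.1 - h₀) - evalAt R S p₀ (q.1 - h₀)) 0 (h₀, p₀) := by
    refine IsBigO.hasFDerivAt (n := 2) (IsBigO.of_bound (2 / r) ?_) one_lt_two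
    have hev : ∀ᶠ q : HoloSpace R S × (ℂ × ℂ) in 𝓝 (h₀, p₀), q.2 ∈ ball p₀ r :=
      continuousAt_snd.eventually (ball_mem_nhds p₀ hr)
    filter_upwards [hev] with q hq
    have := norm_sub_le_of_bounded (f := fun p => evalAt R S p (q.1 - h₀)) (w := p₀) (z := q.2) hr
      ((differentiableOn_evalAt _).mono hsub) (fun p _ => norm_evalAt_le p _) (norm_evalAt_le _ _)
    refine this.trans ?_
    have e1 : ‖q.1 - h₀‖ ≤ ‖q - (h₀, p₀)‖ := norm_fst_le (q - (h₀, p₀))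
    have e2 : ‖q.2 - p₀‖ ≤ ‖q - (h₀, p₀)‖ := norm_snd_le (q - (h₀, p₀))
    rw [norm_pow, norm_norm]
    calc 2 * ‖q.1 - h₀‖ / r * ‖q.2 - p₀‖
        ≤ 2 * ‖q - (h₀, p₀)‖ / r * ‖q - (h₀, p₀)‖ := by gcongr
      _ = _ := by ring
  refine ((h1.add h2).add h3.differentiableAt).congr_of_eventuallyEq
    (Eventually.of_forall fun q => ?_)
  change evalAt R S q.2 q.1 = evalAt R S q.2 h₀ + evalAt R S p₀ (q.1 - h₀)
    + (evalAt R S q.2 (q.1 - h₀) - evalAt R S p₀ (q.1 - h₀))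
  rw [ContinuousLinearMap.map_sub (evalAt R S q.2)]
  ring

/-- The family `F + h`, where `h` runs through the bounded holomorphic functions. -/
def addFamily (F : ℂ × ℂ → ℂ) (h : HoloSpace R S) (p : ℂ × ℂ) : ℂ := F p + evalAt R S p h

theorem Admissible.addFamily {F : ℂ × ℂ → ℂ} (hF : Admissible R S M F) (h : HoloSpace R S) :
    Admissible R S (M + ‖h‖) (addFamily F h) where
  diff := hF.diff.add (differentiableOn_evalAt h)
  bound p hp := (norm_add_le _ _).trans (add_le_add (hF.bound p hp) (norm_evalAt_le p h))
  zero s hs := by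
    rw [InfiniteSystem.addFamily, hF.zero s hs, zero_add]
    exact h.2.2 s hs

theorem addFamily_zero (F : ℂ × ℂ → ℂ) : addFamily F (0 : HoloSpace R S) = F := by
  ext p; rw [addFamily, ContinuousLinearMap.map_zero, add_zero]

theorem CriticalPoint.holomorphicFamily {x₀ y₀ A B : ℝ} {F : ℂ × ℂ → ℂ}
    (hF : CriticalPoint R S x₀ y₀ A B F) (hF' : Admissible R S M F) :
    HolomorphicFamily 1 R S (M + 1) x₀ y₀ A B
      (InfiniteSystem.addFamily (R := R) (S := S) F) where
  r_pos := one_pos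
  diff q hq := by
    refine DifferentiableAt.differentiableWithinAt ?_
    have h1 : DifferentiableAt ℂ (fun q : HoloSpace R S × (ℂ × ℂ) => F q.2) q :=
      DifferentiableAt.comp (g := F) (f := Prod.snd) q
        (hF.diff.differentiableAt ((isOpen_polydisc R S).mem_nhds hq.2)) differentiableAt_snd
    exact h1.add (differentiableAt_evalAt hq.2)
  adm h hh := by
    have h1 := hF'.addFamily h
    have h2 : ‖h‖ ≤ 1 := (by simpa using hh : ‖h‖ < 1).le
    exact ⟨h1.diff, fun p hp => (h1.bound p hp).trans (by linarith), h1.zero⟩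
  crit := by rwa [addFamily_zero]

theorem fderiv_addFamily (F : ℂ × ℂ → ℂ) (p : ℂ × ℂ) (h v : HoloSpace R S) :
    fderiv ℂ (fun h => addFamily F h p) h v = evalAt R S p v := by
  simp only [addFamily]
  rw [fderiv_const_add, ContinuousLinearMap.fderiv]

end HoloSpace

/-! ### Power series of the system, generating functions, and the main theorem -/

section Coefficients

/-- The power series of `∑_j y_j(x, u)` are the solutions of the reduced equation. -/
theorem IsSolution.solCoeff_eq {y₀ ε R S M r : ℝ} {a : ℕ+ → ℕ → (ℕ+ →₀ ℕ) → Circle → ℂ}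
    {Y : ℕ+ → Circle → PowerSeries ℂ} {y : Circle → PowerSeries ℂ} (hY : IsSolution y₀ ε a Y)
    (hy : ∀ u n, HasSum (fun j => (Y j u).coeff n) ((y u).coeff n)) {E : ℂ × ℂ → ℂ}
    (hE : Admissible R S M E) (hr : SmallRadius R S M y₀ r) {u : Circle}
    (hred : ∀ q : ℝ, 0 ≤ q → q < y₀ + ε → ∀ᶠ x : ℂ in 𝓝 0, ∀ z : ℕ+ → ℂ,
      wnorm 0 z ≤ ENNReal.ofReal q → (∀ j, z j = systemValue a j x z u) →
        ‖∑' i, z i‖ < S ∧ E (x, ∑' i, z i) = ∑' i, z i) (n : ℕ) :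
    solCoeff E n = (y u).coeff n := by
  obtain ⟨ρ, hρ, hsum, hsol⟩ := hY u
  set Q := ∑' j : ℕ+, ∑' n : ℕ, ‖(Y j u).coeff n‖ₑ * (ρ : ℝ≥0∞) ^ n with hQ
  have hQt : Q ≠ ∞ := (hsum.trans ENNReal.ofReal_lt_top).ne
  have hSum : Summable fun p : ℕ+ × ℕ => ‖(Y p.1 u).coeff p.2‖ * (ρ : ℝ) ^ p.2 := by
    have h1 : ∑' p : ℕ+ × ℕ, ‖(Y p.1 u).coeff p.2‖ₑ * (ρ : ℝ≥0∞) ^ p.2 ≠ ∞ := by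
      rw [ENNReal.tsum_prod (f := fun j n => ‖(Y j u).coeff n‖ₑ * (ρ : ℝ≥0∞) ^ n)]; exact hQt
    simpa using ENNReal.summable_toReal h1
  set z : ℂ → ℕ+ → ℂ := fun x j => ∑' n : ℕ, (Y j u).coeff n * x ^ n with hz
  have hx1 : ∀ x : ℂ, ‖x‖ < ρ →
      HasSum (fun n => (y u).coeff n * x ^ n) (∑' j, z x j) := by
    intro x hx
    have h1 : Summable fun p : ℕ+ × ℕ => (Y p.1 u).coeff p.2 * x ^ p.2 := by
      refine Summable.of_norm_bounded hSum fun p => ?_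
      rw [norm_mul, norm_pow]
      gcongr
    have h2 := h1.hasSum.prod_fiberwise fun j => (h1.prod_factor j).hasSum
    have h3 := ((Equiv.prodComm ℕ ℕ+).hasSum_iff
      (f := fun p : ℕ+ × ℕ => (Y p.1 u).coeff p.2 * x ^ p.2)).2 h1.hasSum
    have h4 := h3.prod_fiberwise (g := fun n => (y u).coeff n * x ^ n) fun n =>
      (hy u n).mul_right (x ^ n)
    rw [hz, h2.tsum_eq]
    exact h4
  have hx2 : ∀ x : ℂ, ‖x‖ < ρ → wnorm 0 (z x) ≤ ENNReal.ofReal Q.toReal := by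
    intro x hx
    rw [ENNReal.ofReal_toReal hQt, wnorm_zero_eq, hQ]
    refine ENNReal.tsum_le_tsum fun j => ?_
    rw [ofReal_norm]
    refine (enorm_tsum_le_tsum_enorm).trans (ENNReal.tsum_le_tsum fun n => ?_)
    rw [enorm_mul, enorm_pow]
    gcongr
    rw [← ofReal_norm, ← ENNReal.ofReal_coe_nnreal]
    exact ENNReal.ofReal_le_ofReal hx.le
  have hball := ball_mem_nhds (0 : ℂ) (by exact_mod_cast hρ : (0 : ℝ) < ρ)
  rw [hE.solCoeff_eq hr (f := fun x => ∑' j, z x j) ?_ n]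
  · refine inv_factorial_mul_iteratedDeriv_of_hasSum (a := fun n => (y u).coeff n) ?_ n
    filter_upwards [hball] with x hx using hx1 x (by simpa using hx)
  · filter_upwards [hball, hred Q.toReal ENNReal.toReal_nonneg
      (ENNReal.toReal_lt_of_lt_ofReal hsum)] with x hx hxr
    have hx' : ‖x‖ < ρ := by simpa using hx
    exact hxr (z x) (hx2 x hx') fun j => hsol x hx' j

/-- The characteristic functions of random variables with a given generating function. -/
theorem HasGeneratingFunction.charFun_eq {Ω : ℕ → Type*} [∀ n, MeasurableSpace (Ω n)]
    {P : ∀ n, Measure (Ω n)} {X : ∀ n, Ω n → ℝ} {g : Circle → PowerSeries ℂ}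
    (h : HasGeneratingFunction P X g) (hX : ∀ n, AEMeasurable (X n) (P n)) {n : ℕ}
    (hn : (g 1).coeff n ≠ 0) (t : ℝ) :
    charFun ((P n).map (X n)) t = (g (Circle.exp t)).coeff n / (g 1).coeff n := by
  rw [← h n hn t, charFun_apply_real, integral_map (hX n) (by fun_prop)]
  refine integral_congr_ae (Eventually.of_forall fun ω => ?_)
  simp only
  congr 1
  ring

end Coefficients

/-- Radii slightly above `x₀` and `y₀`. -/
theorem MainEquation.exists_radii {c : ℕ → ℕ → ℝ} {x₀ y₀ ε : ℝ} (hF : MainEquation c x₀ y₀ ε) :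
    ∃ R S : ℝ, x₀ < R ∧ R < x₀ + ε ∧ y₀ < S ∧ S < y₀ + ε ∧ realValue c R S < y₀ + ε := by
  have hε := hF.ε_pos
  have hx := hF.x₀_pos
  have hy := hF.y₀_pos
  have hadm := hF.admissible (R := x₀ + ε / 2) (S := y₀ + ε / 2) (by linarith) (by linarith)
    (by linarith) (by linarith)
  have hp : ((x₀ : ℂ), (y₀ : ℂ)) ∈ polydisc (x₀ + ε / 2) (y₀ + ε / 2) := mem_polydisc.2
    ⟨by simp [abs_of_pos hx]; linarith, by simp [abs_of_pos hy]; linarith⟩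
  have h1 := (hadm.diff.continuousOn.continuousAt ((isOpen_polydisc _ _).mem_nhds hp)).tendsto
  have h2 : Tendsto (fun h : ℝ => (((x₀ + h : ℝ) : ℂ), ((y₀ + h : ℝ) : ℂ))) (𝓝[>] 0)
      (𝓝 ((x₀ : ℂ), (y₀ : ℂ))) :=
    (Continuous.tendsto' (by fun_prop) _ _ (by simp)).mono_left nhdsWithin_le_nhds
  have h3 := (Complex.continuous_re.tendsto _).comp (h1.comp h2)
  simp only [hF.eq_point, Complex.ofReal_re] at h3
  have h4 : ∀ᶠ h : ℝ in 𝓝[>] 0, 0 < h := self_mem_nhdsWithin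
  have h5 : ∀ᶠ h : ℝ in 𝓝[>] 0, h < ε := nhdsWithin_le_nhds (Iio_mem_nhds hε)
  obtain ⟨h, hlt, hh0, hhε⟩ := ((h3.eventually_lt_const (by linarith : y₀ < y₀ + ε)).and
    (h4.and h5)).exists
  refine ⟨x₀ + h, y₀ + h, by linarith, by linarith, by linarith, by linarith, ?_⟩
  simpa only [Function.comp_apply, seriesValue_ofReal, Complex.ofReal_re] using hlt

end

end InfiniteSystem

theorem mainTheorem2 (w x₀ y₀ ε : ℝ) (hw : 0 ≤ w) (c : ℕ → ℕ → ℝ) (Ft : ℕ+ → ℂ → ℂ → ℂ)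
    (a : ℕ+ → ℕ → (ℕ+ →₀ ℕ) → Circle → ℂ)
    (Y : ℕ+ → Circle → PowerSeries ℂ) (y : Circle → PowerSeries ℂ)
    (hF : InfiniteSystem.MainEquation c x₀ y₀ ε)
    (hS : InfiniteSystem.PartitionSystem w x₀ y₀ ε c Ft a)
    (hY : InfiniteSystem.IsSolution y₀ ε a Y)
    (hy : ∀ u n, HasSum (fun j => (Y j u).coeff n) ((y u).coeff n))
    (hper : InfiniteSystem.Aperiodic (y 1)) :
    ∃ μ σsq : ℝ, 0 ≤ σsq ∧
      (0 < μ ↔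
        0 < ∑' j : ℕ+, (InfiniteSystem.tDeriv a 1 j x₀ (fun i => Ft i x₀ y₀) 0).im) ∧
      (∀ (Ω : ℕ → Type*) [∀ n, MeasurableSpace (Ω n)] (P : ∀ n, Measure (Ω n))
        [∀ n, IsProbabilityMeasure (P n)] (X : ∀ n, Ω n → ℝ),
        (∀ n, AEMeasurable (X n) (P n)) →
        InfiniteSystem.HasGeneratingFunction P X y →
        InfiniteSystem.SatisfiesCLT P X μ σsq) ∧
      (∀ (Ω : ℕ → Type*) [∀ n, MeasurableSpace (Ω n)] (P : ∀ n, Measure (Ω n))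
        [∀ n, IsProbabilityMeasure (P n)] (X : ∀ n, Ω n → ℝ),
        (∀ n, AEMeasurable (X n) (P n)) →
        InfiniteSystem.HasGeneratingFunction P X (fun u => InfiniteSystem.expIntegral (y u)) →
        InfiniteSystem.SatisfiesCLT P X μ σsq) := by
  open InfiniteSystem in
  obtain ⟨R, S, hRx, hR, hSy, hSε, hRS⟩ := hF.exists_radii
  have hx₀ := hF.x₀_pos
  have hy₀ := hF.y₀_pos
  obtain ⟨t₂, ht₂, C, hC, E, E₁, E₂, hE, hE₁, hE₂, hexp, hder, hred⟩ :=
    hS.exists_reduction hw hF hRx hR hSy hSε hRS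
  set F : ℂ × ℂ → ℂ := fun p => seriesValue c p.1 p.2 with hFdef
  have hadm : Admissible R S (realValue c R S) F := hF.admissible (by linarith) hR (by linarith) hSε
  -- The perturbations form a curve `e` in `HoloSpace`; its values for `|t| ≥ t₂` are arbitrary and
  -- never used.
  choose! e he using fun t (ht : |t| < t₂) => (hE t ht).exists_holoSpace
  obtain ⟨z₁, hz₁⟩ := hE₁.exists_holoSpace
  obtain ⟨z₂, hz₂⟩ := hE₂.exists_holoSpace
  have hc : ∀ t : ℝ, |t| < t₂ → ‖e t - ((t : ℂ) • z₁ + (t : ℂ) ^ 2 • z₂)‖ ≤ C * |t| ^ 3 := by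
    intro t ht
    refine norm_holoSpace_le (by positivity) fun p => ?_
    rw [ContinuousLinearMap.map_sub, ContinuousLinearMap.map_add, ContinuousLinearMap.map_smul,
      ContinuousLinearMap.map_smul, he t ht, hz₁, hz₂]
    by_cases hp : p ∈ polydisc R S
    · simpa only [Set.indicator_of_mem hp, smul_eq_mul] using hexp t ht p hp
    · simp only [Set.indicator_of_notMem hp, smul_zero, add_zero, sub_zero, norm_zero]
      positivity
  have h0t : |(0 : ℝ)| < t₂ := by simpa using ht₂
  -- The expansion at `t = 0` has no remainder, so the curve starts at the unperturbed equation.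
  have he0 : e 0 = 0 := by
    have := hc 0 h0t
    simpa using this
  have hcoeff : ∀ t : ℝ, |t| < t₂ → ∀ n,
      solCoeff (addFamily F (e t)) n = (y (Circle.exp t)).coeff n := by
    intro t ht
    obtain ⟨r, hr⟩ := exists_smallRadius (R := R) (M := realValue c R S + ‖e t‖)
      (hx₀.trans hRx) hy₀ hSy
    refine hY.solCoeff_eq hy (hadm.addFamily (e t)) hr fun q hq0 hq => ?_
    filter_upwards [hred t ht q hq0 hq, Metric.ball_mem_nhds (0 : ℂ) (hx₀.trans hRx)]
      with x hx hxR z hz hsol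
    obtain ⟨h1, h2⟩ := hx z hz hsol
    refine ⟨h1, ?_⟩
    rw [addFamily, he t ht, Set.indicator_of_mem (mem_polydisc.2 ⟨by simpa using hxR, h1⟩)]
    exact h2
  have hmk : ∀ t : ℝ, |t| < t₂ →
      PowerSeries.mk (solCoeff (addFamily F (e t))) = y (Circle.exp t) := fun t ht => by
    ext n; rw [PowerSeries.coeff_mk, hcoeff t ht]
  -- This transfers the aperiodicity of `y(x, 1)` to the series that solves the main equation.
  have hmk0 : PowerSeries.mk (solCoeff F) = y 1 := by
    have := hmk 0 h0t
    rwa [he0, addFamily_zero, Circle.exp_zero] at this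
  obtain ⟨A, B, hcrit⟩ := hF.exists_criticalPoint (by rwa [hmk0]) hRx hR hSy hSε
  have hA := hcrit.A_pos
  obtain ⟨b, ρ, hρ, hb, hb0, hbder, hq₁, hq₂⟩ := (hcrit.holomorphicFamily hadm).exists_quasiPowers
  set v := -2 * (iteratedDeriv 2 (fun z : ℂ => b (z • z₁ + z ^ 2 • z₂)) 0 / 2).re with hv
  have hμ : (fderiv ℂ b 0 z₁).im
      = (∑' j : ℕ+, (tDeriv a 1 j x₀ (fun i => Ft i x₀ y₀) 0).im) / (x₀ * A) := by
    rw [hbder, fderiv_addFamily, hz₁, Set.indicator_of_mem hcrit.mem,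
      (Complex.hasSum_im hder).tsum_eq, ← Complex.ofReal_mul, Complex.div_ofReal_im]
  -- Nonnegativity of `v` is deduced from the variances of random variables with the given
  -- generating function. Since none need be given, the constant is truncated at `0`; it equals `v`
  -- whenever such variables exist.
  refine ⟨(fderiv ℂ b 0 z₁).im, max 0 v, le_max_left _ _, ?_, ?_, ?_⟩
  · rw [hμ]
    exact div_pos_iff_of_pos_right (by positivity)
  · intro Ω _ P _ X hX hXg
    obtain ⟨h1, h2⟩ := hq₁.satisfiesCLT hρ hb hb0 ht₂ hc P X hX fun n hn t ht => by
      rw [addFamily_zero] at hn ⊢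
      have h3 : solCoeff F n = (y 1).coeff n := by rw [← hmk0, PowerSeries.coeff_mk]
      rw [h3] at hn ⊢
      rw [hXg.charFun_eq hX hn, hcoeff t ht]
    rwa [max_eq_right h1]
  · intro Ω _ P _ X hX hXg
    obtain ⟨h1, h2⟩ := hq₂.satisfiesCLT hρ hb hb0 ht₂ hc P X hX fun n hn t ht => by
      rw [addFamily_zero] at hn ⊢
      have h3 : expCoeff F n = (expIntegral (y 1)).coeff n := by rw [← hmk0]; rfl
      rw [h3] at hn ⊢
      rw [hXg.charFun_eq hX hn, ← hmk t ht]
      rfl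
    rwa [max_eq_right h1]
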